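/- Let $m\ge 1$, $\alpha_1<\cdots<\alpha_m$ and $\beta_1,\dots,\beta_m$ be real numbers. Put $f_i(w)=e^{-\frac13w^3+\alpha_iw^2+\beta_iw}$, $F_1=f_1$, and $F_i=f_i/f_{i-1}$ for $2\le i\le m$. **Contours.** Let $\Gamma^{\rm in}_{m,L},\dots,\Gamma^{\rm in}_{2,L},\Gamma_{1,L},\Gamma^{\rm out}_{2,L},\dots,\Gamma^{\rm out}_{m,L}$, ordered from left to right, be contours of the form $\{a+re^{\pm 2\pi i/3}:r\ge 0\}$ with real vertices $a<0$, oriented from $\infty e^{-2\pi i/3}$ to $\infty e^{2\pi i/3}$, and let $\Gamma^{\rm in}_{m,R},\dots,\Gamma^{\rm in}_{2,R},\Gamma_{1,R},\Gamma^{\rm out}_{2,R},\dots,\Gamma^{\rm out}_{m,R}$, ordered from right to left, be contours of the form $\{b+re^{\pm\pi i/5}:r\ge0\}$ with real vertices $b>0$, oriented from $\infty e^{-\pi i/5}$ to $\infty e^{\pi i/5}$. The vertices are strictly ordered and otherwise arbitrary. **Equal-time multipoint formula.** For vectors of equal length put $\mathrm C(W;\tilde W)=\det[1/(w_i-\tilde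 w_j)]$, and let $\sqcup$ denote concatenation. For $n=(n_1,\dots,n_m)\in\mathbb Z_{\ge0}^m$ and vectors of variables $U^{(i)}=(u^{(i)}_\ell)_{\ell\le n_i}$, $V^{(i)}=(v^{(i)}_\ell)_{\ell\le n_i}$, with $U^{(m+1)}$, $V^{(m+1)}$ empty, let $$\mathcal D_n(z)=\prod_{i=1}^{m-1}(1-z_i)^{n_i}(1-z_i^{-1})^{n_{i+1}}\;\mathcal I\Big[\mathrm C(V^{(1)};U^{(1)})\prod_{i=1}^m\mathrm C(U^{(i)}\sqcup V^{(i+1)};V^{(i)}\sqcup U^{(i+1)})\prod_{i=1}^m\prod_{\ell=1}^{n_i}\frac{F_i(u^{(i)}_\ell)}{F_i(v^{(i)}_\ell)}\Big],$$ where $\mathcal I$ integrates each $u^{(1)}_\ell$ over $\Gamma_{1,L}$ and each $v^{(1)}_\ell$ over $\Gamma_{1,R}$ with respect to $\frac{dw}{2\pi i}$, and for $i\ge2$ applies $\frac1{1-z_{i-1}}\int_{\Gamma^{\rm in}_{i,\ast}}\frac{dw}{2\pi i}-\frac{z_{i-1}}{1-z_{i-1}}\int_{\Gamma^{\rm out}_{i,\ast}}\frac{dw}{2\pi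 i}$ to each $u^{(i)}_\ell$ (with $\ast=L$) and each $v^{(i)}_\ell$ (with $\ast=R$). Let $\mathcal D(z)=\sum_{n}\frac{\mathcal D_n(z)}{(n_1!\cdots n_m!)^2}$ and $$\mathcal P=\oint\cdots\oint\mathcal D(z)\prod_{i=1}^{m-1}\frac{dz_i}{2\pi i\,z_i(1-z_i)}$$ over counterclockwise circles $|z_i|=r_i$ with arbitrary $0<r_i<1$. **Kernels.** For $z,u\in\Gamma_{1,L}$ and $1\le i,j\le m$ let, with $u_1=z$, $$\mathbf K(i,z;j,u)=\int_{\Gamma_{1,R}}\frac{dv}{2\pi i}\prod_{\ell=2}^i\int_{\Gamma^{\rm in}_{\ell,L}}\frac{du_\ell}{2\pi i}\;\frac{f_1(z)\prod_{\ell=2}^iF_\ell(u_\ell)}{f_i(v)\prod_{\ell=1}^{i-1}(u_\ell-u_{\ell+1})\,(u_i-v)(v-u)} .$$ For $\lambda,\theta>0$ let $$\mathbf L(\lambda,\theta)=\sum_{i=1}^m\int_{\Gamma_{1,L}}\frac{du_1}{2\pi i}\int_{\Gamma_{1,R}}\frac{dv}{2\pi i}\prod_{\ell=2}^i\int_{\Gamma^{\rm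 in}_{\ell,L}}\frac{du_\ell}{2\pi i}\;\frac{f_1(u_1)e^{\lambda u_1}\prod_{\ell=2}^iF_\ell(u_\ell)}{f_i(v)e^{\theta v}\prod_{\ell=1}^{i-1}(u_\ell-u_{\ell+1})\,(u_i-v)},$$ $$A(i,\lambda;j,\theta)=\int_0^\infty\int_{\Gamma_{1,L}}\frac{du}{2\pi i}\int_{\Gamma_{1,R}}\frac{dv}{2\pi i}\,\frac{f_j(u)e^{(\theta+\gamma)u}}{f_i(v)e^{(\lambda+\gamma)v}}\,d\gamma,$$ $$B(i,\lambda;j,\theta)=\int_{i\mathbb R}e^{(\theta-\lambda)w}\prod_{\ell=i+1}^jF_\ell(w)\frac{dw}{2\pi i}\ \text{ if } i<j,\qquad B(i,\lambda;j,\theta)=0\ \text{ if } i\ge j .$$ Let $\mathrm{Ai}(x)=\int e^{-\frac13u^3+xu}\frac{du}{2\pi i}$ over $\{-1+re^{\pm2\pi i/3}:r\ge0\}$, oriented as the left contours above, and let the extended Airy kernel be $$K^{\rm ext}_{\rm Ai}(\alpha_i,x;\alpha_j,y)=\begin{cases}\int_0^\infty e^{-z(\alpha_i-\alpha_j)}\mathrm{Ai}(x+z)\mathrm{Ai}(y+z)\,dz,&\alpha_i\ge\alpha_j,\\-\int_{-\infty}^0e^{-z(\alpha_i-\alpha_j)}\mathrm{Ai}(x+z)\mathrm{Ai}(y+z)\,dz,&\alpha_i<\alpha_j,\end{cases}$$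 with $\chi(\alpha_i,x)=\mathbf 1_{x>\beta_i+\alpha_i^2}$. All Fredholm determinants are defined by their series $\det(\mathrm I+T)=\sum_{k\ge0}\frac1{k!}\int\det[T(x_a,x_b)]_{a,b=1}^k\prod_a d\mu(x_a)$. The measure $\mu$ is counting measure times $\frac{du}{2\pi i}$ on $\{1,\dots,m\}\times\Gamma_{1,L}$ for $\mathbf K$, Lebesgue measure on $(0,\infty)$ for $\mathbf L$, and counting times Lebesgue measure on $\{1,\dots,m\}\times(0,\infty)$ for $B-A$ and on $\{\alpha_1,\dots,\alpha_m\}\times\mathbb R$ for $-\chi^{1/2}K^{\rm ext}_{\rm Ai}\chi^{1/2}$. **Claim.** The integrals and the series defining $\mathcal P$, the integrals defining $\mathbf K$, and the four Fredholm series converge absolutely, and $$\mathcal P=\det(\mathrm I+\mathbf K)=\det(\mathrm I+\mathbf L)=\det(\mathrm I+B-A)=\det\big(\mathrm I-\chi^{1/2}K^{\rm ext}_{\rm Ai}\chi^{1/2}\big)_{L^2(\{\alpha_1,\dots,\alpha_m\}\times\mathbb R)}.$$ Moreover, let $g_i(\lambda)=\frac23\alpha_i^3+(\lambda+\beta_i)\alpha_i$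 and $\Phi_{ij}(\gamma)=e^{-(\alpha_i-\alpha_j)\gamma}\mathrm{Ai}(\lambda+\beta_i+\alpha_i^2+\gamma)\mathrm{Ai}(\theta+\beta_j+\alpha_j^2+\gamma)$. Then for all $\lambda,\theta>0$ one has $A(i,\lambda;j,\theta)=e^{-g_i(\lambda)+g_j(\theta)}\int_0^\infty\Phi_{ij}(\gamma)\,d\gamma$ for all $i,j$, and $B(i,\lambda;j,\theta)=e^{-g_i(\lambda)+g_j(\theta)}\int_{-\infty}^\infty\Phi_{ij}(\gamma)\,d\gamma$ for $i<j$ (these integrals converge absolutely). Hence $$(B-A)(i,\lambda;j,\theta)=-e^{-g_i(\lambda)+g_j(\theta)}K^{\rm ext}_{\rm Ai}(\alpha_i,\lambda+\beta_i+\alpha_i^2;\alpha_j,\theta+\beta_j+\alpha_j^2)\quad\text{for all } i,j.$$ -/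

import Mathlib

open MeasureTheory Set

namespace ParabolicAiry

noncomputable section

/-! ### Wedge-shaped contours and contour integrals -/

/-- The contour `{vertex + s * exp (± i * angle) : s ≥ 0}`, oriented from
`∞ * exp (- i * angle)` to `∞ * exp (i * angle)`. -/
structure Wedge where
  angle : ℝ
  vertex : ℝ

/-- Parametrization of a wedge by arc length: `t ≥ 0` runs through the upper ray and
`t ≤ 0` through the lower one. -/
def Wedge.point (c : Wedge) (t : ℝ) : ℂ :=
  (c.vertex : ℂ) + ((|t| * Real.cos c.angle : ℝ) : ℂ)
    + ((t * Real.sin c.angle : ℝ) : ℂ) * Complex.I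

/-- The density of the complex measure `dw / (2πi)` along a wedge: the derivative of the
parametrization (off the vertex) divided by `2πi`. -/
def Wedge.density (c : Wedge) (t : ℝ) : ℂ :=
  (((Real.sign t * Real.cos c.angle : ℝ) : ℂ) + ((Real.sin c.angle : ℝ) : ℂ) * Complex.I)
    / (2 * (Real.pi : ℂ) * Complex.I)

/-- A contour from `∞ * exp (-2πi/3)` to `∞ * exp (2πi/3)`. -/
def leftWedge (a : ℝ) : Wedge := ⟨2 * Real.pi / 3, a⟩

/-- A contour from `∞ * exp (-πi/5)` to `∞ * exp (πi/5)`. -/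
def rightWedge (b : ℝ) : Wedge := ⟨Real.pi / 5, b⟩

/-- `∫_c g(w) dw / (2πi)`. -/
def wedgeIntegral (c : Wedge) (g : ℂ → ℂ) : ℂ :=
  ∫ t : ℝ, c.density t * g (c.point t)

/-- The pull-back to `ι → ℝ` of `g(w) ∏ i, dw_i / (2πi)` with `w_i` on the contour `c i`. -/
def contourIntegrand {ι : Type} [Fintype ι] (c : ι → Wedge) (g : (ι → ℂ) → ℂ)
    (t : ι → ℝ) : ℂ :=
  (∏ i, (c i).density (t i)) * g (fun i => (c i).point (t i))

/-- The multiple contour integral of `g(w) ∏ i, dw_i / (2πi)` with `w_i` on `c i`. -/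
def contourIntegral {ι : Type} [Fintype ι] (c : ι → Wedge) (g : (ι → ℂ) → ℂ) : ℂ :=
  ∫ t : ι → ℝ, contourIntegrand c g t

/-- Absolute convergence of the multiple contour integral. -/
def ContourIntegrable {ι : Type} [Fintype ι] (c : ι → Wedge) (g : (ι → ℂ) → ℂ) : Prop :=
  Integrable (contourIntegrand c g)

/-- The vertices of the contours, for `m = M + 1` points; the index `0` stands for the first
point. From left to right the contours are
`leftIn M, …, leftIn 1, leftIn 0 = leftOut 0, leftOut 1, …, leftOut M` in the left half plane
and `rightOut M, …, rightOut 1, rightOut 0 = rightIn 0, rightIn 1, …, rightIn M` in the right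
half plane. -/
structure ContourSystem (M : ℕ) where
  leftIn : Fin (M + 1) → ℝ
  leftOut : Fin (M + 1) → ℝ
  rightIn : Fin (M + 1) → ℝ
  rightOut : Fin (M + 1) → ℝ
  leftIn_strictAnti : StrictAnti leftIn
  leftOut_strictMono : StrictMono leftOut
  leftOut_zero : leftOut 0 = leftIn 0
  leftOut_neg : ∀ i, leftOut i < 0
  rightIn_strictMono : StrictMono rightIn
  rightOut_strictAnti : StrictAnti rightOut
  rightOut_zero : rightOut 0 = rightIn 0
  rightOut_pos : ∀ i, 0 < rightOut i

/-- The contour `Γ_{1,L}`. -/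
def ContourSystem.gammaL {M : ℕ} (Γ : ContourSystem M) : Wedge := leftWedge (Γ.leftIn 0)

/-- The contour `Γ_{1,R}`. -/
def ContourSystem.gammaR {M : ℕ} (Γ : ContourSystem M) : Wedge := rightWedge (Γ.rightIn 0)

/-! ### Fredholm determinants as series -/

/-- The integrand of the `k`-fold integral in the Fredholm series of a kernel on `ι × Y`,
where `Y` carries the complex measure `ρ(y) dμ(y)`. -/
def fredholmIntegrand {ι Y : Type} (ρ : Y → ℂ) (K : ι → Y → ι → Y → ℂ) (k : ℕ)
    (l : Fin k → ι) (y : Fin k → Y) : ℂ :=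
  (∏ i, ρ (y i)) * (Matrix.of fun i j : Fin k => K (l i) (y i) (l j) (y j)).det

/-- `det (I + K)` for a kernel `K` on `ι × Y`, `ι` finite with the counting measure and `Y`
with the complex measure `ρ(y) dμ(y)`, as the Fredholm series. -/
def fredholmDet {ι Y : Type} [Fintype ι] [MeasurableSpace Y] (μ : Measure Y) (ρ : Y → ℂ)
    (K : ι → Y → ι → Y → ℂ) : ℂ :=
  ∑' k : ℕ, (1 / (k.factorial : ℂ)) *
    ∑ l : Fin k → ι, ∫ y : Fin k → Y, fredholmIntegrand ρ K k l y ∂(Measure.pi fun _ => μ)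

/-- Absolute convergence of the multiple integrals and of the sum in the Fredholm series. -/
def FredholmConverges {ι Y : Type} [Fintype ι] [MeasurableSpace Y] (μ : Measure Y)
    (ρ : Y → ℂ) (K : ι → Y → ι → Y → ℂ) : Prop :=
  (∀ (k : ℕ) (l : Fin k → ι),
    Integrable (fredholmIntegrand ρ K k l) (Measure.pi fun _ => μ)) ∧
  Summable fun k : ℕ => (1 / (k.factorial : ℝ)) *
    ∑ l : Fin k → ι, ∫ y : Fin k → Y, ‖fredholmIntegrand ρ K k l y‖ ∂(Measure.pi fun _ => μ)

/-- Lebesgue measure on the positive half line. -/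
abbrev halfLine : Measure ℝ := volume.restrict (Ioi 0)

/-! ### The functions `f_i` and `F_i` -/

/-- `f_i(w) = exp (-w³/3 + α_i w² + β_i w)`. -/
def f {M : ℕ} (α β : Fin (M + 1) → ℝ) (i : Fin (M + 1)) (w : ℂ) : ℂ :=
  Complex.exp (-(1 / 3) * w ^ 3 + (α i : ℂ) * w ^ 2 + (β i : ℂ) * w)

/-- `F_1 = f_1`, and `F_i = f_i / f_{i-1}` for the later indices. -/
def F {M : ℕ} (α β : Fin (M + 1) → ℝ) (i : Fin (M + 1)) (w : ℂ) : ℂ :=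
  Fin.cases (motive := fun _ => ℂ) (f α β 0 w)
    (fun k : Fin M => f α β k.succ w / f α β k.castSucc w) i

/-! ### The equal-time multipoint formula of the KPZ fixed point -/

/-- The Cauchy determinant `det [1 / (w_i - w'_j)]`. -/
def cauchyDet {ι : Type} [Fintype ι] [DecidableEq ι] (w w' : ι → ℂ) : ℂ :=
  (Matrix.of fun i j : ι => 1 / (w i - w' j)).det

/-- The index set of the variables `u_ℓ^{(i)}`, `1 ≤ ℓ ≤ n_i` (and of the `v_ℓ^{(i)}`). -/
abbrev VarIndex {M : ℕ} (n : Fin (M + 1) → ℕ) : Type := (i : Fin (M + 1)) × Fin (n i)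

/-- The integrand of `D_n` as a function of all `u` and `v` variables. -/
def liuIntegrand {M : ℕ} (α β : Fin (M + 1) → ℝ) (n : Fin (M + 1) → ℕ)
    (u v : VarIndex n → ℂ) : ℂ :=
  cauchyDet (fun l : Fin (n 0) => v ⟨0, l⟩) (fun l => u ⟨0, l⟩) *
  ((∏ k : Fin M,
      cauchyDet
        (Sum.elim (fun l : Fin (n k.castSucc) => u ⟨k.castSucc, l⟩)
          (fun l : Fin (n k.succ) => v ⟨k.succ, l⟩))
        (Sum.elim (fun l : Fin (n k.castSucc) => v ⟨k.castSucc, l⟩)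
          (fun l : Fin (n k.succ) => u ⟨k.succ, l⟩))) *
    cauchyDet (fun l : Fin (n (Fin.last M)) => u ⟨Fin.last M, l⟩)
      (fun l => v ⟨Fin.last M, l⟩)) *
  ∏ x : VarIndex n, F α β x.1 (u x) / F α β x.1 (v x)

/-- The coefficient of the integral over the `in` (`true`) or `out` (`false`) contour for a
variable with upper index `i`: `1 / (1 - z_{i-1})` and `- z_{i-1} / (1 - z_{i-1})`. A variable
with the first index runs over a single contour with coefficient `1`. -/
def sideWeight {M : ℕ} (z : Fin M → ℂ) (i : Fin (M + 1)) (s : Bool) : ℂ :=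
  Fin.cases (motive := fun _ => ℂ) (if s then 1 else 0)
    (fun k : Fin M => if s then 1 / (1 - z k) else -(z k / (1 - z k))) i

/-- The contours of the `u` and `v` variables for given choices of sides. -/
def liuContours {M : ℕ} (Γ : ContourSystem M) (n : Fin (M + 1) → ℕ)
    (s s' : VarIndex n → Bool) : VarIndex n ⊕ VarIndex n → Wedge :=
  Sum.elim
    (fun x => leftWedge (if s x then Γ.leftIn x.1 else Γ.leftOut x.1))
    (fun x => rightWedge (if s' x then Γ.rightIn x.1 else Γ.rightOut x.1))

/-- `D_n(z)`: the product of the linear combinations of `in` and `out` integrals is expanded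
into the sum over all choices of a side for each variable. -/
def liuTerm {M : ℕ} (α β : Fin (M + 1) → ℝ) (Γ : ContourSystem M)
    (n : Fin (M + 1) → ℕ) (z : Fin M → ℂ) : ℂ :=
  (∏ k : Fin M, (1 - z k) ^ n k.castSucc * (1 - (z k)⁻¹) ^ n k.succ) *
  ∑ s : VarIndex n → Bool, ∑ s' : VarIndex n → Bool,
    (∏ x, sideWeight z x.1 (s x)) * (∏ x, sideWeight z x.1 (s' x)) *
    contourIntegral (liuContours Γ n s s')
      (fun w => liuIntegrand α β n (fun x => w (Sum.inl x)) (fun x => w (Sum.inr x)))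

/-- The summand `D_n(z) / (n_1! ⋯ n_m!)²`. -/
def liuSummand {M : ℕ} (α β : Fin (M + 1) → ℝ) (Γ : ContourSystem M)
    (z : Fin M → ℂ) (n : Fin (M + 1) → ℕ) : ℂ :=
  1 / (∏ i, ((n i).factorial : ℂ)) ^ 2 * liuTerm α β Γ n z

/-- The function `D(z)`. -/
def liuD {M : ℕ} (α β : Fin (M + 1) → ℝ) (Γ : ContourSystem M) (z : Fin M → ℂ) : ℂ :=
  ∑' n : Fin (M + 1) → ℕ, liuSummand α β Γ z n

/-- `D(z) ∏ 1 / (2πi z_k (1 - z_k))`. -/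
def liuOuter {M : ℕ} (α β : Fin (M + 1) → ℝ) (Γ : ContourSystem M) (z : Fin M → ℂ) : ℂ :=
  liuD α β Γ z * ∏ k : Fin M, 1 / (2 * (Real.pi : ℂ) * Complex.I * z k * (1 - z k))

/-- The equal-time formula: the integral over the circles `|z_k| = r_k`. -/
def liuFormula {M : ℕ} (α β : Fin (M + 1) → ℝ) (Γ : ContourSystem M) (r : Fin M → ℝ) : ℂ :=
  torusIntegral (liuOuter α β Γ) 0 r

/-- Absolute convergence of everything in the equal-time formula. -/
def LiuConverges {M : ℕ} (α β : Fin (M + 1) → ℝ) (Γ : ContourSystem M)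
    (r : Fin M → ℝ) : Prop :=
  (∀ (n : Fin (M + 1) → ℕ) (s s' : VarIndex n → Bool),
    ContourIntegrable (liuContours Γ n s s')
      (fun w => liuIntegrand α β n (fun x => w (Sum.inl x)) (fun x => w (Sum.inr x)))) ∧
  (∀ z : Fin M → ℂ, (∀ k, ‖z k‖ = r k) → Summable (liuSummand α β Γ z)) ∧
  TorusIntegrable (liuOuter α β Γ) 0 r

/-! ### The kernel `K` -/

/-- `f_1(u_1) / f_i(v) * ∏_{ℓ=2}^i F_ℓ(u_ℓ) / (∏_{ℓ=1}^{i-1} (u_ℓ - u_{ℓ+1}) * (u_i - v))`,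
where `u_ℓ` is `p (ℓ - 1)`. -/
def chain {M : ℕ} (α β : Fin (M + 1) → ℝ) (i : Fin (M + 1))
    (p : Fin (i.val + 1) → ℂ) (v : ℂ) : ℂ :=
  f α β 0 (p 0) / f α β i v *
    ((∏ k : Fin i.val,
        F α β ⟨k.val + 1, lt_of_le_of_lt (Nat.succ_le_of_lt k.isLt) i.isLt⟩ (p k.succ)) /
      ((∏ k : Fin i.val, (p k.castSucc - p k.succ)) * (p (Fin.last i.val) - v)))

/-- The contours of `u_2, …, u_i` and `v` in the definition of `K`. -/
def kernelContours {M : ℕ} (Γ : ContourSystem M) (i : Fin (M + 1)) :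
    Fin i.val ⊕ Unit → Wedge :=
  Sum.elim
    (fun k => leftWedge
      (Γ.leftIn ⟨k.val + 1, lt_of_le_of_lt (Nat.succ_le_of_lt k.isLt) i.isLt⟩))
    (fun _ => Γ.gammaR)

/-- The integrand in `K(i, z; j, u)`; it does not depend on `j`. -/
def kernelIntegrand {M : ℕ} (α β : Fin (M + 1) → ℝ) (i : Fin (M + 1)) (z u : ℂ)
    (w : Fin i.val ⊕ Unit → ℂ) : ℂ :=
  chain α β i (Fin.cons z (fun k : Fin i.val => w (Sum.inl k)) : Fin (i.val + 1) → ℂ)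
    (w (Sum.inr ())) / (w (Sum.inr ()) - u)

/-- The kernel `K(i, z; j, u)`. -/
def kernelK {M : ℕ} (α β : Fin (M + 1) → ℝ) (Γ : ContourSystem M)
    (i : Fin (M + 1)) (z : ℂ) (_j : Fin (M + 1)) (u : ℂ) : ℂ :=
  contourIntegral (kernelContours Γ i) (kernelIntegrand α β i z u)

/-- The kernel `K` with `z` and `u` on `Γ_{1,L}`, in the parametrization of this contour. -/
def kernelKParam {M : ℕ} (α β : Fin (M + 1) → ℝ) (Γ : ContourSystem M)
    (i : Fin (M + 1)) (s : ℝ) (j : Fin (M + 1)) (t : ℝ) : ℂ :=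
  kernelK α β Γ i (Γ.gammaL.point s) j (Γ.gammaL.point t)

/-! ### The kernels `L`, `A` and `B` -/

/-- The kernel `L(λ, θ)` on the half line. -/
def kernelL {M : ℕ} (α β : Fin (M + 1) → ℝ) (Γ : ContourSystem M) (lam θ : ℝ) : ℂ :=
  ∑ i : Fin (M + 1),
    contourIntegral
      (Sum.elim
        (fun k : Fin (i.val + 1) => leftWedge
          (Γ.leftIn ⟨k.val, lt_of_le_of_lt (Nat.le_of_lt_succ k.isLt) i.isLt⟩))
        (fun _ : Unit => Γ.gammaR))
      (fun w =>
        chain α β i (fun k => w (Sum.inl k)) (w (Sum.inr ())) *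
          (Complex.exp ((lam : ℂ) * w (Sum.inl 0)) /
            Complex.exp ((θ : ℂ) * w (Sum.inr ()))))

/-- The kernel `A(i, λ; j, θ)`. -/
def kernelA {M : ℕ} (α β : Fin (M + 1) → ℝ) (Γ : ContourSystem M)
    (i : Fin (M + 1)) (lam : ℝ) (j : Fin (M + 1)) (θ : ℝ) : ℂ :=
  ∫ γ in Ioi (0 : ℝ),
    wedgeIntegral Γ.gammaL fun u => wedgeIntegral Γ.gammaR fun v =>
      (f α β j u * Complex.exp (((θ + γ : ℝ) : ℂ) * u)) /
        (f α β i v * Complex.exp (((lam + γ : ℝ) : ℂ) * v))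

/-- The kernel `B(i, λ; j, θ)`, an integral over the imaginary axis when `i < j` and
`λ, θ > 0`, and zero elsewhere. -/
def kernelB {M : ℕ} (α β : Fin (M + 1) → ℝ)
    (i : Fin (M + 1)) (lam : ℝ) (j : Fin (M + 1)) (θ : ℝ) : ℂ :=
  if i < j ∧ 0 < lam ∧ 0 < θ then
    ∫ y : ℝ, (Complex.I / (2 * (Real.pi : ℂ) * Complex.I)) *
      (Complex.exp (((θ - lam : ℝ) : ℂ) * ((y : ℂ) * Complex.I)) *
        ∏ l ∈ Finset.Ioc i j, F α β l ((y : ℂ) * Complex.I))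
  else 0

/-! ### The Airy function and the extended Airy kernel -/

/-- The Airy function as a contour integral. -/
def airyAi (x : ℝ) : ℂ :=
  wedgeIntegral (leftWedge (-1)) fun u => Complex.exp (-(1 / 3) * u ^ 3 + (x : ℂ) * u)

/-- `exp (-z (s - t)) Ai(x + z) Ai(y + z)`. -/
def airyProduct (s x t y z : ℝ) : ℂ :=
  ((Real.exp (-z * (s - t)) : ℝ) : ℂ) * airyAi (x + z) * airyAi (y + z)

/-- The extended Airy kernel `K_Ai^ext(s, x; t, y)`. -/
def extAiry (s x t y : ℝ) : ℂ :=
  if t ≤ s then ∫ z in Ioi (0 : ℝ), airyProduct s x t y z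
  else -∫ z in Iio (0 : ℝ), airyProduct s x t y z

/-- `χ(α_i, x)`, the indicator function of `x > β_i + α_i²`. -/
def chi {M : ℕ} (α β : Fin (M + 1) → ℝ) (i : Fin (M + 1)) (x : ℝ) : ℝ :=
  (Ioi (β i + α i ^ 2)).indicator (fun _ => (1 : ℝ)) x

/-- The kernel `χ^{1/2} K_Ai^ext χ^{1/2}` on `{α_1, …, α_m} × ℝ`. -/
def cutAiry {M : ℕ} (α β : Fin (M + 1) → ℝ)
    (i : Fin (M + 1)) (x : ℝ) (j : Fin (M + 1)) (y : ℝ) : ℂ :=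
  ((Real.sqrt (chi α β i x) : ℝ) : ℂ) * extAiry (α i) x (α j) y *
    ((Real.sqrt (chi α β j y) : ℝ) : ℂ)

/-- The exponent of the conjugating function, `(2/3) α_i³ + (λ + β_i) α_i`. -/
def conjExponent {M : ℕ} (α β : Fin (M + 1) → ℝ) (i : Fin (M + 1)) (lam : ℝ) : ℝ :=
  2 / 3 * α i ^ 3 + (lam + β i) * α i

/-- `exp (-g_i(λ) + g_j(θ)) exp (-γ (α_i - α_j)) Ai(λ + β_i + α_i² + γ) Ai(θ + β_j + α_j² + γ)`,
where `g` is the exponent of the conjugating function. -/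
def conjAiryProduct {M : ℕ} (α β : Fin (M + 1) → ℝ)
    (i : Fin (M + 1)) (lam : ℝ) (j : Fin (M + 1)) (θ : ℝ) (γ : ℝ) : ℂ :=
  ((Real.exp (-conjExponent α β i lam + conjExponent α β j θ) : ℝ) : ℂ) *
    airyProduct (α i) (lam + β i + α i ^ 2) (α j) (θ + β j + α j ^ 2) γ

end

end ParabolicAiry

open ParabolicAiry

/-!
All five quantities are Fredholm determinants of kernels that factor through one another, and they
are compared by the identities `det (I + ST) = det (I + TS)` and `det ((I + T)(I + N)) = det (I + T)`
for strictly triangular `N`. Both are proved for kernels with `|T(x, y)| ≤ C p(x) q(y)`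
(`KernelBound`), where Hadamard's inequality makes every series converge:
`fredholm_comp_comm` and `fredholm_add_comp_of_level`.

*The equal-time formula.* The product of Cauchy determinants in `D_n` is a single determinant of
entries `1 / (w - w')` between linked variables (`prod_cauchyDet`). If some `v` of index `i ≥ 2` is on
an `in` contour, one of maximal index can be moved to infinity on the right, where the integrand is
holomorphic and `1 / F_i = f_{i-1} / f_i` decays like a Gaussian; so the integral vanishes
(`contourIntegral_liu_eq_zero`). With all `v` on `out` contours, the coefficients `-z / (1 - z)` cancel
the factors `1 - 1 / z`, and what is left of `D_n(z)` is holomorphic in the unit polydisc. By Cauchy's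
formula (`torusIntegral_eq_center`) the integral over the circles is the value at `z = 0`, where all
`u` run over `in` contours (`liuOuter_integral`). The resulting sum over `n` is the Fredholm series of
`linkKernel` on the set of all labelled variables, sorted by the numbers of variables of each label
(`fredholm_linkKernel_eq_tsum`): terms with different numbers of `u` and `v` of an index vanish.

*The kernels `K` and `L`.* Write `linkKernel = a + b + c + d`, where `a` links the variables `u` among
themselves, `d` the variables `v`, and `b`, `c` the two groups. As `a` and `d` are strictly triangular,
`I + a + b + c + d = (I + b (I + d)⁻¹ + c (I + a)⁻¹)(I + a + d)` reduces the determinant to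
`b' = b (I + d)⁻¹` and `c' = c (I + a)⁻¹`, and then to `det (I - b' c')` (`fredholm_add_of_offDiagonal`).
Residues show that `b'` has the closed form `blockB`; in `b' c'` the integrals over `v` of index `≥ 2`
vanish by moving the contour to infinity. This leaves `rightKernel` on `Γ_{1,R}`
(`fredholm_linkKernel`). Cutting the chain of integrals in `K` and in `L` at `Γ_{1,R}` gives the same
kernel (`fredholmDet_kernelK`, `fredholmDet_kernelL_eq`).

*The kernels `A` and `B`.* Since `1 / (v - u) = ∫_0^∞ e^{-γ (v - u)} dγ` for `Re u < Re v`, one has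
`L = -R P` and `A = P Q` on the half line, where `P` has the kernel `∫ e^{-(λ + γ) v} / f_i(v)`.
A residue at the last variable of a chain gives `R (I + B) = Q` by telescoping (`comp_kernelR_B`), so
`I + B - A = (I - P R)(I + B)` with `B` strictly triangular (`fredholmDet_kernelL_eq_kernelBA`).

*The Airy kernel.* Completing the cube writes `f_i(w) e^{λ w}` as a multiple of the integrand of the
Airy function (`f_mul_exp`). This gives `A`; for `B` it is combined with Plancherel's identity on a
vertical line between `α_i` and `α_j` (`kernelA_eq`, `kernelB_eq`). Conjugation and a shift of the
variables do not change the Fredholm determinant (`fredholmDet_cutAiry`).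
-/

namespace ParabolicAiry

/-! ### Hadamard's inequality -/

open scoped ComplexOrder in
/-- A form of Hadamard's inequality: the geometric mean of the eigenvalues of `A Aᴴ` is at most
their arithmetic mean. -/
theorem norm_det_le {n : Type} [Fintype n] [DecidableEq n] (A : Matrix n n ℂ) {C : ℝ}
    (hC : 0 ≤ C) (h : ∀ i j, ‖A i j‖ ≤ C) :
    ‖A.det‖ ≤ (Real.sqrt (Fintype.card n) * C) ^ Fintype.card n := by
  rcases isEmpty_or_nonempty n with hn | hn
  · simp
  set N := Fintype.card n with hN
  have hNpos : (0 : ℝ) < N := by exact_mod_cast Fintype.card_pos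
  have hps := Matrix.posSemidef_self_mul_conjTranspose A
  set z := hps.1.eigenvalues with hz
  have hz0 : ∀ i, 0 ≤ z i := hps.eigenvalues_nonneg
  have hdet : (‖A.det‖ ^ 2 : ℝ) = ∏ i, z i := by
    have h1 := hps.1.det_eq_prod_eigenvalues
    rw [Matrix.det_mul, Matrix.det_conjTranspose] at h1
    have h2 : ((‖A.det‖ ^ 2 : ℝ) : ℂ) = ((∏ i, z i : ℝ) : ℂ) := by
      rw [Complex.ofReal_prod]
      rw [show A.det * star A.det = ((‖A.det‖ ^ 2 : ℝ) : ℂ) by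
        rw [← starRingEnd_apply, Complex.mul_conj, Complex.normSq_eq_norm_sq]] at h1
      simpa using h1
    exact_mod_cast h2
  have htr : ∑ i, z i ≤ N * (N * C ^ 2) := by
    have h1 := hps.1.trace_eq_sum_eigenvalues
    have h2 : ((∑ i, z i : ℝ) : ℂ) = ((∑ i, ∑ j, ‖A i j‖ ^ 2 : ℝ) : ℂ) := by
      rw [Complex.ofReal_sum]
      refine Eq.trans (Eq.symm (by simpa using h1)) ?_
      simp only [Matrix.trace, Matrix.diag, Matrix.mul_apply, Matrix.conjTranspose_apply]
      push_cast
      refine Finset.sum_congr rfl fun i _ => Finset.sum_congr rfl fun j _ => ?_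
      rw [← starRingEnd_apply, Complex.mul_conj, Complex.normSq_eq_norm_sq]; push_cast; rfl
    have h3 : (∑ i, z i : ℝ) = ∑ i, ∑ j, ‖A i j‖ ^ 2 := by exact_mod_cast h2
    rw [h3]
    calc ∑ i, ∑ j, ‖A i j‖ ^ 2 ≤ ∑ _i : n, ∑ _j : n, C ^ 2 := by
          gcongr with i _ j _
          exact h i j
      _ = N * (N * C ^ 2) := by simp [hN]
  have hamgm : ∏ i, z i ≤ ((∑ i, z i) / N) ^ N := by
    have h1 := Real.geom_mean_le_arith_mean Finset.univ (fun _ => 1) z (by simp)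
      (by simpa using hNpos) (fun i _ => hz0 i)
    simp only [Real.rpow_one, Finset.sum_const, Finset.card_univ, nsmul_eq_mul, mul_one,
      one_mul] at h1
    have h2 := pow_le_pow_left₀
      (Real.rpow_nonneg (Finset.prod_nonneg fun i _ => hz0 i) _) h1 N
    rwa [← Real.rpow_natCast, ← Real.rpow_mul (Finset.prod_nonneg fun i _ => hz0 i),
      inv_mul_cancel₀ hNpos.ne', Real.rpow_one] at h2
  have hs : ‖A.det‖ ^ 2 ≤ ((Real.sqrt N * C) ^ N) ^ 2 := by
    rw [hdet]
    refine hamgm.trans ?_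
    rw [← pow_mul, mul_comm N 2, pow_mul, mul_pow, Real.sq_sqrt hNpos.le]
    refine pow_le_pow_left₀ (div_nonneg (Finset.sum_nonneg fun i _ => hz0 i) hNpos.le) ?_ _
    rw [div_le_iff₀ hNpos]
    linarith
  exact le_of_sq_le_sq hs (by positivity)

theorem norm_det_le_of_le_mul {n : Type} [Fintype n] [DecidableEq n] (A : Matrix n n ℂ) {C : ℝ}
    {p q : n → ℝ} (hC : 0 ≤ C) (hp : ∀ i, 0 ≤ p i) (hq : ∀ i, 0 ≤ q i)
    (h : ∀ i j, ‖A i j‖ ≤ C * (p i * q j)) :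
    ‖A.det‖ ≤ (Real.sqrt (Fintype.card n) * C) ^ Fintype.card n * ∏ i, p i * q i := by
  set B : Matrix n n ℂ := Matrix.of fun i j => A i j / ((p i : ℂ) * q j) with hB
  have hBb : ∀ i j, ‖B i j‖ ≤ C := by
    intro i j
    simp only [hB, Matrix.of_apply, norm_div, norm_mul, Complex.norm_real, Real.norm_eq_abs,
      abs_of_nonneg (hp i), abs_of_nonneg (hq j)]
    exact div_le_of_le_mul₀ (mul_nonneg (hp i) (hq j)) hC (h i j)
  have hA : A = Matrix.of fun i j => (p i : ℂ) * (Matrix.of fun i j => (q j : ℂ) * B i j) i j := by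
    ext i j
    simp only [hB, Matrix.of_apply]
    by_cases h0 : (p i : ℂ) * q j = 0
    · have h1 : p i * q j = 0 := by exact_mod_cast h0
      have h2 := h i j
      rw [h1, mul_zero, norm_le_zero_iff] at h2
      rw [h2]; simp
    · rw [← mul_assoc, mul_div_cancel₀ _ h0]
  rw [hA, Matrix.det_mul_column, Matrix.det_mul_row]
  simp only [norm_mul, norm_prod, Complex.norm_real, Real.norm_eq_abs, abs_of_nonneg (hp _),
    abs_of_nonneg (hq _), Finset.prod_mul_distrib]
  have := norm_det_le B hC hBb
  have h1 : 0 ≤ ∏ i, p i := Finset.prod_nonneg fun i _ => hp i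
  have h2 : 0 ≤ ∏ i, q i := Finset.prod_nonneg fun i _ => hq i
  calc (∏ i, p i) * ((∏ i, q i) * ‖B.det‖)
      ≤ (∏ i, p i) * ((∏ i, q i) * (Real.sqrt (Fintype.card n) * C) ^ Fintype.card n) := by gcongr
    _ = _ := by ring

theorem summable_pow_div_sqrt_factorial {D : ℝ} (hD : 0 < D) :
    Summable fun k : ℕ => D ^ k / Real.sqrt k.factorial := by
  refine summable_of_ratio_test_tendsto_lt_one (l := 0) one_pos
    (.of_forall fun k => by positivity) ?_
  have h : ∀ k : ℕ, ‖D ^ (k + 1) / Real.sqrt (k + 1).factorial‖ / ‖D ^ k / Real.sqrt k.factorial‖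
      = D * Real.sqrt ((k + 1 : ℝ)⁻¹) := by
    intro k
    rw [Real.norm_of_nonneg (by positivity), Real.norm_of_nonneg (by positivity),
      Nat.factorial_succ, Nat.cast_mul, Real.sqrt_mul (by positivity), Real.sqrt_inv]
    push_cast
    field_simp
    rw [pow_succ]
  simp_rw [h]
  have h2 : Filter.Tendsto (fun k : ℕ => ((k : ℝ) + 1)⁻¹) Filter.atTop (nhds 0) := by
    simpa using tendsto_one_div_add_atTop_nhds_zero_nat (𝕜 := ℝ)
  simpa using (((Real.continuous_sqrt.tendsto 0).comp h2).const_mul D)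

theorem summable_hadamard {C : ℝ} (hC : 0 ≤ C) :
    Summable fun k : ℕ => 1 / (k.factorial : ℝ) * (Real.sqrt k * C) ^ k := by
  have key : ∀ k : ℕ, (Real.sqrt k) ^ k ≤ Real.sqrt (Real.exp 1) ^ k * Real.sqrt k.factorial := by
    intro k
    have h1 : ((k : ℝ)) ^ k ≤ Real.exp 1 ^ k * k.factorial := by
      have h := Real.pow_div_factorial_le_exp (k : ℝ) (by positivity) k
      rw [div_le_iff₀ (by positivity)] at h
      rwa [← Real.exp_nat_mul, mul_one]
    refine le_of_sq_le_sq ?_ (by positivity)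
    rw [mul_pow, ← pow_mul, ← pow_mul, mul_comm k 2, pow_mul, pow_mul, Real.sq_sqrt (by positivity),
      Real.sq_sqrt (by positivity), Real.sq_sqrt (by positivity)]
    exact h1
  refine Summable.of_nonneg_of_le (fun k => by positivity) (fun k => ?_)
    (summable_pow_div_sqrt_factorial (D := Real.sqrt (Real.exp 1) * (C + 1)) (by positivity))
  have hf : Real.sqrt k.factorial * Real.sqrt k.factorial = k.factorial :=
    Real.mul_self_sqrt (by positivity)
  have hf0 : 0 < Real.sqrt k.factorial := by positivity
  rw [mul_pow, mul_pow, le_div_iff₀ hf0]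
  have h3 : C ^ k ≤ (C + 1) ^ k := by gcongr; linarith
  calc 1 / (k.factorial : ℝ) * (Real.sqrt k ^ k * C ^ k) * Real.sqrt k.factorial
      ≤ 1 / (k.factorial : ℝ) * ((Real.sqrt (Real.exp 1) ^ k * Real.sqrt k.factorial) *
        (C + 1) ^ k) * Real.sqrt k.factorial := by gcongr; exact key k
    _ = Real.sqrt (Real.exp 1) ^ k * (C + 1) ^ k *
        ((Real.sqrt k.factorial * Real.sqrt k.factorial) / k.factorial) := by ring
    _ = _ := by rw [hf, div_self (by positivity), mul_one]

/-! ### Kernels and their Fredholm determinants -/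

section Kernels

set_option linter.unusedSectionVars false

variable {X Y Z : Type} [MeasurableSpace X] [MeasurableSpace Y] [MeasurableSpace Z]

/-- Measurable kernels `T(x, y)` bounded by a constant times `p(x) q(y)`. Such kernels can be
composed when the weights of the middle variable have an integrable product. -/
structure KernelBound (p : X → ℝ) (q : Y → ℝ) (T : X → Y → ℂ) : Prop where
  meas : Measurable (Function.uncurry T)
  left_nonneg : ∀ x, 0 ≤ p x
  right_nonneg : ∀ y, 0 ≤ q y
  bound : ∃ C : ℝ, 0 ≤ C ∧ ∀ x y, ‖T x y‖ ≤ C * (p x * q y)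

/-- Composition of kernels. -/
noncomputable def comp (ν : Measure Y) (T : X → Y → ℂ) (S : Y → Z → ℂ) (x : X) (z : Z) : ℂ :=
  ∫ y, T x y * S y z ∂ν

/-- The `k`-fold integral in the Fredholm series of a kernel. -/
noncomputable def fredholmCoeff (μ : Measure X) (T : X → X → ℂ) (k : ℕ) : ℂ :=
  ∫ y : Fin k → X, (Matrix.of fun a b : Fin k => T (y a) (y b)).det ∂(Measure.pi fun _ => μ)

/-- `det (I + T)` on a single measure space. -/
noncomputable def fredholm (μ : Measure X) (T : X → X → ℂ) : ℂ :=
  ∑' k : ℕ, 1 / (k.factorial : ℂ) * fredholmCoeff μ T k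

namespace KernelBound

variable {p : X → ℝ} {q : Y → ℝ} {T S : X → Y → ℂ}

theorem measurable_apply {W : Type} [MeasurableSpace W] (hT : KernelBound p q T) {f : W → X}
    {g : W → Y} (hf : Measurable f) (hg : Measurable g) : Measurable fun w => T (f w) (g w) :=
  hT.meas.comp (hf.prodMk hg)

theorem add (hT : KernelBound p q T) (hS : KernelBound p q S) :
    KernelBound p q (fun x y => T x y + S x y) := by
  obtain ⟨C, hC, h⟩ := hT.bound
  obtain ⟨D, hD, h'⟩ := hS.bound
  refine ⟨hT.meas.add hS.meas, hT.left_nonneg, hT.right_nonneg, C + D, by positivity,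
    fun x y => ?_⟩
  calc _ ≤ ‖T x y‖ + ‖S x y‖ := norm_add_le _ _
    _ ≤ _ := by linarith [h x y, h' x y]

theorem const_mul (hT : KernelBound p q T) (c : ℂ) :
    KernelBound p q (fun x y => c * T x y) := by
  obtain ⟨C, hC, h⟩ := hT.bound
  refine ⟨hT.meas.const_mul c, hT.left_nonneg, hT.right_nonneg, ‖c‖ * C, by positivity,
    fun x y => ?_⟩
  rw [norm_mul, mul_assoc]
  gcongr
  exact h x y

theorem neg (hT : KernelBound p q T) : KernelBound p q (fun x y => -T x y) := by
  simpa using hT.const_mul (-1)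

theorem sub (hT : KernelBound p q T) (hS : KernelBound p q S) :
    KernelBound p q (fun x y => T x y - S x y) := by
  simpa [sub_eq_add_neg] using hT.add hS.neg

theorem sum {ι : Type} (s : Finset ι) {T : ι → X → Y → ℂ} (hp : ∀ x, 0 ≤ p x)
    (hq : ∀ y, 0 ≤ q y) (h : ∀ i ∈ s, KernelBound p q (T i)) :
    KernelBound p q (fun x y => ∑ i ∈ s, T i x y) := by
  classical
  induction s using Finset.induction_on with
  | empty =>
    exact ⟨(measurable_const : Measurable fun _ : X × Y => (0 : ℂ)), hp, hq, 0, le_rfl, by simp⟩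
  | insert a s ha ih =>
    simp only [Finset.sum_insert ha]
    exact (h a (by simp)).add (ih fun i hi => h i (by simp [hi]))

theorem integrable_mul {p' : Y → ℝ} {r : Z → ℝ} {R : Y → Z → ℂ} {ν : Measure Y}
    (hT : KernelBound p q T) (hR : KernelBound p' r R) (hν : Integrable (fun y => p' y * q y) ν)
    (x : X) (z : Z) : Integrable (fun y => T x y * R y z) ν := by
  obtain ⟨C, hC, h⟩ := hT.bound
  obtain ⟨D, hD, h'⟩ := hR.bound
  refine (hν.const_mul (C * D * (p x * r z))).mono'
    ((hT.meas.comp (measurable_const.prodMk measurable_id)).mul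
      (hR.meas.comp (measurable_id.prodMk measurable_const))).aestronglyMeasurable
    (.of_forall fun y => ?_)
  rw [norm_mul]
  calc ‖T x y‖ * ‖R y z‖ ≤ C * (p x * q y) * (D * (p' y * r z)) :=
        mul_le_mul (h x y) (h' y z) (norm_nonneg _) ((norm_nonneg _).trans (h x y))
    _ = _ := by ring

theorem comp {p' : Y → ℝ} {r : Z → ℝ} {R : Y → Z → ℂ} {ν : Measure Y} [SFinite ν]
    (hT : KernelBound p q T) (hR : KernelBound p' r R)
    (hν : Integrable (fun y => p' y * q y) ν) : KernelBound p r (comp ν T R) := by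
  obtain ⟨C, hC, h⟩ := hT.bound
  obtain ⟨D, hD, h'⟩ := hR.bound
  refine ⟨?_, hT.left_nonneg, hR.right_nonneg, C * D * ∫ y, p' y * q y ∂ν, ?_, fun x z => ?_⟩
  · have : StronglyMeasurable fun w : (X × Z) × Y => T w.1.1 w.2 * R w.2 w.1.2 :=
      ((hT.meas.comp ((measurable_fst.comp measurable_fst).prodMk measurable_snd)).mul
        (hR.meas.comp (measurable_snd.prodMk (measurable_snd.comp measurable_fst)))).stronglyMeasurable
    exact (this.integral_prod_right' (ν := ν)).measurable
  · have : 0 ≤ ∫ y, p' y * q y ∂ν :=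
      integral_nonneg fun y => mul_nonneg (hR.left_nonneg y) (hT.right_nonneg y)
    positivity
  · calc ‖ParabolicAiry.comp ν T R x z‖
        ≤ ∫ y, C * D * (p x * r z) * (p' y * q y) ∂ν := by
          refine norm_integral_le_of_norm_le (hν.const_mul _) (.of_forall fun y => ?_)
          rw [norm_mul]
          calc ‖T x y‖ * ‖R y z‖ ≤ C * (p x * q y) * (D * (p' y * r z)) :=
                mul_le_mul (h x y) (h' y z) (norm_nonneg _) ((norm_nonneg _).trans (h x y))
            _ = _ := by ring
      _ = _ := by rw [integral_const_mul]; ring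

end KernelBound

theorem comp_add_left {p : X → ℝ} {q : Y → ℝ} {p' : Y → ℝ} {r : Z → ℝ} {T S : X → Y → ℂ}
    {R : Y → Z → ℂ} {ν : Measure Y} (hT : KernelBound p q T) (hS : KernelBound p q S)
    (hR : KernelBound p' r R) (hν : Integrable (fun y => p' y * q y) ν) :
    comp ν (fun x y => T x y + S x y) R = fun x z => comp ν T R x z + comp ν S R x z := by
  ext x z
  simp only [comp, add_mul]
  exact integral_add (hT.integrable_mul hR hν x z) (hS.integrable_mul hR hν x z)

theorem comp_add_right {p : X → ℝ} {q : Y → ℝ} {p' : Y → ℝ} {r : Z → ℝ} {T : X → Y → ℂ}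
    {R S : Y → Z → ℂ} {ν : Measure Y} (hT : KernelBound p q T) (hR : KernelBound p' r R)
    (hS : KernelBound p' r S) (hν : Integrable (fun y => p' y * q y) ν) :
    comp ν T (fun x y => R x y + S x y) = fun x z => comp ν T R x z + comp ν T S x z := by
  ext x z
  simp only [comp, mul_add]
  exact integral_add (hT.integrable_mul hR hν x z) (hT.integrable_mul hS hν x z)

theorem comp_const_mul_left (c : ℂ) (T : X → Y → ℂ) (R : Y → Z → ℂ) (ν : Measure Y) :
    comp ν (fun x y => c * T x y) R = fun x z => c * comp ν T R x z := by
  ext x z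
  simp only [comp, mul_assoc]
  exact integral_const_mul _ _

theorem comp_const_mul_right (c : ℂ) (T : X → Y → ℂ) (R : Y → Z → ℂ) (ν : Measure Y) :
    comp ν T (fun x y => c * R x y) = fun x z => c * comp ν T R x z := by
  ext x z
  simp only [comp, mul_left_comm _ c]
  exact integral_const_mul _ _

theorem comp_assoc {W : Type} [MeasurableSpace W] {p : X → ℝ} {q : Y → ℝ} {p' : Y → ℝ}
    {r : Z → ℝ} {p'' : Z → ℝ} {s : W → ℝ}
    {T : X → Y → ℂ} {R : Y → Z → ℂ} {S : Z → W → ℂ} {ν : Measure Y} {ρ : Measure Z} [SFinite ν]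
    [SFinite ρ] (hT : KernelBound p q T) (hR : KernelBound p' r R) (hS : KernelBound p'' s S)
    (hν : Integrable (fun y => p' y * q y) ν) (hρ : Integrable (fun y => p'' y * r y) ρ) :
    comp ρ (comp ν T R) S = comp ν T (comp ρ R S) := by
  ext x w
  simp only [comp, ← integral_const_mul, ← integral_mul_const, mul_assoc]
  obtain ⟨C, hC, h⟩ := hT.bound
  obtain ⟨D, hD, h'⟩ := hR.bound
  obtain ⟨E, hE, h''⟩ := hS.bound
  refine integral_integral_swap ?_
  refine ((hρ.mul_prod hν).const_mul (C * D * E * (p x * s w))).mono' ?_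
    (.of_forall fun y => ?_)
  · exact ((hT.meas.comp (measurable_const.prodMk measurable_snd)).mul
      ((hR.meas.comp (measurable_snd.prodMk measurable_fst)).mul
        (hS.meas.comp (measurable_fst.prodMk measurable_const)))).aestronglyMeasurable
  · obtain ⟨z, y⟩ := y
    simp only [Function.uncurry, norm_mul]
    calc ‖T x y‖ * (‖R y z‖ * ‖S z w‖)
        ≤ C * (p x * q y) * (D * (p' y * r z) * (E * (p'' z * s w))) := by
          have h1 := h x y
          have h2 := h' y z
          have h3 := h'' z w
          have n1 := (norm_nonneg _).trans h1
          have n2 := (norm_nonneg _).trans h2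
          gcongr
      _ = _ := by ring

theorem measurable_det {n : Type} [Fintype n] [DecidableEq n] {A : X → Matrix n n ℂ}
    (h : ∀ i j, Measurable fun x => A x i j) : Measurable fun x => (A x).det := by
  simp only [Matrix.det_apply']
  exact Finset.measurable_sum _ fun σ _ =>
    measurable_const.mul (Finset.measurable_prod _ fun i _ => h _ _)

theorem integrable_prod_pi {p : X → ℝ} {q : X → ℝ} {μ : Measure X} [SigmaFinite μ]
    (hμ : Integrable (fun x => p x * q x) μ) (k : ℕ) :
    Integrable (fun y : Fin k → X => ∏ i, p (y i) * q (y i)) (Measure.pi fun _ => μ) :=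
  Integrable.fintype_prod (f := fun _ x => p x * q x) fun _ => hμ

theorem integral_prod_pi {p : X → ℝ} {q : X → ℝ} {μ : Measure X} [SigmaFinite μ] (k : ℕ) :
    ∫ y : Fin k → X, ∏ i, p (y i) * q (y i) ∂(Measure.pi fun _ => μ) =
      (∫ x, p x * q x ∂μ) ^ k := by
  rw [integral_fintype_prod_eq_prod (μ := fun _ => μ) (fun _ x => p x * q x)]
  simp

theorem KernelBound.integrable_det {p q : X → ℝ} {T : X → X → ℂ} {μ : Measure X} [SigmaFinite μ]
    (hT : KernelBound p q T) (hμ : Integrable (fun x => p x * q x) μ) (k : ℕ) :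
    Integrable (fun y : Fin k → X => (Matrix.of fun a b : Fin k => T (y a) (y b)).det)
      (Measure.pi fun _ => μ) := by
  obtain ⟨C, hC, h⟩ := hT.bound
  refine ((integrable_prod_pi hμ k).const_mul
    ((Real.sqrt (Fintype.card (Fin k)) * C) ^ Fintype.card (Fin k))).mono'
    (measurable_det fun i j => hT.meas.comp
      ((measurable_pi_apply i).prodMk (measurable_pi_apply j))).aestronglyMeasurable
    (.of_forall fun y => ?_)
  exact norm_det_le_of_le_mul _ hC (fun i => hT.left_nonneg _) (fun i => hT.right_nonneg _)
    fun i j => h _ _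

/-- A determinant whose rows are integrals is the integral of the determinant with an independent
variable in each row. -/
theorem det_integral_rows {ν : Measure Y} [SigmaFinite ν] {k : ℕ} (G : Fin k → Y → Fin k → ℂ)
    (hG : ∀ a b, Integrable (fun y => G a y b) ν) :
    (Matrix.of fun a b : Fin k => ∫ y, G a y b ∂ν).det =
      ∫ y : Fin k → Y, (Matrix.of fun a b : Fin k => G a (y a) b).det ∂(Measure.pi fun _ => ν) := by
  rw [← Matrix.det_transpose, Matrix.det_apply']
  simp_rw [← Matrix.det_transpose (Matrix.of fun a b : Fin k => G a _ b), Matrix.det_apply',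
    Matrix.transpose_apply, Matrix.of_apply]
  rw [integral_finsetSum]
  · refine Finset.sum_congr rfl fun σ _ => ?_
    rw [integral_const_mul,
      integral_fintype_prod_eq_prod (μ := fun _ : Fin k => ν) (fun a y => G a y (σ a))]
  · intro σ _
    exact (Integrable.fintype_prod (f := fun a y => G a y (σ a)) fun a => hG _ _).const_mul _

/-- `det (I + TS) = det (I + ST)`, term by term. -/
theorem fredholmCoeff_comp_comm {p : X → ℝ} {q : X → ℝ} {p' q' : Y → ℝ} {T : X → Y → ℂ}
    {S : Y → X → ℂ} {μ : Measure X} {ν : Measure Y} [SigmaFinite μ] [SigmaFinite ν]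
    (hT : KernelBound p q' T) (hS : KernelBound p' q S)
    (hμ : Integrable (fun x => p x * q x) μ) (hν : Integrable (fun y => p' y * q' y) ν) (k : ℕ) :
    fredholmCoeff μ (comp ν T S) k = fredholmCoeff ν (comp μ S T) k := by
  have h1 : ∀ x : Fin k → X, (Matrix.of fun a b : Fin k => comp ν T S (x a) (x b)).det =
      ∫ y : Fin k → Y, (∏ a, T (x a) (y a)) *
        (Matrix.of fun a b : Fin k => S (y a) (x b)).det ∂(Measure.pi fun _ => ν) := by
    intro x
    refine (det_integral_rows (fun a y b => T (x a) y * S y (x b))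
      fun a b => hT.integrable_mul hS hν _ _).trans ?_
    congr 1
    ext y
    exact Matrix.det_mul_column (fun a => T (x a) (y a)) (Matrix.of fun a b => S (y a) (x b))
  have h2 : ∀ y : Fin k → Y, (Matrix.of fun a b : Fin k => comp μ S T (y a) (y b)).det =
      ∫ x : Fin k → X, (∏ a, T (x a) (y a)) *
        (Matrix.of fun a b : Fin k => S (y a) (x b)).det ∂(Measure.pi fun _ => μ) := by
    intro y
    rw [← Matrix.det_transpose]
    refine (det_integral_rows (fun a x b => S (y b) x * T x (y a))
      fun a b => hS.integrable_mul hT hμ _ _).trans ?_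
    congr 1
    ext x
    rw [← Matrix.det_transpose, ← Matrix.det_mul_row]
    congr 1
    ext a b
    simp [mul_comm]
  simp only [fredholmCoeff, h1, h2]
  refine integral_integral_swap ?_
  obtain ⟨C, hC, h⟩ := hT.bound
  obtain ⟨D, hD, h'⟩ := hS.bound
  refine (((integrable_prod_pi hμ k).mul_prod (integrable_prod_pi hν k)).const_mul
    (C ^ k * (Real.sqrt (Fintype.card (Fin k)) * D) ^ Fintype.card (Fin k))).mono' ?_
    (.of_forall fun z => ?_)
  · refine Measurable.aestronglyMeasurable (Measurable.mul ?_ (measurable_det fun i j => ?_))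
    · exact Finset.measurable_prod _ fun a _ => hT.measurable_apply
        ((measurable_pi_apply a).comp measurable_fst) ((measurable_pi_apply a).comp measurable_snd)
    · exact hS.measurable_apply
        ((measurable_pi_apply i).comp measurable_snd) ((measurable_pi_apply j).comp measurable_fst)
  · obtain ⟨x, y⟩ := z
    simp only [Function.uncurry, norm_mul, norm_prod]
    have e1 : ∏ a, ‖T (x a) (y a)‖ ≤ C ^ k * ∏ a, p (x a) * q' (y a) := by
      calc _ ≤ ∏ a : Fin k, C * (p (x a) * q' (y a)) :=
            Finset.prod_le_prod (fun _ _ => norm_nonneg _) fun a _ => h _ _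
        _ = _ := by rw [Finset.prod_mul_distrib]; simp
    have e2 := norm_det_le_of_le_mul (Matrix.of fun a b : Fin k => S (y a) (x b)) hD
      (fun a => hS.left_nonneg (y a)) (fun a => hS.right_nonneg (x a)) fun i j => h' _ _
    calc _ ≤ (C ^ k * ∏ a, p (x a) * q' (y a)) * _ :=
          mul_le_mul e1 e2 (norm_nonneg _) ((Finset.prod_nonneg fun _ _ => norm_nonneg _).trans e1)
      _ = _ := by simp only [Finset.prod_mul_distrib]; ring

theorem fredholm_comp_comm {p : X → ℝ} {q : X → ℝ} {p' q' : Y → ℝ} {T : X → Y → ℂ}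
    {S : Y → X → ℂ} {μ : Measure X} {ν : Measure Y} [SigmaFinite μ] [SigmaFinite ν]
    (hT : KernelBound p q' T) (hS : KernelBound p' q S)
    (hμ : Integrable (fun x => p x * q x) μ) (hν : Integrable (fun y => p' y * q' y) ν) :
    fredholm μ (comp ν T S) = fredholm ν (comp μ S T) := by
  simp only [fredholm, fredholmCoeff_comp_comm hT hS hμ hν]

end Kernels

/-! ### Multiplicativity of Fredholm determinants -/

section Multiplicativity

set_option linter.unusedSectionVars false

variable {X : Type} [MeasurableSpace X]

/-- The integral over `t` of the determinant with rows indexed by the points `x, t` and columns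
by the points `w, t`. -/
noncomputable def minorCoeff (μ : Measure X) (T : X → X → ℂ) (k : ℕ) (x w : X) : ℂ :=
  ∫ t : Fin k → X, (Matrix.of fun a b : Fin (k + 1) =>
    T ((Fin.cons x t : Fin (k + 1) → X) a) ((Fin.cons w t : Fin (k + 1) → X) b)).det
    ∂(Measure.pi fun _ => μ)

theorem measurable_cons {k : ℕ} {W : Type} [MeasurableSpace W] {f : W → X} {g : W → Fin k → X}
    (hf : Measurable f) (hg : Measurable g) (a : Fin (k + 1)) :
    Measurable fun w => (Fin.cons (f w) (g w) : Fin (k + 1) → X) a := by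
  refine Fin.cases ?_ (fun b => ?_) a
  · simpa using hf
  · simp only [Fin.cons_succ]
    exact (measurable_pi_apply b).comp hg

theorem norm_det_cons_le {p q : X → ℝ} {T : X → X → ℂ} {C : ℝ} (hC : 0 ≤ C)
    (hp : ∀ x, 0 ≤ p x) (hq : ∀ x, 0 ≤ q x) (h : ∀ x y, ‖T x y‖ ≤ C * (p x * q y)) {k : ℕ}
    (x w : X) (t : Fin k → X) :
    ‖(Matrix.of fun a b : Fin (k + 1) => T ((Fin.cons x t : Fin (k + 1) → X) a)
      ((Fin.cons w t : Fin (k + 1) → X) b)).det‖ ≤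
      (Real.sqrt (k + 1 : ℕ) * C) ^ (k + 1) * (p x * q w * ∏ i, p (t i) * q (t i)) := by
  have := norm_det_le_of_le_mul (Matrix.of fun a b : Fin (k + 1) =>
    T ((Fin.cons x t : Fin (k + 1) → X) a) ((Fin.cons w t : Fin (k + 1) → X) b)) hC
    (p := fun a => p ((Fin.cons x t : Fin (k + 1) → X) a))
    (q := fun a => q ((Fin.cons w t : Fin (k + 1) → X) a))
    (fun _ => hp _) (fun _ => hq _) (fun i j => h _ _)
  simpa only [Fintype.card_fin, Fin.prod_univ_succ, Fin.cons_zero, Fin.cons_succ] using this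

variable {p q : X → ℝ} {T : X → X → ℂ} {μ : Measure X} [SigmaFinite μ]

theorem KernelBound.norm_minorCoeff_le {C : ℝ} (hC : 0 ≤ C) (hT : KernelBound p q T)
    (h : ∀ x y, ‖T x y‖ ≤ C * (p x * q y))
    (hμ : Integrable (fun x => p x * q x) μ) (k : ℕ) (x w : X) :
    ‖minorCoeff μ T k x w‖ ≤
      (Real.sqrt (k + 1 : ℕ) * C) ^ (k + 1) * (∫ x, p x * q x ∂μ) ^ k * (p x * q w) := by
  calc _ ≤ ∫ t : Fin k → X, (Real.sqrt (k + 1 : ℕ) * C) ^ (k + 1) *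
        (p x * q w * ∏ i, p (t i) * q (t i)) ∂(Measure.pi fun _ => μ) :=
        norm_integral_le_of_norm_le (((integrable_prod_pi hμ k).const_mul _).const_mul _)
          (.of_forall fun t =>
            norm_det_cons_le hC hT.left_nonneg hT.right_nonneg h x w t)
    _ = _ := by rw [integral_const_mul, integral_const_mul, integral_prod_pi]; ring

theorem KernelBound.minorCoeff (hT : KernelBound p q T)
    (hμ : Integrable (fun x => p x * q x) μ) (k : ℕ) :
    KernelBound p q (minorCoeff μ T k) := by
  obtain ⟨C, hC, h⟩ := hT.bound
  have hI : 0 ≤ ∫ x, p x * q x ∂μ :=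
    integral_nonneg fun x => mul_nonneg (hT.left_nonneg x) (hT.right_nonneg x)
  refine ⟨?_, hT.left_nonneg, hT.right_nonneg,
    (Real.sqrt (k + 1 : ℕ) * C) ^ (k + 1) * (∫ x, p x * q x ∂μ) ^ k, by positivity,
    hT.norm_minorCoeff_le hC h hμ k⟩
  have : StronglyMeasurable fun z : (X × X) × (Fin k → X) =>
      (Matrix.of fun a b : Fin (k + 1) => T ((Fin.cons z.1.1 z.2 : Fin (k + 1) → X) a)
        ((Fin.cons z.1.2 z.2 : Fin (k + 1) → X) b)).det := by
    refine (measurable_det fun a b => hT.measurable_apply ?_ ?_).stronglyMeasurable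
    · exact measurable_cons (measurable_fst.comp measurable_fst) measurable_snd a
    · exact measurable_cons (measurable_snd.comp measurable_fst) measurable_snd b
  exact (this.integral_prod_right' (ν := Measure.pi fun _ => μ)).measurable

theorem integral_pi_eq_integral_insertNth {k : ℕ} (a : Fin (k + 1)) (F : (Fin (k + 1) → X) → ℂ) :
    ∫ y, F y ∂(Measure.pi fun _ => μ) =
      ∫ z : X × (Fin k → X), F (a.insertNth z.1 z.2) ∂(μ.prod (Measure.pi fun _ => μ)) := by
  have := (measurePreserving_piFinSuccAbove (fun _ : Fin (k + 1) => μ) a).symm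
  exact (this.integral_comp' F).symm

theorem integrable_pi_iff_insertNth {k : ℕ} (a : Fin (k + 1)) (F : (Fin (k + 1) → X) → ℂ) :
    Integrable F (Measure.pi fun _ => μ) ↔
      Integrable (fun z : X × (Fin k → X) => F (a.insertNth z.1 z.2))
        (μ.prod (Measure.pi fun _ => μ)) := by
  have := (measurePreserving_piFinSuccAbove (fun _ : Fin (k + 1) => μ) a).symm
  exact (this.integrable_comp_emb (MeasurableEquiv.measurableEmbedding _)).symm

theorem integrable_mul_det_cons (hT : KernelBound p q T)
    (hμ : Integrable (fun x => p x * q x) μ) {g : X → ℂ} (hg : Measurable g) {G : ℝ}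
    (hgb : ∀ x, ‖g x‖ ≤ G * p x) (k : ℕ) (x : X) :
    Integrable (fun z : X × (Fin k → X) => g z.1 * (Matrix.of fun a b : Fin (k + 1) =>
      T ((Fin.cons x z.2 : Fin (k + 1) → X) a) ((Fin.cons z.1 z.2 : Fin (k + 1) → X) b)).det)
      (μ.prod (Measure.pi fun _ => μ)) := by
  obtain ⟨C, hC, h⟩ := hT.bound
  refine ((hμ.mul_prod (integrable_prod_pi hμ k)).const_mul
    (G * (Real.sqrt (k + 1 : ℕ) * C) ^ (k + 1) * p x)).mono' ?_
    (.of_forall fun z => ?_)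
  · refine ((hg.comp measurable_fst).mul
      (measurable_det fun a b => hT.measurable_apply ?_ ?_)).aestronglyMeasurable
    · exact measurable_cons measurable_const measurable_snd a
    · exact measurable_cons measurable_fst measurable_snd b
  · rw [norm_mul]
    calc _ ≤ (G * p z.1) * _ :=
          mul_le_mul (hgb _) (norm_det_cons_le hC hT.left_nonneg hT.right_nonneg h x z.1 z.2)
            (norm_nonneg _) ((norm_nonneg _).trans (hgb _))
      _ = _ := by ring

/-- Laplace expansion along the first column of a matrix bordered by the function `g`, integrated
over the points: the summands of the expansion other than the first one have equal integrals. -/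
theorem integral_det_bordered (hT : KernelBound p q T)
    (hμ : Integrable (fun x => p x * q x) μ) {g : X → ℂ} (hg : Measurable g) {G : ℝ}
    (hgb : ∀ x, ‖g x‖ ≤ G * p x) (k : ℕ) (x : X) :
    ∫ y : Fin (k + 1) → X, (Matrix.of fun a b : Fin (k + 2) =>
      (Fin.cons (g ((Fin.cons x y : Fin (k + 2) → X) a))
        (fun b' => T ((Fin.cons x y : Fin (k + 2) → X) a) (y b')) : Fin (k + 2) → ℂ) b).det
      ∂(Measure.pi fun _ => μ) =
    g x * fredholmCoeff μ T (k + 1) - (k + 1) * ∫ w, minorCoeff μ T k x w * g w ∂μ := by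
  set Ψ : X × (Fin k → X) → ℂ := fun z => g z.1 * (Matrix.of fun a b : Fin (k + 1) =>
      T ((Fin.cons x z.2 : Fin (k + 1) → X) a) ((Fin.cons z.1 z.2 : Fin (k + 1) → X) b)).det with hΨ
  have hΨi : Integrable Ψ (μ.prod (Measure.pi fun _ => μ)) :=
    integrable_mul_det_cons hT hμ hg hgb k x
  have hΨint : ∫ z, Ψ z ∂(μ.prod (Measure.pi fun _ => μ)) = ∫ w, minorCoeff μ T k x w * g w ∂μ := by
    rw [integral_prod _ hΨi]
    simp only [hΨ, integral_const_mul, minorCoeff, mul_comm]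
  -- the cofactor of row `a + 1`, after moving the column of the point `y a` to the front
  have hterm : ∀ (a : Fin (k + 1)) (z : X × (Fin k → X)),
      (fun y : Fin (k + 1) → X => (-1) ^ ((a.succ : Fin (k + 2)) : ℕ) * g (y a) *
        (Matrix.of fun r b : Fin (k + 1) =>
          T ((Fin.cons x y : Fin (k + 2) → X) (a.succ.succAbove r)) (y b)).det)
        (a.insertNth z.1 z.2) = - Ψ z := by
    intro a z
    have hrow : ∀ r : Fin (k + 1), (Fin.cons x (a.insertNth z.1 z.2 : Fin (k + 1) → X) :
        Fin (k + 2) → X) (a.succ.succAbove r) = (Fin.cons x z.2 : Fin (k + 1) → X) r := by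
      intro r
      refine Fin.cases ?_ (fun r' => ?_) r
      · rw [Fin.succ_succAbove_zero, Fin.cons_zero, Fin.cons_zero]
      · rw [Fin.succ_succAbove_succ, Fin.cons_succ, Fin.cons_succ, Fin.insertNth_apply_succAbove]
    have hcol : ∀ b : Fin (k + 1), (a.insertNth z.1 z.2 : Fin (k + 1) → X) b =
        (Fin.cons z.1 z.2 : Fin (k + 1) → X) (a.cycleRange b) := by
      intro b
      rw [← Fin.cons_comp_cycleRange, Function.comp_apply]
    simp only [hrow]
    have hdet : (Matrix.of fun r b : Fin (k + 1) => T ((Fin.cons x z.2 : Fin (k + 1) → X) r)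
        ((a.insertNth z.1 z.2 : Fin (k + 1) → X) b)).det = (-1) ^ (a : ℕ) *
        (Matrix.of fun r b : Fin (k + 1) => T ((Fin.cons x z.2 : Fin (k + 1) → X) r)
          ((Fin.cons z.1 z.2 : Fin (k + 1) → X) b)).det := by
      have := Matrix.det_permute' a.cycleRange
        (Matrix.of fun r b : Fin (k + 1) => T ((Fin.cons x z.2 : Fin (k + 1) → X) r)
          ((Fin.cons z.1 z.2 : Fin (k + 1) → X) b))
      rw [Fin.sign_cycleRange] at this
      push_cast at this
      rw [← this]
      simp only [hcol]
      rfl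
    rw [hdet]
    simp only [Fin.insertNth_apply_same, Fin.val_succ, hΨ]
    have h1 : ((-1 : ℂ)) ^ ((a : ℕ) + 1) * (-1) ^ (a : ℕ) = -1 := by
      rw [← pow_add]; exact Odd.neg_one_pow ⟨a, by ring⟩
    linear_combination (g z.1 * (Matrix.of fun r b : Fin (k + 1) =>
      T ((Fin.cons x z.2 : Fin (k + 1) → X) r) ((Fin.cons z.1 z.2 : Fin (k + 1) → X) b)).det) * h1
  have hexp : ∀ y : Fin (k + 1) → X, (Matrix.of fun a b : Fin (k + 2) =>
      (Fin.cons (g ((Fin.cons x y : Fin (k + 2) → X) a))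
        (fun b' => T ((Fin.cons x y : Fin (k + 2) → X) a) (y b')) : Fin (k + 2) → ℂ) b).det =
      g x * (Matrix.of fun a b => T (y a) (y b)).det + ∑ a : Fin (k + 1),
        (-1) ^ ((a.succ : Fin (k + 2)) : ℕ) * g (y a) * (Matrix.of fun r b : Fin (k + 1) =>
          T ((Fin.cons x y : Fin (k + 2) → X) (a.succ.succAbove r)) (y b)).det := by
    intro y
    rw [Matrix.det_succ_column_zero, Fin.sum_univ_succ]
    congr 1
    · simp only [Fin.val_zero, pow_zero, one_mul, Matrix.of_apply, Fin.cons_zero]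
      congr 2
  simp_rw [hexp]
  rw [integral_add, integral_const_mul, integral_finsetSum]
  · have : ∀ a ∈ (Finset.univ : Finset (Fin (k + 1))), ∫ y : Fin (k + 1) → X,
        (-1) ^ ((a.succ : Fin (k + 2)) : ℕ) * g (y a) * (Matrix.of fun r b : Fin (k + 1) =>
          T ((Fin.cons x y : Fin (k + 2) → X) (a.succ.succAbove r)) (y b)).det
          ∂(Measure.pi fun _ => μ) = - ∫ w, minorCoeff μ T k x w * g w ∂μ := by
      intro a _
      rw [integral_pi_eq_integral_insertNth a, ← hΨint, ← integral_neg]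
      exact integral_congr_ae (.of_forall fun z => hterm a z)
    rw [Finset.sum_congr rfl this]
    simp [fredholmCoeff, sub_eq_add_neg]
  · intro a _
    rw [integrable_pi_iff_insertNth a]
    exact hΨi.neg.congr (.of_forall fun z => (hterm a z).symm)
  · exact (hT.integrable_det hμ (k + 1)).const_mul _
  · refine integrable_finsetSum _ fun a _ => ?_
    rw [integrable_pi_iff_insertNth a]
    exact hΨi.neg.congr (.of_forall fun z => (hterm a z).symm)

theorem hasDerivAt_det_add_mul {n : Type} [Fintype n] [DecidableEq n] (A B : Matrix n n ℂ)
    (t : ℝ) :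
    HasDerivAt (fun s : ℝ => (Matrix.of fun a b => A a b + (s : ℂ) * B a b).det)
      (∑ b, ((Matrix.of fun a b => A a b + (t : ℂ) * B a b).updateCol b (fun a => B a b)).det) t := by
  have h1 : ∀ a b, HasDerivAt (fun s : ℝ => A a b + (s : ℂ) * B a b) (B a b) t := by
    intro a b
    simpa using ((Complex.ofRealCLM.hasDerivAt (x := t)).mul_const (B a b)).const_add (A a b)
  simp only [Matrix.det_apply']
  rw [Finset.sum_comm]
  apply HasDerivAt.fun_sum
  intro σ _
  simp_rw [← Finset.mul_sum]
  refine HasDerivAt.const_mul _ ?_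
  have h2 := HasDerivAt.fun_finsetProd (u := Finset.univ) (x := t)
    (f := fun i (s : ℝ) => A (σ i) i + (s : ℂ) * B (σ i) i) (f' := fun i => B (σ i) i)
    (fun i _ => h1 _ _)
  refine h2.congr_deriv (Finset.sum_congr rfl fun i _ => ?_)
  symm
  rw [← Finset.mul_prod_erase _ _ (Finset.mem_univ i), smul_eq_mul, mul_comm]
  congr 1
  · refine Finset.prod_congr rfl fun j hj => ?_
    rw [Matrix.updateCol_ne (Finset.ne_of_mem_erase hj)]
    rfl
  · simp

theorem norm_det_updateCol_le {p q : X → ℝ} {S : X → X → ℂ} {C : ℝ} (hC : 0 ≤ C)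
    (hp : ∀ x, 0 ≤ p x) (hq : ∀ x, 0 ≤ q x) (h : ∀ x y, ‖T x y‖ ≤ C * (p x * q y))
    (h' : ∀ x y, ‖S x y‖ ≤ C * (p x * q y)) {k : ℕ} (y : Fin k → X) (b : Fin k) :
    ‖((Matrix.of fun a b : Fin k => T (y a) (y b)).updateCol b (fun a => S (y a) (y b))).det‖ ≤
      (Real.sqrt k * C) ^ k * ∏ i, p (y i) * q (y i) := by
  have := norm_det_le_of_le_mul
    ((Matrix.of fun a b : Fin k => T (y a) (y b)).updateCol b (fun a => S (y a) (y b))) hC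
    (p := fun a => p (y a)) (q := fun a => q (y a)) (fun _ => hp _) (fun _ => hq _) ?_
  · simpa using this
  · intro i j
    by_cases hj : j = b
    · subst hj; simpa using h' _ _
    · rw [Matrix.updateCol_ne hj]; exact h _ _

theorem KernelBound.integrable_diag (hT : KernelBound p q T)
    (hμ : Integrable (fun x => p x * q x) μ) : Integrable (fun x => T x x) μ := by
  obtain ⟨C, hC, h⟩ := hT.bound
  exact (hμ.const_mul C).mono' (hT.measurable_apply measurable_id measurable_id).aestronglyMeasurable
    (.of_forall fun x => h x x)

/-- Replacing any one column by values of `S` gives the same integral as replacing the first. -/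
theorem integral_det_updateCol (hT : KernelBound p q T) {S : X → X → ℂ} (hS : KernelBound p q S)
    (hμ : Integrable (fun x => p x * q x) μ) (k : ℕ) (b : Fin (k + 1)) :
    ∫ y : Fin (k + 1) → X, ((Matrix.of fun a b : Fin (k + 1) => T (y a) (y b)).updateCol b
        (fun a => S (y a) (y b))).det ∂(Measure.pi fun _ => μ) =
      (∫ x, S x x ∂μ) * fredholmCoeff μ T k -
        k * ∫ x, comp μ (ParabolicAiry.minorCoeff μ T (k - 1)) S x x ∂μ := by
  obtain ⟨C, hC, h⟩ := hT.bound
  obtain ⟨D, hD, h'⟩ := hS.bound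
  have hb : Integrable (fun y : Fin (k + 1) → X => ((Matrix.of fun a b : Fin (k + 1) =>
      T (y a) (y b)).updateCol b (fun a => S (y a) (y b))).det) (Measure.pi fun _ => μ) := by
    refine ((integrable_prod_pi hμ (k + 1)).const_mul
      ((Real.sqrt (k + 1 : ℕ) * (C + D)) ^ (k + 1))).mono'
      (measurable_det fun i j => ?_).aestronglyMeasurable
      (.of_forall fun y => norm_det_updateCol_le (by positivity)
        hT.left_nonneg hT.right_nonneg (fun x y => ?_) (fun x y => ?_) y b)
    · by_cases hj : j = b
      · subst hj
        simpa using hS.measurable_apply (measurable_pi_apply i) (measurable_pi_apply j)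
      · simp only [Matrix.updateCol_ne hj]
        exact hT.measurable_apply (measurable_pi_apply i) (measurable_pi_apply j)
    · have := mul_nonneg (hT.left_nonneg x) (hT.right_nonneg y)
      refine (h x y).trans ?_
      gcongr
      linarith
    · have := mul_nonneg (hT.left_nonneg x) (hT.right_nonneg y)
      refine (h' x y).trans ?_
      gcongr
      linarith
  rw [integrable_pi_iff_insertNth b] at hb
  rw [integral_pi_eq_integral_insertNth b, integral_prod _ hb]
  have hmat : ∀ (x : X) (s : Fin k → X), ((Matrix.of fun a c : Fin (k + 1) =>
      T ((b.insertNth x s : Fin (k + 1) → X) a) ((b.insertNth x s : Fin (k + 1) → X) c)).updateCol b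
        (fun a => S ((b.insertNth x s : Fin (k + 1) → X) a)
          ((b.insertNth x s : Fin (k + 1) → X) b))).det =
      (Matrix.of fun a c : Fin (k + 1) => (Fin.cons (S ((Fin.cons x s : Fin (k + 1) → X) a) x)
        (fun c' => T ((Fin.cons x s : Fin (k + 1) → X) a) (s c')) : Fin (k + 1) → ℂ) c).det := by
    intro x s
    rw [← Matrix.det_submatrix_equiv_self b.cycleRange (Matrix.of fun a c : Fin (k + 1) => _)]
    congr 1
    have hz : ∀ c : Fin (k + 1), (b.insertNth x s : Fin (k + 1) → X) c =
        (Fin.cons x s : Fin (k + 1) → X) (b.cycleRange c) := by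
      intro c
      rw [← Fin.cons_comp_cycleRange, Function.comp_apply]
    ext a c
    simp only [Matrix.submatrix_apply, Matrix.of_apply]
    by_cases hc : c = b
    · subst hc
      rw [Matrix.updateCol_self, hz, hz, Fin.cycleRange_self, Fin.cons_zero, Fin.cons_zero]
    · rw [Matrix.updateCol_ne hc]
      have h0 : b.cycleRange c ≠ 0 := by
        rw [← Fin.cycleRange_self b]
        exact fun hh => hc (b.cycleRange.injective hh)
      obtain ⟨c', hc'⟩ := Fin.exists_succ_eq.mpr h0
      rw [Matrix.of_apply, hz, hz, ← hc', Fin.cons_succ, Fin.cons_succ]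
  simp only [hmat]
  have hSd := hS.integrable_diag hμ
  rcases k with _ | k
  · simp [fredholmCoeff, Matrix.det_unique, integral_unique, measureReal_def]
  · have hbord : ∀ x : X, ∫ y : Fin (k + 1) → X, (Matrix.of fun a c : Fin (k + 1 + 1) =>
        (Fin.cons (S ((Fin.cons x y : Fin (k + 1 + 1) → X) a) x)
        (fun c' => T ((Fin.cons x y : Fin (k + 1 + 1) → X) a) (y c')) : Fin (k + 1 + 1) → ℂ) c).det
        ∂(Measure.pi fun _ => μ) = S x x * fredholmCoeff μ T (k + 1) -
          (k + 1) * comp μ (ParabolicAiry.minorCoeff μ T k) S x x := by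
      intro x
      exact integral_det_bordered hT hμ (g := fun w => S w x) (G := D * q x)
        (hS.measurable_apply measurable_id measurable_const)
        (fun w => (h' w x).trans (le_of_eq (by ring))) k x
    simp only [hbord]
    rw [integral_sub (hSd.mul_const _) ((((hT.minorCoeff hμ k).comp hS hμ).integrable_diag hμ).const_mul _),
      integral_mul_const, integral_const_mul]
    simp

theorem minorCoeff_succ (hT : KernelBound p q T)
    (hμ : Integrable (fun x => p x * q x) μ) (k : ℕ) (x y : X) :
    minorCoeff μ T k x y = T x y * fredholmCoeff μ T k -
      k * comp μ (minorCoeff μ T (k - 1)) T x y := by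
  obtain ⟨C, hC, h⟩ := hT.bound
  rcases k with _ | k
  · simp [minorCoeff, fredholmCoeff, Matrix.det_unique, integral_unique, mul_comm (T x y)]
  · have := integral_det_bordered hT hμ (g := fun w => T w y) (G := C * q y)
      (hT.measurable_apply measurable_id measurable_const)
      (fun w => (h w y).trans (le_of_eq (by ring))) k x
    simp only [Nat.cast_add, Nat.cast_one, Nat.add_sub_cancel]
    rw [comp, ← this, minorCoeff]
    congr 1
    ext t
    congr 1
    ext a b
    refine Fin.cases ?_ (fun b' => ?_) b <;> simp

theorem KernelBound.norm_fredholmCoeff_le {C : ℝ} (hC : 0 ≤ C) (hT : KernelBound p q T)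
    (h : ∀ x y, ‖T x y‖ ≤ C * (p x * q y)) (hμ : Integrable (fun x => p x * q x) μ) (k : ℕ) :
    ‖fredholmCoeff μ T k‖ ≤ (Real.sqrt k * (C * ∫ x, p x * q x ∂μ)) ^ k := by
  calc _ ≤ ∫ y : Fin k → X, (Real.sqrt k * C) ^ k * ∏ i, p (y i) * q (y i)
        ∂(Measure.pi fun _ => μ) := by
        refine norm_integral_le_of_norm_le ((integrable_prod_pi hμ k).const_mul _)
          (.of_forall fun y => ?_)
        simpa using norm_det_le_of_le_mul (Matrix.of fun a b : Fin k => T (y a) (y b)) hC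
          (p := fun a => p (y a)) (q := fun a => q (y a))
          (fun _ => hT.left_nonneg _) (fun _ => hT.right_nonneg _) fun i j => h _ _
    _ = _ := by rw [integral_const_mul, integral_prod_pi, ← mul_pow]; ring

theorem KernelBound.summable_fredholmCoeff (hT : KernelBound p q T)
    (hμ : Integrable (fun x => p x * q x) μ) :
    Summable fun k : ℕ => 1 / (k.factorial : ℂ) * fredholmCoeff μ T k := by
  obtain ⟨C, hC, h⟩ := hT.bound
  have hI : 0 ≤ ∫ x, p x * q x ∂μ :=
    integral_nonneg fun x => mul_nonneg (hT.left_nonneg x) (hT.right_nonneg x)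
  refine Summable.of_norm_bounded (summable_hadamard (C := C * ∫ x, p x * q x ∂μ) (by positivity))
    fun k => ?_
  rw [norm_mul, norm_div, norm_one, Complex.norm_natCast]
  gcongr
  exact hT.norm_fredholmCoeff_le hC h hμ k

theorem KernelBound.measurable_det_updateCol (hT : KernelBound p q T) {S : X → X → ℂ}
    (hS : KernelBound p q S) {k : ℕ} (b : Fin k) : Measurable fun y : Fin k → X =>
      ((Matrix.of fun a b : Fin k => T (y a) (y b)).updateCol b (fun a => S (y a) (y b))).det := by
  refine measurable_det fun i j => ?_
  by_cases hj : j = b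
  · subst hj
    simpa using hS.measurable_apply (measurable_pi_apply i) (measurable_pi_apply j)
  · simp only [Matrix.updateCol_ne hj]
    exact hT.measurable_apply (measurable_pi_apply i) (measurable_pi_apply j)

theorem KernelBound.integrable_det_updateCol (hT : KernelBound p q T) {S : X → X → ℂ}
    (hS : KernelBound p q S) (hμ : Integrable (fun x => p x * q x) μ) {C : ℝ} (hC : 0 ≤ C)
    (h : ∀ x y, ‖T x y‖ ≤ C * (p x * q y)) (h' : ∀ x y, ‖S x y‖ ≤ C * (p x * q y))
    {k : ℕ} (b : Fin k) : Integrable (fun y : Fin k → X =>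
      ((Matrix.of fun a b : Fin k => T (y a) (y b)).updateCol b (fun a => S (y a) (y b))).det)
      (Measure.pi fun _ => μ) :=
  ((integrable_prod_pi hμ k).const_mul ((Real.sqrt k * C) ^ k)).mono'
    (hT.measurable_det_updateCol hS b).aestronglyMeasurable (.of_forall fun y =>
      norm_det_updateCol_le hC hT.left_nonneg hT.right_nonneg h h' y b)

/-- The derivative of a term of the Fredholm series along the line `T + s S`. -/
noncomputable def fredholmCoeffDeriv (μ : Measure X) (T S : X → X → ℂ) (k : ℕ) : ℂ :=
  ∑ b : Fin k, ∫ y : Fin k → X, ((Matrix.of fun a b : Fin k => T (y a) (y b)).updateCol b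
    (fun a => S (y a) (y b))).det ∂(Measure.pi fun _ => μ)

theorem norm_add_ofReal_mul_le {S : X → X → ℂ} {C D R : ℝ} {s : ℝ} (hs : |s| ≤ R)
    (hpq : ∀ x y, 0 ≤ p x * q y) (hD : 0 ≤ D)
    (h : ∀ x y, ‖T x y‖ ≤ C * (p x * q y)) (h' : ∀ x y, ‖S x y‖ ≤ D * (p x * q y)) (x y : X) :
    ‖T x y + (s : ℂ) * S x y‖ ≤ (C + (R + 1) * D) * (p x * q y) := by
  have hR : 0 ≤ R := (abs_nonneg s).trans hs
  calc _ ≤ ‖T x y‖ + ‖(s : ℂ) * S x y‖ := norm_add_le _ _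
    _ ≤ C * (p x * q y) + R * (D * (p x * q y)) := by
        rw [norm_mul, Complex.norm_real, Real.norm_eq_abs]
        gcongr
        · exact h x y
        · exact h' x y
    _ ≤ _ := by nlinarith [hpq x y, mul_nonneg hD (hpq x y)]

theorem norm_le_add_mul {S : X → X → ℂ} {C D R : ℝ} (hR : 0 ≤ R)
    (hpq : ∀ x y, 0 ≤ p x * q y) (hC : 0 ≤ C) (hD : 0 ≤ D)
    (h' : ∀ x y, ‖S x y‖ ≤ D * (p x * q y)) (x y : X) :
    ‖S x y‖ ≤ (C + (R + 1) * D) * (p x * q y) := by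
  refine (h' x y).trans ?_
  have := hpq x y
  gcongr
  nlinarith

theorem hasDerivAt_fredholmCoeff (hT : KernelBound p q T) {S : X → X → ℂ}
    (hS : KernelBound p q S) (hμ : Integrable (fun x => p x * q x) μ) (t : ℝ) (k : ℕ) :
    HasDerivAt (fun s : ℝ => fredholmCoeff μ (fun x y => T x y + (s : ℂ) * S x y) k)
      (fredholmCoeffDeriv μ (fun x y => T x y + (t : ℂ) * S x y) S k) t := by
  obtain ⟨C, hC, h⟩ := hT.bound
  obtain ⟨D, hD, h'⟩ := hS.bound
  have hpq : ∀ x y, 0 ≤ p x * q y := fun x y => mul_nonneg (hT.left_nonneg x) (hT.right_nonneg y)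
  set E := C + (|t| + 1 + 1) * D with hE
  have hE0 : 0 ≤ E := by positivity
  have hKs : ∀ s ∈ Metric.ball t 1, ∀ x y, ‖T x y + (s : ℂ) * S x y‖ ≤ E * (p x * q y) := by
    intro s hs
    refine norm_add_ofReal_mul_le ?_ hpq hD h h'
    have h1 : |s - t| < 1 := by simpa [Real.dist_eq] using hs
    calc |s| = |t + (s - t)| := by ring_nf
      _ ≤ |t| + |s - t| := abs_add_le _ _
      _ ≤ _ := by linarith
  have hSs : ∀ x y, ‖S x y‖ ≤ E * (p x * q y) := norm_le_add_mul (by positivity) hpq hC hD h'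
  have hK : ∀ s : ℝ, KernelBound p q fun x y => T x y + (s : ℂ) * S x y :=
    fun s => hT.add (hS.const_mul _)
  have hder := hasDerivAt_integral_of_dominated_loc_of_deriv_le (μ := Measure.pi fun _ : Fin k => μ)
    (F := fun (s : ℝ) (y : Fin k → X) =>
      (Matrix.of fun a b : Fin k => T (y a) (y b) + (s : ℂ) * S (y a) (y b)).det)
    (F' := fun (s : ℝ) (y : Fin k → X) => ∑ b, ((Matrix.of fun a b : Fin k =>
      T (y a) (y b) + (s : ℂ) * S (y a) (y b)).updateCol b (fun a => S (y a) (y b))).det)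
    (x₀ := t) (s := Metric.ball t 1)
    (bound := fun y => ∑ _b : Fin k, (Real.sqrt k * E) ^ k * ∏ i, p (y i) * q (y i))
    (Metric.ball_mem_nhds t one_pos)
    (.of_forall fun s => ((hK s).integrable_det hμ k).aestronglyMeasurable)
    ((hK t).integrable_det hμ k)
    (Finset.measurable_sum _ fun b _ =>
      (hK t).measurable_det_updateCol hS b).aestronglyMeasurable
    (.of_forall fun y s hs => (norm_sum_le _ _).trans
      (Finset.sum_le_sum fun b _ => norm_det_updateCol_le hE0 hT.left_nonneg hT.right_nonneg
        (hKs s hs) hSs y b))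
    (integrable_finsetSum _ fun b _ => (integrable_prod_pi hμ k).const_mul _)
    (.of_forall fun y s _ => hasDerivAt_det_add_mul
      (Matrix.of fun a b => T (y a) (y b)) (Matrix.of fun a b => S (y a) (y b)) s)
  refine hder.2.congr_deriv ?_
  rw [integral_finsetSum _ fun b _ => (hK t).integrable_det_updateCol hS hμ hE0
    (hKs t (Metric.mem_ball_self one_pos)) hSs b]
  rfl

theorem KernelBound.norm_fredholmCoeffDeriv_le (hT : KernelBound p q T) {S : X → X → ℂ}
    {C : ℝ} (hC : 0 ≤ C) (h : ∀ x y, ‖T x y‖ ≤ C * (p x * q y))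
    (h' : ∀ x y, ‖S x y‖ ≤ C * (p x * q y)) (hμ : Integrable (fun x => p x * q x) μ) (k : ℕ) :
    ‖fredholmCoeffDeriv μ T S k‖ ≤ (Real.sqrt k * (2 * (C * ∫ x, p x * q x ∂μ))) ^ k := by
  have hI : 0 ≤ ∫ x, p x * q x ∂μ :=
    integral_nonneg fun x => mul_nonneg (hT.left_nonneg x) (hT.right_nonneg x)
  have hk : (k : ℝ) ≤ 2 ^ k := by exact_mod_cast Nat.lt_two_pow_self.le
  calc _ ≤ ∑ _b : Fin k, (Real.sqrt k * C) ^ k * (∫ x, p x * q x ∂μ) ^ k := by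
        refine (norm_sum_le _ _).trans (Finset.sum_le_sum fun b _ => ?_)
        rw [← integral_prod_pi, ← integral_const_mul]
        exact norm_integral_le_of_norm_le ((integrable_prod_pi hμ k).const_mul _)
          (.of_forall fun y =>
            norm_det_updateCol_le hC hT.left_nonneg hT.right_nonneg h h' y b)
    _ = k * ((Real.sqrt k * C) ^ k * (∫ x, p x * q x ∂μ) ^ k) := by simp
    _ ≤ 2 ^ k * ((Real.sqrt k * C) ^ k * (∫ x, p x * q x ∂μ) ^ k) := by gcongr
    _ = _ := by rw [← mul_pow, ← mul_pow]; ring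

/-- If `S = N + T N` with `N` vanishing on the diagonal, then the derivatives of the terms of the
Fredholm series in the direction `S` are differences of consecutive traces. -/
theorem fredholmCoeffDeriv_succ (hT : KernelBound p q T) {S N : X → X → ℂ}
    (hS : KernelBound p q S) (hN : KernelBound p q N)
    (hμ : Integrable (fun x => p x * q x) μ)
    (hSN : ∀ x y, S x y = N x y + comp μ T N x y) (hN0 : ∀ x, N x x = 0) (k : ℕ) :
    fredholmCoeffDeriv μ T S (k + 1) =
      (k + 1) * ((∫ x, comp μ (minorCoeff μ T k) N x x ∂μ) -
        k * ∫ x, comp μ (minorCoeff μ T (k - 1)) N x x ∂μ) := by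
  rw [fredholmCoeffDeriv, Finset.sum_congr rfl fun b _ => integral_det_updateCol hT hS hμ k b,
    Finset.sum_const, Finset.card_univ, Fintype.card_fin, nsmul_eq_mul]
  push_cast
  congr 1
  have hTN := hT.comp hN hμ
  have hm := hT.minorCoeff hμ (k - 1)
  have hmT := hm.comp hT hμ
  have hS' : S = fun x y => N x y + comp μ T N x y := by ext x y; exact hSN x y
  have e1 : ∫ x, S x x ∂μ = ∫ x, comp μ T N x x ∂μ := by
    simp only [hSN, hN0, zero_add]
  have e2 : ∫ x, comp μ (ParabolicAiry.minorCoeff μ T (k - 1)) S x x ∂μ =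
      (∫ x, comp μ (ParabolicAiry.minorCoeff μ T (k - 1)) N x x ∂μ) +
        ∫ x, comp μ (comp μ (ParabolicAiry.minorCoeff μ T (k - 1)) T) N x x ∂μ := by
    rw [comp_assoc hm hT hN hμ hμ, hS', comp_add_right hm hN hTN hμ]
    exact integral_add ((hm.comp hN hμ).integrable_diag hμ) ((hm.comp hTN hμ).integrable_diag hμ)
  have e3 : ∫ x, comp μ (ParabolicAiry.minorCoeff μ T k) N x x ∂μ =
      (∫ x, comp μ T N x x ∂μ) * fredholmCoeff μ T k -
        k * ∫ x, comp μ (comp μ (ParabolicAiry.minorCoeff μ T (k - 1)) T) N x x ∂μ := by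
    have : ParabolicAiry.minorCoeff μ T k = fun x y => fredholmCoeff μ T k * T x y +
        (-(k : ℂ)) * comp μ (ParabolicAiry.minorCoeff μ T (k - 1)) T x y := by
      ext x y
      rw [minorCoeff_succ hT hμ k x y]; ring
    rw [this, comp_add_left (hT.const_mul _) (hmT.const_mul _) hN hμ, comp_const_mul_left,
      comp_const_mul_left, integral_add ((hTN.integrable_diag hμ).const_mul _)
      (((hmT.comp hN hμ).integrable_diag hμ).const_mul _), integral_const_mul, integral_const_mul]
    ring
  rw [e1, e2, e3]
  ring

theorem sum_fredholmCoeffDeriv (hT : KernelBound p q T) {S N : X → X → ℂ}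
    (hS : KernelBound p q S) (hN : KernelBound p q N)
    (hμ : Integrable (fun x => p x * q x) μ)
    (hSN : ∀ x y, S x y = N x y + comp μ T N x y) (hN0 : ∀ x, N x x = 0) (n : ℕ) :
    ∑ k ∈ Finset.range (n + 2), 1 / (k.factorial : ℂ) * fredholmCoeffDeriv μ T S k =
      1 / (n.factorial : ℂ) * ∫ x, comp μ (minorCoeff μ T n) N x x ∂μ := by
  induction n with
  | zero =>
    rw [Finset.sum_range_succ, Finset.sum_range_one, fredholmCoeffDeriv_succ hT hS hN hμ hSN hN0]
    simp [fredholmCoeffDeriv]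
  | succ n ih =>
    rw [Finset.sum_range_succ, ih, fredholmCoeffDeriv_succ hT hS hN hμ hSN hN0,
      Nat.factorial_succ (n + 1), Nat.factorial_succ n]
    have h1 : ((n.factorial : ℕ) : ℂ) ≠ 0 := by exact_mod_cast n.factorial_ne_zero
    have h2 : (n : ℂ) + 1 ≠ 0 := by exact_mod_cast n.succ_ne_zero
    have h3 : (n : ℂ) + 1 + 1 ≠ 0 := by exact_mod_cast (n + 1).succ_ne_zero
    simp only [Nat.add_sub_cancel]
    push_cast
    field_simp
    ring

theorem tendsto_trace_minorCoeff (hT : KernelBound p q T) {N : X → X → ℂ}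
    (hN : KernelBound p q N) (hμ : Integrable (fun x => p x * q x) μ) :
    Filter.Tendsto (fun n : ℕ => 1 / (n.factorial : ℂ) * ∫ x, comp μ (minorCoeff μ T n) N x x ∂μ)
      Filter.atTop (nhds 0) := by
  obtain ⟨C, hC, h⟩ := hT.bound
  obtain ⟨D, hD, h'⟩ := hN.bound
  set I := ∫ x, p x * q x ∂μ with hIdef
  have hI : 0 ≤ I :=
    integral_nonneg fun x => mul_nonneg (hT.left_nonneg x) (hT.right_nonneg x)
  have hsum := (summable_nat_add_iff 1).mpr (summable_hadamard (C := 2 * (C * (I + 1)))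
    (by positivity))
  refine squeeze_zero_norm (fun n => ?_) (by simpa using hsum.tendsto_atTop_zero.const_mul (D * I * I))
  have hb : ∀ x, ‖comp μ (minorCoeff μ T n) N x x‖ ≤
      (Real.sqrt (n + 1 : ℕ) * C) ^ (n + 1) * I ^ n * D * I * (p x * q x) := by
    intro x
    calc _ ≤ ∫ y, (Real.sqrt (n + 1 : ℕ) * C) ^ (n + 1) * I ^ n * D * (p x * q x) * (p y * q y) ∂μ := by
          refine norm_integral_le_of_norm_le (hμ.const_mul _) (.of_forall fun y => ?_)
          rw [norm_mul]
          calc _ ≤ _ := mul_le_mul (hT.norm_minorCoeff_le hC h hμ n x y) (h' y x) (norm_nonneg _)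
                ((norm_nonneg _).trans (hT.norm_minorCoeff_le hC h hμ n x y))
            _ = _ := by ring
      _ = _ := by rw [integral_const_mul]; ring
  have hint : ‖∫ x, comp μ (minorCoeff μ T n) N x x ∂μ‖ ≤
      (Real.sqrt (n + 1 : ℕ) * C) ^ (n + 1) * I ^ n * D * I * I := by
    rw [hIdef, ← integral_const_mul]
    exact norm_integral_le_of_norm_le (hμ.const_mul _) (.of_forall hb)
  rw [norm_mul, norm_div, norm_one, Complex.norm_natCast]
  have hk : ((n : ℝ) + 1) ≤ 2 ^ (n + 1) := by exact_mod_cast (Nat.lt_two_pow_self (n := n + 1)).le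
  have hfac : 1 / (n.factorial : ℝ) = (n + 1) * (1 / ((n + 1).factorial : ℝ)) := by
    rw [Nat.factorial_succ]; push_cast; field_simp
  calc _ ≤ 1 / (n.factorial : ℝ) * ((Real.sqrt (n + 1 : ℕ) * C) ^ (n + 1) * I ^ n * D * I * I) := by
        gcongr
    _ = (n + 1) * (D * I * I * (1 / ((n + 1).factorial : ℝ) * ((Real.sqrt (n + 1 : ℕ) * C) ^ (n + 1) *
          I ^ n))) := by rw [hfac]; ring
    _ ≤ 2 ^ (n + 1) * (D * I * I * (1 / ((n + 1).factorial : ℝ) *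
          ((Real.sqrt (n + 1 : ℕ) * C) ^ (n + 1) * (I + 1) ^ (n + 1)))) := by
        have : I ^ n ≤ (I + 1) ^ (n + 1) :=
          (pow_le_pow_left₀ hI (by linarith) n).trans (pow_le_pow_right₀ (by linarith) (by lia))
        gcongr
    _ = _ := by
        simp only [mul_pow]; push_cast; ring

/-- Right multiplication by `I + t N` does not change a Fredholm determinant, if `N` has a
resolvent that vanishes on the diagonal for every `t`. -/
theorem fredholm_add_comp_of_resolvent (hT : KernelBound p q T) {N : X → X → ℂ}
    (hN : KernelBound p q N) (hμ : Integrable (fun x => p x * q x) μ)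
    (hres : ∀ t : ℝ, ∃ R : X → X → ℂ, KernelBound p q R ∧
      (∀ x y, N x y = R x y + t * comp μ N R x y) ∧ ∀ x, R x x = 0) :
    fredholm μ (fun x y => T x y + (N x y + comp μ T N x y)) = fredholm μ T := by
  set S : X → X → ℂ := fun x y => N x y + comp μ T N x y with hSdef
  have hTN := hT.comp hN hμ
  have hS : KernelBound p q S := hN.add hTN
  set φ : ℝ → ℂ := fun s => fredholm μ (fun x y => T x y + (s : ℂ) * S x y) with hφ
  have hK : ∀ s : ℝ, KernelBound p q fun x y => T x y + (s : ℂ) * S x y :=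
    fun s => hT.add (hS.const_mul _)
  obtain ⟨C, hC, h⟩ := hT.bound
  obtain ⟨D, hD, h'⟩ := hS.bound
  have hpq : ∀ x y, 0 ≤ p x * q y := fun x y => mul_nonneg (hT.left_nonneg x) (hT.right_nonneg y)
  have hI : 0 ≤ ∫ x, p x * q x ∂μ := integral_nonneg fun x => hpq x x
  have hderiv : ∀ t : ℝ, HasDerivAt φ 0 t := by
    intro t
    set E := C + (|t| + 1 + 1) * D
    have hE : 0 ≤ E := by positivity
    have hu := summable_hadamard (C := 2 * (E * ∫ x, p x * q x ∂μ)) (by positivity)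
    have hb : ∀ (k : ℕ), ∀ s ∈ Metric.ball t 1, ‖1 / (k.factorial : ℂ) *
        fredholmCoeffDeriv μ (fun x y => T x y + (s : ℂ) * S x y) S k‖ ≤
        1 / (k.factorial : ℝ) * (Real.sqrt k * (2 * (E * ∫ x, p x * q x ∂μ))) ^ k := by
      intro k s hs
      have hs' : |s| ≤ |t| + 1 := by
        have h1 : |s - t| < 1 := by simpa [Real.dist_eq] using hs
        calc |s| = |t + (s - t)| := by ring_nf
          _ ≤ |t| + |s - t| := abs_add_le _ _
          _ ≤ _ := by linarith
      rw [norm_mul, norm_div, norm_one, Complex.norm_natCast]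
      gcongr
      exact (hK s).norm_fredholmCoeffDeriv_le hE (norm_add_ofReal_mul_le hs' hpq hD h h')
        (norm_le_add_mul (by positivity) hpq hC hD h') hμ k
    have hd := hasDerivAt_tsum_of_isPreconnected hu Metric.isOpen_ball
      (convex_ball t 1).isPreconnected
      (g := fun (k : ℕ) (s : ℝ) => 1 / (k.factorial : ℂ) *
        fredholmCoeff μ (fun x y => T x y + (s : ℂ) * S x y) k)
      (g' := fun (k : ℕ) (s : ℝ) => 1 / (k.factorial : ℂ) *
        fredholmCoeffDeriv μ (fun x y => T x y + (s : ℂ) * S x y) S k)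
      (fun k s _ => (hasDerivAt_fredholmCoeff hT hS hμ s k).const_mul _) hb
      (Metric.mem_ball_self one_pos) ((hK t).summable_fredholmCoeff hμ)
      (Metric.mem_ball_self one_pos)
    refine hd.congr_deriv ?_
    obtain ⟨R, hR, hNR, hR0⟩ := hres t
    have hSR : ∀ x y, S x y = R x y + comp μ (fun x y => T x y + (t : ℂ) * S x y) R x y := by
      intro x y
      have hN' : N = fun x y => R x y + (t : ℂ) * comp μ N R x y := by ext x y; exact hNR x y
      have hNRb := hN.comp hR hμ
      have e1 : comp μ (fun x y => T x y + (t : ℂ) * S x y) R = fun x y => comp μ T R x y +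
          t * (comp μ N R x y + comp μ (comp μ T N) R x y) := by
        rw [comp_add_left hT (hS.const_mul _) hR hμ, comp_const_mul_left, hSdef,
          comp_add_left hN hTN hR hμ]
      have e2 : comp μ T N = fun x y => comp μ T R x y + t * comp μ (comp μ T N) R x y := by
        conv_lhs => rw [hN']
        rw [comp_add_right hT hR (hNRb.const_mul _) hμ, comp_const_mul_right,
          comp_assoc hT hN hR hμ hμ]
      rw [e1]
      show N x y + comp μ T N x y = _
      rw [hNR x y, congrFun (congrFun e2 x) y]
      ring
    have hsum : Summable fun k : ℕ => 1 / (k.factorial : ℂ) *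
        fredholmCoeffDeriv μ (fun x y => T x y + (t : ℂ) * S x y) S k :=
      Summable.of_norm_bounded hu fun k => hb k t (Metric.mem_ball_self one_pos)
    have h1 := (Filter.tendsto_add_atTop_iff_nat 2).mpr hsum.hasSum.tendsto_sum_nat
    simp only [sum_fredholmCoeffDeriv (hK t) hS hR hμ hSR hR0] at h1
    exact tendsto_nhds_unique h1 (tendsto_trace_minorCoeff (hK t) hR hμ)
  have hconst := is_const_of_deriv_eq_zero (fun t => (hderiv t).differentiableAt)
    (fun t => (hderiv t).deriv) 1 0
  simpa [hφ] using hconst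

/-- The powers `N, N², N³, …` of a kernel. -/
noncomputable def kernelPow (μ : Measure X) (N : X → X → ℂ) : ℕ → X → X → ℂ
  | 0 => N
  | j + 1 => comp μ N (kernelPow μ N j)

theorem KernelBound.kernelPow {N : X → X → ℂ} (hN : KernelBound p q N)
    (hμ : Integrable (fun x => p x * q x) μ) (j : ℕ) : KernelBound p q (kernelPow μ N j) := by
  induction j with
  | zero => exact hN
  | succ j ih => exact hN.comp ih hμ

theorem comp_kernelPow {N : X → X → ℂ} (hN : KernelBound p q N)
    (hμ : Integrable (fun x => p x * q x) μ) (j : ℕ) :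
    comp μ (kernelPow μ N j) N = kernelPow μ N (j + 1) := by
  induction j with
  | zero => rfl
  | succ j ih =>
    change comp μ (comp μ N (kernelPow μ N j)) N = comp μ N (kernelPow μ N (j + 1))
    rw [← ih, comp_assoc hN (hN.kernelPow hμ j) hN hμ hμ]

theorem comp_ne_zero {N R : X → X → ℂ} {x y : X} (h : comp μ N R x y ≠ 0) :
    ∃ z, N x z ≠ 0 ∧ R z y ≠ 0 := by
  by_contra! hc
  refine h ?_
  rw [comp, integral_congr_ae (g := fun _ => 0), integral_zero]
  refine Filter.Eventually.of_forall fun z => ?_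
  by_cases hz : N x z = 0
  · simp [hz]
  · simp [hc z hz]

theorem level_add_lt_of_kernelPow_ne_zero {N : X → X → ℂ} {lev : X → ℕ}
    (hlev : ∀ x y, N x y ≠ 0 → lev x < lev y) (j : ℕ) {x y : X} (h : kernelPow μ N j x y ≠ 0) :
    lev x + j < lev y := by
  induction j generalizing x with
  | zero => exact hlev x y h
  | succ j ih =>
    obtain ⟨z, h1, h2⟩ := comp_ne_zero h
    have := hlev x z h1
    have := ih h2
    lia

/-- A strictly triangular kernel is nilpotent, so `I + t N` is inverted by a finite Neumann
series. -/
theorem exists_resolvent_of_level {N : X → X → ℂ} (hN : KernelBound p q N)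
    (hμ : Integrable (fun x => p x * q x) μ) {lev : X → ℕ} {m : ℕ} (hm : ∀ x, lev x ≤ m)
    (hlev : ∀ x y, N x y ≠ 0 → lev x < lev y) (t : ℝ) :
    ∃ R : X → X → ℂ, KernelBound p q R ∧ (∀ x y, N x y = R x y + t * comp μ N R x y) ∧
      (∀ x y, N x y = R x y + t * comp μ R N x y) ∧ ∀ x y, R x y ≠ 0 → lev x < lev y := by
  have hpow : ∀ x y, kernelPow μ N m x y = 0 := by
    intro x y
    by_contra h
    have := level_add_lt_of_kernelPow_ne_zero hlev m h
    have := hm y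
    lia
  have htel : ∀ x y, ∑ j ∈ Finset.range m, ((-t : ℂ) ^ j * kernelPow μ N j x y) +
      t * ∑ j ∈ Finset.range m, ((-t : ℂ) ^ j * kernelPow μ N (j + 1) x y) = N x y := by
    intro x y
    have := Finset.sum_range_sub' (fun j => (-t : ℂ) ^ j * kernelPow μ N j x y) m
    rw [hpow, Finset.sum_sub_distrib] at this
    simp only [pow_zero, one_mul, mul_zero, sub_zero] at this
    rw [show N x y = kernelPow μ N 0 x y from rfl, ← this, Finset.mul_sum, sub_eq_add_neg,
      ← Finset.sum_neg_distrib]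
    congr 1
    exact Finset.sum_congr rfl fun j _ => by ring
  refine ⟨fun x y => ∑ j ∈ Finset.range m, (-t : ℂ) ^ j * kernelPow μ N j x y,
    KernelBound.sum _ hN.left_nonneg hN.right_nonneg fun j _ => (hN.kernelPow hμ j).const_mul _,
    fun x y => ?_, fun x y => ?_, fun x y h => ?_⟩
  · rw [← htel x y]
    congr 2
    simp only [comp, Finset.mul_sum]
    rw [integral_finsetSum]
    · refine Finset.sum_congr rfl fun j _ => ?_
      simp only [kernelPow, comp, ← integral_const_mul]
      congr 1; ext z; ring
    · intro j _
      exact hN.integrable_mul ((hN.kernelPow hμ j).const_mul _) hμ x y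
  · rw [← htel x y]
    congr 2
    simp only [comp, Finset.sum_mul]
    rw [integral_finsetSum]
    · refine Finset.sum_congr rfl fun j _ => ?_
      rw [← comp_kernelPow hN hμ j]
      simp only [comp, ← integral_const_mul]
      congr 1; ext z; ring
    · intro j _
      exact ((hN.kernelPow hμ j).const_mul _).integrable_mul hN hμ x y
  · obtain ⟨j, -, hj⟩ := Finset.exists_ne_zero_of_sum_ne_zero h
    have := level_add_lt_of_kernelPow_ne_zero hlev j (right_ne_zero_of_mul hj)
    lia

/-- `det ((I + T) (I + N)) = det (I + T)` for a strictly triangular kernel `N`. -/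
theorem fredholm_add_comp_of_level (hT : KernelBound p q T) {N : X → X → ℂ}
    (hN : KernelBound p q N) (hμ : Integrable (fun x => p x * q x) μ) {lev : X → ℕ} {m : ℕ}
    (hm : ∀ x, lev x ≤ m) (hlev : ∀ x y, N x y ≠ 0 → lev x < lev y) :
    fredholm μ (fun x y => T x y + (N x y + comp μ T N x y)) = fredholm μ T := by
  refine fredholm_add_comp_of_resolvent hT hN hμ fun t => ?_
  obtain ⟨R, h1, h2, -, h4⟩ := exists_resolvent_of_level hN hμ hm hlev t
  refine ⟨R, h1, h2, fun x => ?_⟩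
  by_contra h
  exact lt_irrefl _ (h4 x x h)

end Multiplicativity

/-! ### Fredholm series on a product with a finite set -/

section Conversion

set_option linter.unusedSectionVars false

variable {ι Y : Type} [Fintype ι] [MeasurableSpace Y] [MeasurableSpace ι]
  [MeasurableSingletonClass ι] {μ : Measure Y} [SigmaFinite μ]

theorem integral_count_prod {F : ι × Y → ℂ} (hF : Integrable F ((Measure.count : Measure ι).prod μ)) :
    ∫ x, F x ∂((Measure.count : Measure ι).prod μ) = ∑ i, ∫ y, F (i, y) ∂μ := by
  rw [integral_prod _ hF, integral_fintype Integrable.of_finite]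
  simp [Measure.real]

theorem integrable_count_prod {F : ι × Y → ℝ} (hF : Measurable F)
    (h : ∀ i, Integrable (fun y => F (i, y)) μ) :
    Integrable F ((Measure.count : Measure ι).prod μ) :=
  (integrable_prod_iff hF.aestronglyMeasurable).mpr
    ⟨Filter.Eventually.of_forall h, Integrable.of_finite⟩

theorem integral_pi_count_prod {k : ℕ} {F : (Fin k → ι × Y) → ℂ}
    (hF : Integrable F (Measure.pi fun _ => (Measure.count : Measure ι).prod μ)) :
    ∫ x, F x ∂(Measure.pi fun _ => (Measure.count : Measure ι).prod μ) =
      ∑ l : Fin k → ι, ∫ y : Fin k → Y, F (fun i => (l i, y i)) ∂(Measure.pi fun _ => μ) := by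
  have hmp := (measurePreserving_arrowProdEquivProdArrow ι Y (Fin k)
    (fun _ => (Measure.count : Measure ι)) (fun _ => μ)).symm
  have hpi : (Measure.pi fun _ : Fin k => (Measure.count : Measure ι)) = Measure.count :=
    Measure.ext_of_singleton fun a => by simp [Measure.pi_singleton]
  have hint := (hmp.integrable_comp_emb (MeasurableEquiv.measurableEmbedding _)).mpr hF
  rw [← hmp.integral_comp' F]
  rw [hpi] at hint ⊢
  exact integral_count_prod hint

/-- The kernel on `ι × Y` to which the Fredholm series of `K` with density `ρ` belongs. -/
def weightedKernel (ρ : Y → ℂ) (K : ι → Y → ι → Y → ℂ) (x y : ι × Y) : ℂ :=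
  K x.1 x.2 y.1 y.2 * ρ y.2

theorem fredholmIntegrand_eq (ρ : Y → ℂ) (K : ι → Y → ι → Y → ℂ) {k : ℕ} (l : Fin k → ι)
    (y : Fin k → Y) : fredholmIntegrand ρ K k l y =
      (Matrix.of fun a b : Fin k => weightedKernel ρ K (l a, y a) (l b, y b)).det := by
  rw [fredholmIntegrand, ← Matrix.det_mul_row]
  congr 1
  ext a b
  simp [weightedKernel, mul_comm]

theorem fredholmDet_eq_fredholm {ρ : Y → ℂ} {K : ι → Y → ι → Y → ℂ} {p q : ι × Y → ℝ}
    (hK : KernelBound p q (weightedKernel ρ K))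
    (hpq : Integrable (fun x => p x * q x) ((Measure.count : Measure ι).prod μ)) :
    fredholmDet μ ρ K = fredholm ((Measure.count : Measure ι).prod μ) (weightedKernel ρ K) := by
  simp only [fredholmDet, fredholm, fredholmCoeff, fredholmIntegrand_eq]
  congr 1
  ext k
  rw [integral_pi_count_prod (hK.integrable_det hpq k)]

theorem fredholmConverges_of_kernelBound {ρ : Y → ℂ} {K : ι → Y → ι → Y → ℂ} {p q : ι × Y → ℝ}
    (hK : KernelBound p q (weightedKernel ρ K))
    (hpq : ∀ i, Integrable (fun y => p (i, y) * q (i, y)) μ) :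
    FredholmConverges μ ρ K := by
  obtain ⟨C, hC, h⟩ := hK.bound
  have hint : ∀ (k : ℕ) (l : Fin k → ι), Integrable (fun y : Fin k → Y =>
      ∏ i, p (l i, y i) * q (l i, y i)) (Measure.pi fun _ => μ) := fun k l =>
    Integrable.fintype_prod (f := fun i y => p (l i, y) * q (l i, y)) fun i => hpq (l i)
  have hb : ∀ (k : ℕ) (l : Fin k → ι) (y : Fin k → Y), ‖fredholmIntegrand ρ K k l y‖ ≤
      (Real.sqrt k * C) ^ k * ∏ i, p (l i, y i) * q (l i, y i) := by
    intro k l y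
    rw [fredholmIntegrand_eq]
    simpa using norm_det_le_of_le_mul
      (Matrix.of fun a b : Fin k => weightedKernel ρ K (l a, y a) (l b, y b)) hC
      (p := fun a => p (l a, y a)) (q := fun a => q (l a, y a))
      (fun _ => hK.left_nonneg _) (fun _ => hK.right_nonneg _) fun i j => h _ _
  have hI : ∀ (k : ℕ) (l : Fin k → ι),
      Integrable (fredholmIntegrand ρ K k l) (Measure.pi fun _ => μ) := by
    intro k l
    refine ((hint k l).const_mul _).mono' ?_ (.of_forall (hb k l))
    refine Measurable.aestronglyMeasurable ?_
    simp only [funext fun y => fredholmIntegrand_eq ρ K l y]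
    exact measurable_det fun i j => hK.measurable_apply
      (measurable_const.prodMk (measurable_pi_apply i)) (measurable_const.prodMk (measurable_pi_apply j))
  refine ⟨hI, ?_⟩
  set I : ι → ℝ := fun i => ∫ y, p (i, y) * q (i, y) ∂μ with hIdef
  have hI0 : ∀ i, 0 ≤ I i := fun i =>
    integral_nonneg fun y => mul_nonneg (hK.left_nonneg _) (hK.right_nonneg _)
  refine Summable.of_nonneg_of_le (fun k => mul_nonneg (by positivity)
    (Finset.sum_nonneg fun l _ => integral_nonneg fun y => norm_nonneg _)) (fun k => ?_)
    (summable_hadamard (C := C * ∑ i, I i) (mul_nonneg hC (Finset.sum_nonneg fun i _ => hI0 i)))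
  gcongr
  calc _ ≤ ∑ l : Fin k → ι, (Real.sqrt k * C) ^ k * ∏ i, I (l i) := by
        refine Finset.sum_le_sum fun l _ => ?_
        rw [← integral_fintype_prod_eq_prod (μ := fun _ : Fin k => μ)
          (fun i y => p (l i, y) * q (l i, y)), ← integral_const_mul]
        exact integral_mono (hI k l).norm ((hint k l).const_mul _) (hb k l)
    _ = _ := by rw [← Finset.mul_sum, ← Fintype.sum_pow, ← mul_pow, mul_assoc]

end Conversion

/-! ### Cauchy's theorem for wedges -/

section Contours

/-- The direction of the upper ray of a wedge. -/
noncomputable def Wedge.dir (c : Wedge) : ℂ := ⟨Real.cos c.angle, Real.sin c.angle⟩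

theorem Wedge.point_of_nonneg (c : Wedge) {t : ℝ} (ht : 0 ≤ t) :
    c.point t = c.vertex + c.dir * t := by
  apply Complex.ext <;> simp [Wedge.point, Wedge.dir, abs_of_nonneg ht, mul_comm,
    -Complex.ofReal_cos, -Complex.ofReal_sin]

theorem Wedge.point_neg_of_nonneg (c : Wedge) {t : ℝ} (ht : 0 ≤ t) :
    c.point (-t) = c.vertex + (starRingEnd ℂ) c.dir * t := by
  apply Complex.ext <;> simp [Wedge.point, Wedge.dir, abs_of_nonneg ht, mul_comm,
    -Complex.ofReal_cos, -Complex.ofReal_sin]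

theorem Wedge.density_of_pos (c : Wedge) {t : ℝ} (ht : 0 < t) :
    c.density t = c.dir / (2 * Real.pi * Complex.I) := by
  rw [Wedge.density, Real.sign_of_pos ht]
  congr 1
  apply Complex.ext <;> simp [Wedge.dir, -Complex.ofReal_cos, -Complex.ofReal_sin]

theorem Wedge.density_neg_of_pos (c : Wedge) {t : ℝ} (ht : 0 < t) :
    c.density (-t) = -(starRingEnd ℂ) c.dir / (2 * Real.pi * Complex.I) := by
  rw [Wedge.density, Real.sign_of_neg (by linarith)]
  congr 1
  apply Complex.ext <;> simp [Wedge.dir, -Complex.ofReal_cos, -Complex.ofReal_sin]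

/-- Cauchy's theorem for the quadrilateral swept out by moving one segment to another. -/
theorem integral_segment_sub {h : ℂ → ℂ} {A₁ B₁ A₂ B₂ : ℂ} {T : ℝ} (hT : 0 ≤ T)
    (hd : ∀ σ ∈ Icc (0 : ℝ) 1, ∀ t ∈ Icc (0 : ℝ) T,
      DifferentiableAt ℂ h ((1 - σ) * (A₁ + B₁ * t) + σ * (A₂ + B₂ * t))) :
    (∫ t in (0 : ℝ)..T, h (A₂ + B₂ * t) * B₂) - (∫ t in (0 : ℝ)..T, h (A₁ + B₁ * t) * B₁) =
      (∫ σ in (0 : ℝ)..1, h ((1 - σ) * (A₁ + B₁ * T) + σ * (A₂ + B₂ * T)) *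
        ((A₂ - A₁) + (B₂ - B₁) * T)) -
      ∫ σ in (0 : ℝ)..1, h ((1 - σ) * A₁ + σ * A₂) * (A₂ - A₁) := by
  set w : ℝ × ℝ → ℂ := fun z => (1 - z.1) * (A₁ + B₁ * z.2) + z.1 * (A₂ + B₂ * z.2) with hw
  set w1 : ℝ × ℝ → ℂ := fun z => (A₂ - A₁) + (B₂ - B₁) * z.2 with hw1
  set w2 : ℝ × ℝ → ℂ := fun z => (1 - z.1) * B₁ + z.1 * B₂ with hw2
  set e1 : ℝ × ℝ →L[ℝ] ℂ := Complex.ofRealCLM.comp (ContinuousLinearMap.fst ℝ ℝ ℝ) with he1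
  set e2 : ℝ × ℝ →L[ℝ] ℂ := Complex.ofRealCLM.comp (ContinuousLinearMap.snd ℝ ℝ ℝ) with he2
  have d1 : ∀ z : ℝ × ℝ, HasFDerivAt (fun z : ℝ × ℝ => (z.1 : ℂ)) e1 z := fun z => e1.hasFDerivAt
  have d2 : ∀ z : ℝ × ℝ, HasFDerivAt (fun z : ℝ × ℝ => (z.2 : ℂ)) e2 z := fun z => e2.hasFDerivAt
  have dw1 : ∀ z, HasFDerivAt w1 ((B₂ - B₁) • e2) z := fun z =>
    ((d2 z).const_mul (B₂ - B₁)).const_add _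
  have dw2 : ∀ z, HasFDerivAt w2 ((B₂ - B₁) • e1) z := by
    intro z
    have := (((d1 z).const_sub 1).mul_const' B₁).add ((d1 z).mul_const' B₂)
    refine this.congr_fderiv ?_
    ext <;> simp [e1] <;> ring
  have dw : ∀ z, HasFDerivAt w (w1 z • e1 + w2 z • e2) z := by
    intro z
    have a1 : HasFDerivAt (fun z : ℝ × ℝ => A₁ + B₁ * (z.2 : ℂ)) (B₁ • e2) z :=
      ((d2 z).const_mul B₁).const_add _
    have a2 : HasFDerivAt (fun z : ℝ × ℝ => A₂ + B₂ * (z.2 : ℂ)) (B₂ • e2) z :=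
      ((d2 z).const_mul B₂).const_add _
    have := (((d1 z).const_sub 1).mul a1).add ((d1 z).mul a2)
    refine this.congr_fderiv ?_
    ext <;> simp [e1, e2, w1, w2] <;> ring
  have hmem : ∀ z ∈ uIcc (0 : ℝ) 1 ×ˢ uIcc 0 T, DifferentiableAt ℂ h (w z) := by
    rintro ⟨σ, t⟩ ⟨h1, h2⟩
    rw [uIcc_of_le zero_le_one] at h1
    rw [uIcc_of_le hT] at h2
    exact hd σ h1 t h2
  have dh : ∀ z ∈ uIcc (0 : ℝ) 1 ×ˢ uIcc 0 T,
      HasFDerivAt (fun z => h (w z)) (deriv h (w z) • (w1 z • e1 + w2 z • e2)) z := by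
    intro z hz
    have := ((hmem z hz).hasDerivAt.hasFDerivAt.restrictScalars ℝ).comp z (dw z)
    refine this.congr_fderiv ?_
    ext <;> simp [mul_comm]
  have df : ∀ z ∈ uIcc (0 : ℝ) 1 ×ˢ uIcc 0 T, HasFDerivAt (fun z => h (w z) * w2 z)
      (h (w z) • ((B₂ - B₁) • e1) + w2 z • (deriv h (w z) • (w1 z • e1 + w2 z • e2))) z :=
    fun z hz => (dh z hz).mul (dw2 z)
  have dg : ∀ z ∈ uIcc (0 : ℝ) 1 ×ˢ uIcc 0 T, HasFDerivAt (fun z => -(h (w z) * w1 z))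
      (-(h (w z) • ((B₂ - B₁) • e2) + w1 z • (deriv h (w z) • (w1 z • e1 + w2 z • e2)))) z :=
    fun z hz => ((dh z hz).mul (dw1 z)).neg
  have hsub : Ioo (min 0 1) (max 0 1) ×ˢ Ioo (min 0 T) (max 0 T) ⊆ uIcc (0 : ℝ) 1 ×ˢ uIcc 0 T :=
    prod_mono Ioo_subset_Icc_self Ioo_subset_Icc_self
  have hzero : ∀ z : ℝ × ℝ,
      (h (w z) • ((B₂ - B₁) • e1) + w2 z • (deriv h (w z) • (w1 z • e1 + w2 z • e2))) (1, 0) +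
      (-(h (w z) • ((B₂ - B₁) • e2) + w1 z • (deriv h (w z) • (w1 z • e1 + w2 z • e2)))) (0, 1)
        = 0 := by
    intro z
    simp [e1, e2]
    ring
  have key := integral2_divergence_prod_of_hasFDerivAt (fun z => h (w z) * w2 z)
    (fun z => -(h (w z) * w1 z)) _ _ 0 0 1 T
    (fun z hz => (df z hz).continuousAt.continuousWithinAt)
    (fun z hz => (dg z hz).continuousAt.continuousWithinAt)
    (fun z hz => df z (hsub hz)) (fun z hz => dg z (hsub hz))
    (by simp only [hzero]; exact integrableOn_zero)
  simp only [hzero, intervalIntegral.integral_zero, intervalIntegral.integral_neg] at key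
  simp only [hw, hw1, hw2, Complex.ofReal_zero, Complex.ofReal_one, mul_zero, add_zero, sub_zero,
    sub_self, zero_mul, zero_add, one_mul] at key
  linear_combination -key

/-- The integral over the part of a wedge with parameters in `[-T, T]`. -/
theorem integral_wedge_trunc {c : Wedge} {h : ℂ → ℂ}
    (hi : ∀ a b, IntervalIntegrable (fun t => c.density t * h (c.point t)) volume a b) {T : ℝ}
    (hT : 0 ≤ T) :
    ∫ t in (-T)..T, c.density t * h (c.point t) = (2 * Real.pi * Complex.I)⁻¹ *
      ((∫ t in (0 : ℝ)..T, h (c.vertex + c.dir * t) * c.dir) -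
        ∫ t in (0 : ℝ)..T, h (c.vertex + (starRingEnd ℂ) c.dir * t) * (starRingEnd ℂ) c.dir) := by
  rw [← intervalIntegral.integral_add_adjacent_intervals (b := 0) (hi _ _) (hi _ _)]
  have e1 : ∫ t in (0 : ℝ)..T, c.density t * h (c.point t) = (2 * Real.pi * Complex.I)⁻¹ *
      ∫ t in (0 : ℝ)..T, h (c.vertex + c.dir * t) * c.dir := by
    rw [← intervalIntegral.integral_const_mul]
    refine intervalIntegral.integral_congr_ae (.of_forall fun t ht => ?_)
    rw [uIoc_of_le hT] at ht
    rw [c.density_of_pos ht.1, c.point_of_nonneg ht.1.le]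
    ring
  have e2 : ∫ t in (-T)..0, c.density t * h (c.point t) = (2 * Real.pi * Complex.I)⁻¹ *
      -∫ t in (0 : ℝ)..T, h (c.vertex + (starRingEnd ℂ) c.dir * t) * (starRingEnd ℂ) c.dir := by
    have := intervalIntegral.integral_comp_neg (a := 0) (b := T)
      (fun t => c.density t * h (c.point t))
    rw [neg_zero] at this
    rw [← this, ← intervalIntegral.integral_neg, ← intervalIntegral.integral_const_mul]
    refine intervalIntegral.integral_congr_ae (.of_forall fun t ht => ?_)
    rw [uIoc_of_le hT] at ht
    rw [c.density_neg_of_pos ht.1, c.point_neg_of_nonneg ht.1.le]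
    ring
  rw [e1, e2]
  ring

/-- Points swept out when a wedge is moved linearly to another one; `t ≥ 0` refers to the
upper and `t ≤ 0` to the lower rays. -/
noncomputable def sweep (c₁ c₂ : Wedge) (σ t : ℝ) : ℂ := (1 - σ) * c₁.point t + σ * c₂.point t

theorem wedge_trunc_sub {c₁ c₂ : Wedge} {h : ℂ → ℂ}
    (h1 : ∀ a b, IntervalIntegrable (fun t => c₁.density t * h (c₁.point t)) volume a b)
    (h2 : ∀ a b, IntervalIntegrable (fun t => c₂.density t * h (c₂.point t)) volume a b)
    {T : ℝ} (hT : 0 ≤ T)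
    (hd : ∀ σ ∈ Icc (0 : ℝ) 1, ∀ t, DifferentiableAt ℂ h (sweep c₁ c₂ σ t)) :
    (∫ t in (-T)..T, c₂.density t * h (c₂.point t)) -
      (∫ t in (-T)..T, c₁.density t * h (c₁.point t)) = (2 * Real.pi * Complex.I)⁻¹ *
      ((∫ σ in (0 : ℝ)..1, h (sweep c₁ c₂ σ T) * (c₂.point T - c₁.point T)) -
        ∫ σ in (0 : ℝ)..1, h (sweep c₁ c₂ σ (-T)) * (c₂.point (-T) - c₁.point (-T))) := by
  rw [integral_wedge_trunc h1 hT, integral_wedge_trunc h2 hT]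
  have u := integral_segment_sub (h := h) (A₁ := c₁.vertex) (B₁ := c₁.dir) (A₂ := c₂.vertex)
    (B₂ := c₂.dir) hT (fun σ hσ t ht => by
      have := hd σ hσ t
      rwa [sweep, c₁.point_of_nonneg ht.1, c₂.point_of_nonneg ht.1] at this)
  have l := integral_segment_sub (h := h) (A₁ := c₁.vertex) (B₁ := (starRingEnd ℂ) c₁.dir)
    (A₂ := c₂.vertex) (B₂ := (starRingEnd ℂ) c₂.dir) hT (fun σ hσ t ht => by
      have := hd σ hσ (-t)
      rwa [sweep, c₁.point_neg_of_nonneg ht.1, c₂.point_neg_of_nonneg ht.1] at this)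
  simp only [sweep, c₁.point_of_nonneg hT, c₂.point_of_nonneg hT, c₁.point_neg_of_nonneg hT,
    c₂.point_neg_of_nonneg hT]
  rw [show (c₂.vertex : ℂ) + c₂.dir * T - (c₁.vertex + c₁.dir * T) =
    (c₂.vertex - c₁.vertex) + (c₂.dir - c₁.dir) * T by ring,
    show (c₂.vertex : ℂ) + (starRingEnd ℂ) c₂.dir * T - (c₁.vertex + (starRingEnd ℂ) c₁.dir * T) =
    (c₂.vertex - c₁.vertex) + ((starRingEnd ℂ) c₂.dir - (starRingEnd ℂ) c₁.dir) * T by ring]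
  linear_combination (2 * Real.pi * Complex.I : ℂ)⁻¹ * u - (2 * Real.pi * Complex.I : ℂ)⁻¹ * l

theorem tendsto_wedge_trunc {c : Wedge} {h : ℂ → ℂ}
    (hi : Integrable fun t => c.density t * h (c.point t)) :
    Filter.Tendsto (fun T : ℝ => ∫ t in (-T)..T, c.density t * h (c.point t)) Filter.atTop
      (nhds (wedgeIntegral c h)) :=
  intervalIntegral_tendsto_integral hi Filter.tendsto_neg_atTop_atBot Filter.tendsto_id

/-- A contour integral does not change when the contour is moved through a region where the
integrand is holomorphic and small at infinity. -/
theorem wedgeIntegral_eq_of_sweep {c₁ c₂ : Wedge} {h : ℂ → ℂ}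
    (h1 : Integrable fun t => c₁.density t * h (c₁.point t))
    (h2 : Integrable fun t => c₂.density t * h (c₂.point t))
    (hd : ∀ σ ∈ Icc (0 : ℝ) 1, ∀ t, DifferentiableAt ℂ h (sweep c₁ c₂ σ t))
    {b : ℝ → ℝ} (hb : Filter.Tendsto b Filter.atTop (nhds 0))
    (hbound : ∀ᶠ T in Filter.atTop, ∀ σ ∈ Icc (0 : ℝ) 1,
      ‖h (sweep c₁ c₂ σ T) * (c₂.point T - c₁.point T)‖ ≤ b T ∧
      ‖h (sweep c₁ c₂ σ (-T)) * (c₂.point (-T) - c₁.point (-T))‖ ≤ b T) :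
    wedgeIntegral c₁ h = wedgeIntegral c₂ h := by
  have hlim := (tendsto_wedge_trunc h2).sub (tendsto_wedge_trunc h1)
  have hz : Filter.Tendsto (fun T : ℝ => (∫ t in (-T)..T, c₂.density t * h (c₂.point t)) -
      (∫ t in (-T)..T, c₁.density t * h (c₁.point t))) Filter.atTop (nhds 0) := by
    refine squeeze_zero_norm' (a := fun T => ‖(2 * Real.pi * Complex.I : ℂ)⁻¹‖ * (2 * b T)) ?_
      (by simpa using (hb.const_mul 2).const_mul ‖(2 * Real.pi * Complex.I : ℂ)⁻¹‖)
    filter_upwards [hbound, Filter.eventually_ge_atTop 0] with T hT hT0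
    rw [wedge_trunc_sub (fun _ _ => h1.intervalIntegrable) (fun _ _ => h2.intervalIntegrable) hT0 hd, norm_mul]
    gcongr
    refine (norm_sub_le _ _).trans ?_
    have i1 := intervalIntegral.norm_integral_le_of_norm_le_const (a := (0 : ℝ)) (b := 1)
      (f := fun σ : ℝ => h (sweep c₁ c₂ σ T) * (c₂.point T - c₁.point T)) (C := b T) (fun σ hσ => by
        rw [uIoc_of_le zero_le_one] at hσ
        exact (hT σ ⟨hσ.1.le, hσ.2⟩).1)
    have i2 := intervalIntegral.norm_integral_le_of_norm_le_const (a := (0 : ℝ)) (b := 1)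
      (f := fun σ : ℝ => h (sweep c₁ c₂ σ (-T)) * (c₂.point (-T) - c₁.point (-T))) (C := b T)
      (fun σ hσ => by
        rw [uIoc_of_le zero_le_one] at hσ
        exact (hT σ ⟨hσ.1.le, hσ.2⟩).2)
    simp only [sub_zero, abs_one, mul_one] at i1 i2
    linarith
  have := tendsto_nhds_unique hlim hz
  exact (sub_eq_zero.mp this).symm

theorem Wedge.continuous_point (c : Wedge) : Continuous c.point := by
  unfold Wedge.point
  fun_prop

theorem Wedge.measurable_density (c : Wedge) : Measurable c.density := by
  have : Measurable Real.sign := by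
    unfold Real.sign
    exact Measurable.ite measurableSet_Iio measurable_const
      (Measurable.ite measurableSet_Ioi measurable_const measurable_const)
  unfold Wedge.density
  fun_prop

theorem Wedge.norm_density_le (c : Wedge) (t : ℝ) : ‖c.density t‖ ≤ 1 := by
  rw [Wedge.density, norm_div]
  refine div_le_one_of_le₀ ?_ (norm_nonneg _)
  have h1 : ‖(((Real.sign t * Real.cos c.angle : ℝ) : ℂ) +
      ((Real.sin c.angle : ℝ) : ℂ) * Complex.I)‖ ≤ 2 := by
    refine (norm_add_le _ _).trans ?_
    rw [norm_mul, Complex.norm_I, Complex.norm_real, Complex.norm_real, Real.norm_eq_abs,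
      Real.norm_eq_abs, abs_mul, mul_one]
    have h2 := Real.abs_cos_le_one c.angle
    have h3 := Real.abs_sin_le_one c.angle
    have h4 : |Real.sign t| ≤ 1 := by
      rcases Real.sign_apply_eq t with h | h | h <;> simp [h]
    nlinarith [abs_nonneg (Real.cos c.angle), abs_nonneg (Real.sign t)]
  have h5 : ‖(2 * Real.pi * Complex.I : ℂ)‖ = 2 * Real.pi := by
    simp [abs_of_pos Real.pi_pos]
  rw [h5]
  nlinarith [Real.pi_gt_three]

theorem Wedge.intervalIntegrable {c : Wedge} {h : ℂ → ℂ} (hc : Continuous fun t => h (c.point t))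
    (a b : ℝ) : IntervalIntegrable (fun t => c.density t * h (c.point t)) volume a b := by
  refine (hc.norm.intervalIntegrable a b).mono_fun
    (c.measurable_density.aestronglyMeasurable.mul hc.aestronglyMeasurable) ?_
  refine Filter.Eventually.of_forall fun t => ?_
  beta_reduce
  rw [norm_mul, norm_norm]
  exact mul_le_of_le_one_left (norm_nonneg _) (c.norm_density_le t)

/-- The vertex of the wedge with the given angle through the point `w`. -/
noncomputable def wedgeLevel (φ : ℝ) (w : ℂ) : ℝ := w.re - Real.cos φ / Real.sin φ * |w.im|

theorem Wedge.point_re (c : Wedge) (t : ℝ) : (c.point t).re = c.vertex + |t| * Real.cos c.angle := by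
  simp [Wedge.point, -Complex.ofReal_cos, -Complex.ofReal_sin]

theorem Wedge.point_im (c : Wedge) (t : ℝ) : (c.point t).im = t * Real.sin c.angle := by
  simp [Wedge.point, -Complex.ofReal_cos, -Complex.ofReal_sin]

theorem wedgeLevel_point {c : Wedge} (hs : 0 < Real.sin c.angle) (t : ℝ) :
    wedgeLevel c.angle (c.point t) = c.vertex := by
  rw [wedgeLevel, c.point_re, c.point_im, abs_mul, abs_of_pos hs]
  field_simp
  ring

theorem sweep_parallel (φ a₁ a₂ σ t : ℝ) :
    sweep ⟨φ, a₁⟩ ⟨φ, a₂⟩ σ t = (⟨φ, (1 - σ) * a₁ + σ * a₂⟩ : Wedge).point t := by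
  simp only [sweep, Wedge.point]
  push_cast
  ring

theorem sweep_parallel_level {φ : ℝ} (hs : 0 < Real.sin φ) {a₁ a₂ σ : ℝ} (h12 : a₁ ≤ a₂)
    (hσ : σ ∈ Icc (0 : ℝ) 1) (t : ℝ) :
    wedgeLevel φ (sweep ⟨φ, a₁⟩ ⟨φ, a₂⟩ σ t) ∈ Icc a₁ a₂ := by
  rw [sweep_parallel, wedgeLevel_point (c := ⟨φ, _⟩) hs]
  obtain ⟨h0, h1⟩ := hσ
  constructor <;> nlinarith

theorem abs_wedgeLevel_sub_le (φ : ℝ) (w w' : ℂ) :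
    |wedgeLevel φ w - wedgeLevel φ w'| ≤ (1 + |Real.cos φ / Real.sin φ|) * ‖w - w'‖ := by
  have h1 : |w.re - w'.re| ≤ ‖w - w'‖ := by simpa using Complex.abs_re_le_norm (w - w')
  have h2 : |(|w.im| - |w'.im|)| ≤ ‖w - w'‖ :=
    (abs_abs_sub_abs_le _ _).trans (by simpa using Complex.abs_im_le_norm (w - w'))
  calc _ = |(w.re - w'.re) - Real.cos φ / Real.sin φ * (|w.im| - |w'.im|)| := by
        rw [wedgeLevel, wedgeLevel]; ring_nf
    _ ≤ |w.re - w'.re| + |Real.cos φ / Real.sin φ| * |(|w.im| - |w'.im|)| := by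
        rw [← abs_mul]; exact abs_sub _ _
    _ ≤ _ := by nlinarith [abs_nonneg (Real.cos φ / Real.sin φ)]

theorem integrable_exp_neg_mul_abs {k : ℝ} (hk : 0 < k) :
    Integrable fun t : ℝ => Real.exp (-(k * |t|)) := by
  have h1 : IntegrableOn (fun t : ℝ => Real.exp (-(k * |t|))) (Ioi 0) :=
    (integrableOn_exp_mul_Ioi (neg_lt_zero.mpr hk) 0).congr_fun (fun t ht => by
      beta_reduce; rw [abs_of_pos ht, neg_mul]) measurableSet_Ioi
  have h2 : IntegrableOn (fun t : ℝ => Real.exp (-(k * |t|))) (Iic 0) := by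
    refine (integrableOn_exp_mul_Iic hk 0).congr_fun (fun t ht => ?_) measurableSet_Iic
    beta_reduce; rw [abs_of_nonpos ht]; ring_nf
  rw [← integrableOn_univ, ← Iic_union_Ioi (a := (0 : ℝ))]
  exact h2.union h1

/-- Moving a wedge to infinity on the side where the integrand is holomorphic and decays. -/
theorem wedgeIntegral_eq_zero_of_decay {φ : ℝ} (hs : 0 < Real.sin φ) (hc : 0 < Real.cos φ)
    {a : ℝ} {h : ℂ → ℂ} (hd : ∀ w, a ≤ wedgeLevel φ w → DifferentiableAt ℂ h w) {C : ℝ}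
    (hb : ∀ w, a ≤ wedgeLevel φ w → ‖h w‖ ≤ C * Real.exp (-w.re)) :
    wedgeIntegral ⟨φ, a⟩ h = 0 := by
  have hC : 0 ≤ C := by
    have := (norm_nonneg _).trans (hb ((⟨φ, a⟩ : Wedge).point 0)
      (wedgeLevel_point (c := ⟨φ, a⟩) hs 0).ge)
    exact nonneg_of_mul_nonneg_left this (Real.exp_pos _)
  have hexp : Integrable fun t : ℝ => Real.exp (-(Real.cos φ * |t|)) :=
    integrable_exp_neg_mul_abs hc
  have hlev : ∀ a', a ≤ a' → ∀ t, a ≤ wedgeLevel φ ((⟨φ, a'⟩ : Wedge).point t) := fun a' ha' t => by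
    rwa [wedgeLevel_point (c := ⟨φ, a'⟩) hs]
  have hpt : ∀ a', a ≤ a' → ∀ t, ‖h ((⟨φ, a'⟩ : Wedge).point t)‖ ≤
      C * Real.exp (-a') * Real.exp (-(Real.cos φ * |t|)) := fun a' ha' t => by
    refine (hb _ (hlev a' ha' t)).trans (le_of_eq ?_)
    rw [Wedge.point_re, mul_assoc, ← Real.exp_add]
    congr 2
    ring
  have hcont : ∀ a', a ≤ a' → Continuous fun t => h ((⟨φ, a'⟩ : Wedge).point t) := fun a' ha' =>
    continuous_iff_continuousAt.mpr fun t => ContinuousAt.comp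
      (hd _ (hlev a' ha' t)).continuousAt (Wedge.continuous_point _).continuousAt
  have hnorm : ∀ a', a ≤ a' → ∀ t, ‖(⟨φ, a'⟩ : Wedge).density t * h ((⟨φ, a'⟩ : Wedge).point t)‖ ≤
      C * Real.exp (-a') * Real.exp (-(Real.cos φ * |t|)) := fun a' ha' t => by
    rw [norm_mul]
    exact (mul_le_of_le_one_left (norm_nonneg _) (Wedge.norm_density_le _ t)).trans (hpt a' ha' t)
  have hint : ∀ a', a ≤ a' → Integrable fun t => (⟨φ, a'⟩ : Wedge).density t *
      h ((⟨φ, a'⟩ : Wedge).point t) := fun a' ha' =>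
    (hexp.const_mul (C * Real.exp (-a'))).mono'
      ((Wedge.measurable_density _).aestronglyMeasurable.mul (hcont a' ha').aestronglyMeasurable)
      (.of_forall (hnorm a' ha'))
  have hshift : ∀ n : ℝ, 0 ≤ n → wedgeIntegral ⟨φ, a⟩ h = wedgeIntegral ⟨φ, a + n⟩ h := by
    intro n hn
    have hT : Filter.Tendsto (fun T : ℝ => C * Real.exp (-a) * Real.exp (-(Real.cos φ * |T|)) * n)
        Filter.atTop (nhds 0) := by
      have h1 : Filter.Tendsto (fun T : ℝ => Real.cos φ * |T|) Filter.atTop Filter.atTop :=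
        Filter.tendsto_abs_atTop_atTop.const_mul_atTop hc
      simpa using ((Real.tendsto_exp_neg_atTop_nhds_zero.comp h1).const_mul
        (C * Real.exp (-a))).mul_const n
    refine wedgeIntegral_eq_of_sweep (hint a le_rfl) (hint (a + n) (by linarith))
      (fun σ hσ t => hd _ (sweep_parallel_level hs (by linarith) hσ t).1) hT
      (.of_forall fun T σ hσ => ?_)
    have key : ∀ t : ℝ, ‖h (sweep ⟨φ, a⟩ ⟨φ, a + n⟩ σ t) * ((⟨φ, a + n⟩ : Wedge).point t -
        (⟨φ, a⟩ : Wedge).point t)‖ ≤ C * Real.exp (-a) * Real.exp (-(Real.cos φ * |t|)) * n := by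
      intro t
      have hdiff : (⟨φ, a + n⟩ : Wedge).point t - (⟨φ, a⟩ : Wedge).point t = (n : ℂ) := by
        simp only [Wedge.point]; push_cast; ring
      rw [hdiff, norm_mul, Complex.norm_real, Real.norm_of_nonneg hn, sweep_parallel]
      have hle : a ≤ (1 - σ) * a + σ * (a + n) := by nlinarith [hσ.1]
      gcongr
      refine (hpt _ hle t).trans ?_
      gcongr
    refine ⟨key T, ?_⟩
    simpa using key (-T)
  have hsmall : ∀ n : ℝ, 0 ≤ n → ‖wedgeIntegral ⟨φ, a⟩ h‖ ≤
      C * Real.exp (-a) * (∫ t : ℝ, Real.exp (-(Real.cos φ * |t|))) * Real.exp (-n) := by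
    intro n hn
    rw [hshift n hn]
    calc _ ≤ ∫ t : ℝ, C * Real.exp (-(a + n)) * Real.exp (-(Real.cos φ * |t|)) :=
          norm_integral_le_of_norm_le (hexp.const_mul _)
            (.of_forall (hnorm (a + n) (by linarith)))
      _ = _ := by rw [integral_const_mul, neg_add, Real.exp_add]; ring
  have hlim := (Real.tendsto_exp_neg_atTop_nhds_zero.const_mul
    (C * Real.exp (-a) * (∫ t : ℝ, Real.exp (-(Real.cos φ * |t|)))))
  rw [mul_zero] at hlim
  have := ge_of_tendsto hlim (Filter.eventually_atTop.mpr ⟨0, hsmall⟩)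
  exact norm_le_zero_iff.mp this

theorem abs_le_norm_point_sub {c : Wedge} (w₀ : ℂ) (t : ℝ) :
    |t| * |Real.sin c.angle| - ‖w₀‖ ≤ ‖c.point t - w₀‖ := by
  have h1 := Complex.abs_im_le_norm (c.point t)
  rw [c.point_im, abs_mul] at h1
  have := norm_sub_norm_le (c.point t) w₀
  linarith

theorem Wedge.mem_slitPlane_of_right {c : Wedge} (hs : 0 < Real.sin c.angle) {w₀ : ℂ}
    (h : wedgeLevel c.angle w₀ < c.vertex) (t : ℝ) : c.point t - w₀ ∈ Complex.slitPlane := by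
  rw [Complex.mem_slitPlane_iff]
  by_contra! hcon
  obtain ⟨hre, him⟩ := hcon
  have h1 := wedgeLevel_point hs t
  rw [Complex.sub_re] at hre
  rw [Complex.sub_im, sub_eq_zero] at him
  rw [wedgeLevel, him] at h1
  rw [wedgeLevel] at h
  linarith

theorem Wedge.mem_slitPlane_of_left {c : Wedge} (hs : 0 < Real.sin c.angle) {w₀ : ℂ}
    (h : c.vertex < wedgeLevel c.angle w₀) (t : ℝ) : w₀ - c.point t ∈ Complex.slitPlane := by
  rw [Complex.mem_slitPlane_iff]
  by_contra! hcon
  obtain ⟨hre, him⟩ := hcon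
  have h1 := wedgeLevel_point hs t
  rw [Complex.sub_re] at hre
  rw [Complex.sub_im, sub_eq_zero] at him
  rw [wedgeLevel, ← him] at h1
  rw [wedgeLevel] at h
  linarith

theorem integral_div_add_mul {A B : ℂ} {T : ℝ} (hT : 0 ≤ T)
    (h : ∀ t : ℝ, 0 ≤ t → A + B * t ∈ Complex.slitPlane) :
    ∫ t in (0 : ℝ)..T, 1 / (A + B * t) * B = Complex.log (A + B * T) - Complex.log A := by
  have hder : ∀ t ∈ uIcc 0 T, HasDerivAt (fun t : ℝ => Complex.log (A + B * t))
      (1 / (A + B * t) * B) t := by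
    intro t ht
    rw [uIcc_of_le hT] at ht
    have h1 : HasDerivAt (fun t : ℝ => A + B * (t : ℂ)) B t := by
      simpa using ((Complex.ofRealCLM.hasDerivAt (x := t)).const_mul B).const_add A
    have := (Complex.hasDerivAt_log (h t ht.1)).comp t h1
    rwa [← one_div] at this
  rw [intervalIntegral.integral_eq_sub_of_hasDerivAt hder]
  · simp
  · refine ContinuousOn.intervalIntegrable fun t ht => ContinuousAt.continuousWithinAt ?_
    rw [uIcc_of_le hT] at ht
    have := Complex.slitPlane_ne_zero (h t ht.1)
    fun_prop (disch := assumption)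

theorem tendsto_log_sub_log {A B B' : ℂ} (hB : B ∈ Complex.slitPlane)
    (hB' : B' ∈ Complex.slitPlane) (h : ∀ t : ℝ, 0 ≤ t → A + B * t ∈ Complex.slitPlane)
    (h' : ∀ t : ℝ, 0 ≤ t → A + B' * t ∈ Complex.slitPlane) :
    Filter.Tendsto (fun T : ℝ => Complex.log (A + B * T) - Complex.log (A + B' * T)) Filter.atTop
      (nhds (Complex.log B - Complex.log B')) := by
  have key : ∀ D : ℂ, D ∈ Complex.slitPlane → Filter.Tendsto
      (fun T : ℝ => Complex.log (A * ((T⁻¹ : ℝ) : ℂ) + D)) Filter.atTop (nhds (Complex.log D)) := by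
    intro D hD
    have h1 : Filter.Tendsto (fun T : ℝ => A * ((T⁻¹ : ℝ) : ℂ) + D) Filter.atTop (nhds D) := by
      have h2 := (Complex.continuous_ofReal.tendsto 0).comp tendsto_inv_atTop_zero
      simpa using (h2.const_mul A).add_const D
    exact (continuousAt_clog hD).tendsto.comp h1
  refine ((key B hB).sub (key B' hB')).congr' ?_
  filter_upwards [Filter.eventually_gt_atTop 0] with T hT
  have e : ∀ D : ℂ, A + D * T ∈ Complex.slitPlane →
      Complex.log (A * ((T⁻¹ : ℝ) : ℂ) + D) = Real.log T⁻¹ + Complex.log (A + D * T) := by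
    intro D hD
    rw [← Complex.log_ofReal_mul (inv_pos.mpr hT) (Complex.slitPlane_ne_zero hD)]
    congr 1
    push_cast
    have : (T : ℂ) ≠ 0 := by exact_mod_cast hT.ne'
    field_simp
  rw [e B (h T hT.le), e B' (h' T hT.le)]
  ring

theorem Wedge.dir_mem_slitPlane {c : Wedge} (hs : 0 < Real.sin c.angle) :
    c.dir ∈ Complex.slitPlane ∧ (starRingEnd ℂ) c.dir ∈ Complex.slitPlane ∧
    -c.dir ∈ Complex.slitPlane ∧ -(starRingEnd ℂ) c.dir ∈ Complex.slitPlane := by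
  refine ⟨?_, ?_, ?_, ?_⟩ <;> (right; simp [Wedge.dir, hs.ne', -Complex.ofReal_sin])

/-- The four arguments that appear at infinity when two wedges enclose a point add up to one
full turn. -/
theorem Wedge.log_dir_sum {c : Wedge} (hs : 0 < Real.sin c.angle) :
    (Complex.log c.dir - Complex.log ((starRingEnd ℂ) c.dir)) -
      (Complex.log (-c.dir) - Complex.log (-(starRingEnd ℂ) c.dir)) = 2 * Real.pi * Complex.I := by
  have him : 0 < c.dir.im := hs
  have h1 : Complex.log ((starRingEnd ℂ) c.dir) = (starRingEnd ℂ) (Complex.log c.dir) :=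
    Complex.log_conj _ (fun h => by
      have := Complex.arg_eq_pi_iff.mp h
      linarith [this.2])
  have h2 : Complex.log (-(starRingEnd ℂ) c.dir) = (starRingEnd ℂ) (Complex.log (-c.dir)) := by
    rw [← map_neg]
    refine Complex.log_conj _ (fun h => ?_)
    have := (Complex.arg_eq_pi_iff.mp h).2
    simp at this
    linarith
  have h3 : Complex.log (-c.dir) = Complex.log c.dir - Real.pi * Complex.I := by
    rw [Complex.log, Complex.log, Complex.arg_neg_eq_arg_sub_pi_of_im_pos him, norm_neg]
    push_cast
    ring
  rw [h1, h2, h3]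
  simp only [map_sub, map_mul, Complex.conj_ofReal, Complex.conj_I]
  ring

theorem Wedge.tendsto_trunc_inv_of_right {c : Wedge} (hs : 0 < Real.sin c.angle) {w₀ : ℂ}
    (h : wedgeLevel c.angle w₀ < c.vertex) :
    Filter.Tendsto (fun T : ℝ => ∫ t in (-T)..T, c.density t * (1 / (c.point t - w₀)))
      Filter.atTop (nhds ((2 * Real.pi * Complex.I : ℂ)⁻¹ *
        (Complex.log c.dir - Complex.log ((starRingEnd ℂ) c.dir)))) := by
  have s2 := c.mem_slitPlane_of_right hs h
  have i2 := Wedge.intervalIntegrable (c := c) (h := fun w => 1 / (w - w₀)) (by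
    have := c.continuous_point
    have h0 : ∀ t, c.point t - w₀ ≠ 0 := fun t => Complex.slitPlane_ne_zero (s2 t)
    fun_prop (disch := exact h0))
  obtain ⟨d1, d2, -, -⟩ := c.dir_mem_slitPlane hs
  have r : ∀ (D : ℂ) (t : ℝ), (c.vertex : ℂ) + D * t - w₀ = (c.vertex - w₀) + D * t := by
    intros; ring
  have m : ∀ t : ℝ, 0 ≤ t → (c.vertex - w₀) + c.dir * t ∈ Complex.slitPlane := fun t ht => by
    rw [← r, ← c.point_of_nonneg ht]; exact s2 t
  have m' : ∀ t : ℝ, 0 ≤ t → (c.vertex - w₀) + (starRingEnd ℂ) c.dir * t ∈ Complex.slitPlane :=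
    fun t ht => by rw [← r, ← c.point_neg_of_nonneg ht]; exact s2 (-t)
  refine ((tendsto_log_sub_log d1 d2 m m').const_mul _).congr' ?_
  filter_upwards [Filter.eventually_ge_atTop 0] with T hT
  refine Eq.trans ?_ (integral_wedge_trunc (h := fun w => 1 / (w - w₀)) i2 hT).symm
  simp only [r]
  rw [integral_div_add_mul hT m, integral_div_add_mul hT m']
  ring

theorem Wedge.tendsto_trunc_inv_of_left {c : Wedge} (hs : 0 < Real.sin c.angle) {w₀ : ℂ}
    (h : c.vertex < wedgeLevel c.angle w₀) :
    Filter.Tendsto (fun T : ℝ => ∫ t in (-T)..T, c.density t * (1 / (c.point t - w₀)))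
      Filter.atTop (nhds ((2 * Real.pi * Complex.I : ℂ)⁻¹ *
        (Complex.log (-c.dir) - Complex.log (-(starRingEnd ℂ) c.dir)))) := by
  have s2 := c.mem_slitPlane_of_left hs h
  have i2 := Wedge.intervalIntegrable (c := c) (h := fun w => 1 / (w - w₀)) (by
    have := c.continuous_point
    have h0 : ∀ t, c.point t - w₀ ≠ 0 := fun t h =>
      Complex.slitPlane_ne_zero (s2 t) (by rw [← neg_sub, h, neg_zero])
    fun_prop (disch := exact h0))
  obtain ⟨-, -, d1, d2⟩ := c.dir_mem_slitPlane hs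
  have r' : ∀ (D : ℂ) (t : ℝ), w₀ - ((c.vertex : ℂ) + D * t) = (w₀ - c.vertex) + -D * t := by
    intros; ring
  have r : ∀ (D : ℂ) (t : ℝ), 1 / ((c.vertex : ℂ) + D * t - w₀) * D =
      1 / ((w₀ - c.vertex) + -D * t) * -D := by
    intro D t
    rw [← r', ← neg_sub w₀, one_div_neg_eq_neg_one_div]
    ring
  have m : ∀ t : ℝ, 0 ≤ t → (w₀ - c.vertex) + -c.dir * t ∈ Complex.slitPlane := fun t ht => by
    rw [← r', ← c.point_of_nonneg ht]; exact s2 t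
  have m' : ∀ t : ℝ, 0 ≤ t → (w₀ - c.vertex) + -(starRingEnd ℂ) c.dir * t ∈ Complex.slitPlane :=
    fun t ht => by rw [← r', ← c.point_neg_of_nonneg ht]; exact s2 (-t)
  refine ((tendsto_log_sub_log d1 d2 m m').const_mul _).congr' ?_
  filter_upwards [Filter.eventually_ge_atTop 0] with T hT
  refine Eq.trans ?_ (integral_wedge_trunc (h := fun w => 1 / (w - w₀)) i2 hT).symm
  simp only [r]
  rw [integral_div_add_mul hT m, integral_div_add_mul hT m']
  ring

theorem tendsto_wedge_trunc_inv {φ : ℝ} (hs : 0 < Real.sin φ) {a₁ a₂ : ℝ} {w₀ : ℂ}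
    (h₁ : a₁ < wedgeLevel φ w₀) (h₂ : wedgeLevel φ w₀ < a₂) :
    Filter.Tendsto (fun T : ℝ =>
      (∫ t in (-T)..T, (⟨φ, a₂⟩ : Wedge).density t * (1 / ((⟨φ, a₂⟩ : Wedge).point t - w₀))) -
      ∫ t in (-T)..T, (⟨φ, a₁⟩ : Wedge).density t * (1 / ((⟨φ, a₁⟩ : Wedge).point t - w₀)))
      Filter.atTop (nhds 1) := by
  have h := (Wedge.tendsto_trunc_inv_of_right (c := ⟨φ, a₂⟩) hs h₂).sub
    (Wedge.tendsto_trunc_inv_of_left (c := ⟨φ, a₁⟩) hs h₁)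
  have hd : (⟨φ, a₁⟩ : Wedge).dir = (⟨φ, a₂⟩ : Wedge).dir := rfl
  rwa [hd, ← mul_sub, Wedge.log_dir_sum (c := ⟨φ, a₂⟩) hs,
    inv_mul_cancel₀ (by simp [Real.pi_ne_zero])] at h

/-- The residue theorem for the region between two parallel wedges. -/
theorem wedgeIntegral_sub_of_pole {φ : ℝ} (hs : 0 < Real.sin φ) {a₁ a₂ : ℝ} {w₀ : ℂ}
    (h₁ : a₁ < wedgeLevel φ w₀) (h₂ : wedgeLevel φ w₀ < a₂) {g : ℂ → ℂ}
    (hd : ∀ w, wedgeLevel φ w ∈ Icc a₁ a₂ → DifferentiableAt ℂ g w) {C : ℝ}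
    (hb : ∀ w, wedgeLevel φ w ∈ Icc a₁ a₂ → ‖g w‖ ≤ C)
    (hi₁ : Integrable fun t => (⟨φ, a₁⟩ : Wedge).density t *
      (g ((⟨φ, a₁⟩ : Wedge).point t) / ((⟨φ, a₁⟩ : Wedge).point t - w₀)))
    (hi₂ : Integrable fun t => (⟨φ, a₂⟩ : Wedge).density t *
      (g ((⟨φ, a₂⟩ : Wedge).point t) / ((⟨φ, a₂⟩ : Wedge).point t - w₀))) :
    wedgeIntegral ⟨φ, a₂⟩ (fun w => g w / (w - w₀)) -
      wedgeIntegral ⟨φ, a₁⟩ (fun w => g w / (w - w₀)) = g w₀ := by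
  set c₁ : Wedge := ⟨φ, a₁⟩ with hc₁
  set c₂ : Wedge := ⟨φ, a₂⟩ with hc₂
  have h12 : a₁ ≤ a₂ := (h₁.trans h₂).le
  have hC : 0 ≤ C := (norm_nonneg _).trans (hb w₀ ⟨h₁.le, h₂.le⟩)
  have hcont : Continuous (wedgeLevel φ) := by unfold wedgeLevel; fun_prop
  have hopen : IsOpen {w | wedgeLevel φ w ∈ Ioo a₁ a₂} := isOpen_Ioo.preimage hcont
  have hdd : ∀ w, wedgeLevel φ w ∈ Icc a₁ a₂ → DifferentiableAt ℂ (dslope g w₀) w := by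
    intro w hw
    by_cases hww : w = w₀
    · subst hww
      have hmem : {w | wedgeLevel φ w ∈ Ioo a₁ a₂} ∈ nhds w := hopen.mem_nhds ⟨h₁, h₂⟩
      exact ((Complex.differentiableOn_dslope hmem).mpr fun w' hw' =>
        (hd w' (Ioo_subset_Icc_self hw')).differentiableWithinAt).differentiableAt hmem
    · exact (differentiableAt_dslope_of_ne hww).mpr (hd w hw)
  have ne2 : ∀ t, c₂.point t - w₀ ≠ 0 := fun t =>
    Complex.slitPlane_ne_zero (c₂.mem_slitPlane_of_right (w₀ := w₀) hs h₂ t)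
  have ne1 : ∀ t, c₁.point t - w₀ ≠ 0 := fun t h =>
    Complex.slitPlane_ne_zero (c₁.mem_slitPlane_of_left (w₀ := w₀) hs h₁ t)
      (by rw [← neg_sub, h, neg_zero])
  have i2 := Wedge.intervalIntegrable (c := c₂) (h := fun w => 1 / (w - w₀)) (by
    have := c₂.continuous_point
    fun_prop (disch := exact ne2))
  have i1 := Wedge.intervalIntegrable (c := c₁) (h := fun w => 1 / (w - w₀)) (by
    have := c₁.continuous_point
    fun_prop (disch := exact ne1))
  have lev1 : ∀ t, wedgeLevel φ (c₁.point t) ∈ Icc a₁ a₂ := fun t => by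
    rw [wedgeLevel_point (c := c₁) hs]; exact ⟨le_rfl, h12⟩
  have lev2 : ∀ t, wedgeLevel φ (c₂.point t) ∈ Icc a₁ a₂ := fun t => by
    rw [wedgeLevel_point (c := c₂) hs]; exact ⟨h12, le_rfl⟩
  have j1 := Wedge.intervalIntegrable (c := c₁) (h := dslope g w₀)
    (continuous_iff_continuousAt.mpr fun t => ContinuousAt.comp
      (hdd _ (lev1 t)).continuousAt c₁.continuous_point.continuousAt)
  have j2 := Wedge.intervalIntegrable (c := c₂) (h := dslope g w₀)
    (continuous_iff_continuousAt.mpr fun t => ContinuousAt.comp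
      (hdd _ (lev2 t)).continuousAt c₂.continuous_point.continuousAt)
  have hds : ∀ w, w - w₀ ≠ 0 → g w / (w - w₀) = dslope g w₀ w + g w₀ * (1 / (w - w₀)) := by
    intro w hw
    rw [dslope_of_ne _ (sub_ne_zero.mp hw), slope_def_field]
    field_simp
    ring
  -- the boundary terms of `dslope g w₀` at infinity
  have hzero : Filter.Tendsto (fun T : ℝ => (∫ t in (-T)..T, c₂.density t * dslope g w₀ (c₂.point t)) -
      ∫ t in (-T)..T, c₁.density t * dslope g w₀ (c₁.point t)) Filter.atTop (nhds 0) := by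
    have hlin : Filter.Tendsto (fun T : ℝ => T * Real.sin φ - ‖w₀‖) Filter.atTop Filter.atTop :=
      Filter.tendsto_atTop_add_const_right _ _ (Filter.tendsto_id.atTop_mul_const hs)
    refine squeeze_zero_norm' (a := fun T => ‖(2 * Real.pi * Complex.I : ℂ)⁻¹‖ *
      (2 * ((T * Real.sin φ - ‖w₀‖)⁻¹ * (2 * C * (a₂ - a₁))))) ?_
      (by simpa using (((tendsto_inv_atTop_zero.comp hlin).mul_const (2 * C * (a₂ - a₁))).const_mul
        2).const_mul ‖(2 * Real.pi * Complex.I : ℂ)⁻¹‖)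
    filter_upwards [hlin.eventually_gt_atTop 0, Filter.eventually_ge_atTop 0] with T hT hT0
    rw [wedge_trunc_sub j1 j2 hT0 fun σ hσ t => hdd _ (sweep_parallel_level hs h12 hσ t), norm_mul]
    gcongr
    refine (norm_sub_le _ _).trans ?_
    have bound : ∀ t : ℝ, |t| = T → ∀ σ ∈ uIoc (0 : ℝ) 1,
        ‖dslope g w₀ (sweep c₁ c₂ σ t) * (c₂.point t - c₁.point t)‖ ≤
        (T * Real.sin φ - ‖w₀‖)⁻¹ * (2 * C * (a₂ - a₁)) := by
      intro t ht σ hσ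
      rw [uIoc_of_le zero_le_one] at hσ
      have hdiff : c₂.point t - c₁.point t = ((a₂ - a₁ : ℝ) : ℂ) := by
        simp only [Wedge.point, hc₁, hc₂]; push_cast; ring
      have hlev := sweep_parallel_level hs h12 ⟨hσ.1.le, hσ.2⟩ t
      have hfar := abs_le_norm_point_sub (c := ⟨φ, (1 - σ) * a₁ + σ * a₂⟩) w₀ t
      rw [← sweep_parallel, ht, abs_of_pos hs] at hfar
      have hne : sweep c₁ c₂ σ t ≠ w₀ := fun h => by
        rw [h, sub_self, norm_zero] at hfar
        linarith
      rw [hdiff, norm_mul, Complex.norm_real, Real.norm_of_nonneg (by linarith),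
        dslope_of_ne _ hne, slope_def_field, norm_div, div_eq_mul_inv]
      have hn := (norm_sub_le (g (sweep c₁ c₂ σ t)) (g w₀)).trans
        (add_le_add (hb _ hlev) (hb w₀ ⟨h₁.le, h₂.le⟩))
      have hinv := inv_anti₀ hT hfar
      calc _ ≤ (C + C) * (T * Real.sin φ - ‖w₀‖)⁻¹ * (a₂ - a₁) := by
            gcongr
        _ = _ := by ring
    have b1 := intervalIntegral.norm_integral_le_of_norm_le_const (bound T (abs_of_nonneg hT0))
    have b2 := intervalIntegral.norm_integral_le_of_norm_le_const
      (bound (-T) (by rw [abs_neg, abs_of_nonneg hT0]))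
    simp only [sub_zero, abs_one, mul_one] at b1 b2
    linarith
  have hlim := (hzero.add ((tendsto_wedge_trunc_inv hs h₁ h₂).const_mul (g w₀)))
  rw [zero_add, mul_one] at hlim
  have hl2 := (tendsto_wedge_trunc (c := c₂) (h := fun w => g w / (w - w₀)) hi₂).sub
    (tendsto_wedge_trunc (c := c₁) (h := fun w => g w / (w - w₀)) hi₁)
  refine tendsto_nhds_unique hl2 (hlim.congr fun T => ?_)
  have e : ∀ c : Wedge, (∀ t, c.point t - w₀ ≠ 0) →
      (∀ a b, IntervalIntegrable (fun t => c.density t * dslope g w₀ (c.point t)) volume a b) →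
      (∀ a b, IntervalIntegrable (fun t => c.density t * (1 / (c.point t - w₀))) volume a b) →
      ∫ t in (-T)..T, c.density t * (g (c.point t) / (c.point t - w₀)) =
      (∫ t in (-T)..T, c.density t * dslope g w₀ (c.point t)) +
        g w₀ * ∫ t in (-T)..T, c.density t * (1 / (c.point t - w₀)) := by
    intro c hne j i
    rw [← intervalIntegral.integral_const_mul, ← intervalIntegral.integral_add (j _ _)
      ((i _ _).const_mul _)]
    refine intervalIntegral.integral_congr fun t _ => ?_
    rw [hds _ (hne t)]
    ring
  rw [e c₂ ne2 j2 i2, e c₁ ne1 j1 i1]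
  ring

theorem Wedge.integrable_of_norm_le {c : Wedge} {h : ℂ → ℂ} {C k : ℝ} (hk : 0 < k)
    (hm : Measurable fun t => h (c.point t))
    (hb : ∀ t, ‖h (c.point t)‖ ≤ C * Real.exp (-(k * |t|))) :
    Integrable fun t => c.density t * h (c.point t) := by
  refine ((integrable_exp_neg_mul_abs hk).const_mul C).mono'
    (c.measurable_density.aestronglyMeasurable.mul hm.aestronglyMeasurable)
    (.of_forall fun t => ?_)
  rw [norm_mul]
  exact (mul_le_of_le_one_left (norm_nonneg _) (c.norm_density_le t)).trans (hb t)

theorem Wedge.continuous_comp_point {c : Wedge} {h : ℂ → ℂ}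
    (hd : ∀ t, DifferentiableAt ℂ h (c.point t)) : Continuous fun t => h (c.point t) :=
  continuous_iff_continuousAt.mpr fun t =>
    ContinuousAt.comp (hd t).continuousAt c.continuous_point.continuousAt

/-- The contribution of the simple pole to the right of a wedge on which the integrand decays. -/
theorem wedgeIntegral_div_of_decay {φ : ℝ} (hs : 0 < Real.sin φ) (hc : 0 < Real.cos φ)
    {a : ℝ} {w₀ : ℂ} (h₀ : a < wedgeLevel φ w₀) {g : ℂ → ℂ}
    (hd : ∀ w, a ≤ wedgeLevel φ w → DifferentiableAt ℂ g w) {C : ℝ}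
    (hb : ∀ w, a ≤ wedgeLevel φ w → ‖g w‖ ≤ C * Real.exp (-w.re)) :
    wedgeIntegral ⟨φ, a⟩ (fun w => g w / (w - w₀)) = -g w₀ := by
  have hC : 0 ≤ C := by
    have := (norm_nonneg _).trans (hb w₀ h₀.le)
    exact nonneg_of_mul_nonneg_left this (Real.exp_pos _)
  have hcot : 0 < Real.cos φ / Real.sin φ := div_pos hc hs
  set κ := 1 + |Real.cos φ / Real.sin φ| with hκ
  have hκ0 : 0 < κ := by positivity
  have hfar : ∀ w d, 0 < d → d ≤ |wedgeLevel φ w - wedgeLevel φ w₀| → d / κ ≤ ‖w - w₀‖ :=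
    fun w d _ hw => by
      rw [div_le_iff₀' hκ0]
      exact hw.trans (abs_wedgeLevel_sub_le φ w w₀)
  have hquot : ∀ d, 0 < d → ∀ w, a ≤ wedgeLevel φ w → d ≤ |wedgeLevel φ w - wedgeLevel φ w₀| →
      ‖g w / (w - w₀)‖ ≤ C * (κ / d) * Real.exp (-w.re) := fun d hd0 w hw hdw => by
    rw [norm_div]
    have h1 := hfar w d hd0 hdw
    calc _ ≤ C * Real.exp (-w.re) / (d / κ) := by
          gcongr
          exact hb w hw
      _ = _ := by field_simp
  have hne : ∀ d, 0 < d → ∀ w, d ≤ |wedgeLevel φ w - wedgeLevel φ w₀| → w - w₀ ≠ 0 :=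
    fun d hd0 w hdw h => by
      have := hfar w d hd0 hdw
      rw [h, norm_zero] at this
      exact absurd this (not_le.mpr (by positivity))
  have hdiff : ∀ d, 0 < d → ∀ w, a ≤ wedgeLevel φ w → d ≤ |wedgeLevel φ w - wedgeLevel φ w₀| →
      DifferentiableAt ℂ (fun w => g w / (w - w₀)) w := fun d hd0 w hw hdw =>
    (hd w hw).div (by fun_prop) (hne d hd0 w hdw)
  have hint : ∀ a', a ≤ a' → a' ≠ wedgeLevel φ w₀ → Integrable fun t =>
      (⟨φ, a'⟩ : Wedge).density t *
        (g ((⟨φ, a'⟩ : Wedge).point t) / ((⟨φ, a'⟩ : Wedge).point t - w₀)) := by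
    intro a' ha' hne'
    have hlev := fun t => wedgeLevel_point (c := ⟨φ, a'⟩) hs t
    have hd0 : 0 < |a' - wedgeLevel φ w₀| := abs_pos.mpr (sub_ne_zero.mpr hne')
    refine Wedge.integrable_of_norm_le (c := ⟨φ, a'⟩) (h := fun w => g w / (w - w₀))
      (C := C * (κ / |a' - wedgeLevel φ w₀|) * Real.exp (-a')) hc
      (Wedge.continuous_comp_point fun t => hdiff _ hd0 _ (ha'.trans (hlev t).ge)
        (by rw [hlev])).measurable fun t => ?_
    refine (hquot _ hd0 _ (ha'.trans (hlev t).ge) (by rw [hlev])).trans (le_of_eq ?_)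
    rw [Wedge.point_re, mul_assoc _ (Real.exp (-a')), ← Real.exp_add]
    congr 2
    ring
  have hzero : wedgeIntegral ⟨φ, wedgeLevel φ w₀ + 1⟩ (fun w => g w / (w - w₀)) = 0 := by
    refine wedgeIntegral_eq_zero_of_decay hs hc (C := C * (κ / 1)) (fun w hw => ?_) fun w hw => ?_
    · exact hdiff 1 one_pos w (by linarith) (by rw [le_abs]; left; linarith)
    · exact hquot 1 one_pos w (by linarith) (by rw [le_abs]; left; linarith)
  have := wedgeIntegral_sub_of_pole hs h₀ (lt_add_one (wedgeLevel φ w₀)) (g := g)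
    (fun w hw => hd w hw.1) (C := C * Real.exp (-a)) (fun w hw => (hb w hw.1).trans (by
      have h1 := hw.1
      rw [wedgeLevel] at h1
      have : a ≤ w.re := by nlinarith [abs_nonneg w.im]
      gcongr)) (hint a le_rfl h₀.ne) (hint _ (by linarith) (by linarith))
  rw [hzero, zero_sub] at this
  rw [← this, neg_neg]

theorem sweep_im (c₁ c₂ : Wedge) (σ t : ℝ) : (sweep c₁ c₂ σ t).im =
    t * ((1 - σ) * Real.sin c₁.angle + σ * Real.sin c₂.angle) := by
  have : sweep c₁ c₂ σ t = ((1 - σ : ℝ) : ℂ) * c₁.point t + (σ : ℂ) * c₂.point t := by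
    simp [sweep]
  rw [this, Complex.add_im, Complex.im_ofReal_mul, Complex.im_ofReal_mul, c₁.point_im, c₂.point_im]
  ring

theorem sweep_re (c₁ c₂ : Wedge) (σ t : ℝ) : (sweep c₁ c₂ σ t).re =
    (1 - σ) * (c₁.vertex + |t| * Real.cos c₁.angle) +
      σ * (c₂.vertex + |t| * Real.cos c₂.angle) := by
  have : sweep c₁ c₂ σ t = ((1 - σ : ℝ) : ℂ) * c₁.point t + (σ : ℂ) * c₂.point t := by
    simp [sweep]
  rw [this, Complex.add_re, Complex.re_ofReal_mul, Complex.re_ofReal_mul, c₁.point_re, c₂.point_re]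

/-- A contour can be moved through a region where the integrand decays exponentially in the
imaginary direction. -/
theorem wedgeIntegral_eq_of_im_decay {c₁ c₂ : Wedge} (hs₁ : 1 / 2 ≤ Real.sin c₁.angle)
    (hs₂ : 1 / 2 ≤ Real.sin c₂.angle) {h : ℂ → ℂ} {C : ℝ}
    (hd : ∀ σ ∈ Icc (0 : ℝ) 1, ∀ t, DifferentiableAt ℂ h (sweep c₁ c₂ σ t))
    (hb : ∀ σ ∈ Icc (0 : ℝ) 1, ∀ t, ‖h (sweep c₁ c₂ σ t)‖ ≤
      C * Real.exp (-(2 * |(sweep c₁ c₂ σ t).im|))) :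
    wedgeIntegral c₁ h = wedgeIntegral c₂ h := by
  have hC : 0 ≤ C := by
    have := (norm_nonneg _).trans (hb 0 ⟨le_rfl, zero_le_one⟩ 0)
    exact nonneg_of_mul_nonneg_left this (Real.exp_pos _)
  have hb' : ∀ σ ∈ Icc (0 : ℝ) 1, ∀ t, ‖h (sweep c₁ c₂ σ t)‖ ≤ C * Real.exp (-(1 * |t|)) := by
    intro σ hσ t
    refine (hb σ hσ t).trans (mul_le_mul_of_nonneg_left
      (Real.exp_le_exp.mpr (neg_le_neg ?_)) hC)
    rw [sweep_im, abs_mul, one_mul]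
    have h1 : 1 / 2 ≤ (1 - σ) * Real.sin c₁.angle + σ * Real.sin c₂.angle := by
      nlinarith [hσ.1, hσ.2]
    rw [abs_of_pos (by linarith : (0 : ℝ) < (1 - σ) * Real.sin c₁.angle + σ * Real.sin c₂.angle)]
    nlinarith [abs_nonneg t]
  have e0 : ∀ t, sweep c₁ c₂ 0 t = c₁.point t := fun t => by simp [sweep]
  have e1 : ∀ t, sweep c₁ c₂ 1 t = c₂.point t := fun t => by simp [sweep]
  have h0mem : (0 : ℝ) ∈ Icc (0 : ℝ) 1 := ⟨le_rfl, zero_le_one⟩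
  have h1mem : (1 : ℝ) ∈ Icc (0 : ℝ) 1 := ⟨zero_le_one, le_rfl⟩
  have i1 : Integrable fun t => c₁.density t * h (c₁.point t) :=
    Wedge.integrable_of_norm_le one_pos
      (Wedge.continuous_comp_point fun t => e0 t ▸ hd 0 h0mem t).measurable
      fun t => e0 t ▸ hb' 0 h0mem t
  have i2 : Integrable fun t => c₂.density t * h (c₂.point t) :=
    Wedge.integrable_of_norm_le one_pos
      (Wedge.continuous_comp_point fun t => e1 t ▸ hd 1 h1mem t).measurable
      fun t => e1 t ▸ hb' 1 h1mem t
  have hdist : ∀ t, ‖c₂.point t - c₁.point t‖ ≤ |c₂.vertex - c₁.vertex| + 4 * |t| := by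
    intro t
    refine (Complex.norm_le_abs_re_add_abs_im _).trans ?_
    rw [Complex.sub_re, Complex.sub_im, c₁.point_re, c₂.point_re, c₁.point_im, c₂.point_im]
    have a1 : |c₂.vertex + |t| * Real.cos c₂.angle - (c₁.vertex + |t| * Real.cos c₁.angle)| ≤
        |c₂.vertex - c₁.vertex| + |t| * 2 := by
      rw [show c₂.vertex + |t| * Real.cos c₂.angle - (c₁.vertex + |t| * Real.cos c₁.angle) =
        (c₂.vertex - c₁.vertex) + |t| * (Real.cos c₂.angle - Real.cos c₁.angle) by ring]
      refine (abs_add_le _ _).trans ?_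
      rw [abs_mul, abs_abs]
      gcongr
      rw [abs_le]
      constructor <;> linarith [Real.cos_le_one c₁.angle, Real.cos_le_one c₂.angle,
        Real.neg_one_le_cos c₁.angle, Real.neg_one_le_cos c₂.angle]
    have a2 : |t * Real.sin c₂.angle - t * Real.sin c₁.angle| ≤ |t| * 2 := by
      rw [← mul_sub, abs_mul]
      gcongr
      rw [abs_le]
      constructor <;> linarith [Real.sin_le_one c₁.angle, Real.sin_le_one c₂.angle]
    linarith
  have hT : Filter.Tendsto (fun T : ℝ => C * Real.exp (-(1 * |T|)) *
      (|c₂.vertex - c₁.vertex| + 4 * |T|)) Filter.atTop (nhds 0) := by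
    have t0 : Filter.Tendsto (fun T : ℝ => |T|) Filter.atTop Filter.atTop :=
      Filter.tendsto_abs_atTop_atTop
    have t1 := (Real.tendsto_exp_neg_atTop_nhds_zero.comp t0).const_mul
      (C * |c₂.vertex - c₁.vertex|)
    have t2 := ((Real.tendsto_pow_mul_exp_neg_atTop_nhds_zero 1).comp t0).const_mul (4 * C)
    have := t1.add t2
    simp only [mul_zero, add_zero] at this
    refine this.congr fun T => ?_
    simp only [Function.comp_apply, one_mul, pow_one]
    ring
  refine wedgeIntegral_eq_of_sweep i1 i2 hd hT (.of_forall fun T σ hσ => ?_)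
  have key : ∀ t, ‖h (sweep c₁ c₂ σ t) * (c₂.point t - c₁.point t)‖ ≤
      C * Real.exp (-(1 * |t|)) * (|c₂.vertex - c₁.vertex| + 4 * |t|) := fun t => by
    rw [norm_mul]
    exact mul_le_mul (hb' σ hσ t) (hdist t) (norm_nonneg _) (by positivity)
  exact ⟨key T, by simpa using key (-T)⟩

end Contours

/-! ### Decay of the exponential factors -/

section Decay

theorem re_gauss (D e : ℝ) (w : ℂ) :
    ((D : ℂ) * w ^ 2 + (e : ℂ) * w).re = D * (w.re ^ 2 - w.im ^ 2) + e * w.re := by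
  simp [pow_two]

theorem re_cubic (x : ℝ) (w : ℂ) : (-(1 / 3) * w ^ 3 + (x : ℂ) * w).re =
    -(w.re ^ 3 - 3 * w.re * w.im ^ 2) / 3 + x * w.re := by
  have h3 : (-(1 / 3) : ℂ) = ((-(1 / 3) : ℝ) : ℂ) := by push_cast; ring
  rw [h3, Complex.add_re, Complex.re_ofReal_mul, Complex.re_ofReal_mul]
  simp [pow_succ]
  ring

/-- A Gaussian is small in the sector where `|Re w|` is smaller than `|Im w|`. -/
theorem exists_gauss_le {D : ℝ} (hD : 0 < D) (e : ℝ) {K c : ℝ} (hc : 0 ≤ c)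
    (hc1 : c < 1) : ∃ C : ℝ, 0 ≤ C ∧ ∀ w : ℂ, |w.re| ≤ c * |w.im| + K →
      ‖Complex.exp ((D : ℂ) * w ^ 2 + (e : ℂ) * w)‖ ≤ C * Real.exp (-(2 * |w.im|)) := by
  have ha : 0 < D * (1 - c ^ 2) := mul_pos hD (by nlinarith)
  set a := D * (1 - c ^ 2)
  set b := 2 * D * c * K + |e| * c + 2
  refine ⟨Real.exp (D * K ^ 2 + |e| * K + b ^ 2 / (4 * a)), (Real.exp_pos _).le, fun w hw => ?_⟩
  rw [Complex.norm_exp, re_gauss, ← Real.exp_add, Real.exp_le_exp]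
  set y := |w.im| with hy
  have hy0 : 0 ≤ y := abs_nonneg _
  have h1 : w.re ^ 2 ≤ (c * y + K) ^ 2 := by
    rw [← sq_abs w.re]
    exact pow_le_pow_left₀ (abs_nonneg _) hw 2
  have h2 : e * w.re ≤ |e| * (c * y + K) :=
    (le_abs_self _).trans (by rw [abs_mul]; gcongr)
  have h3 : w.im ^ 2 = y ^ 2 := (sq_abs _).symm
  have h4 : b * y - a * y ^ 2 ≤ b ^ 2 / (4 * a) := by
    rw [le_div_iff₀ (by positivity)]
    nlinarith [sq_nonneg (2 * a * y - b)]
  have h5 : D * w.re ^ 2 ≤ D * (c * y + K) ^ 2 := by gcongr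
  rw [h3]
  simp only [a, b] at h4 ⊢
  nlinarith

/-- The reciprocal of a Gaussian is small in the sector where `|Im w|` is smaller than `|Re w|`. -/
theorem exists_inv_gauss_le {D : ℝ} (hD : 0 < D) (e : ℝ) {K c : ℝ} (hc : 0 ≤ c)
    (hc1 : c < 1) : ∃ C : ℝ, 0 ≤ C ∧ ∀ w : ℂ, |w.im| ≤ c * |w.re| + K →
      ‖Complex.exp (-((D : ℂ) * w ^ 2 + (e : ℂ) * w))‖ ≤ C * Real.exp (-(2 * |w.re|)) := by
  have ha : 0 < D * (1 - c ^ 2) := mul_pos hD (by nlinarith)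
  set a := D * (1 - c ^ 2)
  set b := 2 * D * c * K + |e| + 2
  refine ⟨Real.exp (D * K ^ 2 + b ^ 2 / (4 * a)), (Real.exp_pos _).le, fun w hw => ?_⟩
  rw [Complex.norm_exp, Complex.neg_re, re_gauss, ← Real.exp_add, Real.exp_le_exp]
  set y := |w.re| with hy
  have hy0 : 0 ≤ y := abs_nonneg _
  have h1 : w.im ^ 2 ≤ (c * y + K) ^ 2 := by
    rw [← sq_abs w.im]
    exact pow_le_pow_left₀ (abs_nonneg _) hw 2
  have h2 : -(e * w.re) ≤ |e| * y := by
    rw [hy, ← abs_mul]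
    exact neg_le_abs _
  have h3 : w.re ^ 2 = y ^ 2 := (sq_abs _).symm
  have h4 : b * y - a * y ^ 2 ≤ b ^ 2 / (4 * a) := by
    rw [le_div_iff₀ (by positivity)]
    nlinarith [sq_nonneg (2 * a * y - b)]
  have h5 : D * w.im ^ 2 ≤ D * (c * y + K) ^ 2 := by gcongr
  rw [h3]
  simp only [a, b] at h4 ⊢
  nlinarith

/-- The integrand of the Airy function. -/
noncomputable def airyExp (x : ℝ) (w : ℂ) : ℂ := Complex.exp (-(1 / 3) * w ^ 3 + (x : ℂ) * w)

/-- `airyExp` is small in the sector `|Re w| ≤ c |Im w|`, `c < √3`, of the left half plane. -/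
theorem exists_airyExp_le (x : ℝ) {ρ K c Y : ℝ} (hρ : 0 < ρ) (hK : 0 ≤ K) (hc : 0 ≤ c)
    (hc1 : c ^ 2 < 3) : ∃ C : ℝ, 0 ≤ C ∧ ∀ w : ℂ, |w.re| ≤ c * |w.im| + K →
      (w.re ≤ -ρ ∨ |w.im| ≤ Y) → ‖airyExp x w‖ ≤ C * Real.exp (-(2 * |w.im|)) := by
  have ha : 0 < 1 - c ^ 2 / 3 := by linarith
  set a := 1 - c ^ 2 / 3 with hadef
  set b := 2 * c * K / 3 + 2 / ρ with hbdef
  set k := K ^ 2 / 3 + |x| with hkdef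
  have hb0 : 0 ≤ b := by positivity
  have hk0 : 0 ≤ k := by positivity
  -- for `|Im w| > Y₁` the cubic term beats the others; elsewhere everything is bounded
  set Y₁ := max Y ((b + k) / a + 1) with hY₁
  have hY₁1 : 1 ≤ Y₁ := le_trans (by have := div_nonneg (add_nonneg hb0 hk0) ha.le; linarith)
    (le_max_right _ _)
  set P := c * Y₁ + K with hP
  have hP0 : 0 ≤ P := by positivity
  refine ⟨Real.exp (P ^ 3 / 3 + P * Y₁ ^ 2 + |x| * P + 2 * Y₁), (Real.exp_pos _).le,
    fun w hw hw' => ?_⟩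
  rw [airyExp, Complex.norm_exp, re_cubic, ← Real.exp_add, Real.exp_le_exp]
  set y := |w.im| with hy
  have hy0 : 0 ≤ y := abs_nonneg _
  have hyy : w.im ^ 2 = y ^ 2 := (sq_abs _).symm
  rw [hyy]
  rcases le_or_gt y Y₁ with hle | hgt
  · have h1 : |w.re| ≤ P := hw.trans (by rw [hP]; gcongr)
    have h2 : -w.re ^ 3 ≤ P ^ 3 := by
      refine (neg_le_abs _).trans ?_
      rw [abs_pow]
      exact pow_le_pow_left₀ (abs_nonneg _) h1 3
    have h3 : w.re * y ^ 2 ≤ P * Y₁ ^ 2 :=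
      mul_le_mul ((le_abs_self _).trans h1) (pow_le_pow_left₀ hy0 hle 2) (by positivity) hP0
    have h4 : x * w.re ≤ |x| * P := (le_abs_self _).trans (by rw [abs_mul]; gcongr)
    linarith
  · have h0 : w.re ≤ -ρ := hw'.resolve_right (not_le.mpr ((le_max_left _ _).trans_lt hgt))
    set r := -w.re with hr
    have hre : w.re = -r := by rw [hr, neg_neg]
    have hrρ : ρ ≤ r := by linarith
    have hr0 : 0 < r := hρ.trans_le hrρ
    rw [hre, abs_neg, abs_of_pos hr0] at hw
    have h1 : r ^ 2 ≤ (c * y + K) ^ 2 := pow_le_pow_left₀ hr0.le hw 2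
    have hy1 : 1 ≤ y := hY₁1.trans hgt.le
    have h2 : b + k ≤ a * y := by
      have : (b + k) / a ≤ y := by linarith [le_max_right Y ((b + k) / a + 1)]
      rwa [div_le_iff₀' ha] at this
    have h3 : r ^ 2 / 3 - y ^ 2 + |x| ≤ -(2 / ρ) * y := by
      have e1 : b * y + k * y ≤ a * y ^ 2 := by nlinarith
      have e2 : k ≤ k * y := le_mul_of_one_le_right hk0 hy1
      have e3 : r ^ 2 / 3 ≤ (c * y + K) ^ 2 / 3 := by gcongr
      simp only [hadef, hbdef] at e1
      rw [hkdef] at e1 e2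
      nlinarith
    have h4 : -(2 / ρ) * y * r ≤ -(2 * y) := by
      have : 1 ≤ r / ρ := by rwa [one_le_div hρ]
      have e : -(2 / ρ) * y * r = -(2 * y) * (r / ρ) := by field_simp
      rw [e]
      nlinarith
    have h5 : x * -r ≤ |x| * r := by
      have := neg_le_abs x
      nlinarith
    have h6 := mul_le_mul_of_nonneg_right h3 hr0.le
    rw [hre]
    have h7 : 0 ≤ P ^ 3 / 3 + P * Y₁ ^ 2 + |x| * P + 2 * Y₁ := by positivity
    nlinarith

variable {M : ℕ} (α β : Fin (M + 1) → ℝ)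

/-- Completing the cube in `f_i(w) e^{s w}`. -/
theorem f_mul_exp (i : Fin (M + 1)) (s : ℝ) (w : ℂ) :
    f α β i w * Complex.exp ((s : ℂ) * w) = (Real.exp (conjExponent α β i s) : ℂ) *
      airyExp (s + β i + α i ^ 2) (w - (α i : ℂ)) := by
  rw [f, airyExp, Complex.ofReal_exp, ← Complex.exp_add, ← Complex.exp_add, conjExponent]
  congr 1
  push_cast
  ring

theorem inv_f_mul_exp (i : Fin (M + 1)) (s : ℝ) (w : ℂ) :
    1 / (f α β i w * Complex.exp ((s : ℂ) * w)) = (Real.exp (-conjExponent α β i s) : ℂ) *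
      airyExp (s + β i + α i ^ 2) ((α i : ℂ) - w) := by
  rw [f, airyExp, Complex.ofReal_exp, ← Complex.exp_add, ← Complex.exp_add, one_div,
    ← Complex.exp_neg, conjExponent]
  congr 1
  push_cast
  ring

theorem f_ne_zero (i : Fin (M + 1)) (w : ℂ) : f α β i w ≠ 0 := Complex.exp_ne_zero _

theorem f_div_f (i j : Fin (M + 1)) (w : ℂ) : f α β j w / f α β i w =
    Complex.exp (((α j - α i : ℝ) : ℂ) * w ^ 2 + ((β j - β i : ℝ) : ℂ) * w) := by
  rw [f, f, ← Complex.exp_sub]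
  congr 1
  push_cast
  ring

theorem f_div_f' (i j : Fin (M + 1)) (w : ℂ) : f α β i w / f α β j w =
    Complex.exp (-(((α j - α i : ℝ) : ℂ) * w ^ 2 + ((β j - β i : ℝ) : ℂ) * w)) := by
  rw [f, f, ← Complex.exp_sub]
  congr 1
  push_cast
  ring

theorem differentiable_f (i : Fin (M + 1)) : Differentiable ℂ (f α β i) := by
  unfold f
  fun_prop

theorem differentiable_airyExp (x : ℝ) : Differentiable ℂ (airyExp x) := by
  unfold airyExp
  fun_prop

theorem F_succ (k : Fin M) (w : ℂ) : F α β k.succ w = f α β k.succ w / f α β k.castSucc w := rfl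

theorem F_zero (w : ℂ) : F α β 0 w = f α β 0 w := rfl

theorem sin_two_pi_div_three : Real.sin (2 * Real.pi / 3) = √3 / 2 := by
  rw [show 2 * Real.pi / 3 = Real.pi - Real.pi / 3 by ring, Real.sin_pi_sub, Real.sin_pi_div_three]

theorem cos_two_pi_div_three : Real.cos (2 * Real.pi / 3) = -(1 / 2) := by
  rw [show 2 * Real.pi / 3 = Real.pi - Real.pi / 3 by ring, Real.cos_pi_sub, Real.cos_pi_div_three]

theorem sqrt_three_bounds : 1.7 ≤ √3 ∧ √3 ≤ 1.8 :=
  ⟨Real.le_sqrt_of_sq_le (by norm_num), Real.sqrt_le_iff.mpr (by norm_num)⟩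

theorem sin_cos_pi_div_five : 1 / 2 ≤ Real.sin (Real.pi / 5) ∧ 0.8 ≤ Real.cos (Real.pi / 5) ∧
    Real.cos (Real.pi / 5) ≤ 0.81 + 0.001 ∧ Real.sin (Real.pi / 5) ≤ 0.6 := by
  have hc := Real.cos_pi_div_five
  have h5 : 2.236 ≤ √5 ∧ √5 ≤ 2.24 :=
    ⟨Real.le_sqrt_of_sq_le (by norm_num), Real.sqrt_le_iff.mpr (by norm_num)⟩
  have hs := Real.sin_sq_add_cos_sq (Real.pi / 5)
  have hs0 : 0 ≤ Real.sin (Real.pi / 5) :=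
    Real.sin_nonneg_of_nonneg_of_le_pi (by positivity) (by linarith [Real.pi_pos])
  rw [hc] at hs ⊢
  refine ⟨?_, by linarith, by linarith, ?_⟩ <;> nlinarith

theorem leftWedge_im (a t : ℝ) : |((leftWedge a).point t).im| = √3 / 2 * |t| := by
  rw [Wedge.point_im, leftWedge, sin_two_pi_div_three, abs_mul,
    abs_of_pos (show 0 < √3 / 2 by positivity), mul_comm]

theorem leftWedge_re (a t : ℝ) : ((leftWedge a).point t).re = a - |t| / 2 := by
  rw [Wedge.point_re, leftWedge, cos_two_pi_div_three]
  ring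

theorem exp_im_leftWedge_le (a t : ℝ) :
    Real.exp (-(2 * |((leftWedge a).point t).im|)) ≤ Real.exp (-|t|) := by
  rw [leftWedge_im, Real.exp_le_exp]
  nlinarith [abs_nonneg t, sqrt_three_bounds.1]

theorem rightWedge_re (b t : ℝ) :
    ((rightWedge b).point t).re = b + |t| * Real.cos (Real.pi / 5) := Wedge.point_re _ _

theorem rightWedge_im (b t : ℝ) :
    |((rightWedge b).point t).im| = |t| * Real.sin (Real.pi / 5) := by
  rw [Wedge.point_im, rightWedge, abs_mul, 
    abs_of_pos (show 0 < Real.sin (Real.pi / 5) by linarith [sin_cos_pi_div_five.1])]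

/-- Every `f_i` decays along the left contours. -/
theorem exists_f_left_le (i : Fin (M + 1)) (a : ℝ) : ∃ C : ℝ, 0 ≤ C ∧ ∀ t : ℝ,
    ‖f α β i ((leftWedge a).point t)‖ ≤ C * Real.exp (-|t|) := by
  obtain ⟨C, hC, h⟩ := exists_airyExp_le (β i + α i ^ 2) (ρ := 1) (K := |a - α i|) (c := 1)
    (Y := 2 * |a - α i| + 2) one_pos (abs_nonneg _) zero_le_one (by norm_num)
  refine ⟨Real.exp (conjExponent α β i 0) * C, by positivity, fun t => ?_⟩
  have h3 := sqrt_three_bounds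
  have ht := abs_nonneg t
  have e := f_mul_exp α β i 0 ((leftWedge a).point t)
  rw [Complex.ofReal_zero, zero_mul, Complex.exp_zero, mul_one, zero_add] at e
  rw [e, norm_mul, Complex.norm_real, Real.norm_of_nonneg (Real.exp_pos _).le, mul_assoc]
  have hre : ((leftWedge a).point t - (α i : ℂ)).re = (a - α i) - |t| / 2 := by
    rw [Complex.sub_re, leftWedge_re, Complex.ofReal_re]; ring
  have him : ((leftWedge a).point t - (α i : ℂ)).im = ((leftWedge a).point t).im := by simp
  gcongr
  refine (h _ ?_ ?_).trans ?_
  · rw [hre, him, leftWedge_im]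
    refine (abs_sub _ _).trans ?_
    rw [abs_of_nonneg (by positivity : 0 ≤ |t| / 2)]
    nlinarith
  · rw [hre, him, leftWedge_im]
    by_cases hcase : |t| ≤ 2 * |a - α i| + 2
    · right
      nlinarith
    · left
      have := le_abs_self (a - α i)
      linarith
  · rw [him]
    exact mul_le_mul_of_nonneg_left (exp_im_leftWedge_le a t) hC

theorem exists_inv_f_right_le (i : Fin (M + 1)) (b : ℝ) : ∃ C : ℝ, 0 ≤ C ∧ ∀ t : ℝ,
    ‖1 / f α β i ((rightWedge b).point t)‖ ≤ C * Real.exp (-|t|) := by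
  obtain ⟨hs1, hc1, hc2, hs2⟩ := sin_cos_pi_div_five
  -- the slope: `cot (π / 5) < 1.63 < √3`
  obtain ⟨C, hC, h⟩ := exists_airyExp_le (β i + α i ^ 2) (ρ := 1) (K := |b - α i|) (c := 1.63)
    (Y := 2 * |b - α i| + 2) one_pos (abs_nonneg _) (by norm_num) (by norm_num)
  refine ⟨Real.exp (-conjExponent α β i 0) * C, by positivity, fun t => ?_⟩
  have ht := abs_nonneg t
  have e := inv_f_mul_exp α β i 0 ((rightWedge b).point t)
  rw [Complex.ofReal_zero, zero_mul, Complex.exp_zero, mul_one, zero_add] at e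
  rw [e, norm_mul, Complex.norm_real, Real.norm_of_nonneg (Real.exp_pos _).le, mul_assoc]
  have hre : ((α i : ℂ) - (rightWedge b).point t).re =
      -((b - α i) + |t| * Real.cos (Real.pi / 5)) := by
    rw [Complex.sub_re, rightWedge_re, Complex.ofReal_re]; ring
  have him : |((α i : ℂ) - (rightWedge b).point t).im| = |t| * Real.sin (Real.pi / 5) := by
    rw [Complex.sub_im, Complex.ofReal_im, zero_sub, abs_neg, rightWedge_im]
  gcongr
  refine (h _ ?_ ?_).trans ?_
  · rw [hre, him, abs_neg]
    refine (abs_add_le _ _).trans ?_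
    rw [abs_of_nonneg (by positivity : 0 ≤ |t| * Real.cos (Real.pi / 5))]
    nlinarith
  · rw [hre, him]
    by_cases hcase : |t| ≤ 2 * |b - α i| + 2
    · right
      nlinarith
    · left
      have := neg_abs_le (b - α i)
      nlinarith
  · rw [him]
    gcongr
    nlinarith

variable {α}

theorem exists_quot_le (hα : StrictMono α) {i j : Fin (M + 1)} (hij : i < j) {K c : ℝ}
    (hc : 0 ≤ c) (hc1 : c < 1) : ∃ C : ℝ, 0 ≤ C ∧ ∀ w : ℂ,
      |w.re| ≤ c * |w.im| + K → ‖f α β j w / f α β i w‖ ≤ C * Real.exp (-(2 * |w.im|)) := by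
  simp only [f_div_f]
  exact exists_gauss_le (sub_pos.mpr (hα hij)) _ hc hc1

theorem exists_quot_left_le (hα : StrictMono α) {i j : Fin (M + 1)} (hij : i < j) (a : ℝ) :
    ∃ C : ℝ, 0 ≤ C ∧ ∀ t : ℝ, ‖f α β j ((leftWedge a).point t) / f α β i ((leftWedge a).point t)‖ ≤
      C * Real.exp (-|t|) := by
  -- the slope: `1 / √3 < 0.6`
  obtain ⟨C, hC, h⟩ := exists_quot_le β hα hij (K := |a|) (c := 0.6) (by norm_num)
    (by norm_num)
  refine ⟨C, hC, fun t => (h _ ?_).trans ?_⟩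
  · rw [leftWedge_re, leftWedge_im]
    refine (abs_sub _ _).trans ?_
    rw [abs_of_nonneg (by positivity : 0 ≤ |t| / 2)]
    nlinarith [abs_nonneg t, sqrt_three_bounds.1]
  · exact mul_le_mul_of_nonneg_left (exp_im_leftWedge_le a t) hC

/-- Quotients of the `f_i` decay in the whole region to the right of a right contour. -/
theorem exists_quot_right_le (hα : StrictMono α) {i j : Fin (M + 1)} (hij : i < j) :
    ∃ C : ℝ, 0 ≤ C ∧ ∀ w : ℂ, 0 ≤ wedgeLevel (Real.pi / 5) w →
      ‖f α β i w / f α β j w‖ ≤ C * Real.exp (-(2 * w.re)) := by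
  obtain ⟨hs1, hc1, hc2, hs2⟩ := sin_cos_pi_div_five
  simp only [f_div_f']
  -- the slope: `tan (π / 5) < 0.75`
  obtain ⟨C, hC, h⟩ := exists_inv_gauss_le (sub_pos.mpr (hα hij)) (β j - β i) (K := 0) (c := 0.75)
    (by norm_num) (by norm_num)
  refine ⟨C, hC, fun w hw => ?_⟩
  rw [wedgeLevel, div_mul_eq_mul_div, sub_nonneg, div_le_iff₀ (by linarith)] at hw
  have him := abs_nonneg w.im
  have hre : 0 ≤ w.re := by nlinarith
  have := h w (by rw [abs_of_nonneg hre]; nlinarith)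
  rwa [abs_of_nonneg hre] at this

theorem exists_quot_rightWedge_le (hα : StrictMono α) {i j : Fin (M + 1)} (hij : i < j) {b : ℝ}
    (hb : 0 ≤ b) : ∃ C : ℝ, 0 ≤ C ∧ ∀ t : ℝ,
      ‖f α β i ((rightWedge b).point t) / f α β j ((rightWedge b).point t)‖ ≤
        C * Real.exp (-|t|) := by
  obtain ⟨hs1, hc1, hc2, hs2⟩ := sin_cos_pi_div_five
  obtain ⟨C, hC, h⟩ := exists_quot_right_le β hα hij
  refine ⟨C, hC, fun t => (h _ ?_).trans ?_⟩
  · have := wedgeLevel_point (c := rightWedge b) (by simp only [rightWedge]; linarith) t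
    exact hb.trans this.ge
  · gcongr
    rw [rightWedge_re]
    nlinarith [abs_nonneg t]

theorem exists_F_left_le (hα : StrictMono α) (i : Fin (M + 1)) (a : ℝ) : ∃ C : ℝ, 0 ≤ C ∧
    ∀ t : ℝ, ‖F α β i ((leftWedge a).point t)‖ ≤ C * Real.exp (-|t|) := by
  induction i using Fin.cases with
  | zero => exact exists_f_left_le α β 0 a
  | succ k => exact exists_quot_left_le β hα k.castSucc_lt_succ a

theorem exists_inv_F_right_le (hα : StrictMono α) (i : Fin (M + 1)) {b : ℝ} (hb : 0 ≤ b) :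
    ∃ C : ℝ, 0 ≤ C ∧ ∀ t : ℝ, ‖1 / F α β i ((rightWedge b).point t)‖ ≤ C * Real.exp (-|t|) := by
  induction i using Fin.cases with
  | zero => exact exists_inv_f_right_le α β 0 b
  | succ k =>
    obtain ⟨C, hC, h⟩ := exists_quot_rightWedge_le β hα k.castSucc_lt_succ hb
    refine ⟨C, hC, fun t => ?_⟩
    rw [F_succ, one_div_div]
    exact h t

theorem F_ne_zero (i : Fin (M + 1)) (w : ℂ) : F α β i w ≠ 0 := by
  induction i using Fin.cases with
  | zero => exact f_ne_zero α β 0 w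
  | succ k => exact div_ne_zero (f_ne_zero α β _ w) (f_ne_zero α β _ w)

theorem differentiable_F (i : Fin (M + 1)) : Differentiable ℂ (F α β i) := by
  induction i using Fin.cases with
  | zero => exact differentiable_f α β 0
  | succ k => exact (differentiable_f α β _).div (differentiable_f α β _) (f_ne_zero α β _)

end Decay

/-! ### Separation of the contours -/

section Separation

theorem leftWedge_dist (a a' s t : ℝ) :
    |a - a'| / 2 ≤ ‖(leftWedge a).point s - (leftWedge a').point t‖ := by
  have hs : 0 < Real.sin (2 * Real.pi / 3) := by rw [sin_two_pi_div_three]; positivity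
  have h := abs_wedgeLevel_sub_le (2 * Real.pi / 3) ((leftWedge a).point s) ((leftWedge a').point t)
  have h1 : wedgeLevel (2 * Real.pi / 3) ((leftWedge a).point s) = a :=
    wedgeLevel_point (c := leftWedge a) hs s
  have h2 : wedgeLevel (2 * Real.pi / 3) ((leftWedge a').point t) = a' :=
    wedgeLevel_point (c := leftWedge a') hs t
  rw [h1, h2] at h
  have h3 : |Real.cos (2 * Real.pi / 3) / Real.sin (2 * Real.pi / 3)| ≤ 1 := by
    rw [cos_two_pi_div_three, sin_two_pi_div_three, abs_div, abs_neg,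
      abs_of_pos (by norm_num : (0 : ℝ) < 1 / 2), abs_of_pos (by positivity),
      div_le_one (by positivity)]
    linarith [sqrt_three_bounds.1]
  nlinarith [norm_nonneg ((leftWedge a).point s - (leftWedge a').point t)]

theorem rightWedge_dist (b b' s t : ℝ) :
    |b - b'| / 3 ≤ ‖(rightWedge b).point s - (rightWedge b').point t‖ := by
  obtain ⟨hs1, hc1, hc2, hs2⟩ := sin_cos_pi_div_five
  have hs : 0 < Real.sin (Real.pi / 5) := by linarith
  have h := abs_wedgeLevel_sub_le (Real.pi / 5) ((rightWedge b).point s) ((rightWedge b').point t)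
  have h1 : wedgeLevel (Real.pi / 5) ((rightWedge b).point s) = b :=
    wedgeLevel_point (c := rightWedge b) hs s
  have h2 : wedgeLevel (Real.pi / 5) ((rightWedge b').point t) = b' :=
    wedgeLevel_point (c := rightWedge b') hs t
  rw [h1, h2] at h
  have h3 : |Real.cos (Real.pi / 5) / Real.sin (Real.pi / 5)| ≤ 2 := by
    rw [abs_of_pos (by apply div_pos <;> linarith), div_le_iff₀ hs]
    linarith
  nlinarith [norm_nonneg ((rightWedge b).point s - (rightWedge b').point t)]

theorem leftWedge_rightWedge_dist (a b s t : ℝ) :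
    b - a ≤ ‖(rightWedge b).point t - (leftWedge a).point s‖ := by
  obtain ⟨hs1, hc1, hc2, hs2⟩ := sin_cos_pi_div_five
  refine le_trans ?_ (Complex.re_le_norm _)
  rw [Complex.sub_re, leftWedge_re, rightWedge_re]
  nlinarith [abs_nonneg s, abs_nonneg t]

end Separation

/-! ### Chains of kernels -/

section Chains

variable {X Y Z : Type} [MeasurableSpace X] [MeasurableSpace Y] [MeasurableSpace Z]

/-- The weight `e^{-|t|}` that bounds all integrands along the contours. -/
noncomputable def wt (t : ℝ) : ℝ := Real.exp (-|t|)

theorem wt_nonneg (t : ℝ) : 0 ≤ wt t := (Real.exp_pos _).le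

theorem wt_le_one (t : ℝ) : wt t ≤ 1 := by
  rw [wt, Real.exp_le_one_iff]
  exact neg_nonpos.mpr (abs_nonneg t)

theorem integrable_wt : Integrable wt := by
  have := integrable_exp_neg_mul_abs one_pos
  simp only [one_mul] at this
  exact this

theorem integrable_one_mul_wt : Integrable fun t => (1 : ℝ) * wt t := by
  simpa using integrable_wt

theorem measurable_wt : Measurable wt := by
  unfold wt
  fun_prop

theorem integrable_of_le_prod_wt {ι : Type} [Fintype ι] {G : (ι → ℝ) → ℂ} (hG : Measurable G)
    {C : ℝ} (h : ∀ t, ‖G t‖ ≤ C * ∏ i, wt (t i)) : Integrable G :=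
  ((Integrable.fintype_prod (f := fun _ : ι => wt) fun _ => integrable_wt).const_mul C).mono'
    hG.aestronglyMeasurable (.of_forall h)

theorem integral_sum_unit {ι : Type} [Fintype ι] {G : (ι ⊕ Unit → ℝ) → ℂ} (hG : Integrable G) :
    ∫ t, G t = ∫ t : ι → ℝ, ∫ v : ℝ, G (Sum.elim t fun _ => v) := by
  have h1 := (volume_measurePreserving_sumPiEquivProdPi (fun _ : ι ⊕ Unit => ℝ)).symm
  have h2 := ((MeasurePreserving.id (volume : Measure (ι → ℝ))).prod
    (volume_preserving_funUnique Unit ℝ).symm)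
  have h3 := h1.comp h2
  have hemb : MeasurableEmbedding ((MeasurableEquiv.sumPiEquivProdPi fun _ : ι ⊕ Unit => ℝ).symm ∘
      Prod.map id (MeasurableEquiv.funUnique Unit ℝ).symm) :=
    (MeasurableEquiv.measurableEmbedding _).comp
      (MeasurableEquiv.measurableEmbedding ((MeasurableEquiv.refl (ι → ℝ)).prodCongr
        (MeasurableEquiv.funUnique Unit ℝ).symm))
  have hi := (h3.integrable_comp_emb hemb).mpr hG
  rw [← h3.integral_comp hemb]
  refine (integral_prod _ hi).trans ?_
  refine integral_congr_ae (.of_forall fun t => integral_congr_ae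
    (.of_forall fun v => ?_))
  refine congrArg G (funext fun x => ?_)
  rcases x with x | x <;> rfl

/-- Pulling a kernel back through the first `n` steps of a chain of kernels. -/
noncomputable def chainBack : (ℕ → ℝ → ℝ → ℂ) → ℕ → (ℝ → Z → ℂ) → ℝ → Z → ℂ
  | _, 0, H => H
  | A, n + 1, H => comp volume (A 0) (chainBack (fun k => A (k + 1)) n H)

/-- Pushing a kernel forward through the first `n` steps of a chain of kernels. -/
noncomputable def chainFwd (A : ℕ → ℝ → ℝ → ℂ) : ℕ → (Y → ℝ → ℂ) → Y → ℝ → ℂ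
  | 0, S => S
  | n + 1, S => comp volume (chainFwd A n S) (A n)

theorem chainFwd_succ {Y : Type} (A : ℕ → ℝ → ℝ → ℂ) (n : ℕ) (S : Y → ℝ → ℂ) :
    chainFwd A (n + 1) S = chainFwd (fun k => A (k + 1)) n (comp volume S (A 0)) := by
  induction n with
  | zero => rfl
  | succ n ih => rw [chainFwd, ih]; rfl

/-- The bound satisfied by the steps of a chain. -/
def StepBound (A : ℕ → ℝ → ℝ → ℂ) : Prop := ∀ k, KernelBound (fun _ => 1) wt (A k)

theorem chainFwd_bound {A : ℕ → ℝ → ℝ → ℂ} (hA : StepBound A) {p : Y → ℝ} {S : Y → ℝ → ℂ}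
    (hS : KernelBound p wt S) (n : ℕ) : KernelBound p wt (chainFwd A n S) := by
  induction n with
  | zero => exact hS
  | succ n ih => exact ih.comp (hA n) integrable_one_mul_wt

theorem chainBack_bound {A : ℕ → ℝ → ℝ → ℂ} (hA : StepBound A) {q : Z → ℝ} {H : ℝ → Z → ℂ}
    (hH : KernelBound (fun _ => 1) q H) (n : ℕ) :
    KernelBound (fun _ => 1) q (chainBack A n H) := by
  induction n generalizing A with
  | zero => exact hH
  | succ n ih => exact (hA 0).comp (ih fun k => hA (k + 1)) integrable_one_mul_wt

theorem comp_chainBack {A : ℕ → ℝ → ℝ → ℂ} (hA : StepBound A) {p : Y → ℝ} {q : Z → ℝ}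
    {S : Y → ℝ → ℂ} {H : ℝ → Z → ℂ} (hS : KernelBound p wt S) (hH : KernelBound (fun _ => 1) q H)
    (n : ℕ) : comp volume S (chainBack A n H) = comp volume (chainFwd A n S) H := by
  induction n generalizing A S with
  | zero => rfl
  | succ n ih =>
    rw [chainFwd_succ, ← ih (fun k => hA (k + 1)) (hS.comp (hA 0) integrable_one_mul_wt), chainBack,
      comp_assoc hS (hA 0) (chainBack_bound (fun k => hA (k + 1)) hH n) integrable_one_mul_wt
        integrable_one_mul_wt]

theorem chainBack_comp {A : ℕ → ℝ → ℝ → ℂ} (hA : StepBound A) {q : Z → ℝ} {H : ℝ → Z → ℂ}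
    {W : Type} [MeasurableSpace W] {p' : Z → ℝ} {r : W → ℝ} {R : Z → W → ℂ} {ν : Measure Z}
    [SFinite ν] (hH : KernelBound (fun _ => 1) q H) (hR : KernelBound p' r R)
    (hν : Integrable (fun z => p' z * q z) ν) (n : ℕ) :
    chainBack A n (comp ν H R) = comp ν (chainBack A n H) R := by
  induction n generalizing A with
  | zero => rfl
  | succ n ih =>
    rw [chainBack, chainBack, ih fun k => hA (k + 1),
      comp_assoc (hA 0) (chainBack_bound (fun k => hA (k + 1)) hH n) hR integrable_one_mul_wt hν]

theorem chainFwd_comp {A : ℕ → ℝ → ℝ → ℂ} (hA : StepBound A) {W : Type} [MeasurableSpace W]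
    {ν : Measure Y} [SFinite ν] {r : W → ℝ} {q p : Y → ℝ} {R : W → Y → ℂ} {S : Y → ℝ → ℂ}
    (hR : KernelBound r q R) (hS : KernelBound p wt S) (hν : Integrable (fun y => p y * q y) ν)
    (n : ℕ) : chainFwd A n (comp ν R S) = comp ν R (chainFwd A n S) := by
  induction n with
  | zero => rfl
  | succ n ih =>
    rw [chainFwd, chainFwd, ih, comp_assoc hR (chainFwd_bound hA hS n) (hA n) hν
      integrable_one_mul_wt]

/-- The integrand of a chain of `n` steps starting at `s`. -/
noncomputable def chainProd (A : ℕ → ℝ → ℝ → ℂ) {n : ℕ} (s : ℝ) (t : Fin n → ℝ) : ℂ :=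
  ∏ k : Fin n, A k ((Fin.cons s t : Fin (n + 1) → ℝ) k.castSucc) (t k)

theorem chainProd_cons (A : ℕ → ℝ → ℝ → ℂ) {n : ℕ} (s x : ℝ) (t : Fin n → ℝ) :
    chainProd A s (Fin.cons x t : Fin (n + 1) → ℝ) =
      A 0 s x * chainProd (fun k => A (k + 1)) x t := by
  rw [chainProd, Fin.prod_univ_succ, chainProd]
  rfl

theorem StepBound.exists_chainProd_le {A : ℕ → ℝ → ℝ → ℂ} (hA : StepBound A) (n : ℕ) :
    ∃ C : ℝ, 0 ≤ C ∧ ∀ (s : ℝ) (t : Fin n → ℝ), ‖chainProd A s t‖ ≤ C * ∏ k, wt (t k) := by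
  choose C hC h using fun k => (hA k).bound
  refine ⟨∏ k : Fin n, C k, Finset.prod_nonneg fun _ _ => hC _, fun s t => ?_⟩
  rw [chainProd, norm_prod, ← Finset.prod_mul_distrib]
  exact Finset.prod_le_prod (fun _ _ => norm_nonneg _) fun k _ => by simpa using h k _ _

theorem StepBound.measurable_chainProd {A : ℕ → ℝ → ℝ → ℂ} (hA : StepBound A) (n : ℕ) :
    Measurable fun x : ℝ × (Fin n → ℝ) => chainProd A x.1 x.2 :=
  Finset.measurable_prod _ fun k _ => (hA k).measurable_apply (measurable_cons measurable_fst measurable_snd _)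
    ((measurable_pi_apply k).comp measurable_snd)

theorem integral_chainProd {A : ℕ → ℝ → ℝ → ℂ} (hA : StepBound A) {H : ℝ → Z → ℂ} {q : Z → ℝ}
    (hH : KernelBound (fun _ => 1) q H) (n : ℕ) (s : ℝ) (z : Z) :
    ∫ t : Fin n → ℝ, chainProd A s t * H ((Fin.cons s t : Fin (n + 1) → ℝ) (Fin.last n)) z =
      chainBack A n H s z := by
  induction n generalizing A s with
  | zero =>
    rw [volume_pi, Measure.pi_of_empty, integral_dirac]
    simp [chainProd, chainBack]
  | succ n ih =>
    have hmp := (volume_preserving_piFinSuccAbove (fun _ : Fin (n + 1) => ℝ) 0).symm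
    obtain ⟨C, hC, hb⟩ := hA.exists_chainProd_le (n + 1)
    obtain ⟨D, hD, hb'⟩ := hH.bound
    have hint : Integrable fun t : Fin (n + 1) → ℝ => chainProd A s t *
        H ((Fin.cons s t : Fin (n + 2) → ℝ) (Fin.last (n + 1))) z := by
      refine integrable_of_le_prod_wt (C := C * (D * q z)) ?_ fun t => ?_
      · exact ((hA.measurable_chainProd (n + 1)).comp
          (measurable_const.prodMk measurable_id)).mul (hH.measurable_apply
          (measurable_cons measurable_const measurable_id _) measurable_const)
      · rw [norm_mul, mul_right_comm]
        exact mul_le_mul (hb s t) (by simpa using hb' _ z) (norm_nonneg _)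
          (mul_nonneg hC (Finset.prod_nonneg fun _ _ => wt_nonneg _))
    have hint' := (hmp.integrable_comp_emb (MeasurableEquiv.measurableEmbedding _)).mpr hint
    rw [← hmp.integral_comp' (g := fun t : Fin (n + 1) → ℝ => chainProd A s t *
        H ((Fin.cons s t : Fin (n + 2) → ℝ) (Fin.last (n + 1))) z), chainBack, comp]
    refine (integral_prod _ hint').trans (integral_congr_ae (.of_forall fun x => ?_))
    beta_reduce
    rw [← ih (fun k => hA (k + 1)), ← integral_const_mul]
    refine integral_congr_ae (.of_forall fun t => ?_)
    have e : (MeasurableEquiv.piFinSuccAbove (fun _ : Fin (n + 1) => ℝ) 0).symm (x, t) =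
        (Fin.cons x t : Fin (n + 1) → ℝ) := by
      simp [MeasurableEquiv.piFinSuccAbove, Fin.insertNthEquiv]
    simp only [Function.comp_apply, e, chainProd_cons, mul_assoc]
    rfl

theorem prod_sum_unit_wt {n : ℕ} (x : Fin n ⊕ Unit → ℝ) :
    ∏ i, wt (x i) = (∏ k, wt (x (Sum.inl k))) * wt (x (Sum.inr ())) := by
  simp

theorem integrable_chain {A : ℕ → ℝ → ℝ → ℂ} (hA : StepBound A) {H : ℝ → ℝ → ℂ}
    (hH : KernelBound (fun _ => 1) wt H) {R : ℝ → Z → ℂ} {r : Z → ℝ}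
    (hR : KernelBound (fun _ => 1) r R) (n : ℕ) (s : ℝ) (z : Z) :
    Integrable fun x : Fin n ⊕ Unit → ℝ => chainProd A s (fun k => x (Sum.inl k)) *
      (H ((Fin.cons s (fun k => x (Sum.inl k)) : Fin (n + 1) → ℝ) (Fin.last n)) (x (Sum.inr ())) *
        R (x (Sum.inr ())) z) := by
  obtain ⟨C, hC, hb⟩ := hA.exists_chainProd_le n
  obtain ⟨D, hD, hb'⟩ := hH.bound
  obtain ⟨E, hE, hb''⟩ := hR.bound
  have m1 : Measurable fun x : Fin n ⊕ Unit → ℝ => fun k : Fin n => x (Sum.inl k) :=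
    measurable_pi_lambda _ fun k => measurable_pi_apply _
  refine integrable_of_le_prod_wt (C := C * (D * (E * r z))) ?_ fun x => ?_
  · exact ((hA.measurable_chainProd n).comp (measurable_const.prodMk m1)).mul
      ((hH.measurable_apply (measurable_cons measurable_const m1 _) (measurable_pi_apply _)).mul
        (hR.measurable_apply (measurable_pi_apply _) measurable_const))
  · rw [norm_mul, norm_mul, prod_sum_unit_wt]
    have h1 := hb s fun k => x (Sum.inl k)
    have h2 := hb' ((Fin.cons s (fun k => x (Sum.inl k)) : Fin (n + 1) → ℝ) (Fin.last n))
      (x (Sum.inr ()))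
    have h3 := hb'' (x (Sum.inr ())) z
    rw [one_mul] at h2 h3
    have h4 := hR.right_nonneg z
    have h5 : 0 ≤ ∏ k, wt (x (Sum.inl k : Fin n ⊕ Unit)) :=
      Finset.prod_nonneg fun _ _ => wt_nonneg _
    have h6 := wt_nonneg (x (Sum.inr ()))
    calc _ ≤ (C * ∏ k, wt (x (Sum.inl k))) * ((D * wt (x (Sum.inr ()))) * (E * r z)) := by gcongr
      _ = _ := by ring

theorem integral_chain {A : ℕ → ℝ → ℝ → ℂ} (hA : StepBound A) {H : ℝ → ℝ → ℂ}
    (hH : KernelBound (fun _ => 1) wt H) {R : ℝ → Z → ℂ} {r : Z → ℝ}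
    (hR : KernelBound (fun _ => 1) r R) (n : ℕ) (s : ℝ) (z : Z) :
    ∫ x : Fin n ⊕ Unit → ℝ, chainProd A s (fun k => x (Sum.inl k)) *
      (H ((Fin.cons s (fun k => x (Sum.inl k)) : Fin (n + 1) → ℝ) (Fin.last n)) (x (Sum.inr ())) *
        R (x (Sum.inr ())) z) = comp volume (chainBack A n H) R s z := by
  rw [integral_sum_unit (integrable_chain hA hH hR n s z),
    ← chainBack_comp hA hH hR integrable_one_mul_wt,
    ← integral_chainProd hA (hH.comp hR integrable_one_mul_wt) n s z]
  simp only [Sum.elim_inl, Sum.elim_inr]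
  refine integral_congr_ae (.of_forall fun t => ?_)
  beta_reduce
  rw [integral_const_mul]
  rfl

end Chains

/-! ### The kernel `K` on the right contour -/

section KernelK

variable {M : ℕ} (α β : Fin (M + 1) → ℝ) (Γ : ContourSystem M)

/-- The index `k`, cut off at `M`. -/
def cutIndex (M k : ℕ) : Fin (M + 1) := ⟨min k M, by lia⟩

/-- The contour of the variable `u_{k+1}`. -/
noncomputable def uWedge (k : Fin (M + 1)) : Wedge := leftWedge (Γ.leftIn k)

/-- The factor `F(u') / (u - u')` that links the variable `u` of index `k` to the next one; it is
zero when there is no next one. -/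
noncomputable def stepU (k : ℕ) (s t : ℝ) : ℂ :=
  if h : k < M then
    (uWedge Γ ⟨k + 1, by lia⟩).density t *
      (F α β ⟨k + 1, by lia⟩ ((uWedge Γ ⟨k + 1, by lia⟩).point t) /
        ((uWedge Γ ⟨k, by lia⟩).point s - (uWedge Γ ⟨k + 1, by lia⟩).point t))
  else 0

/-- The factor `1 / (f_i(v) (u_i - v))` at the end of a chain, with `v` on `Γ_{1,R}`. -/
noncomputable def endK (i : Fin (M + 1)) (s t : ℝ) : ℂ :=
  Γ.gammaR.density t * (1 / f α β i (Γ.gammaR.point t) /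
    ((uWedge Γ i).point s - Γ.gammaR.point t))

/-- The factor `f_1(u) / (v - u)` at the start of a chain, with `v` on `Γ_{1,R}`. -/
noncomputable def startK (t s : ℝ) : ℂ :=
  Γ.gammaL.density s * (f α β 0 (Γ.gammaL.point s) / (Γ.gammaR.point t - Γ.gammaL.point s))

/-- The kernel on `Γ_{1,R}` to which the Fredholm determinants of `K` and `L` reduce. -/
noncomputable def rightKernel (t t' : ℝ) : ℂ :=
  ∑ i : Fin (M + 1), comp volume (chainFwd (stepU α β Γ) i (startK α β Γ)) (endK α β Γ i) t t'

variable {α β}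

theorem ContourSystem.leftIn_neg (i : Fin (M + 1)) : Γ.leftIn i < 0 := by
  have h := Γ.leftOut_neg 0
  rw [Γ.leftOut_zero] at h
  exact (Γ.leftIn_strictAnti.antitone (Fin.zero_le i)).trans_lt h

theorem ContourSystem.rightIn_pos (i : Fin (M + 1)) : 0 < Γ.rightIn i := by
  have h := Γ.rightOut_pos 0
  rw [Γ.rightOut_zero] at h
  exact h.trans_le (Γ.rightIn_strictMono.monotone (Fin.zero_le i))

theorem measurable_comp_point {c : Wedge} {h : ℂ → ℂ} (hh : Differentiable ℂ h) :
    Measurable fun t => h (c.point t) := (hh.continuous.comp c.continuous_point).measurable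

theorem Wedge.measurable_point (c : Wedge) : Measurable c.point := c.continuous_point.measurable

/-- A kernel `g(w') / (w - w')` for variables on two separated contours. -/
theorem kernelBound_div_right {c c' : Wedge} {g : ℂ → ℂ} (hg : Measurable fun t => g (c'.point t))
    {C : ℝ} (hC : 0 ≤ C) (hb : ∀ t, ‖g (c'.point t)‖ ≤ C * wt t) {δ : ℝ} (hδ : 0 < δ)
    (hsep : ∀ s t, δ ≤ ‖c.point s - c'.point t‖) :
    KernelBound (fun _ => 1) wt
      (fun s t => c'.density t * (g (c'.point t) / (c.point s - c'.point t))) := by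
  refine ⟨?_, fun _ => zero_le_one, wt_nonneg, C / δ, by positivity, fun s t => ?_⟩
  · exact (c'.measurable_density.comp measurable_snd).mul ((hg.comp measurable_snd).div
      ((c.measurable_point.comp measurable_fst).sub (c'.measurable_point.comp measurable_snd)))
  · rw [norm_mul, norm_div, one_mul]
    refine (mul_le_of_le_one_left (by positivity) (c'.norm_density_le t)).trans ?_
    calc _ ≤ C * wt t / δ := by
          have := wt_nonneg t
          gcongr
          exacts [hb t, hsep s t]
      _ = _ := by ring

theorem stepU_bound (hα : StrictMono α) : StepBound (stepU α β Γ) := by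
  intro k
  by_cases h : k < M
  · obtain ⟨C, hC, hb⟩ := exists_F_left_le β hα ⟨k + 1, by lia⟩ (Γ.leftIn ⟨k + 1, by lia⟩)
    have hlt : Γ.leftIn ⟨k + 1, by lia⟩ < Γ.leftIn ⟨k, by lia⟩ :=
      Γ.leftIn_strictAnti (by simp [Fin.lt_def])
    have e : stepU α β Γ k = fun s t => (uWedge Γ ⟨k + 1, by lia⟩).density t *
        (F α β ⟨k + 1, by lia⟩ ((uWedge Γ ⟨k + 1, by lia⟩).point t) /
          ((uWedge Γ ⟨k, by lia⟩).point s - (uWedge Γ ⟨k + 1, by lia⟩).point t)) := by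
      funext s t
      rw [stepU, dif_pos h]
    rw [e]
    exact kernelBound_div_right (measurable_comp_point (differentiable_F β _)) hC hb
      (δ := |Γ.leftIn ⟨k, by lia⟩ - Γ.leftIn ⟨k + 1, by lia⟩| / 2)
      (by have := abs_pos.mpr (sub_ne_zero.mpr hlt.ne'); positivity)
      (fun s t => leftWedge_dist _ _ s t)
  · have : stepU α β Γ k = fun _ _ => 0 := by
      funext s t
      rw [stepU, dif_neg h]
    rw [this]
    exact ⟨measurable_const, fun _ => zero_le_one, wt_nonneg, 0, le_rfl, by simp⟩

theorem endK_bound (i : Fin (M + 1)) : KernelBound (fun _ => 1) wt (endK α β Γ i) := by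
  obtain ⟨C, hC, hb⟩ := exists_inv_f_right_le α β i (Γ.rightIn 0)
  refine kernelBound_div_right (c := uWedge Γ i) (c' := Γ.gammaR)
    (g := fun w => 1 / f α β i w)
    (measurable_comp_point (c := Γ.gammaR) (h := fun w => 1 / f α β i w) ?_) hC hb
    (δ := Γ.rightIn 0 - Γ.leftIn i) (by linarith [Γ.rightIn_pos 0, Γ.leftIn_neg i]) fun s t => ?_
  · exact (differentiable_const _).div (differentiable_f α β i) (f_ne_zero α β i)
  · rw [norm_sub_rev]
    exact leftWedge_rightWedge_dist _ _ s t

theorem startK_bound : KernelBound (fun _ => 1) wt (startK α β Γ) := by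
  obtain ⟨C, hC, hb⟩ := exists_f_left_le α β 0 (Γ.leftIn 0)
  exact kernelBound_div_right (c := Γ.gammaR) (c' := Γ.gammaL)
    (measurable_comp_point (differentiable_f α β 0)) hC hb
    (δ := Γ.rightIn 0 - Γ.leftIn 0) (by linarith [Γ.rightIn_pos 0, Γ.leftIn_neg 0])
    fun s t => leftWedge_rightWedge_dist _ _ t s

/-- The product of the density and the integrand in `K`, up to the first and the last factor. -/
theorem chainProd_stepU (i : Fin (M + 1)) (s : ℝ) (t : Fin i.val → ℝ) :
    chainProd (stepU α β Γ) s t =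
      (∏ k : Fin i.val, (uWedge Γ ⟨k.val + 1, by lia⟩).density (t k)) *
      ((∏ k : Fin i.val, F α β ⟨k.val + 1, by lia⟩ ((uWedge Γ ⟨k.val + 1, by lia⟩).point (t k))) /
        ∏ k : Fin i.val, ((uWedge Γ ⟨k.val, by lia⟩).point
          ((Fin.cons s t : Fin (i.val + 1) → ℝ) k.castSucc) -
          (uWedge Γ ⟨k.val + 1, by lia⟩).point (t k))) := by
  rw [chainProd, ← Finset.prod_div_distrib, ← Finset.prod_mul_distrib]
  refine Finset.prod_congr rfl fun k _ => ?_
  rw [stepU, dif_pos (by lia)]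

/-- The points on the contours of `u_1, …, u_i`. -/
theorem cons_point (i : Fin (M + 1)) (s : ℝ) (t : Fin i.val → ℝ) (k : Fin (i.val + 1)) :
    (Fin.cons (Γ.gammaL.point s) (fun k : Fin i.val =>
      (uWedge Γ ⟨k.val + 1, by lia⟩).point (t k)) : Fin (i.val + 1) → ℂ) k =
      (uWedge Γ ⟨k.val, by lia⟩).point ((Fin.cons s t : Fin (i.val + 1) → ℝ) k) := by
  induction k using Fin.cases with
  | zero => rfl
  | succ k => rfl

theorem density_mul_chain (i : Fin (M + 1)) (s : ℝ) (t : Fin i.val → ℝ) (v : ℝ) :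
    (∏ k : Fin i.val, (uWedge Γ ⟨k.val + 1, by lia⟩).density (t k)) * Γ.gammaR.density v *
      chain α β i (Fin.cons (Γ.gammaL.point s) (fun k : Fin i.val =>
        (uWedge Γ ⟨k.val + 1, by lia⟩).point (t k)) : Fin (i.val + 1) → ℂ) (Γ.gammaR.point v) =
    f α β 0 (Γ.gammaL.point s) * (chainProd (stepU α β Γ) s t *
      endK α β Γ i ((Fin.cons s t : Fin (i.val + 1) → ℝ) (Fin.last i.val)) v) := by
  rw [chainProd_stepU, chain, endK]
  simp only [cons_point]
  simp only [Fin.val_castSucc, Fin.val_succ, Fin.val_last, Fin.cons_zero, Fin.cons_succ, Fin.val_zero]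
  have e1 : (uWedge Γ ⟨0, by lia⟩) = Γ.gammaL := rfl
  rw [e1]
  simp only [div_eq_mul_inv, mul_inv]
  ring

/-- The factor `1 / (v - u)` at the end of the kernel `K`. -/
noncomputable def tailK (v t : ℝ) : ℂ := 1 / (Γ.gammaR.point v - Γ.gammaL.point t)

theorem tailK_bound : KernelBound (fun _ => 1) (fun _ => 1) (tailK Γ) := by
  have hδ : 0 < Γ.rightIn 0 - Γ.leftIn 0 := by linarith [Γ.rightIn_pos 0, Γ.leftIn_neg 0]
  refine ⟨?_, fun _ => zero_le_one, fun _ => zero_le_one, 1 / (Γ.rightIn 0 - Γ.leftIn 0),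
    by positivity, fun s t => ?_⟩
  · exact measurable_const.div ((Γ.gammaR.measurable_point.comp measurable_fst).sub
      (Γ.gammaL.measurable_point.comp measurable_snd))
  · rw [tailK, norm_div, norm_one, mul_one, mul_one]
    gcongr
    exact leftWedge_rightWedge_dist _ _ t s

theorem contourIntegrand_kernelK (i : Fin (M + 1)) (s t : ℝ) :
    contourIntegrand (kernelContours Γ i)
      (kernelIntegrand α β i (Γ.gammaL.point s) (Γ.gammaL.point t)) = fun x =>
      f α β 0 (Γ.gammaL.point s) * (chainProd (stepU α β Γ) s (fun k => x (Sum.inl k)) *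
      (endK α β Γ i ((Fin.cons s (fun k => x (Sum.inl k)) : Fin (i.val + 1) → ℝ)
        (Fin.last i.val)) (x (Sum.inr ())) * tailK Γ (x (Sum.inr ())) t)) := by
  funext x
  have h := density_mul_chain (α := α) (β := β) Γ i s (fun k => x (Sum.inl k)) (x (Sum.inr ()))
  have hu : ∀ g : Unit → ℂ, ∏ u, g u = g () := fun g => by simp
  rw [contourIntegrand, kernelIntegrand, Fintype.prod_sum_type, hu, ← mul_assoc,
    ← mul_assoc, mul_assoc (f α β 0 _), ← h, tailK, mul_one_div, mul_div_assoc]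
  rfl

/-- The kernel `K` without the last factor. -/
noncomputable def headK (α β : Fin (M + 1) → ℝ) (Γ : ContourSystem M) (x : Fin (M + 1) × ℝ)
    (v : ℝ) : ℂ :=
  f α β 0 (Γ.gammaL.point x.2) * chainBack (stepU α β Γ) x.1 (endK α β Γ x.1) x.2 v

theorem contourIntegrable_kernelK (hα : StrictMono α) (i : Fin (M + 1)) (s t : ℝ) :
    ContourIntegrable (kernelContours Γ i)
      (kernelIntegrand α β i (Γ.gammaL.point s) (Γ.gammaL.point t)) := by
  rw [ContourIntegrable, contourIntegrand_kernelK]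
  exact (integrable_chain (stepU_bound Γ hα) (endK_bound Γ i) (tailK_bound Γ) i s t).const_mul _

theorem kernelKParam_eq (hα : StrictMono α) (i j : Fin (M + 1)) (s t : ℝ) :
    kernelKParam α β Γ i s j t = comp volume (headK α β Γ) (tailK Γ) (i, s) t := by
  rw [kernelKParam, kernelK, contourIntegral, contourIntegrand_kernelK, integral_const_mul,
    integral_chain (stepU_bound Γ hα) (endK_bound Γ i) (tailK_bound Γ) i s t, comp, comp,
    ← integral_const_mul]
  simp only [headK, mul_assoc]

/-- A kernel on a product with a finite set is bounded if all its slices are. -/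
theorem kernelBound_of_slices {X Y : Type} [MeasurableSpace X] [MeasurableSpace Y] {n : ℕ}
    {p : X → ℝ} {q : Y → ℝ} {T : Fin n → X → Y → ℂ} (hp : ∀ x, 0 ≤ p x) (hq : ∀ y, 0 ≤ q y)
    (h : ∀ i, KernelBound p q (T i)) :
    KernelBound (fun x : Fin n × X => p x.2) q (fun x y => T x.1 x.2 y) := by
  choose C hC hb using fun i => (h i).bound
  refine ⟨?_, fun _ => hp _, hq, ∑ i, C i, Finset.sum_nonneg fun i _ => hC i, fun x y => ?_⟩
  · have : Measurable fun z : Fin n × (X × Y) => T z.1 z.2.1 z.2.2 :=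
      measurable_from_prod_countable_right fun i => (h i).meas
    exact this.comp ((measurable_fst.comp measurable_fst).prodMk
      ((measurable_snd.comp measurable_fst).prodMk measurable_snd))
  · refine (hb x.1 x.2 y).trans (mul_le_mul_of_nonneg_right ?_ (mul_nonneg (hp _) (hq _)))
    exact Finset.single_le_sum (fun i _ => hC i) (Finset.mem_univ x.1)

theorem headK_bound (hα : StrictMono α) :
    KernelBound (fun x : Fin (M + 1) × ℝ => wt x.2) wt (headK α β Γ) := by
  refine kernelBound_of_slices (T := fun i s v => f α β 0 (Γ.gammaL.point s) *
    chainBack (stepU α β Γ) i (endK α β Γ i) s v) wt_nonneg wt_nonneg fun i => ?_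
  obtain ⟨C, hC, hb⟩ := exists_f_left_le α β 0 (Γ.leftIn 0)
  have hcb := chainBack_bound (stepU_bound Γ hα (β := β)) (endK_bound Γ i (α := α) (β := β)) i
  obtain ⟨D, hD, hb'⟩ := hcb.bound
  refine ⟨((measurable_comp_point (differentiable_f α β 0)).comp measurable_fst).mul hcb.meas,
    wt_nonneg, wt_nonneg, C * D, by positivity, fun s v => ?_⟩
  rw [norm_mul]
  have h1 := hb s
  have h2 := hb' s v
  rw [one_mul] at h2
  have := wt_nonneg s
  calc _ ≤ (C * wt s) * (D * wt v) :=
        mul_le_mul h1 h2 (norm_nonneg _) (by positivity)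
    _ = _ := by ring

/-- The last factor of `K`, weighted by the density of the contour. -/
noncomputable def tailKWeighted (v : ℝ) (x : Fin (M + 1) × ℝ) : ℂ :=
  tailK Γ v x.2 * Γ.gammaL.density x.2

theorem tailKWeighted_bound : KernelBound (fun _ => 1) (fun _ => 1) (tailKWeighted Γ) := by
  obtain ⟨C, hC, hb⟩ := (tailK_bound Γ).bound
  refine ⟨((tailK_bound Γ).measurable_apply measurable_fst (measurable_snd.comp measurable_snd)).mul
    (Γ.gammaL.measurable_density.comp (measurable_snd.comp measurable_snd)), fun _ => zero_le_one,
    fun _ => zero_le_one, C, hC, fun v x => ?_⟩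
  rw [tailKWeighted, norm_mul]
  exact (mul_le_of_le_one_right (norm_nonneg _) (Γ.gammaL.norm_density_le _)).trans (hb v x.2)

theorem weightedKernel_kernelK (hα : StrictMono α) :
    weightedKernel Γ.gammaL.density (kernelKParam α β Γ) =
      comp volume (headK α β Γ) (tailKWeighted Γ) := by
  funext x y
  rw [weightedKernel, kernelKParam_eq Γ hα, comp, comp, ← integral_mul_const]
  simp only [tailKWeighted, mul_assoc]

theorem integrable_count_prod_wt {n : ℕ} : Integrable (fun x : Fin n × ℝ => wt x.2)
    ((Measure.count : Measure (Fin n)).prod volume) :=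
  integrable_count_prod (measurable_wt.comp measurable_snd) fun _ => integrable_wt

theorem kernelK_bound (hα : StrictMono α) : KernelBound (fun x : Fin (M + 1) × ℝ => wt x.2)
    (fun _ => 1) (weightedKernel Γ.gammaL.density (kernelKParam α β Γ)) := by
  rw [weightedKernel_kernelK Γ hα]
  exact (headK_bound Γ hα).comp (tailKWeighted_bound Γ) integrable_one_mul_wt

theorem fredholmConverges_kernelK (hα : StrictMono α) :
    FredholmConverges volume Γ.gammaL.density (kernelKParam α β Γ) :=
  fredholmConverges_of_kernelBound (kernelK_bound Γ hα) fun i => by simpa using integrable_wt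

theorem fredholmDet_kernelK (hα : StrictMono α) :
    fredholmDet volume Γ.gammaL.density (kernelKParam α β Γ) =
      fredholm volume (rightKernel α β Γ) := by
  rw [fredholmDet_eq_fredholm (kernelK_bound Γ hα) (by simpa using integrable_count_prod_wt),
    weightedKernel_kernelK Γ hα, fredholm_comp_comm (headK_bound Γ hα) (tailKWeighted_bound Γ)
      (by simpa using integrable_count_prod_wt) integrable_one_mul_wt]
  congr 1
  funext v v'
  rw [comp, integral_count_prod ((tailKWeighted_bound Γ).integrable_mul (headK_bound Γ hα)
    (by simpa using integrable_count_prod_wt) v v'), rightKernel]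
  refine Finset.sum_congr rfl fun i _ => ?_
  rw [← comp_chainBack (stepU_bound Γ hα) (startK_bound Γ) (endK_bound Γ i), comp]
  refine integral_congr_ae (.of_forall fun s => ?_)
  simp only [tailKWeighted, headK, tailK, startK]
  ring

end KernelK


/-! ### Kernels on the half line -/

section HalfLine

variable {X Y Z : Type} [MeasurableSpace X] [MeasurableSpace Y] [MeasurableSpace Z]

theorem KernelBound.precomp {X' Y' : Type} [MeasurableSpace X'] [MeasurableSpace Y'] {p : X → ℝ}
    {q : Y → ℝ} {T : X → Y → ℂ} (hT : KernelBound p q T) {a : X' → X} {b : Y' → Y}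
    (ha : Measurable a) (hb : Measurable b) :
    KernelBound (fun x => p (a x)) (fun y => q (b y)) (fun x y => T (a x) (b y)) := by
  obtain ⟨C, hC, h⟩ := hT.bound
  exact ⟨hT.measurable_apply (ha.comp measurable_fst) (hb.comp measurable_snd),
    fun _ => hT.left_nonneg _, fun _ => hT.right_nonneg _, C, hC, fun _ _ => h _ _⟩

theorem KernelBound.swap {p : X → ℝ} {q : Y → ℝ} {T : X → Y → ℂ} (hT : KernelBound p q T) :
    KernelBound q p (fun y x => T x y) := by
  obtain ⟨C, hC, h⟩ := hT.bound
  exact ⟨hT.measurable_apply measurable_snd measurable_fst, hT.right_nonneg, hT.left_nonneg, C, hC,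
    fun y x => by rw [mul_comm (q y)]; exact h x y⟩

theorem KernelBound.mul_left {p : X → ℝ} {q : Y → ℝ} {T : X → Y → ℂ}
    (hT : KernelBound (fun _ => 1) q T) {h : X → ℂ} (hm : Measurable h) (hp : ∀ x, 0 ≤ p x) {C : ℝ}
    (hC : 0 ≤ C) (hb : ∀ x, ‖h x‖ ≤ C * p x) : KernelBound p q (fun x y => h x * T x y) := by
  obtain ⟨D, hD, h'⟩ := hT.bound
  refine ⟨(hm.comp measurable_fst).mul hT.meas, hp, hT.right_nonneg, C * D, by positivity,
    fun x y => ?_⟩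
  have h2 := h' x y
  rw [one_mul] at h2
  rw [norm_mul]
  calc _ ≤ (C * p x) * (D * q y) :=
        mul_le_mul (hb x) h2 (norm_nonneg _) (mul_nonneg hC (hp x))
    _ = _ := by ring

theorem KernelBound.mono {p p' : X → ℝ} {q q' : Y → ℝ} {T : X → Y → ℂ} (hT : KernelBound p q T)
    (hp : ∀ x, p x ≤ p' x) (hq : ∀ y, q y ≤ q' y) : KernelBound p' q' T := by
  obtain ⟨C, hC, h⟩ := hT.bound
  refine ⟨hT.meas, fun x => (hT.left_nonneg x).trans (hp x),
    fun y => (hT.right_nonneg y).trans (hq y), C, hC, fun x y => (h x y).trans ?_⟩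
  have := hT.left_nonneg x
  have := hT.right_nonneg y
  gcongr
  exacts [this.trans (hq y) |> fun _ => (hT.left_nonneg x).trans (hp x), hp x, hq y]

/-- The weight `e^{-δ x}` on the half line, continued by a constant to the negative numbers. -/
noncomputable def hw (δ x : ℝ) : ℝ := Real.exp (-(δ * max x 0))

theorem hw_nonneg (δ x : ℝ) : 0 ≤ hw δ x := (Real.exp_pos _).le

theorem hw_mono {δ δ' : ℝ} (h : δ ≤ δ') (x : ℝ) : hw δ' x ≤ hw δ x := by
  rw [hw, hw, Real.exp_le_exp, neg_le_neg_iff]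
  gcongr

theorem hw_mul (δ δ' x : ℝ) : hw δ x * hw δ' x = hw (δ + δ') x := by
  rw [hw, hw, hw, ← Real.exp_add]
  ring_nf

theorem measurable_hw (δ : ℝ) : Measurable (hw δ) := by
  unfold hw
  fun_prop

theorem integrable_hw {δ : ℝ} (hδ : 0 < δ) : Integrable (hw δ) halfLine := by
  refine (integrableOn_exp_mul_Ioi (neg_lt_zero.mpr hδ) 0).congr_fun (fun t ht => ?_)
    measurableSet_Ioi
  beta_reduce
  rw [hw, max_eq_left (le_of_lt ht), neg_mul]

theorem integrable_hw_mul {δ δ' : ℝ} (hδ : 0 < δ + δ') :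
    Integrable (fun x => hw δ x * hw δ' x) halfLine := by
  simp only [hw_mul]
  exact integrable_hw hδ

/-- The kernel `e^{x g(s)}`, continued to negative `x`. -/
noncomputable def expKernel (g : X → ℂ) (s : X) (x : ℝ) : ℂ :=
  Complex.exp (((max x 0 : ℝ) : ℂ) * g s)

theorem expKernel_of_nonneg {X : Type} (g : X → ℂ) (s : X) {x : ℝ} (hx : 0 ≤ x) :
    expKernel g s x = Complex.exp ((x : ℂ) * g s) := by
  rw [expKernel, max_eq_left hx]

theorem expKernel_bound {g : X → ℂ} (hg : Measurable g) {δ : ℝ} (hδ : ∀ s, (g s).re ≤ -δ) :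
    KernelBound (fun _ => 1) (hw δ) (expKernel g) := by
  refine ⟨?_, fun _ => zero_le_one, hw_nonneg δ, 1, zero_le_one, fun s x => ?_⟩
  · have : Measurable fun z : X × ℝ => Complex.exp (((max z.2 0 : ℝ) : ℂ) * g z.1) := by
      fun_prop
    exact this
  · rw [expKernel, Complex.norm_exp, Complex.re_ofReal_mul, one_mul, one_mul, hw, Real.exp_le_exp]
    have := mul_le_mul_of_nonneg_left (hδ s) (le_max_right x 0)
    linarith

theorem integral_halfLine_exp {a : ℂ} (ha : a.re < 0) :
    ∫ x : ℝ in Ioi 0, Complex.exp ((x : ℂ) * a) = -1 / a := by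
  have := integral_exp_mul_complex_Ioi ha 0
  simp only [Complex.ofReal_zero, mul_zero, Complex.exp_zero] at this
  rw [← this]
  simp only [mul_comm]

theorem comp_expKernel {X Y : Type} (g : X → ℂ) (g' : Y → ℂ) {s : X} {t : Y} (h : (g s + g' t).re < 0) :
    comp halfLine (expKernel g) (fun x t => expKernel g' t x) s t = -1 / (g s + g' t) := by
  rw [← integral_halfLine_exp h, comp]
  refine setIntegral_congr_fun measurableSet_Ioi fun x hx => ?_
  rw [expKernel_of_nonneg g s (le_of_lt hx), expKernel_of_nonneg g' t (le_of_lt hx),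
    ← Complex.exp_add]
  ring_nf

theorem fredholmIntegrand_congr_ae {ι : Type} {s : Set Y} {μ : Measure Y} [SigmaFinite μ]
    (hs : ∀ᵐ y ∂μ, y ∈ s) (ρ : Y → ℂ) {K K' : ι → Y → ι → Y → ℂ}
    (h : ∀ i, ∀ x ∈ s, ∀ j, ∀ y ∈ s, K i x j y = K' i x j y) {k : ℕ} (l : Fin k → ι) :
    fredholmIntegrand ρ K k l =ᵐ[Measure.pi fun _ => μ] fredholmIntegrand ρ K' k l := by
  have h1 : ∀ᵐ y : Fin k → Y ∂(Measure.pi fun _ => μ), ∀ i, y i ∈ s :=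
    ae_all_iff.mpr fun i => Measure.tendsto_eval_ae_ae.eventually hs
  filter_upwards [h1] with y hy
  rw [fredholmIntegrand, fredholmIntegrand]
  congr 2
  ext i j
  exact h _ _ (hy i) _ _ (hy j)

theorem fredholmDet_congr_ae {ι : Type} [Fintype ι] {s : Set Y} {μ : Measure Y} [SigmaFinite μ]
    (hs : ∀ᵐ y ∂μ, y ∈ s) (ρ : Y → ℂ) {K K' : ι → Y → ι → Y → ℂ}
    (h : ∀ i, ∀ x ∈ s, ∀ j, ∀ y ∈ s, K i x j y = K' i x j y) :
    fredholmDet μ ρ K = fredholmDet μ ρ K' := by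
  simp only [fredholmDet]
  congr 1
  ext k
  congr 1
  exact Finset.sum_congr rfl fun l _ => integral_congr_ae (fredholmIntegrand_congr_ae hs ρ h l)

theorem FredholmConverges.congr_ae {ι : Type} [Fintype ι] {s : Set Y} {μ : Measure Y}
    [SigmaFinite μ] (hs : ∀ᵐ y ∂μ, y ∈ s) {ρ : Y → ℂ} {K K' : ι → Y → ι → Y → ℂ}
    (h : ∀ i, ∀ x ∈ s, ∀ j, ∀ y ∈ s, K i x j y = K' i x j y)
    (hK : FredholmConverges μ ρ K) : FredholmConverges μ ρ K' := by
  refine ⟨fun k l => (hK.1 k l).congr (fredholmIntegrand_congr_ae hs ρ h l), ?_⟩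
  refine hK.2.congr fun k => ?_
  congr 1
  exact Finset.sum_congr rfl fun l _ => integral_congr_ae
    ((fredholmIntegrand_congr_ae hs ρ h l).fun_comp norm)

theorem ae_halfLine : ∀ᵐ x ∂halfLine, x ∈ Ioi (0 : ℝ) := ae_restrict_mem measurableSet_Ioi

end HalfLine

/-! ### The kernel `L` -/

section KernelL

variable {M : ℕ} {α β : Fin (M + 1) → ℝ} (Γ : ContourSystem M)

/-- A distance from the imaginary axis kept by the left `in` contours and by `Γ_{1,R}`. -/
noncomputable def ContourSystem.decay : ℝ := min (-Γ.leftIn 0) (Γ.rightIn 0)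

theorem ContourSystem.decay_pos : 0 < Γ.decay :=
  lt_min (neg_pos.mpr (Γ.leftIn_neg 0)) (Γ.rightIn_pos 0)

theorem uWedge_re_le (i : Fin (M + 1)) (s : ℝ) : ((uWedge Γ i).point s).re ≤ -Γ.decay := by
  have h1 := Γ.leftIn_strictAnti.antitone (Fin.zero_le i)
  have h2 : Γ.decay ≤ -Γ.leftIn 0 := min_le_left _ _
  rw [uWedge, leftWedge_re]
  have := abs_nonneg s
  linarith

theorem gammaR_re_ge (s : ℝ) : Γ.decay ≤ (Γ.gammaR.point s).re := by
  have h2 : Γ.decay ≤ Γ.rightIn 0 := min_le_right _ _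
  have h3 := rightWedge_re (Γ.rightIn 0) s
  have h4 := sin_cos_pi_div_five.2.1
  rw [ContourSystem.gammaR, h3]
  nlinarith [abs_nonneg s]

/-- The factor `f_1(u) e^{λ u}` at the start of the kernel `L`. -/
noncomputable def startL (α β : Fin (M + 1) → ℝ) (Γ : ContourSystem M) (x s : ℝ) : ℂ :=
  Γ.gammaL.density s * f α β 0 (Γ.gammaL.point s) * expKernel Γ.gammaL.point s x

/-- The factor `e^{-θ v}` at the end of the kernel `L`. -/
noncomputable def laplaceR (s x : ℝ) : ℂ := expKernel (fun s => -Γ.gammaR.point s) s x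

/-- The kernel `L` without the factor `e^{-θ v}`. -/
noncomputable def headL (α β : Fin (M + 1) → ℝ) (Γ : ContourSystem M) (x v : ℝ) : ℂ :=
  ∑ i : Fin (M + 1), comp volume (chainFwd (stepU α β Γ) i (startL α β Γ)) (endK α β Γ i) x v

theorem startL_bound : KernelBound (hw Γ.decay) wt (startL α β Γ) := by
  obtain ⟨C, hC, hb⟩ := exists_f_left_le α β 0 (Γ.leftIn 0)
  have h1 := expKernel_bound (g := Γ.gammaL.point) Γ.gammaL.measurable_point (uWedge_re_le Γ 0)
  exact (h1.mul_left (h := fun s => Γ.gammaL.density s * f α β 0 (Γ.gammaL.point s))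
    (Γ.gammaL.measurable_density.mul (measurable_comp_point (differentiable_f α β 0))) wt_nonneg hC
    fun s => by
      rw [norm_mul]
      exact (mul_le_of_le_one_left (norm_nonneg _) (Γ.gammaL.norm_density_le s)).trans (hb s)).swap

theorem laplaceR_bound : KernelBound (fun _ => 1) (hw Γ.decay) (laplaceR Γ) :=
  expKernel_bound Γ.gammaR.measurable_point.neg fun s => by
    simpa using gammaR_re_ge Γ s

theorem headL_bound (hα : StrictMono α) : KernelBound (hw Γ.decay) wt (headL α β Γ) :=
  KernelBound.sum _ (hw_nonneg _) wt_nonneg fun i _ =>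
    (chainFwd_bound (stepU_bound Γ hα) (startL_bound Γ) i).comp (endK_bound Γ i)
      integrable_one_mul_wt

/-- The steps of the chain in `L`, where the first variable is integrated as well. -/
noncomputable def stepL (α β : Fin (M + 1) → ℝ) (Γ : ContourSystem M) (x : ℝ) :
    ℕ → ℝ → ℝ → ℂ
  | 0 => fun _ t => startL α β Γ x t
  | k + 1 => stepU α β Γ k

theorem stepL_bound (hα : StrictMono α) (x : ℝ) : StepBound (stepL α β Γ x)
  | 0 => by
    obtain ⟨C, hC, hb⟩ := (startL_bound Γ (α := α) (β := β)).bound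
    refine ⟨(startL_bound Γ).measurable_apply measurable_const measurable_snd, fun _ => zero_le_one,
      wt_nonneg, C * hw Γ.decay x, mul_nonneg hC (hw_nonneg _ _), fun _ t => ?_⟩
    rw [one_mul, mul_assoc]
    exact hb x t
  | k + 1 => stepU_bound Γ hα k

theorem contourIntegrand_kernelL (i : Fin (M + 1)) {x y : ℝ} (hx : 0 ≤ x) (hy : 0 ≤ y) :
    contourIntegrand (Sum.elim
        (fun k : Fin (i.val + 1) => leftWedge
          (Γ.leftIn ⟨k.val, lt_of_le_of_lt (Nat.le_of_lt_succ k.isLt) i.isLt⟩))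
        (fun _ : Unit => Γ.gammaR))
      (fun w => chain α β i (fun k => w (Sum.inl k)) (w (Sum.inr ())) *
          (Complex.exp ((x : ℂ) * w (Sum.inl 0)) / Complex.exp ((y : ℂ) * w (Sum.inr ())))) =
    fun t => chainProd (stepL α β Γ x) 0 (fun k => t (Sum.inl k)) *
      (endK α β Γ i ((Fin.cons 0 (fun k => t (Sum.inl k)) : Fin (i.val + 1 + 1) → ℝ)
        (Fin.last (i.val + 1))) (t (Sum.inr ())) * laplaceR Γ (t (Sum.inr ())) y) := by
  funext t
  have h := density_mul_chain (α := α) (β := β) Γ i (t (Sum.inl 0)) (fun k => t (Sum.inl k.succ))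
    (t (Sum.inr ()))
  have hu : ∀ g : Unit → ℂ, ∏ u, g u = g () := fun g => by simp
  have hcons : (fun k => t (Sum.inl k)) = (Fin.cons (t (Sum.inl 0)) (fun k : Fin i.val =>
      t (Sum.inl k.succ)) : Fin (i.val + 1) → ℝ) := by
    funext k
    induction k using Fin.cases <;> rfl
  have hp : (fun k : Fin (i.val + 1) => (leftWedge (Γ.leftIn ⟨k.val,
      lt_of_le_of_lt (Nat.le_of_lt_succ k.isLt) i.isLt⟩)).point (t (Sum.inl k))) =
      (Fin.cons (Γ.gammaL.point (t (Sum.inl 0))) (fun k : Fin i.val =>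
        (uWedge Γ ⟨k.val + 1, by lia⟩).point (t (Sum.inl k.succ))) : Fin (i.val + 1) → ℂ) := by
    funext k
    induction k using Fin.cases <;> rfl
  have hlast : (Fin.cons (0 : ℝ) (fun k => t (Sum.inl k)) : Fin (i.val + 1 + 1) → ℝ)
      (Fin.last (i.val + 1)) = (Fin.cons (t (Sum.inl 0)) (fun k : Fin i.val =>
      t (Sum.inl k.succ)) : Fin (i.val + 1) → ℝ) (Fin.last i.val) := by
    rw [← Fin.succ_last, Fin.cons_succ]
    exact congrFun hcons (Fin.last i.val)
  rw [hlast, contourIntegrand, Fintype.prod_sum_type, hu, Fin.prod_univ_succ, hcons, chainProd_cons]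
  simp only [Sum.elim_inl, Sum.elim_inr]
  rw [hp]
  have e0 : stepL α β Γ x 0 0 (t (Sum.inl 0)) = Γ.gammaL.density (t (Sum.inl 0)) *
      f α β 0 (Γ.gammaL.point (t (Sum.inl 0))) *
      Complex.exp ((x : ℂ) * Γ.gammaL.point (t (Sum.inl 0))) := by
    rw [← expKernel_of_nonneg _ _ hx]
    rfl
  have e1 : laplaceR Γ (t (Sum.inr ())) y =
      (Complex.exp ((y : ℂ) * Γ.gammaR.point (t (Sum.inr ()))))⁻¹ := by
    rw [laplaceR, expKernel_of_nonneg _ _ hy, ← Complex.exp_neg, mul_neg]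
  have e2 : (fun k => stepL α β Γ x (k + 1)) = stepU α β Γ := rfl
  rw [e0, e1, e2, div_eq_mul_inv]
  have e3 : leftWedge (Γ.leftIn ⟨(0 : Fin (i.val + 1)).val,
    lt_of_le_of_lt (Nat.le_of_lt_succ (0 : Fin (i.val + 1)).isLt) i.isLt⟩) = Γ.gammaL := rfl
  rw [e3]
  have e4 : (∏ k : Fin i.val, (leftWedge (Γ.leftIn ⟨k.succ.val,
      lt_of_le_of_lt (Nat.le_of_lt_succ k.succ.isLt) i.isLt⟩)).density (t (Sum.inl k.succ))) =
      ∏ k : Fin i.val, (uWedge Γ ⟨k.val + 1, by lia⟩).density (t (Sum.inl k.succ)) := rfl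
  rw [e4]
  linear_combination Γ.gammaL.density (t (Sum.inl 0)) *
    Complex.exp ((x : ℂ) * Γ.gammaL.point (t (Sum.inl 0))) *
    (Complex.exp ((y : ℂ) * Γ.gammaR.point (t (Sum.inr ()))))⁻¹ * h

theorem kernelL_eq (hα : StrictMono α) {x y : ℝ} (hx : 0 ≤ x) (hy : 0 ≤ y) :
    kernelL α β Γ x y = comp volume (headL α β Γ) (laplaceR Γ) x y := by
  have hb : ∀ i : Fin (M + 1), KernelBound (hw Γ.decay) wt
      (comp volume (chainFwd (stepU α β Γ) i (startL α β Γ)) (endK α β Γ i)) := fun i =>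
    (chainFwd_bound (stepU_bound Γ hα) (startL_bound Γ) i).comp (endK_bound Γ i)
      integrable_one_mul_wt
  rw [kernelL, comp]
  simp only [headL, Finset.sum_mul]
  rw [integral_finsetSum _ fun i _ => (hb i).integrable_mul (laplaceR_bound Γ)
    integrable_one_mul_wt x y]
  refine Finset.sum_congr rfl fun i _ => ?_
  rw [contourIntegral, contourIntegrand_kernelL Γ i hx hy,
    integral_chain (stepL_bound Γ hα x) (endK_bound Γ i) (laplaceR_bound Γ), comp,
    ← comp_chainBack (stepU_bound Γ hα) (startL_bound Γ) (endK_bound Γ i)]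
  rfl

/-- The kernel `L`, continued to the whole line. -/
noncomputable def extL (α β : Fin (M + 1) → ℝ) (Γ : ContourSystem M) (_ : Unit) (x : ℝ) (_ : Unit)
    (y : ℝ) : ℂ := comp volume (headL α β Γ) (laplaceR Γ) x y

theorem weightedKernel_extL : weightedKernel (fun _ => 1) (extL α β Γ) =
    comp volume (fun (x : Unit × ℝ) v => headL α β Γ x.2 v)
      (fun v (y : Unit × ℝ) => laplaceR Γ v y.2) := by
  funext x y
  rw [weightedKernel, mul_one]
  rfl

theorem integrable_count_prod_hw {n : Type} [Fintype n] [MeasurableSpace n]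
    [MeasurableSingletonClass n] {δ : ℝ} (hδ : 0 < δ) : Integrable (fun x : n × ℝ => hw δ x.2)
    ((Measure.count : Measure n).prod halfLine) :=
  integrable_count_prod ((measurable_hw δ).comp measurable_snd) fun _ => integrable_hw hδ

theorem integrable_count_prod_hw_mul {n : Type} [Fintype n] [MeasurableSpace n]
    [MeasurableSingletonClass n] {δ δ' : ℝ} (hδ : 0 < δ + δ') :
    Integrable (fun x : n × ℝ => hw δ x.2 * hw δ' x.2)
      ((Measure.count : Measure n).prod halfLine) := by
  simp only [hw_mul]
  exact integrable_count_prod_hw hδ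

theorem extL_bound (hα : StrictMono α) : KernelBound (fun x : Unit × ℝ => hw Γ.decay x.2)
    (fun x : Unit × ℝ => hw Γ.decay x.2) (weightedKernel (fun _ => 1) (extL α β Γ)) := by
  rw [weightedKernel_extL]
  exact ((headL_bound Γ hα).precomp measurable_snd measurable_id).comp
    ((laplaceR_bound Γ).precomp measurable_id measurable_snd) integrable_one_mul_wt

theorem extL_eq_kernelL (hα : StrictMono α) : ∀ i : Unit, ∀ x ∈ Ioi (0 : ℝ), ∀ j : Unit,
    ∀ y ∈ Ioi (0 : ℝ), extL α β Γ i x j y =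
      (fun (_ : Unit) x (_ : Unit) y => kernelL α β Γ x y) i x j y :=
  fun _ _ hx _ _ hy => (kernelL_eq Γ hα (le_of_lt hx) (le_of_lt hy)).symm

theorem fredholmConverges_kernelL (hα : StrictMono α) :
    FredholmConverges halfLine (fun _ => 1)
      (fun (_ : Unit) x (_ : Unit) y => kernelL α β Γ x y) :=
  (fredholmConverges_of_kernelBound (extL_bound Γ hα)
    fun _ => integrable_hw_mul (by linarith [Γ.decay_pos])).congr_ae ae_halfLine
      (extL_eq_kernelL Γ hα)

theorem fredholmDet_kernelL (hα : StrictMono α) :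
    fredholmDet halfLine (fun _ => 1) (fun (_ : Unit) x (_ : Unit) y => kernelL α β Γ x y) =
      fredholm ((Measure.count : Measure Unit).prod halfLine)
        (weightedKernel (fun _ => 1) (extL α β Γ)) := by
  rw [← fredholmDet_congr_ae ae_halfLine _ (extL_eq_kernelL Γ hα),
    fredholmDet_eq_fredholm (extL_bound Γ hα)
      (integrable_count_prod_hw_mul (by linarith [Γ.decay_pos]))]

theorem comp_laplaceR_startL : comp halfLine (laplaceR Γ) (startL α β Γ) = startK α β Γ := by
  funext t s
  have h := comp_expKernel (fun s => -Γ.gammaR.point s) Γ.gammaL.point (s := t) (t := s) (by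
    have h1 := gammaR_re_ge Γ t
    have h2 : (Γ.gammaL.point s).re ≤ -Γ.decay := uWedge_re_le Γ 0 s
    have h3 := Γ.decay_pos
    rw [Complex.add_re, Complex.neg_re]
    linarith)
  rw [comp] at h
  rw [comp, startK, div_eq_mul_one_div, ← mul_assoc,
    show (1 : ℂ) / (Γ.gammaR.point t - Γ.gammaL.point s) =
      -1 / (-Γ.gammaR.point t + Γ.gammaL.point s) by
        rw [neg_add_eq_sub, ← neg_sub (Γ.gammaR.point t), neg_div_neg_eq],
    ← h, ← integral_const_mul]
  refine integral_congr_ae (.of_forall fun x => ?_)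
  simp only [laplaceR, startL]
  ring

theorem fredholmDet_kernelL_eq (hα : StrictMono α) :
    fredholmDet halfLine (fun _ => 1) (fun (_ : Unit) x (_ : Unit) y => kernelL α β Γ x y) =
      fredholm volume (rightKernel α β Γ) := by
  have hd := Γ.decay_pos
  have hi : Integrable (fun x => hw Γ.decay x * hw Γ.decay x) halfLine :=
    integrable_hw_mul (by linarith)
  have hH : KernelBound (fun x : Unit × ℝ => hw Γ.decay x.2) wt
      (fun (x : Unit × ℝ) v => headL α β Γ x.2 v) :=
    (headL_bound Γ hα).precomp measurable_snd measurable_id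
  have hR : KernelBound (fun _ => 1) (fun x : Unit × ℝ => hw Γ.decay x.2)
      (fun v (y : Unit × ℝ) => laplaceR Γ v y.2) :=
    (laplaceR_bound Γ).precomp measurable_id measurable_snd
  rw [fredholmDet_kernelL Γ hα, weightedKernel_extL, fredholm_comp_comm hH hR
    (integrable_count_prod_hw_mul (by linarith)) integrable_one_mul_wt]
  congr 1
  funext v v'
  rw [comp, integral_count_prod (hR.integrable_mul hH
    (integrable_count_prod_hw_mul (by linarith)) v v'), Fintype.sum_unique, rightKernel]
  have hb : ∀ i : Fin (M + 1), KernelBound (hw Γ.decay) wt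
      (comp volume (chainFwd (stepU α β Γ) i (startL α β Γ)) (endK α β Γ i)) := fun i =>
    (chainFwd_bound (stepU_bound Γ hα) (startL_bound Γ) i).comp (endK_bound Γ i)
      integrable_one_mul_wt
  simp only [headL, Finset.mul_sum]
  rw [integral_finsetSum _ fun i _ => (laplaceR_bound Γ).integrable_mul (hb i) hi v v']
  refine Finset.sum_congr rfl fun i _ => ?_
  rw [← comp_laplaceR_startL, chainFwd_comp (stepU_bound Γ hα) (laplaceR_bound Γ) (startL_bound Γ)
    hi i, comp_assoc (laplaceR_bound Γ) (chainFwd_bound (stepU_bound Γ hα) (startL_bound Γ) i)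
    (endK_bound Γ i) hi integrable_one_mul_wt]
  rfl

end KernelL

/-! ### The kernels `A` and `B` -/

section Residue

theorem leftLevel_eq (w : ℂ) : wedgeLevel (2 * Real.pi / 3) w = w.re + |w.im| / √3 := by
  rw [wedgeLevel, cos_two_pi_div_three, sin_two_pi_div_three]
  field_simp
  ring

theorem abs_leftLevel_sub_le (w w' : ℂ) :
    |wedgeLevel (2 * Real.pi / 3) w - wedgeLevel (2 * Real.pi / 3) w'| / 2 ≤ ‖w - w'‖ := by
  have h := abs_wedgeLevel_sub_le (2 * Real.pi / 3) w w'
  have h3 : |Real.cos (2 * Real.pi / 3) / Real.sin (2 * Real.pi / 3)| ≤ 1 := by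
    rw [cos_two_pi_div_three, sin_two_pi_div_three, abs_div, abs_neg,
      abs_of_pos (by norm_num : (0 : ℝ) < 1 / 2), abs_of_pos (by positivity),
      div_le_one (by positivity)]
    linarith [sqrt_three_bounds.1]
  nlinarith [norm_nonneg (w - w')]

theorem leftLevel_point (a t : ℝ) :
    wedgeLevel (2 * Real.pi / 3) ((leftWedge a).point t) = a :=
  wedgeLevel_point (c := leftWedge a) (by
    show 0 < Real.sin (2 * Real.pi / 3)
    rw [sin_two_pi_div_three]; positivity) t

theorem leftWedge_sin (a : ℝ) : Real.sin (leftWedge a).angle = √3 / 2 := sin_two_pi_div_three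

theorem leftWedge_cos (a : ℝ) : Real.cos (leftWedge a).angle = -(1 / 2) := cos_two_pi_div_three

/-- The line `Re w = κ`, oriented upwards. -/
noncomputable def vertLine (κ : ℝ) : Wedge := ⟨Real.pi / 2, κ⟩

theorem vertLine_sin (κ : ℝ) : Real.sin (vertLine κ).angle = 1 := Real.sin_pi_div_two

theorem vertLine_cos (κ : ℝ) : Real.cos (vertLine κ).angle = 0 := Real.cos_pi_div_two

theorem norm_div_sub_le {g : ℂ → ℂ} {w u : ℂ} {B δ : ℝ} (hδ : 0 < δ) (hg : ‖g w‖ ≤ B)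
    (h : δ ≤ |wedgeLevel (2 * Real.pi / 3) w - wedgeLevel (2 * Real.pi / 3) u|) :
    w - u ≠ 0 ∧ ‖g w / (w - u)‖ ≤ B * (2 / δ) := by
  have h1 := abs_leftLevel_sub_le w u
  have h2 : δ / 2 ≤ ‖w - u‖ := by linarith
  refine ⟨norm_pos_iff.mp (by linarith), ?_⟩
  have hB : 0 ≤ B := (norm_nonneg _).trans hg
  rw [norm_div]
  calc _ ≤ B / (δ / 2) := by gcongr
    _ = _ := by field_simp

/-- Moving an integral from a vertical line to a left contour across a pole, when the numerator
decays like a Gaussian around the imaginary axis. -/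
theorem integral_div_shift {g : ℂ → ℂ} (hgd : Differentiable ℂ g) {κ a C : ℝ} (hκ : 0 ≤ κ)
    (hC : 0 ≤ C) (hb : ∀ w : ℂ, |w.re| ≤ 0.6 * |w.im| + (|a| + κ) →
      ‖g w‖ ≤ C * Real.exp (-(2 * |w.im|))) {u : ℂ}
    (ha : a < wedgeLevel (2 * Real.pi / 3) u) (hu : wedgeLevel (2 * Real.pi / 3) u < 0) :
    wedgeIntegral (vertLine κ) (fun w => g w / (w - u)) =
      g u + wedgeIntegral (leftWedge a) (fun w => g w / (w - u)) := by
  have h3 := sqrt_three_bounds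
  have hs : 0 < Real.sin (2 * Real.pi / 3) := by rw [sin_two_pi_div_three]; positivity
  have hdiff : ∀ w, w - u ≠ 0 → DifferentiableAt ℂ (fun w => g w / (w - u)) w := fun w hw =>
    (hgd w).fun_div (by fun_prop) hw
  -- the strip between the two left contours lies in the sector where the Gaussian is small
  have hstrip : ∀ w : ℂ, wedgeLevel (2 * Real.pi / 3) w ∈ Icc a 0 →
      |w.re| ≤ 0.6 * |w.im| + (|a| + κ) := by
    rintro w ⟨h1, h2⟩
    rw [leftLevel_eq] at h1 h2
    have h4 : |w.im| / √3 ≤ 0.6 * |w.im| := by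
      rw [div_le_iff₀ (by positivity)]
      nlinarith [abs_nonneg w.im]
    have h5 : 0 ≤ |w.im| / √3 := by positivity
    have h6 := neg_abs_le a
    have h7 := abs_nonneg a
    rw [abs_le]
    constructor <;> linarith
  have hle : ∀ w, |w.re| ≤ 0.6 * |w.im| + (|a| + κ) → ‖g w‖ ≤ C := fun w hw =>
    (hb w hw).trans (mul_le_of_le_one_right hC (Real.exp_le_one_iff.mpr (by
      have := abs_nonneg w.im; linarith)))
  have hint : ∀ a' ∈ Icc a 0, a' ≠ wedgeLevel (2 * Real.pi / 3) u →
      Integrable fun t => (leftWedge a').density t *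
        (g ((leftWedge a').point t) / ((leftWedge a').point t - u)) := by
    intro a' ha' hne
    have hδ : 0 < |a' - wedgeLevel (2 * Real.pi / 3) u| := abs_pos.mpr (sub_ne_zero.mpr hne)
    have key := fun t => norm_div_sub_le (g := g) (w := (leftWedge a').point t) (u := u) hδ
      (hb _ (hstrip _ (by rwa [leftLevel_point]))) (by rw [leftLevel_point])
    refine Wedge.integrable_of_norm_le (c := leftWedge a') (h := fun w => g w / (w - u)) one_pos
      (C := C * (2 / |a' - wedgeLevel (2 * Real.pi / 3) u|))
      (Wedge.continuous_comp_point fun t => hdiff _ (key t).1).measurable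
      fun t => (key t).2.trans ?_
    rw [mul_right_comm, one_mul]
    have := exp_im_leftWedge_le a' t
    gcongr
  have hres := wedgeIntegral_sub_of_pole hs ha hu (g := g) (fun w _ => hgd w) (C := C)
    (fun w hw => hle w (hstrip w hw)) (hint a ⟨le_rfl, (ha.trans hu).le⟩ ha.ne)
    (hint 0 ⟨(ha.trans hu).le, le_rfl⟩ hu.ne')
  have hmove : wedgeIntegral (leftWedge 0) (fun w => g w / (w - u)) =
      wedgeIntegral (vertLine κ) (fun w => g w / (w - u)) := by
    have key : ∀ σ ∈ Icc (0 : ℝ) 1, ∀ t, |(sweep (leftWedge 0) (vertLine κ) σ t).re| ≤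
        0.6 * |(sweep (leftWedge 0) (vertLine κ) σ t).im| + (|a| + κ) ∧
        0 ≤ wedgeLevel (2 * Real.pi / 3) (sweep (leftWedge 0) (vertLine κ) σ t) := by
      intro σ hσ t
      rw [leftLevel_eq, sweep_re, sweep_im, leftWedge_sin, leftWedge_cos, vertLine_sin, vertLine_cos,
        abs_mul,
        abs_of_nonneg (a := (1 - σ) * (√3 / 2) + σ * 1)
          (by have := hσ.1; have := sub_nonneg.mpr hσ.2; positivity)]
      have h1 := sub_nonneg.mpr hσ.2
      have ht := abs_nonneg t
      have p1 : 0 ≤ (1 - σ) * |t| := mul_nonneg h1 ht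
      have p2 : 0 ≤ σ * |t| := mul_nonneg hσ.1 ht
      have p3 : 0 ≤ σ * κ := mul_nonneg hσ.1 hκ
      have p4 : σ * κ ≤ κ := mul_le_of_le_one_left hκ hσ.2
      have p5 : 1.7 * ((1 - σ) * |t|) ≤ √3 * ((1 - σ) * |t|) :=
        mul_le_mul_of_nonneg_right h3.1 p1
      rw [show (leftWedge 0).vertex = 0 from rfl, show (vertLine κ).vertex = κ from rfl]
      have h7 := abs_nonneg a
      constructor
      · rw [abs_le]
        constructor <;> linarith
      · have e : |t| * ((1 - σ) * (√3 / 2) + σ * 1) / √3 =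
            ((1 - σ) * |t|) / 2 + (σ * |t|) / √3 := by
          field_simp
        rw [e]
        have : 0 ≤ (σ * |t|) / √3 := by positivity
        linarith
    have hδ : 0 < -wedgeLevel (2 * Real.pi / 3) u := neg_pos.mpr hu
    have key2 := fun σ hσ t => norm_div_sub_le (g := g) hδ
      (hb _ (key σ hσ t).1) (u := u) (by rw [le_abs]; left; linarith [(key σ hσ t).2])
    refine wedgeIntegral_eq_of_im_decay (C := C * (2 / -wedgeLevel (2 * Real.pi / 3) u)) ?_ ?_
      (fun σ hσ t => hdiff _ (key2 σ hσ t).1) fun σ hσ t =>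
        (key2 σ hσ t).2.trans (le_of_eq (by ring))
    · rw [leftWedge_sin]; linarith
    · rw [vertLine_sin]; norm_num
  rw [← hmove, ← hres]
  exact (sub_add_cancel _ _).symm

theorem wedgeIntegral_vertical {g : ℂ → ℂ} (hgd : Differentiable ℂ g) {κ C : ℝ}
    (hb : ∀ w : ℂ, |w.re| ≤ 0.6 * |w.im| + |κ| → ‖g w‖ ≤ C * Real.exp (-(2 * |w.im|))) :
    wedgeIntegral (vertLine κ) g = wedgeIntegral (vertLine 0) g := by
  have hs : ∀ κ, 1 / 2 ≤ Real.sin (vertLine κ).angle := fun κ => by rw [vertLine_sin]; norm_num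
  refine wedgeIntegral_eq_of_im_decay (hs _) (hs _) (C := C) (fun σ hσ t => hgd _)
    fun σ hσ t => hb _ ?_
  rw [sweep_re, vertLine_cos, vertLine_cos, mul_zero, add_zero]
  simp only [add_zero]
  rw [show (vertLine κ).vertex = κ from rfl, show (vertLine 0).vertex = 0 from rfl, mul_zero,
    add_zero, abs_mul]
  have h1 : |1 - σ| * |κ| ≤ |κ| :=
    mul_le_of_le_one_left (abs_nonneg _) (abs_le.mpr ⟨by linarith [hσ.2], by linarith [hσ.1]⟩)
  have h2 := abs_nonneg (sweep (vertLine κ) (vertLine 0) σ t).im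
  linarith

/-- `(f_j / f_i)(w) e^{c w}`. -/
noncomputable def quotExp {M : ℕ} (α β : Fin (M + 1) → ℝ) (i j : Fin (M + 1)) (c : ℝ) (w : ℂ) : ℂ :=
  f α β j w / f α β i w * Complex.exp ((c : ℂ) * w)

theorem differentiable_quotExp {M : ℕ} (α β : Fin (M + 1) → ℝ) (i j : Fin (M + 1)) (c : ℝ) :
    Differentiable ℂ (quotExp α β i j c) :=
  ((differentiable_f α β j).div (differentiable_f α β i) (f_ne_zero α β i)).mul (by fun_prop)

theorem exists_quotExp_le {M : ℕ} {α : Fin (M + 1) → ℝ} (β : Fin (M + 1) → ℝ) (hα : StrictMono α)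
    {i j : Fin (M + 1)} (hij : i < j) (c K : ℝ) : ∃ C : ℝ, 0 ≤ C ∧ ∀ w : ℂ,
      |w.re| ≤ 0.6 * |w.im| + K → ‖quotExp α β i j c w‖ ≤ C * Real.exp (-(2 * |w.im|)) := by
  have e : ∀ w : ℂ, quotExp α β i j c w =
      Complex.exp (((α j - α i : ℝ) : ℂ) * w ^ 2 + ((β j - β i + c : ℝ) : ℂ) * w) := by
    intro w
    rw [quotExp, f_div_f, ← Complex.exp_add]
    congr 1
    push_cast
    ring
  simp only [e]
  exact exists_gauss_le (sub_pos.mpr (hα hij)) _ (by norm_num) (by norm_num)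

end Residue

section KernelAB

variable {M : ℕ} {α β : Fin (M + 1) → ℝ} (Γ : ContourSystem M)

theorem prod_F (α β : Fin (M + 1) → ℝ) {i j : Fin (M + 1)} (hij : i ≤ j) (w : ℂ) :
    ∏ l ∈ Finset.Ioc i j, F α β l w = f α β j w / f α β i w := by
  induction j using Fin.induction with
  | zero =>
    obtain rfl := Fin.le_zero_iff.mp hij
    rw [Finset.Ioc_self, Finset.prod_empty, div_self (f_ne_zero α β 0 w)]
  | succ k ih =>
    rcases hij.eq_or_lt with rfl | hlt
    · rw [Finset.Ioc_self, Finset.prod_empty, div_self (f_ne_zero α β _ w)]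
    · have hle : i ≤ k.castSucc := Fin.le_castSucc_iff.mpr hlt
      have : Finset.Ioc i k.succ = insert k.succ (Finset.Ioc i k.castSucc) := by
        ext l
        simp only [Finset.mem_Ioc, Finset.mem_insert, Fin.lt_def, Fin.le_def, Fin.ext_iff,
          Fin.val_succ, Fin.val_castSucc] at hlt hle ⊢
        omega
      rw [this, Finset.prod_insert (by simp [Fin.lt_def]), ih hle, F_succ,
        div_mul_div_cancel₀ (f_ne_zero α β _ w)]

/-- The factor `e^{γ u}` for the last variable of a chain. -/
noncomputable def laplaceU (i : Fin (M + 1)) (s x : ℝ) : ℂ := expKernel (uWedge Γ i).point s x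

/-- The factor `e^{-γ v} / f_i(v)`. -/
noncomputable def startV (α β : Fin (M + 1) → ℝ) (Γ : ContourSystem M) (i : Fin (M + 1))
    (x v : ℝ) : ℂ := Γ.gammaR.density v * (1 / f α β i (Γ.gammaR.point v)) * laplaceR Γ v x

theorem laplaceU_bound (i : Fin (M + 1)) :
    KernelBound (fun _ => 1) (hw Γ.decay) (laplaceU Γ i) :=
  expKernel_bound (uWedge Γ i).measurable_point (uWedge_re_le Γ i)

theorem startV_bound (i : Fin (M + 1)) : KernelBound (hw Γ.decay) wt (startV α β Γ i) := by
  obtain ⟨C, hC, hb⟩ := exists_inv_f_right_le α β i (Γ.rightIn 0)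
  refine ((laplaceR_bound Γ).mul_left
    (h := fun v => Γ.gammaR.density v * (1 / f α β i (Γ.gammaR.point v)))
    (Γ.gammaR.measurable_density.mul (measurable_comp_point (c := Γ.gammaR)
      (h := fun w => 1 / f α β i w)
      ((differentiable_const _).div (differentiable_f α β i) (f_ne_zero α β i)))) wt_nonneg hC
    fun s => ?_).swap
  rw [norm_mul]
  exact (mul_le_of_le_one_left (norm_nonneg _) (Γ.gammaR.norm_density_le s)).trans (hb s)

theorem integrable_hw_decay : Integrable (fun x => hw Γ.decay x * hw Γ.decay x) halfLine :=
  integrable_hw_mul (by linarith [Γ.decay_pos])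

theorem endK_eq (i : Fin (M + 1)) :
    endK α β Γ i = fun s v => -comp halfLine (laplaceU Γ i) (startV α β Γ i) s v := by
  funext s v
  have hre : ((uWedge Γ i).point s + -Γ.gammaR.point v).re < 0 := by
    have h1 := gammaR_re_ge Γ v
    have h2 := uWedge_re_le Γ i s
    have h3 := Γ.decay_pos
    rw [Complex.add_re, Complex.neg_re]
    linarith
  have h := comp_expKernel (uWedge Γ i).point (fun s => -Γ.gammaR.point s) (s := s) (t := v) hre
  rw [comp] at h
  have e : comp halfLine (laplaceU Γ i) (startV α β Γ i) s v =
      Γ.gammaR.density v * (1 / f α β i (Γ.gammaR.point v)) *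
        (-1 / ((uWedge Γ i).point s + -Γ.gammaR.point v)) := by
    rw [← h, comp, ← integral_const_mul]
    refine integral_congr_ae (.of_forall fun x => ?_)
    simp only [laplaceU, startV, laplaceR]
    ring
  rw [e, endK, sub_eq_add_neg]
  ring

/-- `∫ e^{-(λ + γ) v} / f_i(v)`. -/
noncomputable def kernelP (α β : Fin (M + 1) → ℝ) (Γ : ContourSystem M) (i : Fin (M + 1))
    (x y : ℝ) : ℂ := comp volume (startV α β Γ i) (laplaceR Γ) x y

theorem kernelP_bound (i : Fin (M + 1)) :
    KernelBound (hw Γ.decay) (hw Γ.decay) (kernelP α β Γ i) :=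
  (startV_bound Γ i).comp (laplaceR_bound Γ) integrable_one_mul_wt

/-- The factor `(f_j / f_{k+1})(u) e^{θ u}` that may end a chain of `k` steps. -/
noncomputable def endS (α β : Fin (M + 1) → ℝ) (Γ : ContourSystem M) (j : Fin (M + 1)) (k : ℕ)
    (s x : ℝ) : ℂ :=
  f α β j ((uWedge Γ (cutIndex M k)).point s) /
    f α β (cutIndex M k) ((uWedge Γ (cutIndex M k)).point s) * laplaceU Γ (cutIndex M k) s x

/-- The chain of `k` steps that starts with `f_1(u) e^{λ u}` and ends with
`(f_j / f_{k+1})(u) e^{θ u}`. -/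
noncomputable def kernelS (α β : Fin (M + 1) → ℝ) (Γ : ContourSystem M) (j : Fin (M + 1)) (k : ℕ)
    (x y : ℝ) : ℂ :=
  comp volume (chainFwd (stepU α β Γ) k (startL α β Γ)) (endS α β Γ j k) x y

theorem cutIndex_val (i : Fin (M + 1)) : cutIndex M i = i := by
  ext
  simp only [cutIndex]
  have := i.isLt
  lia

theorem endS_bound (hα : StrictMono α) {j : Fin (M + 1)} {k : ℕ} (hk : k ≤ j) :
    KernelBound (fun _ => 1) (hw Γ.decay) (endS α β Γ j k) := by
  have hm : Differentiable ℂ fun w => f α β j w / f α β (cutIndex M k) w :=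
    (differentiable_f α β _).div (differentiable_f α β _) (f_ne_zero α β _)
  have hb : ∃ C, 0 ≤ C ∧ ∀ s, ‖f α β j ((uWedge Γ (cutIndex M k)).point s) /
      f α β (cutIndex M k) ((uWedge Γ (cutIndex M k)).point s)‖ ≤ C * 1 := by
    have hle : cutIndex M k ≤ j := by
      rw [Fin.le_def]
      simp only [cutIndex]
      lia
    rcases hle.eq_or_lt with h | h
    · refine ⟨1, zero_le_one, fun s => ?_⟩
      rw [h, div_self (f_ne_zero α β j _)]
      simp
    · obtain ⟨C, hC, hb⟩ := exists_quot_left_le β hα h (Γ.leftIn (cutIndex M k))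
      exact ⟨C, hC, fun s => (hb s).trans (mul_le_mul_of_nonneg_left (wt_le_one s) hC)⟩
  obtain ⟨C, hC, hb⟩ := hb
  exact (laplaceU_bound Γ _).mul_left (measurable_comp_point hm) (fun _ => zero_le_one) hC hb

theorem kernelS_bound (hα : StrictMono α) {j : Fin (M + 1)} {k : ℕ} (hk : k ≤ j) :
    KernelBound (hw Γ.decay) (hw Γ.decay) (kernelS α β Γ j k) :=
  (chainFwd_bound (stepU_bound Γ hα) (startL_bound Γ) k).comp (endS_bound Γ hα hk)
    integrable_one_mul_wt

theorem endS_self (i : Fin (M + 1)) : endS α β Γ i i = laplaceU Γ i := by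
  funext s x
  rw [endS, cutIndex_val, div_self (f_ne_zero α β i _), one_mul]

/-- `L = -R P`, where `R` is the kernel with entries `kernelS i i`. -/
theorem comp_headL_laplaceR (hα : StrictMono α) (x y : ℝ) :
    comp volume (headL α β Γ) (laplaceR Γ) x y =
      ∑ i : Fin (M + 1), -comp halfLine (kernelS α β Γ i i) (kernelP α β Γ i) x y := by
  have hC := fun i : Fin (M + 1) =>
    chainFwd_bound (stepU_bound Γ hα (β := β)) (startL_bound Γ (α := α) (β := β)) i
  have hb : ∀ i : Fin (M + 1), KernelBound (hw Γ.decay) wt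
      (comp volume (chainFwd (stepU α β Γ) i (startL α β Γ)) (endK α β Γ i)) := fun i =>
    (hC i).comp (endK_bound Γ i) integrable_one_mul_wt
  rw [comp]
  simp only [headL, Finset.sum_mul]
  rw [integral_finsetSum _ fun i _ => (hb i).integrable_mul (laplaceR_bound Γ)
    integrable_one_mul_wt x y]
  refine Finset.sum_congr rfl fun i _ => ?_
  have h1 : comp volume (chainFwd (stepU α β Γ) i (startL α β Γ)) (endK α β Γ i) =
      fun x v => -1 * comp halfLine (kernelS α β Γ i i) (startV α β Γ i) x v := by
    have e : endK α β Γ i =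
        fun s v => -1 * comp halfLine (laplaceU Γ i) (startV α β Γ i) s v := by
      rw [endK_eq]
      simp
    rw [e, comp_const_mul_right, ← comp_assoc (hC i) (laplaceU_bound Γ i) (startV_bound Γ i)
      integrable_one_mul_wt (integrable_hw_decay Γ), ← endS_self (α := α) (β := β)]
    rfl
  have h2 := congrFun (congrFun (comp_assoc (kernelS_bound Γ hα (le_refl i.val) (β := β))
    (startV_bound Γ i (α := α) (β := β)) (laplaceR_bound Γ) (integrable_hw_decay Γ)
    integrable_one_mul_wt) x) y
  rw [show kernelP α β Γ i = comp volume (startV α β Γ i) (laplaceR Γ) from rfl, ← h2, h1, comp,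
    ← integral_neg]
  simp

/-- The weight exponents that make the kernel `B` bounded. -/
noncomputable def ContourSystem.shift (i : Fin (M + 1)) : ℝ := (i + 1) * (Γ.decay / (M + 1))

theorem ContourSystem.shift_pos (i : Fin (M + 1)) : 0 < Γ.shift i := by
  have := Γ.decay_pos
  rw [ContourSystem.shift]
  positivity

theorem ContourSystem.shift_le (i : Fin (M + 1)) : Γ.shift i ≤ Γ.decay := by
  have h1 := Γ.decay_pos
  have h2 : (i : ℝ) + 1 ≤ M + 1 := by
    have := i.isLt
    exact_mod_cast (by lia : (i : ℕ) + 1 ≤ M + 1)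
  rw [ContourSystem.shift, ← mul_div_assoc, div_le_iff₀ (by positivity), mul_comm]
  gcongr

/-- The vertical line on which the integral in `B` is taken. -/
noncomputable def shiftLine (i : Fin (M + 1)) : Wedge := vertLine (Γ.shift i)

theorem shiftLine_re (i : Fin (M + 1)) (t : ℝ) : ((shiftLine Γ i).point t).re = Γ.shift i := by
  rw [Wedge.point_re, shiftLine, vertLine_cos, mul_zero, add_zero, vertLine]

theorem shiftLine_im (i : Fin (M + 1)) (t : ℝ) : ((shiftLine Γ i).point t).im = t := by
  rw [Wedge.point_im, shiftLine, vertLine_sin, mul_one]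

/-- The factor `e^{-λ w}` in `B`. -/
noncomputable def startB (i : Fin (M + 1)) (x t : ℝ) : ℂ :=
  expKernel (fun t => -(shiftLine Γ i).point t) t x

/-- The factor `(f_j / f_i)(w) e^{θ w}` in `B`. -/
noncomputable def endB (α β : Fin (M + 1) → ℝ) (Γ : ContourSystem M) (i j : Fin (M + 1))
    (t x : ℝ) : ℂ :=
  (shiftLine Γ i).density t * (f α β j ((shiftLine Γ i).point t) /
    f α β i ((shiftLine Γ i).point t)) * expKernel (shiftLine Γ i).point t x

/-- The kernel `B`, continued to the whole line. -/
noncomputable def extB (α β : Fin (M + 1) → ℝ) (Γ : ContourSystem M) (i : Fin (M + 1)) (x : ℝ)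
    (j : Fin (M + 1)) (y : ℝ) : ℂ :=
  if i < j then comp volume (startB Γ i) (endB α β Γ i j) x y else 0

theorem startB_bound (i : Fin (M + 1)) :
    KernelBound (hw (Γ.shift i)) (fun _ => 1) (startB Γ i) :=
  (expKernel_bound (shiftLine Γ i).measurable_point.neg (δ := Γ.shift i) fun t => by
    simp [shiftLine_re]).swap

theorem endB_bound (hα : StrictMono α) {i j : Fin (M + 1)} (hij : i < j) :
    KernelBound wt (hw (-Γ.shift i)) (endB α β Γ i j) := by
  obtain ⟨C, hC, hb⟩ := exists_quot_le β hα hij (K := |Γ.shift i|) (c := 0) le_rfl one_pos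
  refine (expKernel_bound (shiftLine Γ i).measurable_point (δ := -Γ.shift i) fun t => by
    simp [shiftLine_re]).mul_left ((shiftLine Γ i).measurable_density.mul
      (measurable_comp_point (h := fun w => f α β j w / f α β i w)
      ((differentiable_f α β _).div (differentiable_f α β _) (f_ne_zero α β _)))) wt_nonneg hC
      fun t => ?_
  rw [norm_mul]
  refine (mul_le_of_le_one_left (norm_nonneg _) ((shiftLine Γ i).norm_density_le t)).trans
    ((hb _ (by rw [shiftLine_re]; simp)).trans (mul_le_mul_of_nonneg_left ?_ hC))
  rw [shiftLine_im, wt, Real.exp_le_exp]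
  linarith [abs_nonneg t]

theorem compB_bound (hα : StrictMono α) {i j : Fin (M + 1)} (hij : i < j) :
    KernelBound (hw (Γ.shift i)) (hw (-Γ.shift i))
      (comp volume (startB Γ i) (endB α β Γ i j)) :=
  (startB_bound Γ i).comp (endB_bound Γ hα hij) (by simpa using integrable_wt)

theorem extB_eq (hα : StrictMono α) (i j : Fin (M + 1)) {x y : ℝ} (hx : 0 < x) (hy : 0 < y) :
    extB α β Γ i x j y = kernelB α β i x j y := by
  rw [extB, kernelB]
  by_cases hij : i < j
  · rw [if_pos hij, if_pos ⟨hij, hx, hy⟩]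
    obtain ⟨C, hC, hb⟩ := exists_quotExp_le β hα hij (y - x) |Γ.shift i|
    have h := wedgeIntegral_vertical (differentiable_quotExp α β i j (y - x)) hb
    have h1 : comp volume (startB Γ i) (endB α β Γ i j) x y =
        wedgeIntegral (vertLine (Γ.shift i)) (quotExp α β i j (y - x)) := by
      rw [comp, wedgeIntegral]
      refine integral_congr_ae (.of_forall fun t => ?_)
      simp only [startB, endB, quotExp]
      rw [expKernel_of_nonneg _ _ hx.le, expKernel_of_nonneg _ _ hy.le]
      have : Complex.exp (((y - x : ℝ) : ℂ) * (shiftLine Γ i).point t) =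
          Complex.exp ((x : ℂ) * -(shiftLine Γ i).point t) *
            Complex.exp ((y : ℂ) * (shiftLine Γ i).point t) := by
        rw [← Complex.exp_add]
        congr 1
        push_cast
        ring
      simp only [shiftLine] at this ⊢
      rw [this]
      ring
    rw [h1, h, wedgeIntegral]
    refine integral_congr_ae (.of_forall fun t => ?_)
    beta_reduce
    have hp : (vertLine 0).point t = (t : ℂ) * Complex.I := by
      simp [Wedge.point, vertLine]
    have hd : (vertLine 0).density t =
        Complex.I / (2 * (Real.pi : ℂ) * Complex.I) := by
      simp [Wedge.density, vertLine]
    rw [hp, hd, prod_F α β hij.le, quotExp]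
    ring
  · rw [if_neg hij, if_neg fun h => hij h.1]

/-- The effect of the kernel `B` on the end of a chain: a residue at the last variable, and a
chain that is longer by one step. -/
theorem comp_laplaceU_B (hα : StrictMono α) {i j : Fin (M + 1)} (hij : i < j) :
    comp halfLine (laplaceU Γ i) (comp volume (startB Γ i) (endB α β Γ i j)) =
      fun s y => endS α β Γ j i s y -
        comp volume (stepU α β Γ i) (endS α β Γ j (i + 1)) s y := by
  rw [← comp_assoc (laplaceU_bound Γ i) (startB_bound Γ i) (endB_bound Γ hα hij)
    (integrable_hw_mul (add_pos (Γ.shift_pos i) Γ.decay_pos)) (by simpa using integrable_wt)]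
  funext s y
  set u := (uWedge Γ i).point s with hu
  have hiM : i.val < M := by have := j.isLt; have := Fin.lt_def.mp hij; lia
  have hlev : wedgeLevel (2 * Real.pi / 3) u = Γ.leftIn i := leftLevel_point _ _
  have hlt : Γ.leftIn ⟨i + 1, by lia⟩ < Γ.leftIn i := Γ.leftIn_strictAnti (by simp [Fin.lt_def])
  obtain ⟨C, hC, hb⟩ := exists_quotExp_le β hα hij (max y 0)
    (|Γ.leftIn ⟨i + 1, by lia⟩| + Γ.shift i)
  have h := integral_div_shift (differentiable_quotExp α β i j (max y 0))
    (Γ.shift_pos i).le hC hb (u := u) (by rwa [hlev]) (by rw [hlev]; exact Γ.leftIn_neg i)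
  have hc : cutIndex M (i.val + 1) = ⟨i + 1, by lia⟩ := by
    ext
    simp only [cutIndex]
    lia
  have h1 : endS α β Γ j i s y = quotExp α β i j (max y 0) u := by
    rw [endS, cutIndex_val]
    rfl
  have h2 : comp volume (stepU α β Γ i) (endS α β Γ j (i + 1)) s y =
      -wedgeIntegral (leftWedge (Γ.leftIn ⟨i + 1, by lia⟩))
        (fun w => quotExp α β i j (max y 0) w / (w - u)) := by
    rw [comp, wedgeIntegral, ← integral_neg]
    refine integral_congr_ae (.of_forall fun t => ?_)
    simp only [endS, hc, stepU, dif_pos hiM]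
    have hF := F_succ α β ⟨i, hiM⟩ ((uWedge Γ ⟨i + 1, by lia⟩).point t)
    have e1 : (⟨i, hiM⟩ : Fin M).succ = ⟨i + 1, by lia⟩ := rfl
    have e2 : (⟨i, hiM⟩ : Fin M).castSucc = i := rfl
    rw [e1, e2] at hF
    rw [hF, laplaceU, expKernel, quotExp, ← neg_sub _ u, div_neg]
    have n1 := f_ne_zero α β ⟨i + 1, by lia⟩ ((uWedge Γ ⟨i + 1, by lia⟩).point t)
    have n2 := f_ne_zero α β i ((uWedge Γ ⟨i + 1, by lia⟩).point t)
    simp only [uWedge] at n1 n2 ⊢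
    field_simp
  rw [h1, h2, sub_neg_eq_add, ← h, comp, wedgeIntegral]
  refine integral_congr_ae (.of_forall fun t => ?_)
  beta_reduce
  have hre : (u + -(shiftLine Γ i).point t).re < 0 := by
    have h2 := uWedge_re_le Γ i s
    rw [Complex.add_re, Complex.neg_re, shiftLine_re]
    linarith [Γ.decay_pos, Γ.shift_pos i]
  have hk := comp_expKernel (uWedge Γ i).point (fun t => -(shiftLine Γ i).point t) (s := s)
    (t := t) hre
  rw [show comp halfLine (laplaceU Γ i) (startB Γ i) s t = _ from hk, ← hu, endB, expKernel, quotExp,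
    show u + -(shiftLine Γ i).point t = -((shiftLine Γ i).point t - u) by ring, neg_div_neg_eq]
  simp only [shiftLine]
  ring

theorem comp_kernelS_B (hα : StrictMono α) {i j : Fin (M + 1)} (hij : i < j) (x y : ℝ) :
    comp halfLine (kernelS α β Γ i i) (comp volume (startB Γ i) (endB α β Γ i j)) x y =
      kernelS α β Γ j i x y - kernelS α β Γ j (i + 1) x y := by
  have hC := chainFwd_bound (stepU_bound Γ hα (β := β)) (startL_bound Γ (α := α) (β := β)) i
  have h1 := comp_assoc hC (laplaceU_bound Γ i) (compB_bound Γ hα hij (β := β))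
    integrable_one_mul_wt (integrable_hw_mul (add_pos (Γ.shift_pos i) Γ.decay_pos))
  have e : kernelS α β Γ i i = comp volume (chainFwd (stepU α β Γ) i (startL α β Γ))
      (laplaceU Γ i) := by
    rw [← endS_self (α := α) (β := β)]
    rfl
  have hS1 := endS_bound Γ hα (j := j) (k := i) (Fin.lt_def.mp hij).le (β := β)
  have hS2 := endS_bound Γ hα (j := j) (k := i + 1) (Fin.lt_def.mp hij) (β := β)
  have hst := (stepU_bound Γ hα (β := β) i).comp hS2 integrable_one_mul_wt
  rw [e, h1, comp_laplaceU_B Γ hα hij]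
  have h2 : kernelS α β Γ j (i + 1) = comp volume (chainFwd (stepU α β Γ) i (startL α β Γ))
      (comp volume (stepU α β Γ i) (endS α β Γ j (i + 1))) := by
    rw [← comp_assoc hC (stepU_bound Γ hα i) hS2 integrable_one_mul_wt integrable_one_mul_wt]
    rfl
  rw [h2, kernelS]
  simp only [comp, mul_sub]
  exact integral_sub (hC.integrable_mul hS1 integrable_one_mul_wt x y)
    (hC.integrable_mul hst integrable_one_mul_wt x y)

end KernelAB

/-! ### From `L` to `B - A` -/

section BA

variable {M : ℕ} {α β : Fin (M + 1) → ℝ} (Γ : ContourSystem M)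

/-- The kernel `A`, continued to the whole line. -/
noncomputable def extA (α β : Fin (M + 1) → ℝ) (Γ : ContourSystem M) (i : Fin (M + 1)) (x : ℝ)
    (j : Fin (M + 1)) (y : ℝ) : ℂ := comp halfLine (kernelP α β Γ i) (kernelS α β Γ j 0) x y

theorem kernelP_eq (i : Fin (M + 1)) {x y : ℝ} (hx : 0 ≤ x) (hy : 0 ≤ y) :
    kernelP α β Γ i x y = wedgeIntegral Γ.gammaR fun v =>
      1 / (f α β i v * Complex.exp (((x + y : ℝ) : ℂ) * v)) := by
  rw [kernelP, comp, wedgeIntegral]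
  refine integral_congr_ae (.of_forall fun t => ?_)
  simp only [startV, laplaceR]
  rw [expKernel_of_nonneg _ _ hx, expKernel_of_nonneg _ _ hy]
  have : Complex.exp (((x + y : ℝ) : ℂ) * Γ.gammaR.point t) =
      (Complex.exp ((x : ℂ) * -Γ.gammaR.point t) * Complex.exp ((y : ℂ) * -Γ.gammaR.point t))⁻¹ := by
    rw [← Complex.exp_add, ← Complex.exp_neg]
    congr 1
    push_cast
    ring
  rw [this, one_div, one_div, mul_inv, inv_inv]
  ring

theorem kernelS_zero_eq (j : Fin (M + 1)) {x y : ℝ} (hx : 0 ≤ x) (hy : 0 ≤ y) :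
    kernelS α β Γ j 0 x y = wedgeIntegral Γ.gammaL fun u =>
      f α β j u * Complex.exp (((x + y : ℝ) : ℂ) * u) := by
  have h0 : cutIndex M 0 = 0 := by
    ext
    simp [cutIndex]
  rw [kernelS, comp, wedgeIntegral]
  refine integral_congr_ae (.of_forall fun t => ?_)
  simp only [chainFwd, startL, endS, h0, laplaceU]
  rw [expKernel_of_nonneg _ _ hx, expKernel_of_nonneg _ _ hy]
  have e : uWedge Γ 0 = Γ.gammaL := rfl
  have hexp : Complex.exp (((x + y : ℝ) : ℂ) * Γ.gammaL.point t) =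
      Complex.exp ((x : ℂ) * Γ.gammaL.point t) * Complex.exp ((y : ℂ) * Γ.gammaL.point t) := by
    rw [← Complex.exp_add]
    congr 1
    push_cast
    ring
  have := f_ne_zero α β 0 (Γ.gammaL.point t)
  rw [e, hexp]
  field_simp

theorem extA_eq (i j : Fin (M + 1)) {x y : ℝ} (hx : 0 < x) (hy : 0 < y) :
    extA α β Γ i x j y = kernelA α β Γ i x j y := by
  rw [extA, comp, kernelA]
  refine setIntegral_congr_fun measurableSet_Ioi fun z hz => ?_
  have hz' : 0 ≤ z := le_of_lt hz
  rw [kernelP_eq Γ i hx.le hz', kernelS_zero_eq Γ j hz' hy.le, mul_comm, add_comm z y]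
  simp only [wedgeIntegral]
  rw [← integral_mul_const]
  refine integral_congr_ae (.of_forall fun t => ?_)
  beta_reduce
  rw [mul_assoc]
  congr 1
  rw [← integral_const_mul]
  refine integral_congr_ae (.of_forall fun s => ?_)
  beta_reduce
  ring

/-- The kernel `B - A`, continued to the whole line. -/
noncomputable def extBA (α β : Fin (M + 1) → ℝ) (Γ : ContourSystem M) (i : Fin (M + 1)) (x : ℝ)
    (j : Fin (M + 1)) (y : ℝ) : ℂ := extB α β Γ i x j y - extA α β Γ i x j y

/-- The weight of the first variable that bounds `B - A`. -/
noncomputable def ContourSystem.weightP (x : Fin (M + 1) × ℝ) : ℝ := hw (Γ.shift x.1) x.2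

/-- The weight of the second variable that bounds `B - A`. -/
noncomputable def ContourSystem.weightQ (x : Fin (M + 1) × ℝ) : ℝ :=
  hw (Γ.decay / (M + 1) - Γ.shift x.1) x.2

theorem ContourSystem.integrable_weight (i : Fin (M + 1)) :
    Integrable (fun y => Γ.weightP (i, y) * Γ.weightQ (i, y)) halfLine :=
  have h : 0 < Γ.shift i + (Γ.decay / (M + 1) - Γ.shift i) := by
    rw [add_sub_cancel]
    have := Γ.decay_pos
    positivity
  integrable_hw_mul h

theorem measurable_fin_prod {n : ℕ} {E : Type} [MeasurableSpace E] {g : Fin n × ℝ → E}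
    (h : ∀ i, Measurable fun y => g (i, y)) : Measurable g :=
  measurable_from_prod_countable_right h

theorem ContourSystem.integrable_weight_prod :
    Integrable (fun x => Γ.weightP x * Γ.weightQ x)
      ((Measure.count : Measure (Fin (M + 1))).prod halfLine) :=
  integrable_count_prod ((measurable_fin_prod fun i => measurable_hw (Γ.shift i)).mul
    (measurable_fin_prod fun i => measurable_hw (Γ.decay / (M + 1) - Γ.shift i)))
    Γ.integrable_weight

/-- A kernel on a product with a finite index set whose blocks satisfy weighted bounds. -/
theorem kernelBound_of_blocks {I J : Type} [Fintype I] [Fintype J] [MeasurableSpace I]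
    [MeasurableSpace J] [MeasurableSingletonClass I] [MeasurableSingletonClass J]
    {p : I × ℝ → ℝ} {q : J × ℝ → ℝ} {T : I → J → ℝ → ℝ → ℂ} (hp : ∀ x, 0 ≤ p x) (hq : ∀ y, 0 ≤ q y)
    (h : ∀ i j, KernelBound (fun x => p (i, x)) (fun y => q (j, y)) (T i j)) :
    KernelBound p q (fun x y => T x.1 y.1 x.2 y.2) := by
  choose C hC hb using fun i j => (h i j).bound
  refine ⟨?_, hp, hq, ∑ i, ∑ j, C i j,
    Finset.sum_nonneg fun i _ => Finset.sum_nonneg fun j _ => hC i j, fun x y => ?_⟩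
  · have h1 : Measurable fun z : (I × J) × (ℝ × ℝ) => T z.1.1 z.1.2 z.2.1 z.2.2 :=
      measurable_from_prod_countable_right fun ij => (h ij.1 ij.2).meas
    exact h1.comp (((measurable_fst.comp measurable_fst).prodMk
      (measurable_fst.comp measurable_snd)).prodMk ((measurable_snd.comp measurable_fst).prodMk
      (measurable_snd.comp measurable_snd)))
  · refine (hb x.1 y.1 x.2 y.2).trans (mul_le_mul_of_nonneg_right ?_ (mul_nonneg (hp _) (hq _)))
    exact (Finset.single_le_sum (f := fun j => C x.1 j) (fun j _ => hC x.1 j)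
      (Finset.mem_univ y.1)).trans (Finset.single_le_sum (f := fun i => ∑ j, C i j)
      (fun i _ => Finset.sum_nonneg fun j _ => hC i j) (Finset.mem_univ x.1))

theorem kernelBound_zero {X Y : Type} [MeasurableSpace X] [MeasurableSpace Y] {p : X → ℝ}
    {q : Y → ℝ} (hp : ∀ x, 0 ≤ p x) (hq : ∀ y, 0 ≤ q y) : KernelBound p q fun _ _ => 0 :=
  ⟨measurable_const, hp, hq, 0, le_rfl, by simp⟩

theorem ContourSystem.hw_decay_le_weightP (i : Fin (M + 1)) (x : ℝ) :
    hw Γ.decay x ≤ Γ.weightP (i, x) := hw_mono (Γ.shift_le i) x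

theorem ContourSystem.hw_decay_le_weightQ (i : Fin (M + 1)) (x : ℝ) :
    hw Γ.decay x ≤ Γ.weightQ (i, x) := by
  refine hw_mono ?_ x
  have h1 := Γ.shift_pos i
  have h2 : Γ.decay / (M + 1) ≤ Γ.decay :=
    div_le_self Γ.decay_pos.le (by have : (0 : ℝ) ≤ M := by positivity
                                   linarith)
  linarith

theorem extB_bound (hα : StrictMono α) :
    KernelBound Γ.weightP Γ.weightQ (weightedKernel (fun _ => 1) (extB α β Γ)) := by
  have e : weightedKernel (fun _ => 1) (extB α β Γ) = fun x y => extB α β Γ x.1 x.2 y.1 y.2 := by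
    funext x y
    rw [weightedKernel, mul_one]
  rw [e]
  refine kernelBound_of_blocks (T := fun i j x y => extB α β Γ i x j y) (fun _ => hw_nonneg _ _)
    (fun _ => hw_nonneg _ _) fun i j => ?_
  by_cases hij : i < j
  · simp only [extB, if_pos hij]
    refine (compB_bound Γ hα hij).mono (fun _ => le_rfl) fun y => hw_mono ?_ y
    have h1 : (i : ℝ) + 1 ≤ j := by exact_mod_cast Fin.lt_def.mp hij
    have h2 : 0 < Γ.decay / (M + 1) := by
      have := Γ.decay_pos
      positivity
    simp only [ContourSystem.shift]
    nlinarith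
  · simp only [extB, if_neg hij]
    exact kernelBound_zero (fun _ => hw_nonneg _ _) (fun _ => hw_nonneg _ _)

theorem extA_bound (hα : StrictMono α) :
    KernelBound Γ.weightP Γ.weightQ (weightedKernel (fun _ => 1) (extA α β Γ)) := by
  have e : weightedKernel (fun _ => 1) (extA α β Γ) = fun x y => extA α β Γ x.1 x.2 y.1 y.2 := by
    funext x y
    rw [weightedKernel, mul_one]
  rw [e]
  refine kernelBound_of_blocks (T := fun i j x y => extA α β Γ i x j y) (fun _ => hw_nonneg _ _)
    (fun _ => hw_nonneg _ _) fun i j => ?_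
  exact ((kernelP_bound Γ i).comp (kernelS_bound Γ hα (Nat.zero_le _)) (integrable_hw_decay Γ)).mono
    (Γ.hw_decay_le_weightP i) (Γ.hw_decay_le_weightQ j)

theorem weightedKernel_extBA : weightedKernel (fun _ => 1) (extBA α β Γ) = fun x y =>
    weightedKernel (fun _ => 1) (extB α β Γ) x y - weightedKernel (fun _ => 1) (extA α β Γ) x y := by
  funext x y
  simp only [weightedKernel, extBA, mul_one]

theorem extBA_bound (hα : StrictMono α) :
    KernelBound Γ.weightP Γ.weightQ (weightedKernel (fun _ => 1) (extBA α β Γ)) := by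
  rw [weightedKernel_extBA]
  exact (extB_bound Γ hα).sub (extA_bound Γ hα)

theorem extBA_eq (hα : StrictMono α) : ∀ i, ∀ x ∈ Ioi (0 : ℝ), ∀ j, ∀ y ∈ Ioi (0 : ℝ),
    extBA α β Γ i x j y = (fun i x j y => kernelB α β i x j y - kernelA α β Γ i x j y) i x j y :=
  fun i _ hx j _ hy => by rw [extBA, extB_eq Γ hα i j hx hy, extA_eq Γ i j hx hy]

theorem fredholmConverges_kernelBA (hα : StrictMono α) : FredholmConverges halfLine (fun _ => 1)
    (fun i x j y => kernelB α β i x j y - kernelA α β Γ i x j y) :=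
  (fredholmConverges_of_kernelBound (extBA_bound Γ hα) Γ.integrable_weight).congr_ae ae_halfLine
    (extBA_eq Γ hα)

theorem fredholmDet_kernelBA (hα : StrictMono α) :
    fredholmDet halfLine (fun _ => 1) (fun i x j y => kernelB α β i x j y - kernelA α β Γ i x j y) =
      fredholm ((Measure.count : Measure (Fin (M + 1))).prod halfLine)
        (weightedKernel (fun _ => 1) (extBA α β Γ)) := by
  rw [← fredholmDet_congr_ae ae_halfLine _ (extBA_eq Γ hα),
    fredholmDet_eq_fredholm (extBA_bound Γ hα) Γ.integrable_weight_prod]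

/-- The kernel `R` with `R (I + B) = Q`. -/
noncomputable def kernelR (α β : Fin (M + 1) → ℝ) (Γ : ContourSystem M) (x : ℝ)
    (y : Fin (M + 1) × ℝ) : ℂ := kernelS α β Γ y.1 y.1 x y.2

theorem kernelR_bound (hα : StrictMono α) :
    KernelBound (hw Γ.decay) Γ.weightQ (kernelR α β Γ) := by
  have h := kernelBound_of_slices (p := hw Γ.decay) (T := fun (i : Fin (M + 1)) (y x : ℝ) =>
    kernelS α β Γ i i x y) (hw_nonneg _) (hw_nonneg _) fun i => (kernelS_bound Γ hα le_rfl).swap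
  refine (h.swap).mono (fun _ => le_rfl) fun y => Γ.hw_decay_le_weightQ y.1 y.2

theorem kernelP_prod_bound : KernelBound Γ.weightP (hw Γ.decay)
    (fun (x : Fin (M + 1) × ℝ) y => kernelP α β Γ x.1 x.2 y) := by
  have h := kernelBound_of_slices (p := hw Γ.decay) (T := fun (i : Fin (M + 1)) (x y : ℝ) =>
    kernelP α β Γ i x y) (hw_nonneg _) (hw_nonneg _) fun i => kernelP_bound Γ i
  exact h.mono (fun x => Γ.hw_decay_le_weightP x.1 x.2) fun _ => le_rfl

/-- `R B = Q - R`, by telescoping. -/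
theorem comp_kernelR_B (hα : StrictMono α) (x : ℝ) (y : Fin (M + 1) × ℝ) :
    comp ((Measure.count : Measure (Fin (M + 1))).prod halfLine) (kernelR α β Γ)
      (weightedKernel (fun _ => 1) (extB α β Γ)) x y =
      kernelS α β Γ y.1 0 x y.2 - kernelR α β Γ x y := by
  rw [comp, integral_count_prod ((kernelR_bound Γ hα).integrable_mul (extB_bound Γ hα)
    Γ.integrable_weight_prod x y)]
  have key : ∀ i : Fin (M + 1), ∫ z, kernelR α β Γ x (i, z) *
      weightedKernel (fun _ => 1) (extB α β Γ) (i, z) y ∂halfLine =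
      (fun k : ℕ => if k < y.1 then kernelS α β Γ y.1 k x y.2 - kernelS α β Γ y.1 (k + 1) x y.2
        else 0) i := by
    intro i
    simp only [weightedKernel, mul_one, extB, ← Fin.lt_def]
    by_cases hij : i < y.1
    · simp only [if_pos hij]
      exact comp_kernelS_B Γ hα hij x y.2
    · simp [if_neg hij]
  rw [Finset.sum_congr rfl fun i _ => key i, Fin.sum_univ_eq_sum_range (fun k : ℕ =>
    if k < y.1 then kernelS α β Γ y.1 k x y.2 - kernelS α β Γ y.1 (k + 1) x y.2 else 0) (M + 1),
    ← Finset.sum_filter]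
  have hf : (Finset.range (M + 1)).filter (fun k => k < y.1.val) = Finset.range y.1.val := by
    ext k
    have := y.1.isLt
    simp only [Finset.mem_filter, Finset.mem_range]
    lia
  rw [hf, Finset.sum_range_sub' (fun k => kernelS α β Γ y.1 k x y.2), kernelR]

theorem weightedKernel_extL_eq (hα : StrictMono α) : weightedKernel (fun _ => 1) (extL α β Γ) =
    comp ((Measure.count : Measure (Fin (M + 1))).prod halfLine)
      (fun (x : Unit × ℝ) y => -kernelR α β Γ x.2 y)
      (fun y (z : Unit × ℝ) => kernelP α β Γ y.1 y.2 z.2) := by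
  funext x z
  have hi := ((kernelR_bound Γ hα (β := β)).neg).integrable_mul (kernelP_prod_bound Γ (α := α)
    (β := β)) Γ.integrable_weight_prod x.2 z.2
  rw [weightedKernel, mul_one, extL, comp_headL_laplaceR Γ hα, comp, integral_count_prod hi]
  refine Finset.sum_congr rfl fun i _ => ?_
  rw [comp, ← integral_neg]
  simp only [kernelR, neg_mul]

/-- `det (I - R P) = det (I - P R)` and `I + B - A = (I - P R)(I + B)`. -/
theorem fredholmDet_kernelL_eq_kernelBA (hα : StrictMono α) :
    fredholmDet halfLine (fun _ => 1) (fun (_ : Unit) x (_ : Unit) y => kernelL α β Γ x y) =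
      fredholmDet halfLine (fun _ => 1)
        (fun i x j y => kernelB α β i x j y - kernelA α β Γ i x j y) := by
  have hhd := integrable_hw_decay Γ
  have hR : KernelBound (fun x : Unit × ℝ => hw Γ.decay x.2) Γ.weightQ
      (fun (x : Unit × ℝ) y => -kernelR α β Γ x.2 y) :=
    ((kernelR_bound Γ hα).precomp measurable_snd measurable_id).neg
  have hP : KernelBound Γ.weightP (fun x : Unit × ℝ => hw Γ.decay x.2)
      (fun y (z : Unit × ℝ) => kernelP α β Γ y.1 y.2 z.2) :=
    (kernelP_prod_bound Γ).precomp measurable_id measurable_snd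
  have hPQ := Γ.integrable_weight_prod
  have hu : Integrable (fun x : Unit × ℝ => hw Γ.decay x.2 * hw Γ.decay x.2)
      ((Measure.count : Measure Unit).prod halfLine) :=
    integrable_count_prod_hw_mul (by linarith [Γ.decay_pos])
  rw [fredholmDet_kernelL Γ hα, weightedKernel_extL_eq Γ hα, fredholm_comp_comm hR hP hu hPQ,
    fredholmDet_kernelBA Γ hα]
  set P : Fin (M + 1) × ℝ → ℝ → ℂ := fun x y => kernelP α β Γ x.1 x.2 y with hPdef
  have hP' : KernelBound Γ.weightP (hw Γ.decay) P := kernelP_prod_bound Γ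
  have hR' := kernelR_bound Γ hα (β := β)
  have hPR := hP'.comp hR' hhd
  have h1 : comp ((Measure.count : Measure Unit).prod halfLine)
      (fun y (z : Unit × ℝ) => kernelP α β Γ y.1 y.2 z.2)
      (fun (x : Unit × ℝ) y => -kernelR α β Γ x.2 y) =
      fun x y => -comp halfLine P (kernelR α β Γ) x y := by
    funext x y
    rw [comp, integral_count_prod (hP.integrable_mul hR hu x y), Fintype.sum_unique, comp,
      ← integral_neg]
    simp only [P, mul_neg]
  rw [h1, ← fredholm_add_comp_of_level hPR.neg (extB_bound Γ hα) hPQ (lev := fun x => x.1.val)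
    (m := M) (fun x => by have := x.1.isLt; lia) fun x y h => ?_]
  · congr 1
    funext x y
    have hneg : comp ((Measure.count : Measure (Fin (M + 1))).prod halfLine)
        (fun x y => -comp halfLine P (kernelR α β Γ) x y)
        (weightedKernel (fun _ => 1) (extB α β Γ)) x y =
        -comp halfLine P (comp ((Measure.count : Measure (Fin (M + 1))).prod halfLine)
          (kernelR α β Γ) (weightedKernel (fun _ => 1) (extB α β Γ))) x y := by
      rw [← comp_assoc hP' hR' (extB_bound Γ hα) hhd hPQ]
      simp only [comp, neg_mul, integral_neg]
    have hA : weightedKernel (fun _ => 1) (extA α β Γ) x y =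
        comp halfLine P (comp ((Measure.count : Measure (Fin (M + 1))).prod halfLine)
          (kernelR α β Γ) (weightedKernel (fun _ => 1) (extB α β Γ))) x y +
          comp halfLine P (kernelR α β Γ) x y := by
      have e : (fun z y => kernelS α β Γ y.1 0 z y.2) = fun z (y : Fin (M + 1) × ℝ) =>
          comp ((Measure.count : Measure (Fin (M + 1))).prod halfLine)
          (kernelR α β Γ) (weightedKernel (fun _ => 1) (extB α β Γ)) z y + kernelR α β Γ z y := by
        funext z y
        rw [comp_kernelR_B Γ hα, sub_add_cancel]
      have h2 := congrFun (congrFun (comp_add_right hP' (hR'.comp (extB_bound (β := β) Γ hα) hPQ) hR' hhd) x) y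
      rw [← h2, ← e, weightedKernel, mul_one, extA]
      rfl
    rw [hneg, weightedKernel_extBA]
    beta_reduce
    rw [hA]
    ring
  · by_contra hcon
    exact h (by rw [weightedKernel, extB, if_neg (fun h => hcon (Fin.lt_def.mp h)), zero_mul])

end BA

/-! ### The Airy function -/

section Airy

/-- The contour of the Airy function may be replaced by a vertical line in the left half plane. -/
theorem wedgeIntegral_airyExp {c : Wedge} (h1 : 1 / 2 ≤ Real.sin c.angle)
    (h2 : Real.cos c.angle ≤ -(1 / 2)) (h3 : -(1.63 * Real.sin c.angle) ≤ Real.cos c.angle) (x : ℝ)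
    {κ : ℝ} (hκ : κ < 0) :
    wedgeIntegral c (airyExp x) = wedgeIntegral (vertLine κ) (airyExp x) := by
  obtain ⟨C, -, hb⟩ := exists_airyExp_le x (ρ := -κ) (K := |c.vertex| + |κ|) (c := 1.63)
    (Y := 2 * (|c.vertex| + |κ|)) (neg_pos.mpr hκ) (by positivity) (by norm_num) (by norm_num)
  refine wedgeIntegral_eq_of_im_decay (C := C) h1 (by rw [vertLine_sin]; norm_num)
    (fun σ _ t => differentiable_airyExp x _) fun σ hσ t => hb _ ?_ ?_
  all_goals
    rw [sweep_re, sweep_im, vertLine_sin, vertLine_cos, abs_mul,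
      abs_of_nonneg (a := (1 - σ) * Real.sin c.angle + σ * 1)
        (by have := hσ.1; have := sub_nonneg.mpr hσ.2; positivity)]
    rw [show (vertLine κ).vertex = κ from rfl]
    have hσ0 := hσ.1
    have hσ1 := sub_nonneg.mpr hσ.2
    have ht := abs_nonneg t
    have ha := abs_le.mp (le_refl |c.vertex|)
    have hk : |κ| = -κ := abs_of_neg hκ
    have hsin := Real.sin_le_one c.angle
    have e1 : (1 - σ) * c.vertex ≤ |c.vertex| := by nlinarith [abs_nonneg c.vertex]
    have e2 : -|c.vertex| ≤ (1 - σ) * c.vertex := by nlinarith [abs_nonneg c.vertex]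
    have e3 : 0 ≤ (1 - σ) * |t| := mul_nonneg hσ1 ht
    have e4 : 0 ≤ σ * |t| := mul_nonneg hσ0 ht
  · rw [abs_le]
    constructor
    · nlinarith
    · nlinarith
  · by_cases hT : 2 * (|c.vertex| + |κ|) ≤ |t|
    · left
      have e5 : (1 - σ) * (2 * (|c.vertex| + |κ|)) ≤ (1 - σ) * |t| :=
        mul_le_mul_of_nonneg_left hT hσ1
      have e6 : (1 - σ) * |t| * Real.cos c.angle ≤ (1 - σ) * |t| * -(1 / 2) :=
        mul_le_mul_of_nonneg_left h2 e3
      have e7 : (1 - σ) * c.vertex ≤ (1 - σ) * |c.vertex| :=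
        mul_le_mul_of_nonneg_left ha.2 hσ1
      nlinarith
    · right
      have : |t| * ((1 - σ) * Real.sin c.angle + σ * 1) ≤ |t| * 1 :=
        mul_le_mul_of_nonneg_left (by nlinarith) ht
      linarith

theorem airyAi_eq (x : ℝ) {κ : ℝ} (hκ : κ < 0) :
    airyAi x = wedgeIntegral (vertLine κ) (airyExp x) := by
  have h3 := sqrt_three_bounds
  refine wedgeIntegral_airyExp (c := leftWedge (-1)) ?_ ?_ ?_ x hκ <;>
  simp only [leftWedge_sin, leftWedge_cos] <;> linarith

theorem airyAi_eq_of_angle {c : Wedge} (h1 : 1 / 2 ≤ Real.sin c.angle)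
    (h2 : Real.cos c.angle ≤ -(1 / 2)) (h3 : -(1.63 * Real.sin c.angle) ≤ Real.cos c.angle)
    (x : ℝ) : wedgeIntegral c (airyExp x) = airyAi x := by
  rw [airyAi_eq x neg_one_lt_zero, wedgeIntegral_airyExp h1 h2 h3 x neg_one_lt_zero]

/-- The contour integral of `g(w - a)` over a wedge. -/
theorem wedgeIntegral_comp_sub (φ v a : ℝ) (g : ℂ → ℂ) :
    wedgeIntegral ⟨φ, v⟩ (fun w => g (w - a)) = wedgeIntegral ⟨φ, v - a⟩ g := by
  refine integral_congr_ae (.of_forall fun t => ?_)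
  simp only [Wedge.density, Wedge.point]
  congr 2
  push_cast
  ring

/-- The contour integral of `g(a - w)` over a wedge: the reflection reverses the orientation. -/
theorem wedgeIntegral_comp_const_sub (φ v a : ℝ) (g : ℂ → ℂ) :
    wedgeIntegral ⟨φ, v⟩ (fun w => g (a - w)) = wedgeIntegral ⟨Real.pi - φ, a - v⟩ g := by
  rw [wedgeIntegral, ← integral_neg_eq_self]
  refine integral_congr_ae (.of_forall fun t => ?_)
  simp only [Wedge.density, Wedge.point, Real.cos_pi_sub, Real.sin_pi_sub, abs_neg, Real.sign_neg]
  congr 2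
  · push_cast
    ring
  · push_cast
    ring

variable {M : ℕ} {α β : Fin (M + 1) → ℝ}

theorem wedgeIntegral_f (j : Fin (M + 1)) (a s : ℝ) :
    wedgeIntegral (leftWedge a) (fun u => f α β j u * Complex.exp ((s : ℂ) * u)) =
      (Real.exp (conjExponent α β j s) : ℂ) * airyAi (s + β j + α j ^ 2) := by
  have h3 := sqrt_three_bounds
  have h := wedgeIntegral_comp_sub (2 * Real.pi / 3) a (α j) (airyExp (s + β j + α j ^ 2))
  rw [← airyAi_eq_of_angle (c := leftWedge (a - α j)) (by rw [leftWedge_sin]; linarith)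
    (by rw [leftWedge_cos]) (by rw [leftWedge_sin, leftWedge_cos]; linarith),
    show leftWedge (a - α j) = ⟨2 * Real.pi / 3, a - α j⟩ from rfl, ← h]
  simp only [f_mul_exp, wedgeIntegral, ← integral_const_mul]
  refine integral_congr_ae (.of_forall fun t => ?_)
  simp only [leftWedge]
  ring

theorem wedgeIntegral_inv_f (i : Fin (M + 1)) (b s : ℝ) :
    wedgeIntegral (rightWedge b) (fun v => 1 / (f α β i v * Complex.exp ((s : ℂ) * v))) =
      (Real.exp (-conjExponent α β i s) : ℂ) * airyAi (s + β i + α i ^ 2) := by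
  have h3 := sin_cos_pi_div_five
  have h := wedgeIntegral_comp_const_sub (Real.pi / 5) b (α i) (airyExp (s + β i + α i ^ 2))
  rw [← airyAi_eq_of_angle (c := ⟨Real.pi - Real.pi / 5, α i - b⟩)
    (by simp only [Real.sin_pi_sub]; linarith)
    (by simp only [Real.cos_pi_sub]; linarith)
    (by simp only [Real.sin_pi_sub, Real.cos_pi_sub]; linarith), ← h]
  simp only [inv_f_mul_exp, wedgeIntegral, ← integral_const_mul]
  refine integral_congr_ae (.of_forall fun t => ?_)
  beta_reduce
  rw [rightWedge]
  ring

theorem conjAiryProduct_eq (i j : Fin (M + 1)) (x y γ : ℝ) :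
    conjAiryProduct α β i x j y γ =
      ((Real.exp (-conjExponent α β i (x + γ)) : ℂ) * airyAi (x + γ + β i + α i ^ 2)) *
      ((Real.exp (conjExponent α β j (y + γ)) : ℂ) * airyAi (y + γ + β j + α j ^ 2)) := by
  have e : Real.exp (-conjExponent α β i x + conjExponent α β j y) *
      Real.exp (-γ * (α i - α j)) = Real.exp (-conjExponent α β i (x + γ)) *
        Real.exp (conjExponent α β j (y + γ)) := by
    rw [← Real.exp_add, ← Real.exp_add, conjExponent, conjExponent, conjExponent, conjExponent]
    congr 1
    ring
  have e' := congrArg (fun r : ℝ => (r : ℂ)) e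
  simp only [Complex.ofReal_mul] at e'
  rw [conjAiryProduct, airyProduct, show x + β i + α i ^ 2 + γ = x + γ + β i + α i ^ 2 by ring,
    show y + β j + α j ^ 2 + γ = y + γ + β j + α j ^ 2 by ring, ← mul_assoc, ← mul_assoc, e']
  ring

theorem conjAiryProduct_eq_kernels (Γ : ContourSystem M) (i j : Fin (M + 1)) {x y γ : ℝ}
    (hx : 0 ≤ x) (hy : 0 ≤ y) (hγ : 0 ≤ γ) :
    conjAiryProduct α β i x j y γ = kernelP α β Γ i x γ * kernelS α β Γ j 0 γ y := by
  rw [conjAiryProduct_eq, kernelP_eq Γ i hx hγ, kernelS_zero_eq Γ j hγ hy, add_comm γ y,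
    ContourSystem.gammaL, ContourSystem.gammaR, wedgeIntegral_f, wedgeIntegral_inv_f]

theorem integrableOn_conjAiryProduct (hα : StrictMono α) (Γ : ContourSystem M) (i j : Fin (M + 1))
    {x y : ℝ} (hx : 0 < x) (hy : 0 < y) :
    IntegrableOn (conjAiryProduct α β i x j y) (Ioi 0) := by
  have h := (kernelP_bound (α := α) (β := β) Γ i).integrable_mul
    (kernelS_bound (β := β) Γ hα (Nat.zero_le j.val)) (integrable_hw_decay Γ) x y
  exact IntegrableOn.congr_fun h (fun γ hγ => (conjAiryProduct_eq_kernels Γ i j hx.le hy.le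
    (le_of_lt hγ)).symm) measurableSet_Ioi

theorem kernelA_eq (Γ : ContourSystem M) (i j : Fin (M + 1)) {x y : ℝ} (hx : 0 < x) (hy : 0 < y) :
    kernelA α β Γ i x j y = ∫ γ in Ioi (0 : ℝ), conjAiryProduct α β i x j y γ := by
  rw [← extA_eq Γ i j hx hy, extA, comp]
  exact setIntegral_congr_fun measurableSet_Ioi fun γ hγ =>
    (conjAiryProduct_eq_kernels Γ i j hx.le hy.le (le_of_lt hγ)).symm

theorem exists_f_vertical_le (α β : Fin (M + 1) → ℝ) (j : Fin (M + 1)) {c : ℝ} (hc : c < α j) :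
    ∃ C : ℝ, 0 ≤ C ∧ ∀ w : ℂ, w.re = c → ‖f α β j w‖ ≤ C * Real.exp (-(2 * |w.im|)) := by
  obtain ⟨C, hC, hb⟩ := exists_airyExp_le (0 + β j + α j ^ 2) (ρ := α j - c) (K := α j - c) (c := 0)
    (Y := 0) (sub_pos.mpr hc) (sub_pos.mpr hc).le le_rfl (by norm_num)
  refine ⟨Real.exp (conjExponent α β j 0) * C, by positivity, fun w hw => ?_⟩
  have e := f_mul_exp α β j 0 w
  rw [Complex.ofReal_zero, zero_mul, Complex.exp_zero, mul_one] at e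
  rw [e, norm_mul, Complex.norm_real, Real.norm_of_nonneg (Real.exp_pos _).le, mul_assoc]
  have hre : (w - (α j : ℂ)).re = -(α j - c) := by rw [Complex.sub_re, hw, Complex.ofReal_re]; ring
  have him : (w - (α j : ℂ)).im = w.im := by simp
  have h := hb (w - α j) (by
    rw [hre, abs_neg, abs_of_pos (sub_pos.mpr hc), zero_mul, zero_add]) (Or.inl hre.le)
  rw [him] at h
  exact mul_le_mul_of_nonneg_left h (Real.exp_pos _).le

theorem exists_inv_f_vertical_le (α β : Fin (M + 1) → ℝ) (i : Fin (M + 1)) {c : ℝ} (hc : α i < c) :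
    ∃ C : ℝ, 0 ≤ C ∧ ∀ w : ℂ, w.re = c → ‖1 / f α β i w‖ ≤ C * Real.exp (-(2 * |w.im|)) := by
  obtain ⟨C, hC, hb⟩ := exists_airyExp_le (0 + β i + α i ^ 2) (ρ := c - α i) (K := c - α i) (c := 0)
    (Y := 0) (sub_pos.mpr hc) (sub_pos.mpr hc).le le_rfl (by norm_num)
  refine ⟨Real.exp (-conjExponent α β i 0) * C, by positivity, fun w hw => ?_⟩
  have e := inv_f_mul_exp α β i 0 w
  rw [Complex.ofReal_zero, zero_mul, Complex.exp_zero, mul_one] at e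
  rw [e, norm_mul, Complex.norm_real, Real.norm_of_nonneg (Real.exp_pos _).le, mul_assoc]
  have hre : ((α i : ℂ) - w).re = -(c - α i) := by rw [Complex.sub_re, hw, Complex.ofReal_re]; ring
  have him : ((α i : ℂ) - w).im = -w.im := by simp
  have h := hb (α i - w) (by
    rw [hre, abs_neg, abs_of_pos (sub_pos.mpr hc), zero_mul, zero_add]) (Or.inl hre.le)
  rw [him, abs_neg] at h
  exact mul_le_mul_of_nonneg_left h (Real.exp_pos _).le

theorem vertLine_re (κ t : ℝ) : ((vertLine κ).point t).re = κ := by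
  rw [Wedge.point_re, vertLine_cos, mul_zero, add_zero, vertLine]

theorem vertLine_im (κ t : ℝ) : ((vertLine κ).point t).im = t := by
  rw [Wedge.point_im, vertLine_sin, mul_one]

theorem vertLine_point (κ t : ℝ) : (vertLine κ).point t = κ + t * Complex.I := by
  apply Complex.ext
  · rw [vertLine_re]; simp
  · rw [vertLine_im]; simp

theorem vertLine_density (κ t : ℝ) : (vertLine κ).density t = 1 / (2 * Real.pi) := by
  have := Complex.I_ne_zero
  have : (Real.pi : ℂ) ≠ 0 := by exact_mod_cast Real.pi_ne_zero
  rw [Wedge.density, vertLine_sin, vertLine_cos]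
  simp only [mul_zero, Complex.ofReal_zero, zero_add, Complex.ofReal_one, one_mul]
  field_simp

/-- A Laplace transform along a vertical line. -/
theorem norm_wedgeIntegral_vertLine_le {g : ℂ → ℂ} {c C : ℝ}
    (hb : ∀ w : ℂ, w.re = c → ‖g w‖ ≤ C * Real.exp (-(2 * |w.im|))) (s : ℝ) :
    ‖wedgeIntegral (vertLine c) fun w => g w * Complex.exp ((s : ℂ) * w)‖ ≤
      C * (∫ t : ℝ, Real.exp (-(2 * |t|))) * Real.exp (s * c) := by
  have h : ∀ t : ℝ, ‖(vertLine c).density t * (g ((vertLine c).point t) *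
      Complex.exp ((s : ℂ) * (vertLine c).point t))‖ ≤
      C * Real.exp (s * c) * Real.exp (-(2 * |t|)) := by
    intro t
    have h1 := hb _ (vertLine_re c t)
    rw [vertLine_im] at h1
    rw [norm_mul, norm_mul, Complex.norm_exp, Complex.re_ofReal_mul, vertLine_re]
    calc _ ≤ 1 * (C * Real.exp (-(2 * |t|)) * Real.exp (s * c)) :=
          mul_le_mul ((vertLine c).norm_density_le t)
            (mul_le_mul_of_nonneg_right h1 (Real.exp_pos _).le) (by positivity) zero_le_one
      _ = _ := by ring
  refine (norm_integral_le_of_norm_le ((integrable_exp_neg_mul_abs two_pos).const_mul _)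
    (.of_forall h)).trans_eq ?_
  rw [integral_const_mul]
  ring

/-- The first factor of the product in the Airy representation, as an integral over a vertical line
to the left of `α_j`. -/
theorem airy_eq_vertLine_f (j : Fin (M + 1)) {c : ℝ} (hc : c < α j) (s : ℝ) :
    (Real.exp (conjExponent α β j s) : ℂ) * airyAi (s + β j + α j ^ 2) =
      wedgeIntegral (vertLine c) (fun u => f α β j u * Complex.exp ((s : ℂ) * u)) := by
  rw [airyAi_eq _ (sub_neg.mpr hc),
    show vertLine (c - α j) = ⟨Real.pi / 2, c - α j⟩ from rfl, ← wedgeIntegral_comp_sub]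
  simp only [f_mul_exp, wedgeIntegral, ← integral_const_mul]
  refine integral_congr_ae (.of_forall fun t => ?_)
  simp only [vertLine]
  ring

theorem airy_eq_vertLine_inv_f (i : Fin (M + 1)) {c : ℝ} (hc : α i < c) (s : ℝ) :
    (Real.exp (-conjExponent α β i s) : ℂ) * airyAi (s + β i + α i ^ 2) =
      wedgeIntegral (vertLine c) (fun v => 1 / f α β i v * Complex.exp (((-s : ℝ) : ℂ) * v)) := by
  rw [airyAi_eq _ (sub_neg.mpr hc), show vertLine (α i - c) = ⟨Real.pi - Real.pi / 2, α i - c⟩ by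
    rw [vertLine]; congr 1; ring, ← wedgeIntegral_comp_const_sub]
  simp only [wedgeIntegral, ← integral_const_mul]
  refine integral_congr_ae (.of_forall fun t => ?_)
  have h := inv_f_mul_exp α β i s ((vertLine c).point t)
  have e : 1 / f α β i ((vertLine c).point t) * Complex.exp (((-s : ℝ) : ℂ) * (vertLine c).point t) =
      1 / (f α β i ((vertLine c).point t) * Complex.exp ((s : ℂ) * (vertLine c).point t)) := by
    rw [Complex.ofReal_neg, neg_mul, Complex.exp_neg, one_div, one_div, mul_inv]
  beta_reduce
  rw [e, h]
  simp only [vertLine]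
  ring

theorem continuous_airyAi : Continuous airyAi := by
  have h := fun x => airyAi_eq x (κ := -1) neg_one_lt_zero
  rw [funext h]
  refine continuous_iff_continuousAt.mpr fun x₀ => ?_
  obtain ⟨C, hC, hb⟩ := exists_airyExp_le 0 (ρ := 1) (K := 1) (c := 0) (Y := 0)
    one_pos zero_le_one le_rfl (by norm_num)
  have hb' : ∀ x t, ‖(vertLine (-1)).density t * airyExp x ((vertLine (-1)).point t)‖ ≤
      Real.exp (-x) * (C * Real.exp (-(2 * |t|))) := by
    intro x t
    have e : airyExp x ((vertLine (-1)).point t) =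
        Complex.exp ((x : ℂ) * (vertLine (-1)).point t) * airyExp 0 ((vertLine (-1)).point t) := by
      rw [airyExp, airyExp, ← Complex.exp_add]
      congr 1
      push_cast
      ring
    have h1 := hb ((vertLine (-1)).point t) (by rw [vertLine_re]; norm_num)
      (Or.inl (vertLine_re _ _).le)
    rw [vertLine_im] at h1
    rw [e, norm_mul, norm_mul, Complex.norm_exp, Complex.re_ofReal_mul, vertLine_re, mul_neg_one]
    exact (mul_le_of_le_one_left (by positivity) ((vertLine (-1)).norm_density_le t)).trans
      (mul_le_mul_of_nonneg_left h1 (Real.exp_pos _).le)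
  refine continuousAt_of_dominated (bound := fun t => Real.exp (-(x₀ - 1)) *
    (C * Real.exp (-(2 * |t|)))) (.of_forall fun x => ?_) ?_
    (((integrable_exp_neg_mul_abs two_pos).const_mul C).const_mul _)
    (.of_forall fun t => ?_)
  · exact (((vertLine (-1)).measurable_density).mul ((Wedge.continuous_comp_point fun t =>
      differentiable_airyExp x _).measurable)).aestronglyMeasurable
  · filter_upwards [lt_mem_nhds (show x₀ - 1 < x₀ by linarith)] with x hx
    refine Filter.Eventually.of_forall fun t => (hb' x t).trans ?_
    exact mul_le_mul_of_nonneg_right (Real.exp_le_exp.mpr (by linarith)) (by positivity)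
  · unfold airyExp
    fun_prop

theorem continuous_airyProduct (s x t y : ℝ) : Continuous (airyProduct s x t y) := by
  have := continuous_airyAi
  unfold airyProduct
  fun_prop

theorem continuous_conjAiryProduct (i j : Fin (M + 1)) (x y : ℝ) :
    Continuous (conjAiryProduct α β i x j y) := by
  have := continuous_airyProduct (α i) (x + β i + α i ^ 2) (α j) (y + β j + α j ^ 2)
  unfold conjAiryProduct
  fun_prop

/-- Plancherel's identity in bilinear form. -/
theorem integral_fourier_mul_fourierInv {f g : ℝ → ℂ} (hf : Integrable f) (hg : Integrable g)
    (hgc : Continuous g) (hG : Integrable (FourierTransformInv.fourierInv g)) :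
    ∫ w, FourierTransform.fourier f w * FourierTransformInv.fourierInv g w = ∫ x, f x * g x := by
  have h := VectorFourier.integral_fourierIntegral_smul_eq_flip (L := innerₗ ℝ)
    Real.continuous_fourierChar continuous_inner hf hG
  have hG' : Integrable (FourierTransform.fourier g) := by
    have := hG.comp_neg
    simpa only [Real.fourierInv_eq_fourier_neg, neg_neg] using this
  have e := hgc.fourier_fourierInv_eq hg hG'
  simp only [flip_innerₗ] at h
  refine Eq.trans h ?_
  conv_rhs => rw [← e]
  rfl


end Airy


/-! ### The extended Airy kernel -/

section AiryKernel

variable {M : ℕ} {α β : Fin (M + 1) → ℝ}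

theorem integrable_of_two_sided_decay {h : ℝ → ℂ} (hc : Continuous h) {δ C₁ C₂ : ℝ} (hδ : 0 < δ)
    (h1 : ∀ t, ‖h t‖ ≤ C₁ * Real.exp (t * δ)) (h2 : ∀ t, ‖h t‖ ≤ C₂ * Real.exp (t * -δ)) :
    Integrable h := by
  refine ((integrable_exp_neg_mul_abs hδ).const_mul (max C₁ C₂)).mono' hc.aestronglyMeasurable
    (.of_forall fun t => ?_)
  rcases le_total 0 t with ht | ht
  · refine (h2 t).trans ?_
    rw [abs_of_nonneg ht, mul_neg, mul_comm t]
    exact mul_le_mul_of_nonneg_right (le_max_right _ _) (Real.exp_pos _).le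
  · refine (h1 t).trans ?_
    rw [abs_of_nonpos ht, mul_neg, neg_neg, mul_comm t]
    exact mul_le_mul_of_nonneg_right (le_max_left _ _) (Real.exp_pos _).le

theorem exists_airy_le (α β : Fin (M + 1) → ℝ) (j : Fin (M + 1)) {c : ℝ} (hc : c < α j) :
    ∃ C : ℝ, 0 ≤ C ∧ ∀ s : ℝ, ‖(Real.exp (conjExponent α β j s) : ℂ) *
      airyAi (s + β j + α j ^ 2)‖ ≤ C * Real.exp (s * c) := by
  obtain ⟨C, hC, hb⟩ := exists_f_vertical_le α β j hc
  refine ⟨C * ∫ t : ℝ, Real.exp (-(2 * |t|)), by positivity, fun s => ?_⟩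
  rw [airy_eq_vertLine_f j hc s]
  exact norm_wedgeIntegral_vertLine_le hb s

theorem exists_airy_le_neg (α β : Fin (M + 1) → ℝ) (i : Fin (M + 1)) {c : ℝ} (hc : α i < c) :
    ∃ C : ℝ, 0 ≤ C ∧ ∀ s : ℝ, ‖(Real.exp (-conjExponent α β i s) : ℂ) *
      airyAi (s + β i + α i ^ 2)‖ ≤ C * Real.exp (-s * c) := by
  obtain ⟨C, hC, hb⟩ := exists_inv_f_vertical_le α β i hc
  refine ⟨C * ∫ t : ℝ, Real.exp (-(2 * |t|)), by positivity, fun s => ?_⟩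
  rw [airy_eq_vertLine_inv_f i hc s]
  exact norm_wedgeIntegral_vertLine_le hb (-s)

theorem exists_conjAiryProduct_le (i j : Fin (M + 1)) (x y : ℝ) {c d : ℝ} (hc : α i < c)
    (hd : d < α j) : ∃ C : ℝ, ∀ γ : ℝ, ‖conjAiryProduct α β i x j y γ‖ ≤
      C * Real.exp (γ * (d - c)) := by
  obtain ⟨C₁, hC₁, h1⟩ := exists_airy_le_neg α β i hc
  obtain ⟨C₂, hC₂, h2⟩ := exists_airy_le α β j hd
  refine ⟨C₁ * C₂ * Real.exp (y * d - x * c), fun γ => ?_⟩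
  rw [conjAiryProduct_eq, norm_mul]
  refine (mul_le_mul (h1 _) (h2 _) (norm_nonneg _) (by positivity)).trans_eq ?_
  rw [mul_mul_mul_comm, mul_assoc (C₁ * C₂), ← Real.exp_add, ← Real.exp_add]
  congr 2
  ring

theorem integrable_conjAiryProduct (hα : StrictMono α) {i j : Fin (M + 1)} (hij : i < j) (x y : ℝ) :
    Integrable (conjAiryProduct α β i x j y) := by
  have hd : 0 < (α j - α i) / 3 := by linarith [hα hij]
  obtain ⟨C₁, h1⟩ := exists_conjAiryProduct_le (α := α) (β := β) i j x y
    (c := α i + (α j - α i) / 3) (d := α i + 2 * ((α j - α i) / 3)) (by linarith) (by linarith)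
  obtain ⟨C₂, h2⟩ := exists_conjAiryProduct_le (α := α) (β := β) i j x y
    (c := α i + 2 * ((α j - α i) / 3)) (d := α i + (α j - α i) / 3) (by linarith) (by linarith)
  refine integrable_of_two_sided_decay (continuous_conjAiryProduct i j x y) hd (C₁ := C₁) (C₂ := C₂)
    (fun t => (h1 t).trans_eq ?_) fun t => (h2 t).trans_eq ?_
  · congr 3
    ring
  · congr 3
    ring

theorem kernelB_eq_quotExp {i j : Fin (M + 1)} (hij : i < j) {x y : ℝ} (hx : 0 < x) (hy : 0 < y) :
    kernelB α β i x j y = wedgeIntegral (vertLine 0) (quotExp α β i j (y - x)) := by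
  rw [kernelB, if_pos ⟨hij, hx, hy⟩, wedgeIntegral]
  refine integral_congr_ae (.of_forall fun t => ?_)
  have hp : (vertLine 0).point t = (t : ℂ) * Complex.I := by
    simp [vertLine_point]
  have hd : (vertLine 0).density t = Complex.I / (2 * (Real.pi : ℂ) * Complex.I) := by
    simp [Wedge.density, vertLine]
  beta_reduce
  rw [hp, hd, prod_F α β hij.le, quotExp]
  ring

theorem integrable_vertLine {g : ℂ → ℂ} (hg : Differentiable ℂ g) {c C : ℝ}
    (hb : ∀ w : ℂ, w.re = c → ‖g w‖ ≤ C * Real.exp (-(2 * |w.im|))) (s : ℝ) :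
    Continuous (fun t : ℝ => g (c + t * Complex.I) * Complex.exp ((s : ℂ) * (c + t * Complex.I))) ∧
    Integrable fun t : ℝ => g (c + t * Complex.I) * Complex.exp ((s : ℂ) * (c + t * Complex.I)) := by
  have hcont : Continuous fun t : ℝ =>
      g (c + t * Complex.I) * Complex.exp ((s : ℂ) * (c + t * Complex.I)) :=
    (hg.continuous.comp (by fun_prop)).mul (by fun_prop)
  refine ⟨hcont, ((integrable_exp_neg_mul_abs two_pos).const_mul (C * Real.exp (s * c))).mono'
    hcont.aestronglyMeasurable (.of_forall fun t => ?_)⟩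
  have h1 := hb (c + t * Complex.I) (by simp)
  rw [norm_mul, Complex.norm_exp, Complex.re_ofReal_mul]
  simp only [Complex.add_re, Complex.ofReal_re, Complex.mul_re, Complex.I_re, mul_zero,
    Complex.ofReal_im, Complex.I_im, mul_one, sub_self, add_zero, Complex.add_im, Complex.mul_im,
    zero_add] at h1 ⊢
  rw [mul_right_comm]
  exact mul_le_mul_of_nonneg_right h1 (Real.exp_pos _).le

/-- Plancherel's identity on a vertical line `Re w = c` with `α_i < c < α_j`. -/
theorem kernelB_eq (hα : StrictMono α) {i j : Fin (M + 1)} (hij : i < j) {x y : ℝ} (hx : 0 < x)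
    (hy : 0 < y) : kernelB α β i x j y = ∫ γ : ℝ, conjAiryProduct α β i x j y γ := by
  have hαij := hα hij
  set c := (α i + α j) / 2 with hc
  have hci : α i < c := by linarith
  have hcj : c < α j := by linarith
  obtain ⟨C₁, -, hb₁⟩ := exists_inv_f_vertical_le α β i hci
  obtain ⟨C₂, -, hb₂⟩ := exists_f_vertical_le α β j hcj
  obtain ⟨hψc, hψ⟩ := integrable_vertLine (g := fun w => 1 / f α β i w)
    ((differentiable_const 1).div (differentiable_f α β i) (f_ne_zero α β i)) hb₁ (-x)
  obtain ⟨hφc, hφ⟩ := integrable_vertLine (differentiable_f α β j) hb₂ y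
  set ψ := fun t : ℝ => 1 / f α β i (c + t * Complex.I) *
    Complex.exp (((-x : ℝ) : ℂ) * (c + t * Complex.I)) with hψdef
  set φ := fun t : ℝ => f α β j (c + t * Complex.I) *
    Complex.exp ((y : ℂ) * (c + t * Complex.I)) with hφdef
  have hpi : (Real.pi : ℂ) ≠ 0 := by exact_mod_cast Real.pi_ne_zero
  have eψ : ∀ w : ℝ, FourierTransform.fourier ψ w = 2 * Real.pi *
      Complex.exp (((2 * Real.pi * w * c : ℝ) : ℂ)) *
      ((Real.exp (-conjExponent α β i (x + 2 * Real.pi * w)) : ℂ) *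
        airyAi (x + 2 * Real.pi * w + β i + α i ^ 2)) := by
    intro w
    rw [airy_eq_vertLine_inv_f i hci, wedgeIntegral, Real.fourier_real_eq_integral_exp_smul,
      ← integral_const_mul]
    refine integral_congr_ae (.of_forall fun t => ?_)
    beta_reduce
    rw [vertLine_density, vertLine_point, hψdef, smul_eq_mul]
    have e : Complex.exp (((2 * Real.pi * w * c : ℝ) : ℂ)) *
        Complex.exp (((-(x + 2 * Real.pi * w) : ℝ) : ℂ) * (c + t * Complex.I)) =
        Complex.exp (((-2 * Real.pi * t * w : ℝ) : ℂ) * Complex.I) *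
        Complex.exp (((-x : ℝ) : ℂ) * (c + t * Complex.I)) := by
      rw [← Complex.exp_add, ← Complex.exp_add]
      congr 1
      push_cast
      ring
    linear_combination (exp := 1) (-(1 / f α β i (c + t * Complex.I))) * e +
      (-(1 / f α β i (c + t * Complex.I))) * Complex.exp (((2 * Real.pi * w * c : ℝ) : ℂ)) *
        Complex.exp (((-(x + 2 * Real.pi * w) : ℝ) : ℂ) * (c + t * Complex.I)) *
        (mul_inv_cancel₀ hpi)
  have eφ : ∀ w : ℝ, FourierTransformInv.fourierInv φ w = 2 * Real.pi *
      Complex.exp (((-(2 * Real.pi * w * c) : ℝ) : ℂ)) *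
      ((Real.exp (conjExponent α β j (y + 2 * Real.pi * w)) : ℂ) *
        airyAi (y + 2 * Real.pi * w + β j + α j ^ 2)) := by
    intro w
    rw [airy_eq_vertLine_f j hcj, wedgeIntegral, Real.fourierInv_eq_fourier_neg,
      Real.fourier_real_eq_integral_exp_smul, ← integral_const_mul]
    refine integral_congr_ae (.of_forall fun t => ?_)
    beta_reduce
    rw [vertLine_density, vertLine_point, hφdef, smul_eq_mul]
    have e : Complex.exp (((-(2 * Real.pi * w * c) : ℝ) : ℂ)) *
        Complex.exp (((y + 2 * Real.pi * w : ℝ) : ℂ) * (c + t * Complex.I)) =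
        Complex.exp (((-2 * Real.pi * t * -w : ℝ) : ℂ) * Complex.I) *
        Complex.exp ((y : ℂ) * (c + t * Complex.I)) := by
      rw [← Complex.exp_add, ← Complex.exp_add]
      congr 1
      push_cast
      ring
    linear_combination (exp := 1) (-(f α β j (c + t * Complex.I))) * e +
      (-(f α β j (c + t * Complex.I))) * Complex.exp (((-(2 * Real.pi * w * c) : ℝ) : ℂ)) *
        Complex.exp (((y + 2 * Real.pi * w : ℝ) : ℂ) * (c + t * Complex.I)) *
        (mul_inv_cancel₀ hpi)
  have hG : Integrable (FourierTransformInv.fourierInv φ) := by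
    have hd : 0 < (α j - α i) / 3 := by linarith
    have hcont : Continuous (FourierTransformInv.fourierInv φ) := by
      have := continuous_airyAi
      rw [funext eφ]
      unfold conjExponent
      fun_prop
    have key : ∀ d : ℝ, d < α j → ∃ C, ∀ w : ℝ,
        ‖FourierTransformInv.fourierInv φ w‖ ≤ C * Real.exp (w * (2 * Real.pi * (d - c))) := by
      intro d hdj
      obtain ⟨C, hC, hb⟩ := exists_airy_le α β j hdj
      refine ⟨2 * Real.pi * C * Real.exp (y * d), fun w => ?_⟩
      rw [eφ, norm_mul, norm_mul, Complex.norm_exp, Complex.ofReal_re]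
      have e : ‖(2 * Real.pi : ℂ)‖ = 2 * Real.pi := by
        rw [norm_mul, Complex.norm_real, Real.norm_of_nonneg Real.pi_pos.le, Complex.norm_ofNat]
      rw [e]
      refine (mul_le_mul_of_nonneg_left (hb _) (by positivity)).trans_eq ?_
      rw [mul_mul_mul_comm, mul_assoc (2 * Real.pi * C), ← Real.exp_add, ← Real.exp_add]
      congr 2
      ring
    obtain ⟨C₁, h1⟩ := key (c + (α j - α i) / 3) (by linarith)
    obtain ⟨C₂, h2⟩ := key (c - (α j - α i) / 3) (by linarith)
    refine integrable_of_two_sided_decay hcont (δ := 2 * Real.pi * ((α j - α i) / 3))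
      (mul_pos Real.two_pi_pos hd) (C₁ := C₁) (C₂ := C₂) (fun t => (h1 t).trans_eq ?_)
      fun t => (h2 t).trans_eq ?_
    · congr 3
      ring
    · congr 3
      ring
  have hP := integral_fourier_mul_fourierInv hψ hφ hφc hG
  have e1 : ∫ w : ℝ, conjAiryProduct α β i x j y (2 * Real.pi * w) =
      (1 / (4 * (Real.pi : ℂ) ^ 2)) * ∫ t, ψ t * φ t := by
    rw [← hP, ← integral_const_mul]
    refine integral_congr_ae (.of_forall fun w => ?_)
    beta_reduce
    rw [eψ, eφ, conjAiryProduct_eq, Complex.ofReal_neg (2 * Real.pi * w * c), Complex.exp_neg]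
    have := Complex.exp_ne_zero (((2 * Real.pi * w * c : ℝ) : ℂ))
    field_simp
    ring
  have e2 : (∫ γ : ℝ, conjAiryProduct α β i x j y γ) =
      2 * Real.pi * ∫ w : ℝ, conjAiryProduct α β i x j y (2 * Real.pi * w) := by
    rw [Measure.integral_comp_mul_left, abs_of_pos (by positivity), Complex.real_smul]
    push_cast
    field_simp
  obtain ⟨C, hC, hb⟩ := exists_quotExp_le β hα hij (y - x) |c|
  rw [kernelB_eq_quotExp hij hx hy, ← wedgeIntegral_vertical (differentiable_quotExp α β i j (y - x)) hb,
    e2, e1, wedgeIntegral, ← integral_const_mul, ← integral_const_mul]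
  refine integral_congr_ae (.of_forall fun t => ?_)
  beta_reduce
  rw [vertLine_density, vertLine_point, hψdef, hφdef, quotExp]
  beta_reduce
  have e : Complex.exp (((y - x : ℝ) : ℂ) * (c + t * Complex.I)) =
      Complex.exp (((-x : ℝ) : ℂ) * (c + t * Complex.I)) *
        Complex.exp ((y : ℂ) * (c + t * Complex.I)) := by
    rw [← Complex.exp_add]
    congr 1
    push_cast
    ring
  rw [e]
  have := f_ne_zero α β i (c + t * Complex.I)
  field_simp
  ring

/-- The kernel `B - A` is conjugate to the extended Airy kernel. -/
theorem kernelB_sub_kernelA (hα : StrictMono α) (Γ : ContourSystem M) (i j : Fin (M + 1)) {x y : ℝ}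
    (hx : 0 < x) (hy : 0 < y) : kernelB α β i x j y - kernelA α β Γ i x j y =
      -(((Real.exp (-conjExponent α β i x + conjExponent α β j y) : ℝ) : ℂ) *
        extAiry (α i) (x + β i + α i ^ 2) (α j) (y + β j + α j ^ 2)) := by
  rw [kernelA_eq Γ i j hx hy, extAiry]
  by_cases hij : i < j
  · rw [kernelB_eq hα hij hx hy, if_neg (not_le.mpr (hα hij))]
    have h := integrable_conjAiryProduct (β := β) hα hij x y
    rw [← integral_add_compl (measurableSet_Ioi (a := (0 : ℝ))) h, add_sub_cancel_left, compl_Ioi,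
      integral_Iic_eq_integral_Iio, mul_neg, neg_neg, ← integral_const_mul]
    rfl
  · rw [kernelB, if_neg fun h => hij h.1, if_pos (hα.monotone (not_lt.mp hij)), zero_sub,
      ← integral_const_mul]
    rfl

/-- The shift that takes the support of the cut-off `χ(α_i, ·)` to the positive half line. -/
noncomputable def cutShift (α β : Fin (M + 1) → ℝ) (i : Fin (M + 1)) : ℝ := β i + α i ^ 2

/-- After a shift of the variables, the Fredholm integrand of the cut-off extended Airy kernel
agrees with that of `B - A`: the conjugation drops out of the determinant. -/
theorem fredholmIntegrand_cutAiry (hα : StrictMono α) (Γ : ContourSystem M) (k : ℕ)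
    (l : Fin k → Fin (M + 1)) (x : Fin k → ℝ) :
    fredholmIntegrand (fun _ => 1) (fun i x j y => -cutAiry α β i x j y) k l
        (x + fun a => cutShift α β (l a)) =
      (Set.univ.pi fun _ => Ioi (0 : ℝ)).indicator (fredholmIntegrand (fun _ => 1)
        (fun i x j y => kernelB α β i x j y - kernelA α β Γ i x j y) k l) x := by
  simp only [fredholmIntegrand, Finset.prod_const_one, one_mul]
  have hchi : ∀ a, chi α β (l a) (x a + cutShift α β (l a)) = if 0 < x a then 1 else 0 := by
    intro a
    simp [chi, indicator_apply, cutShift]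
  by_cases hx : x ∈ Set.univ.pi fun _ : Fin k => Ioi (0 : ℝ)
  · rw [indicator_of_mem hx]
    have hx' : ∀ a, 0 < x a := fun a => hx a (mem_univ a)
    set g : Fin k → ℂ := fun a => (Real.exp (conjExponent α β (l a) (x a)) : ℂ) with hg
    have hg0 : ∀ a, g a ≠ 0 := fun a => by
      simp only [hg]
      exact_mod_cast (Real.exp_pos _).ne'
    set B : Matrix (Fin k) (Fin k) ℂ := Matrix.of fun a b =>
      kernelB α β (l a) (x a) (l b) (x b) - kernelA α β Γ (l a) (x a) (l b) (x b) with hB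
    have e : (Matrix.of fun a b => -cutAiry α β (l a) ((x + fun a => cutShift α β (l a)) a) (l b)
        ((x + fun a => cutShift α β (l a)) b)) =
        Matrix.of fun a b => g a * (Matrix.of fun a b => (g b)⁻¹ * B a b) a b := by
      ext a b
      simp only [Matrix.of_apply, hB, cutAiry, Pi.add_apply, hchi, if_pos (hx' _), Real.sqrt_one,
        Complex.ofReal_one, one_mul, mul_one, kernelB_sub_kernelA hα Γ (l a) (l b) (hx' a) (hx' b)]
      have h1 : ((Real.exp (-conjExponent α β (l a) (x a) + conjExponent α β (l b) (x b)) : ℝ) : ℂ) =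
          (g a)⁻¹ * g b := by
        simp only [hg]
        rw [Real.exp_add, Real.exp_neg]
        push_cast
        rfl
      rw [h1, cutShift, cutShift, ← add_assoc, ← add_assoc]
      have := hg0 a
      have := hg0 b
      field_simp
    refine (congrArg Matrix.det e).trans ?_
    rw [Matrix.det_mul_column, Matrix.det_mul_row, Finset.prod_inv_distrib, ← mul_assoc,
      mul_inv_cancel₀ (Finset.prod_ne_zero_iff.mpr fun a _ => hg0 a), one_mul, fredholmIntegrand,
      Finset.prod_const_one, one_mul]
  · rw [indicator_of_notMem hx]
    obtain ⟨a, ha⟩ : ∃ a, ¬ 0 < x a := by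
      by_contra hcon
      push Not at hcon
      exact hx fun a _ => hcon a
    refine Matrix.det_eq_zero_of_row_eq_zero a fun b => ?_
    simp only [Matrix.of_apply, cutAiry, Pi.add_apply, hchi, if_neg ha, Real.sqrt_zero,
      Complex.ofReal_zero, zero_mul, neg_zero]

theorem pi_halfLine (k : ℕ) : (Measure.pi fun _ : Fin k => halfLine) =
    (Measure.pi fun _ : Fin k => (volume : Measure ℝ)).restrict (Set.univ.pi fun _ => Ioi 0) :=
  (Measure.restrict_pi_pi _ _).symm

theorem measurableSet_pi_Ioi (k : ℕ) : MeasurableSet (Set.univ.pi fun _ : Fin k => Ioi (0 : ℝ)) :=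
  MeasurableSet.univ_pi fun _ => measurableSet_Ioi

theorem fredholmDet_cutAiry (hα : StrictMono α) (Γ : ContourSystem M) :
    fredholmDet halfLine (fun _ => 1)
        (fun i x j y => kernelB α β i x j y - kernelA α β Γ i x j y) =
      fredholmDet volume (fun _ => 1) (fun i x j y => -cutAiry α β i x j y) := by
  rw [fredholmDet, fredholmDet]
  refine tsum_congr fun k => ?_
  congr 1
  refine Finset.sum_congr rfl fun l _ => ?_
  refine Eq.trans ?_ (integral_add_right_eq_self (μ := (volume : Measure (Fin k → ℝ))) _
    fun a => cutShift α β (l a))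
  rw [pi_halfLine, ← integral_indicator (measurableSet_pi_Ioi k)]
  simp only [fredholmIntegrand_cutAiry hα Γ]
  rfl

theorem fredholmConverges_cutAiry (hα : StrictMono α) (Γ : ContourSystem M) :
    FredholmConverges volume (fun _ => 1) (fun i x j y => -cutAiry α β i x j y) := by
  obtain ⟨h1, h2⟩ := fredholmConverges_kernelBA (β := β) Γ hα
  have e : ∀ (k : ℕ) (l : Fin k → Fin (M + 1)),
      Integrable (fun x => fredholmIntegrand (fun _ => 1) (fun i x j y => -cutAiry α β i x j y) k l
        (x + fun a => cutShift α β (l a))) := by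
    intro k l
    simp only [fredholmIntegrand_cutAiry hα Γ]
    have h := h1 k l
    rw [pi_halfLine] at h
    exact (integrable_indicator_iff (measurableSet_pi_Ioi k)).mpr h
  refine ⟨fun k l => ?_, ?_⟩
  · have h := (e k l).comp_add_right (-fun a => cutShift α β (l a))
    simp only [neg_add_cancel_right] at h
    exact h
  · refine h2.congr fun k => ?_
    congr 1
    refine Finset.sum_congr rfl fun l _ => ?_
    refine Eq.trans ?_ (integral_add_right_eq_self (μ := (volume : Measure (Fin k → ℝ))) _
      fun a => cutShift α β (l a))
    rw [pi_halfLine, ← integral_indicator (measurableSet_pi_Ioi k)]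
    simp only [fredholmIntegrand_cutAiry hα Γ, norm_indicator_eq_indicator_norm]
    rfl

end AiryKernel


/-! ### Elimination for a kernel with two off-diagonal blocks -/

section OffDiagonal

theorem comp_eq_zero {X Y Z : Type} [MeasurableSpace Y] {ν : Measure Y} {T : X → Y → ℂ}
    {S : Y → Z → ℂ} (h : ∀ x y z, T x y = 0 ∨ S y z = 0) : comp ν T S = fun _ _ => 0 := by
  funext x z
  rw [comp]
  refine integral_eq_zero_of_ae (.of_forall fun y => ?_)
  rcases h x y z with h | h <;> simp [h]

variable {X : Type} [MeasurableSpace X] {p q : X → ℝ} {μ : Measure X} [SigmaFinite μ]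

/-- `det [[1, b], [c, 1]] = det (1 - b c)`, by two triangular factorizations. -/
theorem fredholm_add_of_offDiagonal {b c : X → X → ℂ} (hb : KernelBound p q b)
    (hc : KernelBound p q c) (hμ : Integrable (fun x => p x * q x) μ) {side : X → Prop}
    (hbs : ∀ x y, b x y ≠ 0 → side x ∧ ¬ side y) (hcs : ∀ x y, c x y ≠ 0 → ¬ side x ∧ side y) :
    fredholm μ (fun x y => b x y + c x y) = fredholm μ (fun x y => -comp μ b c x y) := by
  classical
  have hbb : ∀ {Z : Type} (S : Z → X → ℂ), comp μ (comp μ S b) b = fun _ _ => 0 := by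
    intro Z S
    funext x z
    have : ∀ y, comp μ S b x y * b y z = 0 := by
      intro y
      by_cases h : b y z = 0
      · rw [h, mul_zero]
      · have hz : comp μ S b x y = 0 := by
          rw [comp]
          refine integral_eq_zero_of_ae (.of_forall fun w => ?_)
          by_cases h' : b w y = 0
          · simp [h']
          · exact absurd (hbs _ _ h).1 (hbs _ _ h').2
        rw [hz, zero_mul]
    rw [comp]
    simp only [this, integral_zero]
  have hcc : comp μ c c = fun _ _ => 0 := comp_eq_zero fun x y z => by
    by_contra h
    push Not at h
    exact (hcs _ _ h.2).1 (hcs _ _ h.1).2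
  have hbc := hb.comp hc hμ
  have hbcb := hbc.comp hb hμ
  have hcb := hc.comp hb hμ
  -- the factor `1 + c` on the right
  have e1 : fredholm μ (fun x y => b x y + c x y) =
      fredholm μ (fun x y => b x y + -comp μ b c x y) := by
    rw [← fredholm_add_comp_of_level (hb.add hbc.neg) hc hμ (lev := fun x => if side x then 1 else 0)
      (m := 1) (fun x => by split_ifs <;> simp) fun x y h => by
        simp [(hcs x y h).1, (hcs x y h).2]]
    congr 1
    funext x y
    have h1 := congrFun (congrFun (comp_add_left hb hbc.neg hc hμ) x) y
    have h2 : comp μ (fun x y => -comp μ b c x y) c x y = 0 := by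
      have h3 := congrFun (congrFun (comp_assoc hb hc hc hμ hμ) x) y
      rw [hcc] at h3
      have h4 : comp μ (fun x y => -comp μ b c x y) c x y = -comp μ (comp μ b c) c x y := by
        simp only [comp, neg_mul, integral_neg]
      rw [h4, h3]
      simp [comp]
    rw [h1, h2]
    ring
  -- the factor `1 + b` on the right
  have e2 : fredholm μ (fun x y => b x y + -comp μ b c x y) =
      fredholm μ (fun x y => -comp μ b c x y + comp μ (comp μ b c) b x y) := by
    rw [← fredholm_add_comp_of_level (hbc.neg.add hbcb) hb hμ
      (lev := fun x => if side x then 0 else 1)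
      (m := 1) (fun x => by split_ifs <;> simp) fun x y h => by
        simp [(hbs x y h).1, (hbs x y h).2]]
    congr 1
    funext x y
    have h1 := congrFun (congrFun (comp_add_left hbc.neg hbcb hb hμ) x) y
    have h2 := congrFun (congrFun (hbb (comp μ b c)) x) y
    have h4 : comp μ (fun x y => -comp μ b c x y) b x y = -comp μ (comp μ b c) b x y := by
      simp only [comp, neg_mul, integral_neg]
    rw [h1, h2, h4]
    ring
  have e3 : (fun x y => -comp μ b c x y + comp μ (comp μ b c) b x y) =
      comp μ b (fun x y => -c x y + comp μ c b x y) := by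
    rw [comp_add_right hb hc.neg hcb hμ, comp_assoc hb hc hb hμ hμ]
    funext x y
    congr 1
    simp only [comp, mul_neg, integral_neg]
  have e4 : comp μ (fun x y => -c x y + comp μ c b x y) b = comp μ (fun x y => -c x y) b := by
    rw [comp_add_left hc.neg hcb hb hμ, hbb]
    simp only [add_zero]
  rw [e1, e2, e3, fredholm_comp_comm hb (hc.neg.add hcb) hμ hμ, e4,
    fredholm_comp_comm hc.neg hb hμ hμ]
  congr 1
  funext x y
  simp only [comp, mul_neg, integral_neg]

end OffDiagonal

/-! ### The linked kernel -/

section Linked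

variable {M : ℕ} {α β : Fin (M + 1) → ℝ} (Γ : ContourSystem M)

/-- The labels of the variables: `(true, i)` stands for the variables `u` of index `i`, and
`(false, i)` for the variables `v` of index `i`. -/
abbrev Label (M : ℕ) : Type := Bool × Fin (M + 1)

/-- The number of the Cauchy determinant that has the variables of a label in its rows. -/
def rowBlock (y : Label M) : ℕ := if y.1 then y.2 + 1 else y.2

/-- The number of the Cauchy determinant that has the variables of a label in its columns. -/
def colBlock (y : Label M) : ℕ := if y.1 then y.2 else y.2 + 1

/-- The vertex of the `in` (`true`) or `out` (`false`) contour of a label. -/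
def sideVertex (s : Bool) (y : Label M) : ℝ :=
  if y.1 then (if s then Γ.leftIn y.2 else Γ.leftOut y.2)
  else (if s then Γ.rightIn y.2 else Γ.rightOut y.2)

/-- The `in` (`true`) or `out` (`false`) contour of a label. -/
noncomputable def sideWedge (s : Bool) (y : Label M) : Wedge :=
  if y.1 then leftWedge (sideVertex Γ s y) else rightWedge (sideVertex Γ s y)

theorem leftIn_le_leftOut (i j : Fin (M + 1)) : Γ.leftIn i ≤ Γ.leftOut j :=
  (Γ.leftIn_strictAnti.antitone (Fin.zero_le i)).trans
    (Γ.leftOut_zero.ge.trans (Γ.leftOut_strictMono.monotone (Fin.zero_le j)))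

theorem rightOut_le_rightIn (i j : Fin (M + 1)) : Γ.rightOut i ≤ Γ.rightIn j :=
  (Γ.rightOut_strictAnti.antitone (Fin.zero_le i)).trans
    (Γ.rightOut_zero.le.trans (Γ.rightIn_strictMono.monotone (Fin.zero_le j)))

theorem sideVertex_left_neg (s : Bool) (i : Fin (M + 1)) : sideVertex Γ s (true, i) < 0 := by
  cases s
  · exact Γ.leftOut_neg i
  · exact Γ.leftIn_neg i

theorem sideVertex_right_pos (s : Bool) (i : Fin (M + 1)) : 0 < sideVertex Γ s (false, i) := by
  cases s
  · exact Γ.rightOut_pos i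
  · exact Γ.rightIn_pos i

theorem sideVertex_left_ne (s s' : Bool) {i j : Fin (M + 1)} (hij : i < j) :
    sideVertex Γ s (true, i) ≠ sideVertex Γ s' (true, j) := by
  have h1 := Γ.leftIn_strictAnti hij
  have h2 := Γ.leftOut_strictMono hij
  have h3 := leftIn_le_leftOut Γ i i
  cases s <;> cases s' <;> simp only [sideVertex, if_true, Bool.false_eq_true, if_false]
  · exact h2.ne
  · exact (h1.trans_le h3).ne'
  · exact (h3.trans_lt h2).ne
  · exact h1.ne'

theorem sideVertex_right_ne (s s' : Bool) {i j : Fin (M + 1)} (hij : i < j) :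
    sideVertex Γ s (false, i) ≠ sideVertex Γ s' (false, j) := by
  have h1 := Γ.rightIn_strictMono hij
  have h2 := Γ.rightOut_strictAnti hij
  have h3 := rightOut_le_rightIn Γ i i
  cases s <;> cases s' <;> simp only [sideVertex, if_true, Bool.false_eq_true, if_false]
  · exact h2.ne'
  · exact (h3.trans_lt h1).ne
  · exact (h2.trans_le h3).ne'
  · exact h1.ne

/-- Variables in the rows and columns of the same Cauchy determinant run over separated contours. -/
theorem exists_sideWedge_sep (s s' : Bool) {y y' : Label M} (h : rowBlock y = colBlock y') :
    ∃ δ : ℝ, 0 < δ ∧ ∀ t t', δ ≤ ‖(sideWedge Γ s y).point t - (sideWedge Γ s' y').point t'‖ := by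
  obtain ⟨b, i⟩ := y
  obtain ⟨b', j⟩ := y'
  cases b <;> cases b' <;> simp only [rowBlock, colBlock, if_true, Bool.false_eq_true, if_false] at h
  · have hji : j < i := Fin.lt_def.mpr (by lia)
    refine ⟨|sideVertex Γ s (false, i) - sideVertex Γ s' (false, j)| / 3,
      by have := abs_pos.mpr (sub_ne_zero.mpr (sideVertex_right_ne Γ s' s hji).symm); positivity,
      fun t t' => rightWedge_dist _ _ t t'⟩
  · refine ⟨sideVertex Γ s (false, i) - sideVertex Γ s' (true, j),
      by linarith [sideVertex_right_pos Γ s i, sideVertex_left_neg Γ s' j],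
      fun t t' => leftWedge_rightWedge_dist _ _ t' t⟩
  · refine ⟨sideVertex Γ s' (false, j) - sideVertex Γ s (true, i),
      by linarith [sideVertex_right_pos Γ s' j, sideVertex_left_neg Γ s i], fun t t' => ?_⟩
    rw [norm_sub_rev]
    exact leftWedge_rightWedge_dist _ _ t t'
  · have hij : i < j := Fin.lt_def.mpr (by lia)
    refine ⟨|sideVertex Γ s (true, i) - sideVertex Γ s' (true, j)| / 2,
      by have := abs_pos.mpr (sub_ne_zero.mpr (sideVertex_left_ne Γ s s' hij)); positivity,
      fun t t' => leftWedge_dist _ _ t t'⟩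

variable (α β) in
/-- The weight `F(u)` or `-1 / F(v)` of a variable. -/
noncomputable def labelWeight (y : Label M) (w : ℂ) : ℂ :=
  if y.1 then F α β y.2 w else -(1 / F α β y.2 w)

theorem differentiable_labelWeight (y : Label M) : Differentiable ℂ (labelWeight α β y) := by
  obtain ⟨b, i⟩ := y
  cases b
  · exact ((differentiable_const 1).div (differentiable_F β i) (F_ne_zero β i)).neg
  · exact differentiable_F β i

theorem exists_labelWeight_le (hα : StrictMono α) (s : Bool) (y : Label M) :
    ∃ C : ℝ, 0 ≤ C ∧ ∀ t : ℝ, ‖labelWeight α β y ((sideWedge Γ s y).point t)‖ ≤ C * wt t := by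
  obtain ⟨b, i⟩ := y
  cases b
  · obtain ⟨C, hC, h⟩ := exists_inv_F_right_le β hα i (sideVertex_right_pos Γ s i).le
    refine ⟨C, hC, fun t => ?_⟩
    rw [labelWeight, if_neg (by simp), norm_neg]
    exact h t
  · exact exists_F_left_le β hα i _

/-- The contour of a label at the centre `z = 0` of the tori: `in` for the variables `u`, `out` for
the variables `v`. -/
noncomputable def labelWedge (y : Label M) : Wedge := sideWedge Γ y.1 y

variable (α β) in
/-- The kernel whose determinants are the products of Cauchy determinants in the equal-time
formula. -/
noncomputable def linkKernel (x y : Label M × ℝ) : ℂ :=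
  if rowBlock x.1 = colBlock y.1 then (labelWedge Γ y.1).density y.2 *
    (labelWeight α β y.1 ((labelWedge Γ y.1).point y.2) /
      ((labelWedge Γ x.1).point x.2 - (labelWedge Γ y.1).point y.2))
  else 0

theorem linkKernel_bound (hα : StrictMono α) :
    KernelBound (fun _ => 1) (fun x => wt x.2) (linkKernel α β Γ) := by
  refine kernelBound_of_blocks (T := fun y y' s t => linkKernel α β Γ (y, s) (y', t))
    (fun _ => zero_le_one) (fun _ => wt_nonneg _) fun y y' => ?_
  by_cases h : rowBlock y = colBlock y'
  · obtain ⟨C, hC, hb⟩ := exists_labelWeight_le (β := β) Γ hα y'.1 y'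
    obtain ⟨δ, hδ, hs⟩ := exists_sideWedge_sep Γ y.1 y'.1 h
    simp only [linkKernel, if_pos h]
    exact kernelBound_div_right (measurable_comp_point (differentiable_labelWeight y')) hC hb hδ hs
  · simp only [linkKernel, if_neg h]
    exact kernelBound_zero (fun _ => zero_le_one) wt_nonneg

end Linked


/-! ### Reduction of the linked kernel to the right contour -/

section Elimination

variable {M : ℕ} {α β : Fin (M + 1) → ℝ} (Γ : ContourSystem M)

/-- The `out` contour of the variables `v` of index `i`. -/
noncomputable def vWedge (i : Fin (M + 1)) : Wedge := rightWedge (Γ.rightOut i)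

theorem vWedge_zero : vWedge Γ 0 = Γ.gammaR := by
  rw [vWedge, Γ.rightOut_zero, ContourSystem.gammaR]

variable (α β) in
/-- The factor `f_i / (F_i f_j)`, which is `f_{i-1} / f_j`, or `1 / f_j` for the first index. -/
noncomputable def quotV (i j : Fin (M + 1)) (w : ℂ) : ℂ := f α β i w / (F α β i w * f α β j w)

theorem quotV_zero (j : Fin (M + 1)) (w : ℂ) : quotV α β 0 j w = 1 / f α β j w := by
  have h0 := f_ne_zero α β 0 w
  have hj := f_ne_zero α β j w
  rw [quotV, F_zero]
  field_simp

theorem quotV_succ (k : Fin M) (j : Fin (M + 1)) (w : ℂ) :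
    quotV α β k.succ j w = f α β k.castSucc w / f α β j w := by
  have h0 := f_ne_zero α β k.succ w
  have h1 := f_ne_zero α β k.castSucc w
  have hj := f_ne_zero α β j w
  rw [quotV, F_succ]
  field_simp

theorem differentiable_quotV (i j : Fin (M + 1)) : Differentiable ℂ (quotV α β i j) :=
  (differentiable_f α β i).div ((differentiable_F β i).mul (differentiable_f α β j))
    fun w => mul_ne_zero (F_ne_zero β i w) (f_ne_zero α β j w)

theorem exists_quotV_le (hα : StrictMono α) {i j : Fin (M + 1)} (hij : i ≤ j) {b : ℝ}
    (hb : 0 ≤ b) : ∃ C : ℝ, 0 ≤ C ∧ ∀ t : ℝ, ‖quotV α β i j ((rightWedge b).point t)‖ ≤ C * wt t := by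
  induction i using Fin.cases with
  | zero =>
    simp only [quotV_zero]
    exact exists_inv_f_right_le α β j b
  | succ k =>
    simp only [quotV_succ]
    exact exists_quot_rightWedge_le β hα (k.castSucc_lt_succ.trans_le hij) hb

theorem exists_quotV_region_le (hα : StrictMono α) {i j : Fin (M + 1)} (hi : i ≠ 0) (hij : i ≤ j) :
    ∃ C : ℝ, 0 ≤ C ∧ ∀ w : ℂ, 0 ≤ wedgeLevel (Real.pi / 5) w →
      ‖quotV α β i j w‖ ≤ C * Real.exp (-(2 * w.re)) := by
  induction i using Fin.cases with
  | zero => exact absurd rfl hi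
  | succ k =>
    simp only [quotV_succ]
    exact exists_quot_right_le β hα (k.castSucc_lt_succ.trans_le hij)

variable (α β) in
/-- The block from `u_j` to `v_i` of `b (1 + d)⁻¹`, where `b` links `u` to `v` and `d` links the
variables `v`. -/
noncomputable def blockB (j i : Fin (M + 1)) (s t : ℝ) : ℂ :=
  if i ≤ j then (-1) ^ (j.val - i.val) * ((vWedge Γ i).density t *
    (-quotV α β i j ((vWedge Γ i).point t) / ((uWedge Γ j).point s - (vWedge Γ i).point t)))
  else 0

variable (α β) in
/-- The kernel `F_i(u) / (v - u)` from `v_i` to `u_i`. -/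
noncomputable def startC (i : Fin (M + 1)) (s t : ℝ) : ℂ :=
  (uWedge Γ i).density t * (F α β i ((uWedge Γ i).point t) /
    ((vWedge Γ i).point s - (uWedge Γ i).point t))

variable (α β) in
/-- The block from `v_i` to `u_k` of `c (1 + a)⁻¹`, where `c` links `v` to `u` and `a` links the
variables `u`. -/
noncomputable def blockC (i k : Fin (M + 1)) (s t : ℝ) : ℂ :=
  if i ≤ k then (-1) ^ (k.val - i.val) *
    chainFwd (fun m => stepU α β Γ (i + m)) (k - i) (startC α β Γ i) s t
  else 0

theorem vWedge_uWedge_dist (i j : Fin (M + 1)) (s t : ℝ) :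
    Γ.rightOut i - Γ.leftIn j ≤ ‖(vWedge Γ i).point s - (uWedge Γ j).point t‖ :=
  leftWedge_rightWedge_dist _ _ t s

theorem rightOut_sub_leftIn_pos (i j : Fin (M + 1)) : 0 < Γ.rightOut i - Γ.leftIn j := by
  linarith [Γ.rightOut_pos i, Γ.leftIn_neg j]

theorem blockB_bound (hα : StrictMono α) (j i : Fin (M + 1)) :
    KernelBound (fun _ => 1) wt (blockB α β Γ j i) := by
  by_cases h : i ≤ j
  · obtain ⟨C, hC, hb⟩ := exists_quotV_le (β := β) hα h (Γ.rightOut_pos i).le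
    unfold blockB
    simp only [if_pos h]
    refine KernelBound.const_mul (kernelBound_div_right (c := uWedge Γ j) (c' := vWedge Γ i)
      (g := fun w => -quotV α β i j w) (measurable_comp_point (differentiable_quotV i j).neg) hC
      (fun t => by rw [norm_neg]; exact hb t) (rightOut_sub_leftIn_pos Γ i j) fun s t => ?_) _
    rw [norm_sub_rev]
    exact vWedge_uWedge_dist Γ i j t s
  · unfold blockB
    simp only [if_neg h]
    exact kernelBound_zero (fun _ => zero_le_one) wt_nonneg

theorem startC_bound (hα : StrictMono α) (i : Fin (M + 1)) :
    KernelBound (fun _ => 1) wt (startC α β Γ i) := by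
  obtain ⟨C, hC, hb⟩ := exists_F_left_le β hα i (Γ.leftIn i)
  exact kernelBound_div_right (c := vWedge Γ i) (c' := uWedge Γ i)
    (measurable_comp_point (differentiable_F β i)) hC hb (rightOut_sub_leftIn_pos Γ i i)
    fun s t => vWedge_uWedge_dist Γ i i s t

theorem blockC_bound (hα : StrictMono α) (i k : Fin (M + 1)) :
    KernelBound (fun _ => 1) wt (blockC α β Γ i k) := by
  by_cases h : i ≤ k
  · unfold blockC
    simp only [if_pos h]
    exact KernelBound.const_mul (chainFwd_bound (fun m => stepU_bound Γ hα _)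
      (startC_bound Γ hα i) _) _
  · unfold blockC
    simp only [if_neg h]
    exact kernelBound_zero (fun _ => zero_le_one) wt_nonneg

theorem rightLevel_point (b t : ℝ) : wedgeLevel (Real.pi / 5) ((rightWedge b).point t) = b := by
  have hs : 0 < Real.sin (Real.pi / 5) := by linarith [sin_cos_pi_div_five.1]
  exact wedgeLevel_point (c := ⟨Real.pi / 5, b⟩) hs t

theorem leftWedge_level_neg {a : ℝ} (ha : a < 0) (t : ℝ) :
    wedgeLevel (Real.pi / 5) ((leftWedge a).point t) < 0 := by
  obtain ⟨hs1, hc1, hc2, hs2⟩ := sin_cos_pi_div_five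
  rw [wedgeLevel, leftWedge_re]
  have h1 : 0 ≤ |((leftWedge a).point t).im| * (Real.cos (Real.pi / 5) / Real.sin (Real.pi / 5)) :=
    mul_nonneg (abs_nonneg _) (div_nonneg (by linarith) (by linarith))
  have h2 := abs_nonneg t
  linarith

theorem ne_of_wedgeLevel {u w : ℂ} (hu : wedgeLevel (Real.pi / 5) u < 0)
    (hw : 0 ≤ wedgeLevel (Real.pi / 5) w) : u - w ≠ 0 := fun h => by
  rw [sub_eq_zero.mp h] at hu
  linarith

/-- Division by the distance to a point outside the sector keeps a decaying bound. -/
theorem exists_div_sub_le {g : ℂ → ℂ} {u : ℂ} (hu : wedgeLevel (Real.pi / 5) u < 0)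
    (h : ∃ C : ℝ, 0 ≤ C ∧ ∀ w : ℂ, 0 ≤ wedgeLevel (Real.pi / 5) w →
      ‖g w‖ ≤ C * Real.exp (-(2 * w.re))) :
    ∃ C : ℝ, 0 ≤ C ∧ ∀ w : ℂ, 0 ≤ wedgeLevel (Real.pi / 5) w →
      ‖g w / (u - w)‖ ≤ C * Real.exp (-(2 * w.re)) := by
  obtain ⟨C, hC, hb⟩ := h
  set κ := 1 + |Real.cos (Real.pi / 5) / Real.sin (Real.pi / 5)| with hκ
  have hκ0 : 0 < κ := by positivity
  set δ := -wedgeLevel (Real.pi / 5) u / κ with hδ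
  have hδ0 : 0 < δ := div_pos (neg_pos.mpr hu) hκ0
  refine ⟨C / δ, by positivity, fun w hw => ?_⟩
  have h1 : δ ≤ ‖u - w‖ := by
    rw [hδ, div_le_iff₀ hκ0, mul_comm]
    have h2 := abs_wedgeLevel_sub_le (Real.pi / 5) u w
    have h3 := neg_abs_le (wedgeLevel (Real.pi / 5) u - wedgeLevel (Real.pi / 5) w)
    linarith
  rw [norm_div, div_mul_eq_mul_div]
  exact div_le_div₀ (by positivity) (hb w hw) hδ0 h1

theorem re_nonneg_of_wedgeLevel {w : ℂ} (hw : 0 ≤ wedgeLevel (Real.pi / 5) w) : 0 ≤ w.re := by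
  obtain ⟨hs1, hc1, hc2, hs2⟩ := sin_cos_pi_div_five
  have h1 : 0 ≤ Real.cos (Real.pi / 5) / Real.sin (Real.pi / 5) * |w.im| :=
    mul_nonneg (div_nonneg (by linarith) (by linarith)) (abs_nonneg _)
  rw [wedgeLevel] at hw
  linarith

theorem exp_neg_two_re_le {w : ℂ} {C : ℝ} (hC : 0 ≤ C) (hw : 0 ≤ wedgeLevel (Real.pi / 5) w) :
    C * Real.exp (-(2 * w.re)) ≤ C * Real.exp (-w.re) :=
  mul_le_mul_of_nonneg_left (Real.exp_le_exp.mpr (by linarith [re_nonneg_of_wedgeLevel hw])) hC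

theorem sin_pi_div_five_pos : 0 < Real.sin (Real.pi / 5) := by linarith [sin_cos_pi_div_five.1]

theorem cos_pi_div_five_pos : 0 < Real.cos (Real.pi / 5) := by linarith [sin_cos_pi_div_five.2.1]

variable (α β) in
/-- The block from `v_{i+1}` to `v_i` of the linked kernel. -/
noncomputable def linkV (i : Fin (M + 1)) (i' : Fin (M + 1)) (s t : ℝ) : ℂ :=
  (vWedge Γ i).density t * (-(1 / F α β i ((vWedge Γ i).point t)) /
    ((vWedge Γ i').point s - (vWedge Γ i).point t))

/-- The residue that moves a link from `v_{i+1}` to `v_i`. -/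
theorem comp_blockB_linkV (hα : StrictMono α) {k : Fin M} {j : Fin (M + 1)} (hkj : k.succ ≤ j) :
    comp volume (blockB α β Γ j k.succ) (linkV α β Γ k.castSucc k.succ) =
      fun s t => -blockB α β Γ j k.castSucc s t := by
  funext s t
  have hkj' : k.castSucc ≤ j := k.castSucc_lt_succ.le.trans hkj
  set u := (uWedge Γ j).point s with hu
  set v := (vWedge Γ k.castSucc).point t with hv
  have hu0 : wedgeLevel (Real.pi / 5) u < 0 := leftWedge_level_neg (Γ.leftIn_neg j) s
  have hvl : wedgeLevel (Real.pi / 5) v = Γ.rightOut k.castSucc := rightLevel_point _ _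
  have hpos := Γ.rightOut_pos k.succ
  obtain ⟨C, hC, hb⟩ := exists_div_sub_le hu0
    (exists_quotV_region_le (β := β) hα (Fin.succ_ne_zero k) hkj)
  have hres := wedgeIntegral_div_of_decay sin_pi_div_five_pos cos_pi_div_five_pos
    (a := Γ.rightOut k.succ) (w₀ := v) (by
      rw [hvl]
      exact Γ.rightOut_strictAnti k.castSucc_lt_succ)
    (g := fun w => quotV α β k.succ j w / (u - w))
    (fun w hw => (differentiable_quotV k.succ j w).fun_div (by fun_prop)
      (ne_of_wedgeLevel hu0 (hpos.le.trans hw))) (C := C)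
    fun w hw => (hb w (hpos.le.trans hw)).trans (exp_neg_two_re_le hC (hpos.le.trans hw))
  have e1 : comp volume (blockB α β Γ j k.succ) (linkV α β Γ k.castSucc k.succ) s t =
      (-1) ^ (j.val - (k.val + 1)) * ((vWedge Γ k.castSucc).density t *
        (1 / F α β k.castSucc v)) *
        wedgeIntegral ⟨Real.pi / 5, Γ.rightOut k.succ⟩
          (fun w => quotV α β k.succ j w / (u - w) / (w - v)) := by
    rw [comp, wedgeIntegral, ← integral_const_mul]
    refine integral_congr_ae (.of_forall fun x => ?_)
    simp only [blockB, if_pos hkj, linkV]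
    rw [← hu, ← hv, Fin.val_succ]
    simp only [vWedge, rightWedge]
    ring
  rw [e1, hres, blockB, if_pos hkj', ← hu, ← hv, quotV_succ, quotV]
  have h1 : j.val - k.castSucc.val = (j.val - (k.val + 1)) + 1 := by
    have := Fin.le_def.mp hkj
    simp only [Fin.val_succ, Fin.val_castSucc] at this ⊢
    lia
  rw [h1, pow_succ]
  have n1 := F_ne_zero (α := α) β k.castSucc v
  have n2 := f_ne_zero α β j v
  have n3 : u - v ≠ 0 := ne_of_wedgeLevel hu0 (by rw [hvl]; exact (Γ.rightOut_pos _).le)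
  field_simp

/-- Variables `v` with an index after the first are not linked to both sides: the integral over
such a variable vanishes, since the contour can be moved to the right. -/
theorem comp_blockB_startC (hα : StrictMono α) {i j : Fin (M + 1)} (hi : i ≠ 0) :
    comp volume (blockB α β Γ j i) (startC α β Γ i) = fun _ _ => 0 := by
  by_cases hij : i ≤ j
  swap
  · exact comp_eq_zero fun x y z => Or.inl (by rw [blockB, if_neg hij])
  funext s t
  set u := (uWedge Γ j).point s with hu
  set u' := (uWedge Γ i).point t with hu'
  have hu0 : wedgeLevel (Real.pi / 5) u < 0 := leftWedge_level_neg (Γ.leftIn_neg j) s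
  have hu0' : wedgeLevel (Real.pi / 5) u' < 0 := leftWedge_level_neg (Γ.leftIn_neg i) t
  have hpos := Γ.rightOut_pos i
  obtain ⟨C, hC, hb⟩ := exists_div_sub_le hu0' (exists_div_sub_le hu0
    (exists_quotV_region_le (β := β) hα hi hij))
  have hzero := wedgeIntegral_eq_zero_of_decay sin_pi_div_five_pos cos_pi_div_five_pos
    (a := Γ.rightOut i) (h := fun w => quotV α β i j w / (u - w) / (u' - w))
    (fun w hw => ((differentiable_quotV i j w).fun_div (by fun_prop)
      (ne_of_wedgeLevel hu0 (hpos.le.trans hw))).fun_div (by fun_prop)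
      (ne_of_wedgeLevel hu0' (hpos.le.trans hw))) (C := C)
    fun w hw => (hb w (hpos.le.trans hw)).trans (exp_neg_two_re_le hC (hpos.le.trans hw))
  have e1 : comp volume (blockB α β Γ j i) (startC α β Γ i) s t =
      (-1) ^ (j.val - i.val) * ((uWedge Γ i).density t * F α β i u') *
        wedgeIntegral ⟨Real.pi / 5, Γ.rightOut i⟩
          (fun w => quotV α β i j w / (u - w) / (u' - w)) := by
    rw [comp, wedgeIntegral, ← integral_const_mul]
    refine integral_congr_ae (.of_forall fun x => ?_)
    simp only [blockB, if_pos hij, startC]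
    rw [← hu, ← hu', ← neg_sub u']
    simp only [vWedge, rightWedge, div_neg]
    ring
  rw [e1, hzero, mul_zero]

theorem comp_blockB_blockC (hα : StrictMono α) {i j k : Fin (M + 1)} (hi : i ≠ 0) :
    comp volume (blockB α β Γ j i) (blockC α β Γ i k) = fun _ _ => 0 := by
  by_cases hik : i ≤ k
  swap
  · exact comp_eq_zero fun x y z => Or.inr (by rw [blockC, if_neg hik])
  have e : blockC α β Γ i k = fun s t => (-1) ^ (k.val - i.val) *
      chainFwd (fun m => stepU α β Γ (i + m)) (k - i) (startC α β Γ i) s t := by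
    funext s t
    rw [blockC, if_pos hik]
  have h0 : ∀ n, chainFwd (fun m => stepU α β Γ (i + m)) n (fun (_ : ℝ) _ => 0) = fun _ _ => 0 := by
    intro n
    induction n with
    | zero => rfl
    | succ n ih => rw [chainFwd, ih]; exact comp_eq_zero fun _ _ _ => Or.inl rfl
  rw [e, comp_const_mul_right, ← chainFwd_comp (fun m => stepU_bound Γ hα _)
    (blockB_bound Γ hα j i) (startC_bound Γ hα i) integrable_one_mul_wt, comp_blockB_startC Γ hα hi,
    h0]
  simp only [mul_zero]

end Elimination


section LinkedReduction

variable {M : ℕ} {α β : Fin (M + 1) → ℝ} (Γ : ContourSystem M)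

/-- Counting measure on the labels times Lebesgue measure. -/
noncomputable abbrev labelMeasure (M : ℕ) : Measure (Label M × ℝ) :=
  (Measure.count : Measure (Label M)).prod volume

variable (α β) in
/-- The part of the linked kernel that stays among the variables `u` or among the variables `v`. -/
noncomputable def fullN (x y : Label M × ℝ) : ℂ :=
  if x.1.1 = y.1.1 then linkKernel α β Γ x y else 0

variable (α β) in
/-- The kernel with the blocks from `u` to `v`. -/
noncomputable def fullB (x y : Label M × ℝ) : ℂ :=
  if x.1.1 = true ∧ y.1.1 = false then blockB α β Γ x.1.2 y.1.2 x.2 y.2 else 0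

variable (α β) in
/-- The kernel with the blocks from `v` to `u`. -/
noncomputable def fullC (x y : Label M × ℝ) : ℂ :=
  if x.1.1 = false ∧ y.1.1 = true then blockC α β Γ x.1.2 y.1.2 x.2 y.2 else 0

theorem kernelBound_ite {X Y : Type} [MeasurableSpace X] [MeasurableSpace Y] {p : X → ℝ} {q : Y → ℝ}
    {T : X → Y → ℂ} (h : KernelBound p q T) (P : Prop) [Decidable P] :
    KernelBound p q (fun x y => if P then T x y else 0) := by
  by_cases hP : P
  · simpa only [if_pos hP] using h
  · simpa only [if_neg hP] using kernelBound_zero h.left_nonneg h.right_nonneg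

theorem fullB_bound (hα : StrictMono α) :
    KernelBound (fun _ => 1) (fun x => wt x.2) (fullB α β Γ) :=
  kernelBound_of_blocks (T := fun y y' s t => fullB α β Γ (y, s) (y', t)) (fun _ => zero_le_one)
    (fun _ => wt_nonneg _) fun y y' => by
      simp only [fullB]
      exact kernelBound_ite (blockB_bound Γ hα y.2 y'.2) (y.1 = true ∧ y'.1 = false)

theorem fullC_bound (hα : StrictMono α) :
    KernelBound (fun _ => 1) (fun x => wt x.2) (fullC α β Γ) :=
  kernelBound_of_blocks (T := fun y y' s t => fullC α β Γ (y, s) (y', t)) (fun _ => zero_le_one)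
    (fun _ => wt_nonneg _) fun y y' => by
      simp only [fullC]
      exact kernelBound_ite (blockC_bound Γ hα y.2 y'.2) (y.1 = false ∧ y'.1 = true)

theorem fullN_bound (hα : StrictMono α) :
    KernelBound (fun _ => 1) (fun x => wt x.2) (fullN α β Γ) := by
  refine kernelBound_of_blocks (T := fun y y' s t => fullN α β Γ (y, s) (y', t))
    (fun _ => zero_le_one) (fun _ => wt_nonneg _) fun y y' => ?_
  simp only [fullN]
  refine kernelBound_ite ?_ (y.1 = y'.1)
  exact (linkKernel_bound Γ hα).precomp (a := fun s => (y, s)) (b := fun t => (y', t))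
    measurable_prodMk_left measurable_prodMk_left

theorem integrable_label_wt : Integrable (fun x : Label M × ℝ => (1 : ℝ) * wt x.2) (labelMeasure M) :=
  integrable_count_prod ((measurable_wt.comp measurable_snd).const_mul 1)
    fun _ => integrable_one_mul_wt

theorem comp_label {X Z : Type} [MeasurableSpace X] [MeasurableSpace Z] {p : X → ℝ} {q : Z → ℝ}
    {T : X → Label M × ℝ → ℂ} {S : Label M × ℝ → Z → ℂ} (hT : KernelBound p (fun x => wt x.2) T)
    (hS : KernelBound (fun _ => 1) q S) (x : X) (z : Z) : comp (labelMeasure M) T S x z =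
      ∑ i, comp volume (fun x t => T x ((true, i), t)) (fun t z => S ((true, i), t) z) x z +
      ∑ i, comp volume (fun x t => T x ((false, i), t)) (fun t z => S ((false, i), t) z) x z := by
  rw [comp, integral_count_prod (hT.integrable_mul hS integrable_label_wt x z),
    Fintype.sum_prod_type, Fintype.sum_bool]
  rfl

theorem fullN_true (k j : Fin (M + 1)) (s t : ℝ) : fullN α β Γ ((true, k), s) ((true, j), t) =
    if k.val + 1 = j.val then stepU α β Γ k s t else 0 := by
  simp only [fullN, linkKernel, rowBlock, colBlock, if_true]
  split_ifs with h
  · have hk : k.val < M := by have := j.isLt; lia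
    obtain ⟨k, hk'⟩ := k
    obtain ⟨j, hj'⟩ := j
    simp only at h hk
    subst h
    rw [stepU, dif_pos hk]
    rfl
  · rfl

theorem fullN_false (k j : Fin (M + 1)) (s t : ℝ) : fullN α β Γ ((false, k), s) ((false, j), t) =
    if k.val = j.val + 1 then linkV α β Γ j k s t else 0 := by
  simp only [fullN, linkKernel, rowBlock, colBlock, if_true, Bool.false_eq_true, if_false]
  rfl

theorem comp_fullB_fullN (hα : StrictMono α) (i j : Fin (M + 1)) (s t : ℝ) :
    comp (labelMeasure M) (fullB α β Γ) (fullN α β Γ) ((true, i), s) ((false, j), t) =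
      if j < i then -blockB α β Γ i j s t else 0 := by
  rw [comp_label (fullB_bound Γ hα) (fullN_bound Γ hα)]
  have h1 : ∑ k, comp volume (fun x t => fullB α β Γ x ((true, k), t))
      (fun t z => fullN α β Γ ((true, k), t) z) ((true, i), s) ((false, j), t) = 0 :=
    Finset.sum_eq_zero fun k _ => integral_eq_zero_of_ae
      (.of_forall fun x => by simp [fullB])
  have h2 : ∀ k : Fin (M + 1), comp volume (fun x t => fullB α β Γ x ((false, k), t))
      (fun t z => fullN α β Γ ((false, k), t) z) ((true, i), s) ((false, j), t) =
      if k.val = j.val + 1 then comp volume (blockB α β Γ i k) (linkV α β Γ j k) s t else 0 := by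
    intro k
    simp only [comp, fullB, fullN_false, true_and, if_true]
    split_ifs with h
    · rfl
    · simp
  rw [h1, zero_add, Finset.sum_congr rfl fun k _ => h2 k]
  by_cases hj : j < i
  · rw [if_pos hj]
    have hjM : j.val < M := by have := i.isLt; have := Fin.lt_def.mp hj; lia
    obtain ⟨j, rfl⟩ : ∃ j' : Fin M, j = j'.castSucc := ⟨⟨j, hjM⟩, rfl⟩
    rw [Finset.sum_eq_single j.succ
      (fun k _ hk => if_neg fun h => hk (Fin.ext (by rw [h, Fin.val_succ, Fin.val_castSucc])))
      (fun h => absurd (Finset.mem_univ _) h), if_pos (by rw [Fin.val_succ, Fin.val_castSucc]), comp_blockB_linkV Γ hα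
      (Fin.castSucc_lt_iff_succ_le.mp hj)]
  · rw [if_neg hj]
    refine Finset.sum_eq_zero fun k _ => ?_
    split_ifs with h
    · rw [comp_eq_zero fun x y z => Or.inl (by
        rw [blockB, if_neg fun hk => hj (Fin.lt_def.mpr (by have := Fin.le_def.mp hk; lia))])]
    · rfl

theorem comp_fullC_fullN (hα : StrictMono α) (i j : Fin (M + 1)) (s t : ℝ) :
    comp (labelMeasure M) (fullC α β Γ) (fullN α β Γ) ((false, i), s) ((true, j), t) =
      if i < j then -blockC α β Γ i j s t else 0 := by
  rw [comp_label (fullC_bound Γ hα) (fullN_bound Γ hα)]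
  have h1 : ∑ k, comp volume (fun x t => fullC α β Γ x ((false, k), t))
      (fun t z => fullN α β Γ ((false, k), t) z) ((false, i), s) ((true, j), t) = 0 :=
    Finset.sum_eq_zero fun k _ => integral_eq_zero_of_ae
      (.of_forall fun x => by simp [fullC])
  have h2 : ∀ k : Fin (M + 1), comp volume (fun x t => fullC α β Γ x ((true, k), t))
      (fun t z => fullN α β Γ ((true, k), t) z) ((false, i), s) ((true, j), t) =
      if k.val + 1 = j.val then comp volume (blockC α β Γ i k) (stepU α β Γ k) s t else 0 := by
    intro k
    simp only [comp, fullC, fullN_true, true_and, if_true]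
    split_ifs with h
    · rfl
    · simp
  rw [h1, add_zero, Finset.sum_congr rfl fun k _ => h2 k]
  by_cases hj : i < j
  · have hj' := Fin.lt_def.mp hj
    rw [if_pos hj, Finset.sum_eq_single ⟨j.val - 1, by have := j.isLt; lia⟩
      (fun k _ hk => if_neg fun h => hk (Fin.ext (by simp only; lia)))
      (fun h => absurd (Finset.mem_univ _) h), if_pos (by simp only; lia)]
    have e : blockC α β Γ i ⟨j.val - 1, by have := j.isLt; lia⟩ = fun s t =>
        (-1) ^ (j.val - 1 - i.val) *
        chainFwd (fun m => stepU α β Γ (i + m)) (j.val - 1 - i) (startC α β Γ i) s t := by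
      funext s t
      rw [blockC, if_pos (Fin.le_def.mpr (by simp only; lia))]
    rw [e, comp_const_mul_left, blockC, if_pos hj.le]
    have e2 : j.val - i.val = (j.val - 1 - i.val) + 1 := by lia
    rw [e2, pow_succ, chainFwd, show i.val + (j.val - 1 - i.val) = j.val - 1 by lia]
    ring
  · rw [if_neg hj]
    refine Finset.sum_eq_zero fun k _ => ?_
    split_ifs with h
    · rw [comp_eq_zero fun x y z => Or.inl (by
        rw [blockC, if_neg fun hk => hj (Fin.lt_def.mpr (by have := Fin.le_def.mp hk; lia))])]
    · rfl

/-- Factorization of the linked kernel: `1 + a + b + c + d = (1 + b (1 + d)⁻¹ + c (1 + a)⁻¹)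
(1 + a + d)`. -/
theorem linkKernel_eq (hα : StrictMono α) (x y : Label M × ℝ) : linkKernel α β Γ x y =
    (fullB α β Γ x y + fullC α β Γ x y) + (fullN α β Γ x y + comp (labelMeasure M)
      (fun x y => fullB α β Γ x y + fullC α β Γ x y) (fullN α β Γ) x y) := by
  have hadd := congrFun (congrFun (comp_add_left (fullB_bound (β := β) Γ hα) (fullC_bound (β := β) Γ hα)
    (fullN_bound (β := β) Γ hα) integrable_label_wt) x) y
  rw [hadd]
  have hB0 : (x.1.1 = true ∧ y.1.1 = false) ∨
      comp (labelMeasure M) (fullB α β Γ) (fullN α β Γ) x y = 0 := by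
    by_contra hcon
    push Not at hcon
    refine hcon.2 (integral_eq_zero_of_ae (.of_forall fun z => ?_))
    by_cases h1 : x.1.1 = true ∧ z.1.1 = false
    · have : ¬ z.1.1 = y.1.1 := fun h => hcon.1 h1.1 (h ▸ h1.2)
      simp [fullN, this]
    · simp [fullB, h1]
  have hC0 : (x.1.1 = false ∧ y.1.1 = true) ∨
      comp (labelMeasure M) (fullC α β Γ) (fullN α β Γ) x y = 0 := by
    by_contra hcon
    push Not at hcon
    refine hcon.2 (integral_eq_zero_of_ae (.of_forall fun z => ?_))
    by_cases h1 : x.1.1 = false ∧ z.1.1 = true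
    · have : ¬ z.1.1 = y.1.1 := fun h => hcon.1 h1.1 (h ▸ h1.2)
      simp [fullN, this]
    · simp [fullC, h1]
  obtain ⟨⟨b, i⟩, s⟩ := x
  obtain ⟨⟨b', j⟩, t⟩ := y
  cases b <;> cases b'
  · rw [hB0.resolve_left (by simp), hC0.resolve_left (by simp)]
    simp [fullB, fullC, fullN]
  · rw [hB0.resolve_left (by simp), comp_fullC_fullN Γ hα]
    simp only [fullB, fullC, fullN, Bool.false_eq_true, false_and, if_false, and_self, if_true,
      zero_add, linkKernel, rowBlock, colBlock]
    rcases lt_trichotomy i j with h | h | h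
    · rw [if_neg (Fin.lt_def.mp h).ne, if_pos h, add_neg_cancel]
    · subst h
      rw [if_pos rfl, if_neg (lt_irrefl _), blockC, if_pos le_rfl, Nat.sub_self, pow_zero, one_mul,
        add_zero]
      rfl
    · rw [if_neg (Fin.lt_def.mp h).ne', if_neg h.not_gt, blockC, if_neg h.not_ge, add_zero]
  · rw [hC0.resolve_left (by simp), comp_fullB_fullN Γ hα]
    simp only [fullB, fullC, fullN, Bool.true_eq_false, if_false, and_self, if_true,
      zero_add, add_zero, linkKernel, rowBlock, colBlock, Bool.false_eq_true, add_left_inj]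
    rcases lt_trichotomy i j with h | h | h
    · rw [if_neg (Fin.lt_def.mp h).ne, if_neg h.not_gt, blockB, if_neg h.not_ge, add_zero]
    · subst h
      rw [if_pos rfl, if_neg (lt_irrefl _), blockB, if_pos le_rfl, Nat.sub_self, pow_zero, one_mul,
        add_zero, quotV]
      have n1 := F_ne_zero (α := α) β i ((vWedge Γ i).point t)
      have n2 := f_ne_zero α β i ((vWedge Γ i).point t)
      have e : f α β i ((vWedge Γ i).point t) / (F α β i ((vWedge Γ i).point t) *
          f α β i ((vWedge Γ i).point t)) = 1 / F α β i ((vWedge Γ i).point t) := by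
        field_simp
      rw [e]
      rfl
    · rw [if_neg (Fin.lt_def.mp h).ne', if_pos h, add_neg_cancel]
  · rw [hB0.resolve_left (by simp), hC0.resolve_left (by simp)]
    simp [fullB, fullC, fullN]

theorem blockC_zero (j : Fin (M + 1)) : blockC α β Γ 0 j = fun s t =>
    (-1) ^ j.val * chainFwd (stepU α β Γ) j (startK α β Γ) s t := by
  funext s t
  have h1 : startC α β Γ 0 = startK α β Γ := by
    funext s t
    rw [startC, startK, F_zero, vWedge_zero]
    rfl
  have h2 : (fun m => stepU α β Γ ((0 : Fin (M + 1)).val + m)) = stepU α β Γ := by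
    funext m
    rw [Fin.val_zero, zero_add]
  rw [blockC, if_pos (Fin.zero_le j), h1, h2, Fin.val_zero, Nat.sub_zero]

theorem blockB_zero (j : Fin (M + 1)) : blockB α β Γ j 0 = fun s t =>
    -((-1) ^ j.val * endK α β Γ j s t) := by
  funext s t
  rw [blockB, if_pos (Fin.zero_le j), vWedge_zero, Fin.val_zero, Nat.sub_zero, endK, quotV_zero]
  ring

/-- The Fredholm determinant of the linked kernel reduces to a kernel on `Γ_{1,R}`. -/
theorem fredholm_linkKernel (hα : StrictMono α) :
    fredholm (labelMeasure M) (linkKernel α β Γ) = fredholm volume (rightKernel α β Γ) := by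
  have hB := fullB_bound (β := β) Γ hα
  have hC := fullC_bound (β := β) Γ hα
  have hN := fullN_bound (β := β) Γ hα
  have e1 : fredholm (labelMeasure M) (linkKernel α β Γ) = fredholm (labelMeasure M)
      (fun x y => fullB α β Γ x y + fullC α β Γ x y) := by
    rw [show linkKernel α β Γ = _ from funext fun x => funext fun y => linkKernel_eq Γ hα x y]
    refine fredholm_add_comp_of_level (hB.add hC) hN integrable_label_wt
      (lev := fun x => if x.1.1 = true then x.1.2.val else M - x.1.2.val) (m := M)
      (fun x => by have := x.1.2.isLt; split_ifs <;> lia) fun x y h => ?_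
    obtain ⟨⟨b, i⟩, s⟩ := x
    obtain ⟨⟨b', j⟩, t⟩ := y
    have hi := i.isLt
    have hj := j.isLt
    cases b <;> cases b'
    · rw [fullN_false] at h
      have := (ite_ne_right_iff.mp h).1
      simp only [Bool.false_eq_true, if_false]
      lia
    · simp [fullN] at h
    · simp [fullN] at h
    · rw [fullN_true] at h
      have := (ite_ne_right_iff.mp h).1
      simp only [if_true]
      lia
  -- the link from `u` through `v` back to `u`, in which only the first index of `v` contributes
  set Bz : Label M × ℝ → ℝ → ℂ := fun x v => fullB α β Γ x ((false, 0), v) with hBz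
  set Cz : ℝ → Label M × ℝ → ℂ := fun v y => -fullC α β Γ ((false, 0), v) y with hCz
  have hBzb : KernelBound (fun _ => 1) wt Bz :=
    hB.precomp (a := id) (b := fun t => ((false, 0), t)) measurable_id measurable_prodMk_left
  have hCzb : KernelBound (fun _ => 1) (fun x => wt x.2) Cz :=
    (hC.precomp (a := fun t => ((false, 0), t)) (b := id) measurable_prodMk_left measurable_id).neg
  have e2 : (fun x y => -comp (labelMeasure M) (fullB α β Γ) (fullC α β Γ) x y) =
      comp volume Bz Cz := by
    funext x y
    rw [comp_label hB hC, Finset.sum_eq_zero fun i _ => ?_, zero_add,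
      Finset.sum_eq_single 0 (fun i _ hi => ?_) (fun h => absurd (Finset.mem_univ _) h)]
    · simp only [comp, hBz, hCz, mul_neg, integral_neg]
    · by_cases h : x.1.1 = true ∧ y.1.1 = true
      · simp only [comp, fullB, fullC, h.1, h.2, and_self, if_true]
        exact congrFun (congrFun (comp_blockB_blockC Γ hα hi) x.2) y.2
      · rw [comp]
        refine integral_eq_zero_of_ae (.of_forall fun t => ?_)
        by_cases h1 : x.1.1 = true
        · have h2 : ¬ y.1.1 = true := fun h2 => h ⟨h1, h2⟩
          simp [fullC, h2]
        · simp [fullB, h1]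
    · refine integral_eq_zero_of_ae (.of_forall fun t => ?_)
      simp [fullB]
  rw [e1, fredholm_add_of_offDiagonal hB hC integrable_label_wt (side := fun x => x.1.1 = true)
    (fun x y h => by
      have := (ite_ne_right_iff.mp h).1
      simp [this.1, this.2]) (fun x y h => by
      have := (ite_ne_right_iff.mp h).1
      simp [this.1, this.2]), e2,
    fredholm_comp_comm hBzb hCzb integrable_label_wt integrable_one_mul_wt]
  congr 1
  funext v v'
  rw [comp_label hCzb hBzb, rightKernel]
  have h1 : ∑ i : Fin (M + 1), comp volume (fun x t => Cz x ((false, i), t))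
      (fun t z => Bz ((false, i), t) z) v v' = 0 :=
    Finset.sum_eq_zero fun i _ => integral_eq_zero_of_ae
      (.of_forall fun t => by simp [hCz, fullC])
  rw [h1, add_zero]
  refine Finset.sum_congr rfl fun j _ => ?_
  rw [comp, comp]
  refine integral_congr_ae (.of_forall fun t => ?_)
  simp only [hCz, hBz, fullB, fullC, and_self, if_true, blockC_zero, blockB_zero]
  have e : ((-1 : ℂ) ^ j.val) * (-1) ^ j.val = 1 := by
    rw [← mul_pow, neg_mul_neg, one_mul, one_pow]
  linear_combination (chainFwd (stepU α β Γ) j (startK α β Γ) v t * endK α β Γ j t v') * e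

end LinkedReduction


/-! ### Products of Cauchy determinants -/

section CauchyProduct

variable {M : ℕ} {α β : Fin (M + 1) → ℝ}

/-- The matrix of the linked Cauchy kernel at given labelled points. -/
noncomputable def linkMatrix {P : Type} (lab : P → Label M) (w : P → ℂ) : Matrix P P ℂ :=
  Matrix.of fun x y => if rowBlock (lab x) = colBlock (lab y) then 1 / (w x - w y) else 0

/-- The label of a variable of the equal-time formula. -/
def varLabel (n : Fin (M + 1) → ℕ) : VarIndex n ⊕ VarIndex n → Label M :=
  Sum.elim (fun x => (true, x.1)) (fun x => (false, x.1))

theorem sign_sumComm (A : Type) [Fintype A] [DecidableEq A] :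
    Equiv.Perm.sign (Equiv.sumComm A A) = (-1) ^ Fintype.card A := by
  have e : Equiv.sumComm A A = (Equiv.boolProdEquivSum A).permCongr
      (Equiv.prodCongrLeft fun _ : A => Equiv.swap false true) := by
    ext x
    rcases x with x | x <;> simp [Equiv.boolProdEquivSum, Equiv.permCongr]
  rw [e, Equiv.Perm.sign_permCongr, Equiv.Perm.sign_prodCongrLeft]
  simp

/-- The number of the Cauchy determinant that has a variable in its rows. -/
def blockIndex (n : Fin (M + 1) → ℕ) (x : VarIndex n ⊕ VarIndex n) : Fin (M + 2) :=
  Sum.elim (fun x => x.1.succ) (fun x => x.1.castSucc) x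

theorem rowBlock_varLabel (n : Fin (M + 1) → ℕ) (x : VarIndex n ⊕ VarIndex n) :
    rowBlock (varLabel n x) = blockIndex n x := by
  rcases x with x | x <;> rfl

theorem colBlock_varLabel (n : Fin (M + 1) → ℕ) (x : VarIndex n ⊕ VarIndex n) :
    colBlock (varLabel n x) = blockIndex n x.swap := by
  rcases x with x | x <;> rfl

theorem det_toSquareBlock {ι P : Type} [Fintype ι] [DecidableEq ι] [Fintype P] [DecidableEq P]
    {m : ℕ} {b : P → Fin m} {k : Fin m} (A : Matrix P P ℂ) (g : ι → P) (hg : ∀ i, b (g i) = k)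
    (hinj : Function.Injective g) (hsurj : ∀ x, b x = k → ∃ i, g i = x) :
    (A.toSquareBlock b k).det = (A.submatrix g g).det := by
  have e : Function.Bijective fun i => (⟨g i, hg i⟩ : {x // b x = k}) :=
    ⟨fun i j h => hinj (congrArg Subtype.val h), fun ⟨x, hx⟩ => by
      obtain ⟨i, hi⟩ := hsurj x hx
      exact ⟨i, Subtype.ext hi⟩⟩
  rw [← Matrix.det_submatrix_equiv_self (Equiv.ofBijective _ e)]
  rfl

/-- The product of the Cauchy determinants is, up to a sign, a single determinant. -/
theorem prod_cauchyDet (n : Fin (M + 1) → ℕ) (w : VarIndex n ⊕ VarIndex n → ℂ) :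
    cauchyDet (fun l : Fin (n 0) => w (Sum.inr ⟨0, l⟩)) (fun l => w (Sum.inl ⟨0, l⟩)) *
    ((∏ k : Fin M,
      cauchyDet
        (Sum.elim (fun l : Fin (n k.castSucc) => w (Sum.inl ⟨k.castSucc, l⟩))
          (fun l : Fin (n k.succ) => w (Sum.inr ⟨k.succ, l⟩)))
        (Sum.elim (fun l : Fin (n k.castSucc) => w (Sum.inr ⟨k.castSucc, l⟩))
          (fun l : Fin (n k.succ) => w (Sum.inl ⟨k.succ, l⟩)))) *
    cauchyDet (fun l : Fin (n (Fin.last M)) => w (Sum.inl ⟨Fin.last M, l⟩))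
      (fun l => w (Sum.inr ⟨Fin.last M, l⟩))) =
    (-1) ^ Fintype.card (VarIndex n) * (linkMatrix (varLabel n) w).det := by
  -- interchanging the columns of `u` and `v` makes the matrix block diagonal
  set A := (linkMatrix (varLabel n) w).submatrix id (Equiv.sumComm (VarIndex n) (VarIndex n)) with hA
  have hentry : ∀ x y, A x y = if blockIndex n x = blockIndex n y then 1 / (w x - w y.swap) else 0 := by
    intro x y
    simp only [hA, Matrix.submatrix_apply, linkMatrix, Matrix.of_apply, id, Equiv.sumComm_apply,
      rowBlock_varLabel, colBlock_varLabel, Sum.swap_swap, Fin.val_inj]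
  have htri : A.BlockTriangular (blockIndex n) := fun x y h => by
    rw [hentry, if_neg h.ne']
  have hdet : A.det = (-1) ^ Fintype.card (VarIndex n) * (linkMatrix (varLabel n) w).det := by
    rw [hA, Matrix.det_permute', sign_sumComm]
    push_cast
    rfl
  have hsub : ∀ {ι : Type} [Fintype ι] [DecidableEq ι] (k : Fin (M + 2))
      (g : ι → VarIndex n ⊕ VarIndex n) (_ : ∀ i, blockIndex n (g i) = k)
      (_ : Function.Injective g) (_ : ∀ x, blockIndex n x = k → ∃ i, g i = x),
      (A.toSquareBlock (blockIndex n) k).det =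
        cauchyDet (fun i => w (g i)) (fun i => w (g i).swap) := by
    intro ι _ _ k g hg hinj hsurj
    rw [det_toSquareBlock A g hg hinj hsurj, cauchyDet]
    congr 1
    ext i j
    rw [Matrix.submatrix_apply, hentry, if_pos ((hg i).trans (hg j).symm), Matrix.of_apply]
  have hmid : ∀ k : Fin M, (A.toSquareBlock (blockIndex n) k.castSucc.succ).det = cauchyDet
      (Sum.elim (fun l : Fin (n k.castSucc) => w (Sum.inl ⟨k.castSucc, l⟩))
        (fun l : Fin (n k.succ) => w (Sum.inr ⟨k.succ, l⟩)))
      (Sum.elim (fun l : Fin (n k.castSucc) => w (Sum.inr ⟨k.castSucc, l⟩))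
        (fun l : Fin (n k.succ) => w (Sum.inl ⟨k.succ, l⟩))) := by
    intro k
    set g : Fin (n k.castSucc) ⊕ Fin (n k.succ) → VarIndex n ⊕ VarIndex n :=
      Sum.elim (fun l => Sum.inl ⟨k.castSucc, l⟩) (fun l => Sum.inr ⟨k.succ, l⟩) with hg
    have e1 : Sum.elim (fun l : Fin (n k.castSucc) => w (Sum.inl ⟨k.castSucc, l⟩))
        (fun l : Fin (n k.succ) => w (Sum.inr ⟨k.succ, l⟩)) = fun i => w (g i) := by
      funext x
      rcases x with x | x <;> rfl
    have e2 : Sum.elim (fun l : Fin (n k.castSucc) => w (Sum.inr ⟨k.castSucc, l⟩))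
        (fun l : Fin (n k.succ) => w (Sum.inl ⟨k.succ, l⟩)) = fun i => w (g i).swap := by
      funext x
      rcases x with x | x <;> rfl
    rw [e1, e2]
    refine hsub _ g ?_ ?_ ?_
    · rintro (x | x) <;> rfl
    · rintro (x | x) (y | y) h
      · simpa [hg] using h
      · exact absurd h Sum.inl_ne_inr
      · exact absurd h Sum.inr_ne_inl
      · simpa [hg] using h
    · rintro (⟨i, l⟩ | ⟨i, l⟩) hx
      · have hi : i = k.castSucc := Fin.succ_injective _ hx
        subst hi
        exact ⟨Sum.inl l, rfl⟩
      · have hi : i = k.succ := Fin.castSucc_injective _ hx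
        subst hi
        exact ⟨Sum.inr l, rfl⟩
  have hlast : (A.toSquareBlock (blockIndex n) (Fin.last M).succ).det =
      cauchyDet (fun l : Fin (n (Fin.last M)) => w (Sum.inl ⟨Fin.last M, l⟩))
        (fun l => w (Sum.inr ⟨Fin.last M, l⟩)) := by
    refine hsub _ (fun l : Fin (n (Fin.last M)) => Sum.inl ⟨Fin.last M, l⟩) (fun _ => rfl)
      (fun i j h => by simpa using h) ?_
    rintro (⟨i, l⟩ | ⟨i, l⟩) hx
    · have hi : i = Fin.last M := Fin.succ_injective _ hx
      subst hi
      exact ⟨l, rfl⟩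
    · have hx' : i.castSucc = (Fin.last M).succ := hx
      have := congrArg Fin.val hx'
      simp only [Fin.val_castSucc, Fin.val_succ, Fin.val_last] at this
      have := i.isLt
      lia
  rw [← hdet, htri.det_fintype, Fin.prod_univ_succ, Fin.prod_univ_castSucc]
  refine congrArg₂ (· * ·) ?_ ?_
  · rw [hsub 0 (fun l : Fin (n 0) => Sum.inr ⟨0, l⟩) (fun _ => rfl)
      (fun i j h => by simpa using h) fun x hx => ?_]
    · rfl
    · rcases x with ⟨i, l⟩ | ⟨i, l⟩
      · exact absurd hx (Fin.succ_ne_zero i)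
      · have hi : i = 0 := by
          simpa [blockIndex] using hx
        subst hi
        exact ⟨l, rfl⟩
  · exact congrArg₂ (· * ·) (Finset.prod_congr rfl fun k _ => (hmid k).symm) hlast.symm

theorem liuIntegrand_eq (n : Fin (M + 1) → ℕ) (w : VarIndex n ⊕ VarIndex n → ℂ) :
    liuIntegrand α β n (fun x => w (Sum.inl x)) (fun x => w (Sum.inr x)) =
      (∏ x, labelWeight α β (varLabel n x) (w x)) * (linkMatrix (varLabel n) w).det := by
  rw [liuIntegrand, prod_cauchyDet n w, Fintype.prod_sum_type]
  have h1 : ∏ x : VarIndex n, labelWeight α β (varLabel n (Sum.inr x)) (w (Sum.inr x)) =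
      (-1) ^ Fintype.card (VarIndex n) * ∏ x : VarIndex n, 1 / F α β x.1 (w (Sum.inr x)) := by
    rw [← Finset.card_univ, ← Finset.prod_const, ← Finset.prod_mul_distrib]
    exact Finset.prod_congr rfl fun x _ => by simp [labelWeight, varLabel]
  have h2 : ∏ x : VarIndex n, labelWeight α β (varLabel n (Sum.inl x)) (w (Sum.inl x)) =
      ∏ x : VarIndex n, F α β x.1 (w (Sum.inl x)) :=
    Finset.prod_congr rfl fun x _ => by simp [labelWeight, varLabel]
  have h3 : ∏ x : VarIndex n, F α β x.1 (w (Sum.inl x)) / F α β x.1 (w (Sum.inr x)) =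
      (∏ x : VarIndex n, F α β x.1 (w (Sum.inl x))) *
        ∏ x : VarIndex n, 1 / F α β x.1 (w (Sum.inr x)) := by
    rw [← Finset.prod_mul_distrib]
    exact Finset.prod_congr rfl fun x _ => by rw [div_eq_mul_one_div]
  rw [h1, h2, h3]
  ring

variable (Γ : ContourSystem M)

theorem liuContours_eq (n : Fin (M + 1) → ℕ) (s s' : VarIndex n → Bool) :
    liuContours Γ n s s' = fun x => sideWedge Γ (Sum.elim s s' x) (varLabel n x) := by
  funext x
  rcases x with x | x <;> rfl

theorem exists_link_le : ∃ C : ℝ, 0 ≤ C ∧ ∀ (s s' : Bool) (y y' : Label M),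
    rowBlock y = colBlock y' → ∀ t t',
      ‖1 / ((sideWedge Γ s y).point t - (sideWedge Γ s' y').point t')‖ ≤ C := by
  have h : ∀ z : (Bool × Bool) × (Label M × Label M), ∃ C : ℝ, 0 ≤ C ∧
      (rowBlock z.2.1 = colBlock z.2.2 → ∀ t t',
        ‖1 / ((sideWedge Γ z.1.1 z.2.1).point t - (sideWedge Γ z.1.2 z.2.2).point t')‖ ≤ C) := by
    intro z
    by_cases hz : rowBlock z.2.1 = colBlock z.2.2
    · obtain ⟨δ, hδ, hs⟩ := exists_sideWedge_sep Γ z.1.1 z.1.2 hz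
      refine ⟨1 / δ, by positivity, fun _ t t' => ?_⟩
      rw [norm_div, norm_one]
      exact one_div_le_one_div_of_le hδ (hs t t')
    · exact ⟨0, le_rfl, fun h => absurd h hz⟩
  choose C hC hb using h
  refine ⟨∑ z, C z, Finset.sum_nonneg fun z _ => hC z, fun s s' y y' hy t t' => ?_⟩
  exact (hb ((s, s'), (y, y')) hy t t').trans
    (Finset.single_le_sum (fun z _ => hC z) (Finset.mem_univ ((s, s'), (y, y'))))

theorem exists_labelWeight_le_uniform (hα : StrictMono α) : ∃ C : ℝ, 0 ≤ C ∧
    ∀ (s : Bool) (y : Label M) (t : ℝ),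
      ‖labelWeight α β y ((sideWedge Γ s y).point t)‖ ≤ C * wt t := by
  choose C hC hb using fun z : Bool × Label M => exists_labelWeight_le (β := β) Γ hα z.1 z.2
  refine ⟨∑ z, C z, Finset.sum_nonneg fun z _ => hC z, fun s y t => (hb (s, y) t).trans ?_⟩
  exact mul_le_mul_of_nonneg_right
    (Finset.single_le_sum (fun z _ => hC z) (Finset.mem_univ (s, y))) (wt_nonneg t)

theorem measurable_linkMatrix_det {P X : Type} [Fintype P] [DecidableEq P] [MeasurableSpace X]
    (lab : P → Label M) {w : X → P → ℂ} (hw : ∀ x, Measurable fun t => w t x) :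
    Measurable fun t => (linkMatrix lab (w t)).det := by
  refine measurable_det fun x y => ?_
  simp only [linkMatrix, Matrix.of_apply]
  split_ifs
  · exact measurable_const.div ((hw x).sub (hw y))
  · exact measurable_const

theorem card_var (n : Fin (M + 1) → ℕ) :
    Fintype.card (VarIndex n ⊕ VarIndex n) = 2 * ∑ i, n i := by
  simp [VarIndex, two_mul]

theorem contourIntegrand_liu (n : Fin (M + 1) → ℕ) (c : VarIndex n ⊕ VarIndex n → Wedge)
    (t : VarIndex n ⊕ VarIndex n → ℝ) :
    contourIntegrand c (fun w => liuIntegrand α β n (fun x => w (Sum.inl x))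
      (fun x => w (Sum.inr x))) t =
    (∏ x, (c x).density (t x) * labelWeight α β (varLabel n x) ((c x).point (t x))) *
      (linkMatrix (varLabel n) fun x => (c x).point (t x)).det := by
  refine (congrArg (fun z => (∏ i, (c i).density (t i)) * z)
    (liuIntegrand_eq (α := α) (β := β) n fun i => (c i).point (t i))).trans ?_
  rw [Finset.prod_mul_distrib, mul_assoc]

variable (α β) in
/-- Uniform bounds on the integrands in the equal-time formula. -/
theorem exists_contourIntegrand_liu_le (hα : StrictMono α) : ∃ C : ℝ, 0 ≤ C ∧
    ∀ (n : Fin (M + 1) → ℕ) (s s' : VarIndex n → Bool) (t : VarIndex n ⊕ VarIndex n → ℝ),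
      ‖contourIntegrand (liuContours Γ n s s') (fun w => liuIntegrand α β n
        (fun x => w (Sum.inl x)) (fun x => w (Sum.inr x))) t‖ ≤
        (Real.sqrt (2 * ∑ i, n i : ℕ) * C) ^ (2 * ∑ i, n i) * ∏ x, wt (t x) := by
  obtain ⟨C₁, hC₁, h1⟩ := exists_link_le Γ
  obtain ⟨C₂, hC₂, h2⟩ := exists_labelWeight_le_uniform (β := β) Γ hα
  refine ⟨C₁ * C₂, by positivity, fun n s s' t => ?_⟩
  rw [contourIntegrand_liu, norm_mul, norm_prod, liuContours_eq]
  have hdet := norm_det_le (linkMatrix (varLabel n) fun x =>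
    (sideWedge Γ (Sum.elim s s' x) (varLabel n x)).point (t x)) hC₁ fun x y => by
      rw [linkMatrix, Matrix.of_apply]
      split_ifs with h
      · exact h1 _ _ _ _ h _ _
      · rw [norm_zero]
        exact hC₁
  rw [card_var] at hdet
  have hw : ∏ x, ‖(sideWedge Γ (Sum.elim s s' x) (varLabel n x)).density (t x) *
      labelWeight α β (varLabel n x)
        ((sideWedge Γ (Sum.elim s s' x) (varLabel n x)).point (t x))‖ ≤ ∏ x, (C₂ * wt (t x)) :=
    Finset.prod_le_prod (fun _ _ => norm_nonneg _) fun x _ => by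
      rw [norm_mul]
      exact (mul_le_of_le_one_left (norm_nonneg _) (Wedge.norm_density_le _ _)).trans (h2 _ _ _)
  refine (mul_le_mul hw hdet (norm_nonneg _)
    (Finset.prod_nonneg fun x _ => mul_nonneg hC₂ (wt_nonneg _))).trans_eq ?_
  rw [Finset.prod_mul_distrib, Finset.prod_const, Finset.card_univ, card_var]
  ring

theorem contourIntegrable_liu (hα : StrictMono α) (n : Fin (M + 1) → ℕ)
    (s s' : VarIndex n → Bool) : ContourIntegrable (liuContours Γ n s s')
      (fun w => liuIntegrand α β n (fun x => w (Sum.inl x)) (fun x => w (Sum.inr x))) := by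
  obtain ⟨C, -, hb⟩ := exists_contourIntegrand_liu_le α β Γ hα
  refine integrable_of_le_prod_wt ?_ (fun t => hb n s s' t)
  rw [show contourIntegrand _ _ = _ from
    funext (contourIntegrand_liu (α := α) (β := β) n (liuContours Γ n s s'))]
  refine Measurable.mul (Finset.measurable_prod _ fun x _ => ?_) (measurable_linkMatrix_det _
    fun x => (Wedge.measurable_point _).comp (measurable_pi_apply x))
  exact ((Wedge.measurable_density _).comp (measurable_pi_apply x)).mul
    ((measurable_comp_point (differentiable_labelWeight _)).comp (measurable_pi_apply x))

variable (α β) in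
theorem exists_contourIntegral_liu_le (hα : StrictMono α) : ∃ C : ℝ, 0 ≤ C ∧
    ∀ (n : Fin (M + 1) → ℕ) (s s' : VarIndex n → Bool),
      ‖contourIntegral (liuContours Γ n s s') (fun w => liuIntegrand α β n
        (fun x => w (Sum.inl x)) (fun x => w (Sum.inr x)))‖ ≤
        (Real.sqrt (2 * ∑ i, n i : ℕ) * C) ^ (2 * ∑ i, n i) := by
  obtain ⟨C, hC, hb⟩ := exists_contourIntegrand_liu_le α β Γ hα
  refine ⟨C * ∫ t, wt t, mul_nonneg hC (integral_nonneg wt_nonneg), fun n s s' => ?_⟩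
  refine (norm_integral_le_of_norm_le ((Integrable.fintype_prod fun _ => integrable_wt).const_mul _)
    (.of_forall fun t => hb n s s' t)).trans_eq ?_
  rw [integral_const_mul, integral_fintype_prod_eq_prod, Finset.prod_const,
    Finset.card_univ, card_var, ← mul_assoc, ← mul_pow]

end CauchyProduct


/-! ### Sorting the terms of a Fredholm series by the multiplicities of the labels -/

section Counts

variable {Y : Type} [Fintype Y] [DecidableEq Y]

/-- How often each label occurs. -/
def counts {P : Type} [Fintype P] (l : P → Y) (y : Y) : ℕ := Fintype.card {a // l a = y}

theorem sum_counts {P : Type} [Fintype P] (l : P → Y) : ∑ y, counts l y = Fintype.card P := by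
  simp only [counts]
  rw [← Fintype.card_sigma, Fintype.card_congr (Equiv.sigmaFiberEquiv l)]

/-- The number of words with prescribed multiplicities is a multinomial coefficient, as the
coefficient of a monomial in a power of the sum of the variables. -/
theorem card_counts_eq (c : Y → ℕ) :
    Fintype.card {l : Fin (∑ y, c y) → Y // counts l = c} = Nat.multinomial Finset.univ c := by
  have h1 := MvPolynomial.coeff_sum_X_pow_of_fintype (R := ℕ) (Finsupp.equivFunOnFinite.symm c)
    (∑ y, c y)
  rw [if_pos (by rw [Finsupp.sum_fintype _ _ fun _ => rfl]; rfl),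
    Finsupp.multinomial_eq_of_support_subset (Finset.subset_univ _), Fintype.sum_pow,
    MvPolynomial.coeff_sum] at h1
  refine Eq.trans ?_ h1
  rw [Fintype.card_subtype, Finset.card_filter]
  refine Finset.sum_congr rfl fun l _ => ?_
  have h2 : ∏ i, (MvPolynomial.X (l i) : MvPolynomial Y ℕ) =
      MvPolynomial.monomial (∑ i, Finsupp.single (l i) 1) 1 := by
    rw [MvPolynomial.monomial_sum_one]
    rfl
  rw [h2, MvPolynomial.coeff_monomial]
  refine if_congr ?_ rfl rfl
  rw [Finsupp.ext_iff, funext_iff]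
  refine forall_congr' fun y => ?_
  rw [Finsupp.finsetSum_apply]
  simp only [Finsupp.single_apply, Finset.sum_boole, counts, Fintype.card_subtype]
  rfl

theorem natCard_counts_fiber (c : Y → ℕ) :
    Nat.card {x : (k : ℕ) × (Fin k → Y) // counts x.2 = c} = Nat.multinomial Finset.univ c := by
  rw [← card_counts_eq, ← Nat.card_eq_fintype_card]
  refine (Nat.card_congr (Equiv.ofBijective (fun l => ⟨⟨_, l.1⟩, l.2⟩) ⟨?_, ?_⟩)).symm
  · rintro ⟨l, hl⟩ ⟨l', hl'⟩ h
    simpa using h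
  · rintro ⟨⟨k, l⟩, hl⟩
    have hk : ∑ y, c y = k := by
      have := sum_counts l
      rw [Fintype.card_fin] at this
      rw [← this, ← hl]
    subst hk
    exact ⟨⟨l, hl⟩, rfl⟩

variable {Ψ : (Y → ℕ) → ℂ}

theorem tsum_counts_fiber (c : Y → ℕ) :
    ∑' x : {x : (k : ℕ) × (Fin k → Y) // counts x.2 = c},
      1 / (x.1.1.factorial : ℂ) * Ψ (counts x.1.2) = 1 / (∏ y, ((c y).factorial : ℂ)) * Ψ c := by
  have h : ∀ x : {x : (k : ℕ) × (Fin k → Y) // counts x.2 = c},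
      1 / (x.1.1.factorial : ℂ) * Ψ (counts x.1.2) =
        1 / ((∑ y, c y).factorial : ℂ) * Ψ c := by
    rintro ⟨⟨k, l⟩, hl⟩
    have := sum_counts l
    rw [Fintype.card_fin] at this
    rw [hl] at this ⊢
    rw [this]
  simp only [h, tsum_const, natCard_counts_fiber, nsmul_eq_mul]
  have hm : (∏ y, ((c y).factorial : ℂ)) * (Nat.multinomial Finset.univ c : ℂ) =
      ((∑ y, c y).factorial : ℂ) := by exact_mod_cast Nat.multinomial_spec Finset.univ c
  have h0 : (∏ y, ((c y).factorial : ℂ)) ≠ 0 :=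
    Finset.prod_ne_zero_iff.mpr fun y _ => by exact_mod_cast Nat.factorial_ne_zero _
  have h1 : ((∑ y, c y).factorial : ℂ) ≠ 0 := by exact_mod_cast Nat.factorial_ne_zero _
  rw [← mul_assoc, ← hm]
  rw [← hm] at h1
  have h2 : (Nat.multinomial Finset.univ c : ℂ) ≠ 0 := right_ne_zero_of_mul h1
  field_simp

theorem summable_words {g : ℕ → ℝ} (hg0 : ∀ k, 0 ≤ g k)
    (hΨ : ∀ c, ‖Ψ c‖ ≤ g (∑ y, c y))
    (hg : Summable fun k : ℕ => 1 / (k.factorial : ℝ) * (Fintype.card Y ^ k * g k)) :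
    Summable fun x : (k : ℕ) × (Fin k → Y) => 1 / (x.1.factorial : ℂ) * Ψ (counts x.2) := by
  have h : Summable fun x : (k : ℕ) × (Fin k → Y) => 1 / (x.1.factorial : ℝ) * g x.1 := by
    refine (summable_sigma_of_nonneg fun x => mul_nonneg (by positivity) (hg0 _)).mpr
      ⟨fun k => Summable.of_finite, hg.congr fun k => ?_⟩
    rw [tsum_fintype]
    dsimp only
    rw [Finset.sum_const, Finset.card_univ, Fintype.card_fun, Fintype.card_fin,
      nsmul_eq_mul]
    push_cast
    ring
  refine Summable.of_norm_bounded h fun x => ?_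
  rw [norm_mul, norm_div, norm_one, Complex.norm_natCast]
  have := hΨ (counts x.2)
  rw [sum_counts, Fintype.card_fin] at this
  gcongr

theorem summable_counts {g : ℕ → ℝ} (hg0 : ∀ k, 0 ≤ g k) (hΨ : ∀ c, ‖Ψ c‖ ≤ g (∑ y, c y))
    (hg : Summable fun k : ℕ => 1 / (k.factorial : ℝ) * (Fintype.card Y ^ k * g k)) :
    Summable fun c : Y → ℕ => 1 / (∏ y, ((c y).factorial : ℂ)) * Ψ c :=
  ((Equiv.sigmaFiberEquiv fun x : (k : ℕ) × (Fin k → Y) => counts x.2).summable_iff.mpr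
    (summable_words hg0 hΨ hg)).sigma.congr fun c => tsum_counts_fiber c

theorem tsum_counts {g : ℕ → ℝ} (hg0 : ∀ k, 0 ≤ g k) (hΨ : ∀ c, ‖Ψ c‖ ≤ g (∑ y, c y))
    (hg : Summable fun k : ℕ => 1 / (k.factorial : ℝ) * (Fintype.card Y ^ k * g k)) :
    ∑' k : ℕ, 1 / (k.factorial : ℂ) * ∑ l : Fin k → Y, Ψ (counts l) =
      ∑' c : Y → ℕ, 1 / (∏ y, ((c y).factorial : ℂ)) * Ψ c := by
  have hs := summable_words hg0 hΨ hg
  set e := Equiv.sigmaFiberEquiv fun x : (k : ℕ) × (Fin k → Y) => counts x.2 with he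
  have h1 := hs.tsum_sigma
  have h2 := (e.summable_iff.mpr hs).tsum_sigma
  rw [show ∑' c, (_ : ℂ) = _ from tsum_congr fun c => (tsum_counts_fiber (Ψ := Ψ) c).symm]
  refine Eq.trans (tsum_congr fun k => ?_) (h1.symm.trans ((e.tsum_eq _).symm.trans h2))
  rw [tsum_fintype, Finset.mul_sum]

end Counts

/-! ### The Fredholm series of the linked kernel -/

section LabelIntegral

variable {Y : Type}

/-- The integral of the determinant of a kernel over points with prescribed labels. -/
noncomputable def labelIntegral (T : Y × ℝ → Y × ℝ → ℂ) {P : Type} [Fintype P] [DecidableEq P]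
    (lab : P → Y) : ℂ :=
  ∫ t : P → ℝ, (Matrix.of fun a b => T (lab a, t a) (lab b, t b)).det

theorem integral_pi_comp_equiv {P P' : Type} [Fintype P] [Fintype P'] (e : P ≃ P')
    (G : (P → ℝ) → ℂ) : ∫ t : P' → ℝ, G (fun a => t (e a)) = ∫ t : P → ℝ, G t := by
  have h := (volume_measurePreserving_piCongrLeft (fun _ : P => ℝ) e.symm).integral_comp
    (MeasurableEquiv.measurableEmbedding _) G
  rw [← h]
  refine integral_congr_ae (.of_forall fun t => congrArg G (funext fun a => ?_))
  have := MeasurableEquiv.piCongrLeft_apply_apply (β := fun _ : P => ℝ) e.symm t (e a)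
  rw [Equiv.symm_apply_apply] at this
  exact this.symm

theorem labelIntegral_comp_equiv (T : Y × ℝ → Y × ℝ → ℂ) {P P' : Type} [Fintype P] [DecidableEq P]
    [Fintype P'] [DecidableEq P'] (e : P ≃ P') (lab : P' → Y) :
    labelIntegral T (fun a => lab (e a)) = labelIntegral T lab := by
  rw [labelIntegral, labelIntegral, ← integral_pi_comp_equiv e]
  refine integral_congr_ae (.of_forall fun t => ?_)
  exact Matrix.det_submatrix_equiv_self e
    (Matrix.of fun a b => T (lab a, t a) (lab b, t b))

variable [Fintype Y] [DecidableEq Y]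

/-- The integral of the determinant over points whose labels have given multiplicities. -/
noncomputable def countIntegral (T : Y × ℝ → Y × ℝ → ℂ) (c : Y → ℕ) : ℂ :=
  labelIntegral T (Sigma.fst : ((y : Y) × Fin (c y)) → Y)

theorem labelIntegral_eq (T : Y × ℝ → Y × ℝ → ℂ) {P : Type} [Fintype P] [DecidableEq P]
    (lab : P → Y) : labelIntegral T lab = countIntegral T (counts lab) := by
  set e : P ≃ (y : Y) × Fin (counts lab y) := (Equiv.sigmaFiberEquiv lab).symm.trans
    (Equiv.sigmaCongrRight fun y => Fintype.equivFin {a // lab a = y}) with he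
  exact labelIntegral_comp_equiv T e Sigma.fst

theorem norm_countIntegral_le {T : Y × ℝ → Y × ℝ → ℂ}
    {C : ℝ} (hC : 0 ≤ C) (h : ∀ x y, ‖T x y‖ ≤ C * (1 * wt y.2)) (c : Y → ℕ) :
    ‖countIntegral T c‖ ≤ (Real.sqrt (∑ y, c y : ℕ) * (C * ∫ t, wt t)) ^ (∑ y, c y) := by
  have hcard : Fintype.card ((y : Y) × Fin (c y)) = ∑ y, c y := by simp
  refine (norm_integral_le_of_norm_le (g := fun t : ((y : Y) × Fin (c y)) → ℝ =>
    (Real.sqrt (∑ y, c y : ℕ) * C) ^ (∑ y, c y) * ∏ a, wt (t a))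
    ((Integrable.fintype_prod fun _ => integrable_wt).const_mul _)
    (.of_forall fun t => ?_)).trans_eq ?_
  · have := norm_det_le_of_le_mul (Matrix.of fun a b : (y : Y) × Fin (c y) =>
      T (a.1, t a) (b.1, t b)) (p := fun _ => 1) (q := fun a => wt (t a)) hC
      (fun _ => zero_le_one) (fun _ => wt_nonneg _) fun a b => h _ _
    simpa only [hcard, one_mul] using this
  · rw [integral_const_mul, integral_fintype_prod_eq_prod, Finset.prod_const,
      Finset.card_univ, hcard, ← mul_pow, mul_assoc]

theorem summable_card_hadamard {C : ℝ} (hC : 0 ≤ C) (n : ℕ) :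
    Summable fun k : ℕ => 1 / (k.factorial : ℝ) * (n ^ k * (Real.sqrt k * C) ^ k) :=
  (summable_hadamard (C := n * C) (by positivity)).congr fun k => by
    rw [← mul_pow]
    ring_nf

theorem fredholm_eq_tsum_counts [MeasurableSpace Y] [MeasurableSingletonClass Y]
    {T : Y × ℝ → Y × ℝ → ℂ}
    (hT : KernelBound (fun _ => 1) (fun x => wt x.2) T) :
    fredholm ((Measure.count : Measure Y).prod volume) T =
      ∑' c : Y → ℕ, 1 / (∏ y, ((c y).factorial : ℂ)) * countIntegral T c := by
  obtain ⟨C, hC, hb⟩ := hT.bound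
  have hI : 0 ≤ ∫ t, wt t := integral_nonneg wt_nonneg
  have hint : Integrable (fun x : Y × ℝ => (1 : ℝ) * wt x.2)
      ((Measure.count : Measure Y).prod volume) :=
    integrable_count_prod ((measurable_wt.comp measurable_snd).const_mul 1)
      fun _ => integrable_one_mul_wt
  rw [← tsum_counts (g := fun k => (Real.sqrt k * (C * ∫ t, wt t)) ^ k) (fun k => by positivity)
    (fun c => norm_countIntegral_le hC hb c) (summable_card_hadamard (by positivity) _), fredholm]
  refine tsum_congr fun k => ?_
  rw [fredholmCoeff, integral_pi_count_prod (hT.integrable_det hint k)]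
  congr 1
  exact Finset.sum_congr rfl fun l _ => labelIntegral_eq T l

end LabelIntegral

section LinkSeries

variable {M : ℕ} {α β : Fin (M + 1) → ℝ} (Γ : ContourSystem M)

theorem counts_eq_of_bijection {P : Type} [Fintype P] (lab : P → Label M) (σ : Equiv.Perm P)
    (h : ∀ x, rowBlock (lab (σ x)) = colBlock (lab x)) (i : Fin (M + 1)) :
    counts lab (true, i) = counts lab (false, i) := by
  classical
  simp only [counts, Fintype.card_subtype, Finset.card_filter]
  -- compare how many rows and how many columns belong to the blocks up to `i`
  have key : ∀ y : Label M, (if rowBlock y ≤ i then 1 else 0) + (if y = (true, i) then 1 else 0) =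
      (if colBlock y ≤ i then 1 else 0) + (if y = (false, i) then 1 else 0) := by
    rintro ⟨b, j⟩
    cases b <;> simp only [rowBlock, colBlock, Prod.mk.injEq, Fin.ext_iff, if_true,
      Bool.false_eq_true, if_false, true_and, false_and, reduceCtorEq] <;> split_ifs <;> lia
  have h1 : ∑ x, (if rowBlock (lab x) ≤ i then 1 else 0) =
      ∑ x, (if colBlock (lab x) ≤ i then 1 else 0) := by
    rw [← Equiv.sum_comp σ]
    exact Finset.sum_congr rfl fun x _ => by rw [h]
  have h2 := Finset.sum_congr (rfl : (Finset.univ : Finset P) = _) fun x _ => key (lab x)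
  rw [Finset.sum_add_distrib, Finset.sum_add_distrib, h1] at h2
  exact Nat.add_left_cancel h2

/-- Each Cauchy determinant has as many rows as columns. -/
theorem countIntegral_linkKernel_eq_zero {c : Label M → ℕ} {i : Fin (M + 1)}
    (hc : c (true, i) ≠ c (false, i)) : countIntegral (linkKernel α β Γ) c = 0 := by
  refine integral_eq_zero_of_ae (.of_forall fun t => ?_)
  beta_reduce
  rw [Matrix.det_apply]
  refine Finset.sum_eq_zero fun σ _ => ?_
  by_contra hne
  refine hc ?_
  have hσ : ∀ x : (y : Label M) × Fin (c y), rowBlock (σ x).1 = colBlock x.1 := by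
    intro x
    by_contra hx
    refine hne ?_
    rw [Finset.prod_eq_zero (Finset.mem_univ x) (by rw [Matrix.of_apply, linkKernel, if_neg hx]),
      smul_zero]
  have hcount : counts (Sigma.fst : ((y : Label M) × Fin (c y)) → Label M) = c := by
    funext y
    rw [counts, Fintype.card_subtype, Finset.card_filter, Fintype.sum_sigma]
    refine (Finset.sum_eq_single y (fun x _ hx => Finset.sum_eq_zero fun _ _ => if_neg hx)
      fun h => absurd (Finset.mem_univ _) h).trans ?_
    simp
  rw [← hcount]
  exact counts_eq_of_bijection _ σ hσ i

/-- The multiplicities of the labels of the variables of `D_n`. -/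
def labelCounts (n : Fin (M + 1) → ℕ) (y : Label M) : ℕ := n y.2

theorem labelCounts_injective : Function.Injective (labelCounts (M := M)) := fun _ _ h =>
  funext fun i => congrFun h (true, i)

theorem sum_labelCounts (n : Fin (M + 1) → ℕ) : ∑ y, labelCounts n y = 2 * ∑ i, n i := by
  simp [labelCounts, Fintype.sum_prod_type, two_mul]

theorem prod_factorial_labelCounts (n : Fin (M + 1) → ℕ) :
    ∏ y, ((labelCounts n y).factorial : ℂ) = (∏ i, ((n i).factorial : ℂ)) ^ 2 := by
  simp [labelCounts, Fintype.prod_prod_type, pow_two]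

theorem counts_varLabel (n : Fin (M + 1) → ℕ) : counts (varLabel n) = labelCounts n := by
  funext ⟨b, i⟩
  rw [counts, labelCounts, Fintype.card_subtype, Finset.card_filter, Fintype.sum_sum_type,
    Fintype.sum_sigma, Fintype.sum_sigma]
  cases b <;> simp [varLabel]

variable (α β) in
/-- The integral of the equal-time integrand over the contours of the labels. -/
noncomputable def linkTerm (n : Fin (M + 1) → ℕ) : ℂ :=
  contourIntegral (fun x => labelWedge Γ (varLabel n x)) (fun w => liuIntegrand α β n
    (fun x => w (Sum.inl x)) (fun x => w (Sum.inr x)))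

theorem linkTerm_eq (n : Fin (M + 1) → ℕ) :
    linkTerm α β Γ n = countIntegral (linkKernel α β Γ) (labelCounts n) := by
  rw [← counts_varLabel, ← labelIntegral_eq, linkTerm, contourIntegral, labelIntegral]
  refine integral_congr_ae (.of_forall fun t => ?_)
  beta_reduce
  rw [contourIntegrand_liu, ← Matrix.det_mul_row]
  congr 1
  ext x y
  simp only [Matrix.of_apply, linkMatrix, linkKernel]
  split_ifs
  · ring
  · rw [mul_zero]

/-- The Fredholm series of the linked kernel is the series of the equal-time formula with the
`z`-dependence removed. -/
theorem fredholm_linkKernel_eq_tsum (hα : StrictMono α) :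
    fredholm (labelMeasure M) (linkKernel α β Γ) =
      ∑' n : Fin (M + 1) → ℕ, 1 / (∏ i, ((n i).factorial : ℂ)) ^ 2 * linkTerm α β Γ n := by
  rw [fredholm_eq_tsum_counts (linkKernel_bound Γ hα),
    ← labelCounts_injective.tsum_eq fun c hc => ?_]
  · refine tsum_congr fun n => ?_
    rw [prod_factorial_labelCounts, linkTerm_eq]
  · refine ⟨fun i => c (true, i), funext fun ⟨b, i⟩ => ?_⟩
    cases b
    · by_contra hne
      exact hc (by beta_reduce; rw [countIntegral_linkKernel_eq_zero Γ hne, mul_zero])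
    · rfl

end LinkSeries


/-! ### Integrating out one variable of the equal-time formula -/

section OneVariable

theorem integrable_pi_comp_equiv {P P' : Type} [Fintype P] [Fintype P'] (e : P ≃ P')
    {G : (P → ℝ) → ℂ} (hG : Integrable G) : Integrable fun t : P' → ℝ => G (fun a => t (e a)) := by
  refine (((volume_measurePreserving_piCongrLeft (fun _ : P => ℝ) e.symm).integrable_comp_emb
    (MeasurableEquiv.measurableEmbedding _)).mpr hG).congr
    (.of_forall fun t => congrArg G (funext fun a => ?_))
  have := MeasurableEquiv.piCongrLeft_apply_apply (β := fun _ : P => ℝ) e.symm t (e a)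
  rwa [Equiv.symm_apply_apply] at this

variable {ι : Type} [Fintype ι] [DecidableEq ι]

theorem integral_eq_zero_of_update {G : (ι → ℝ) → ℂ} (hG : Integrable G) (i : ι)
    (h : ∀ t : ι → ℝ, ∫ v, G (Function.update t i v) = 0) : ∫ t, G t = 0 := by
  set e : ι ≃ {a // a ≠ i} ⊕ Unit :=
    (Equiv.optionSubtypeNe i).symm.trans (Equiv.optionEquivSumPUnit _) with he
  rw [← integral_pi_comp_equiv e, integral_sum_unit (integrable_pi_comp_equiv e hG)]
  refine integral_eq_zero_of_ae (.of_forall fun t => ?_)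
  refine Eq.trans ?_ (h fun a => Sum.elim t (fun _ => 0) (e a))
  refine integral_congr_ae (.of_forall fun v => congrArg G (funext fun a => ?_))
  by_cases ha : a = i
  · subst ha
    simp [he]
  · rw [Function.update_of_ne ha]
    simp [he, Equiv.optionSubtypeNe_symm_of_ne ha]

theorem contourIntegral_eq_zero_of_update {c : ι → Wedge} {g : (ι → ℂ) → ℂ}
    (hg : ContourIntegrable c g) (i : ι)
    (h : ∀ p : ι → ℂ, (∀ j, ∃ t, p j = (c j).point t) →
      wedgeIntegral (c i) (fun w => g (Function.update p i w)) = 0) :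
    contourIntegral c g = 0 := by
  refine integral_eq_zero_of_update hg i fun t => ?_
  have e : ∀ v, contourIntegrand c g (Function.update t i v) =
      (∏ j ∈ Finset.univ.erase i, (c j).density (t j)) * ((c i).density v *
        g (Function.update (fun j => (c j).point (t j)) i ((c i).point v))) := by
    intro v
    have e1 : (fun j => (c j).point (Function.update t i v j)) =
        Function.update (fun j => (c j).point (t j)) i ((c i).point v) := by
      funext j
      by_cases hj : j = i
      · subst hj
        simp
      · simp [Function.update_of_ne hj]
    rw [contourIntegrand, e1, ← Finset.mul_prod_erase _ _ (Finset.mem_univ i),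
      Function.update_self, Finset.prod_congr rfl fun j hj => by
        rw [Function.update_of_ne (Finset.ne_of_mem_erase hj)]]
    ring
  simp only [e]
  rw [integral_const_mul]
  have := h (fun j => (c j).point (t j)) fun j => ⟨t j, rfl⟩
  rw [wedgeIntegral] at this
  rw [this, mul_zero]

end OneVariable

/-! ### Vanishing integrals -/

section Vanishing

variable {M : ℕ} {α β : Fin (M + 1) → ℝ} (Γ : ContourSystem M)

theorem rowBlock_ne_colBlock (y : Label M) : rowBlock y ≠ colBlock y := by
  obtain ⟨b, i⟩ := y
  cases b <;> simp [rowBlock, colBlock]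

theorem exists_linkMatrix_update_le {P : Type} [DecidableEq P] (lab : P → Label M)
    (p : P → ℂ) (i : P) {a : ℝ}
    (h : ∀ y, rowBlock (lab i) = colBlock (lab y) ∨ rowBlock (lab y) = colBlock (lab i) →
      wedgeLevel (Real.pi / 5) (p y) < a) (x y : P) :
    ∃ C : ℝ, 0 ≤ C ∧ ∀ w, a ≤ wedgeLevel (Real.pi / 5) w →
      DifferentiableAt ℂ (fun w => linkMatrix lab (Function.update p i w) x y) w ∧
      ‖linkMatrix lab (Function.update p i w) x y‖ ≤ C := by
  simp only [linkMatrix, Matrix.of_apply]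
  by_cases hxy : rowBlock (lab x) = colBlock (lab y)
  · simp only [if_pos hxy]
    set K := 1 + |Real.cos (Real.pi / 5) / Real.sin (Real.pi / 5)|
    have hK : 0 < K := by positivity
    have hdist : ∀ u w, wedgeLevel (Real.pi / 5) u < a → a ≤ wedgeLevel (Real.pi / 5) w →
        (a - wedgeLevel (Real.pi / 5) u) / K ≤ ‖w - u‖ ∧ w - u ≠ 0 := by
      intro u w hu hw
      have h1 := (le_abs_self _).trans (abs_wedgeLevel_sub_le (Real.pi / 5) w u)
      have h2 : (a - wedgeLevel (Real.pi / 5) u) / K ≤ ‖w - u‖ := by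
        rw [div_le_iff₀' hK]
        linarith
      exact ⟨h2, norm_pos_iff.mp ((div_pos (sub_pos.mpr hu) hK).trans_le h2)⟩
    by_cases hx : x = i
    · have hy : y ≠ i := fun hy => rowBlock_ne_colBlock (lab i) (by rwa [hx, hy] at hxy)
      subst hx
      have hl := h y (Or.inl hxy)
      simp only [Function.update_self, Function.update_of_ne hy]
      refine ⟨1 / ((a - wedgeLevel (Real.pi / 5) (p y)) / K),
        (one_div_pos.mpr (div_pos (sub_pos.mpr hl) hK)).le, fun w hw => ?_⟩
      obtain ⟨h1, h2⟩ := hdist _ _ hl hw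
      refine ⟨(differentiableAt_const _).div (differentiableAt_id.sub_const _) h2, ?_⟩
      rw [norm_div, norm_one]
      exact one_div_le_one_div_of_le (div_pos (sub_pos.mpr hl) hK) h1
    · by_cases hy : y = i
      · subst hy
        have hl := h x (Or.inr hxy)
        simp only [Function.update_self, Function.update_of_ne hx]
        refine ⟨1 / ((a - wedgeLevel (Real.pi / 5) (p x)) / K),
          (one_div_pos.mpr (div_pos (sub_pos.mpr hl) hK)).le, fun w hw => ?_⟩
        obtain ⟨h1, h2⟩ := hdist _ _ hl hw
        rw [← neg_ne_zero, neg_sub] at h2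
        refine ⟨(differentiableAt_const _).div (differentiableAt_id.const_sub _) h2, ?_⟩
        rw [norm_div, norm_one, norm_sub_rev]
        exact one_div_le_one_div_of_le (div_pos (sub_pos.mpr hl) hK) h1
      · simp only [Function.update_of_ne hx, Function.update_of_ne hy]
        exact ⟨_, norm_nonneg _, fun w _ => ⟨differentiableAt_const _, le_rfl⟩⟩
  · simp only [if_neg hxy]
    exact ⟨0, le_rfl, fun w _ => ⟨differentiableAt_const _, norm_zero.le⟩⟩

theorem exists_inv_F_region_le (hα : StrictMono α) {i : Fin (M + 1)} (hi : i ≠ 0) :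
    ∃ C : ℝ, 0 ≤ C ∧ ∀ w : ℂ, 0 ≤ wedgeLevel (Real.pi / 5) w →
      ‖labelWeight α β (false, i) w‖ ≤ C * Real.exp (-(2 * w.re)) := by
  obtain ⟨C, hC, h⟩ := exists_quotV_region_le (β := β) hα hi le_rfl
  refine ⟨C, hC, fun w hw => (le_of_eq ?_).trans (h w hw)⟩
  rw [labelWeight, if_neg (by simp), norm_neg, quotV,
    div_mul_cancel_right₀ (f_ne_zero α β i w), one_div]

/-- A variable `v` of maximal index among those on an `in` contour can be moved to infinity, unless
its index is the first one. -/
theorem contourIntegral_liu_eq_zero (hα : StrictMono α) (n : Fin (M + 1) → ℕ)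
    (s s' : VarIndex n → Bool) {x : VarIndex n} (hx : x.1 ≠ 0) (hs : s' x = true) :
    contourIntegral (liuContours Γ n s s') (fun w => liuIntegrand α β n
      (fun x => w (Sum.inl x)) (fun x => w (Sum.inr x))) = 0 := by
  obtain ⟨x₀, hx₀, hmax⟩ := Finset.exists_max_image
    (Finset.univ.filter fun x : VarIndex n => s' x = true) (fun x => x.1) ⟨x, by simpa using hs⟩
  simp only [Finset.mem_filter, Finset.mem_univ, true_and] at hx₀ hmax
  have h0 : x₀.1 ≠ 0 := fun h => hx (Fin.le_zero_iff.mp (h ▸ hmax x hs))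
  refine contourIntegral_eq_zero_of_update (contourIntegrable_liu Γ hα n s s') (Sum.inr x₀)
    fun p hp => ?_
  have hc : liuContours Γ n s s' (Sum.inr x₀) = ⟨Real.pi / 5, Γ.rightIn x₀.1⟩ := by
    simp [liuContours, hx₀, rightWedge]
  have hpos := Γ.rightIn_pos x₀.1
  have hlev : ∀ y, rowBlock (varLabel n (Sum.inr x₀)) = colBlock (varLabel n y) ∨
      rowBlock (varLabel n y) = colBlock (varLabel n (Sum.inr x₀)) →
      wedgeLevel (Real.pi / 5) (p y) < Γ.rightIn x₀.1 := by
    intro y hy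
    obtain ⟨t, ht⟩ := hp y
    rw [ht]
    rcases y with y | y
    · refine (leftWedge_level_neg ?_ t).trans hpos
      split_ifs
      · exact Γ.leftIn_neg _
      · exact Γ.leftOut_neg _
    · change wedgeLevel _ ((rightWedge _).point t) < _
      rw [rightLevel_point]
      simp only [varLabel, Sum.elim_inr, rowBlock, colBlock, Bool.false_eq_true, if_false] at hy
      split_ifs with hsy
      · refine Γ.rightIn_strictMono (lt_of_le_of_ne (hmax y hsy) fun h => ?_)
        rw [h] at hy
        lia
      · refine (Γ.rightOut_strictAnti.antitone (Fin.zero_le y.1)).trans_lt ?_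
        rw [Γ.rightOut_zero]
        exact Γ.rightIn_strictMono (Fin.pos_iff_ne_zero.mpr h0)
  choose C hC hb using exists_linkMatrix_update_le (varLabel n) p (Sum.inr x₀) hlev
  obtain ⟨D, hD, hw⟩ := exists_inv_F_region_le (β := β) hα h0
  have hsum : ∀ x y, C x y ≤ ∑ x, ∑ y, C x y := fun x y =>
    (Finset.single_le_sum (fun y _ => hC x y) (Finset.mem_univ y)).trans
      (Finset.single_le_sum (f := fun x => ∑ y, C x y)
        (fun x _ => Finset.sum_nonneg fun y _ => hC x y) (Finset.mem_univ x))
  set S := ∑ x, ∑ y, C x y with hS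
  have hS0 : 0 ≤ S := Finset.sum_nonneg fun x _ => Finset.sum_nonneg fun y _ => hC x y
  have e : (fun w => liuIntegrand α β n (fun x => Function.update p (Sum.inr x₀) w (Sum.inl x))
      (fun x => Function.update p (Sum.inr x₀) w (Sum.inr x))) = fun w =>
      (∏ x ∈ Finset.univ.erase (Sum.inr x₀), labelWeight α β (varLabel n x) (p x)) *
        (labelWeight α β (false, x₀.1) w *
          (linkMatrix (varLabel n) (Function.update p (Sum.inr x₀) w)).det) := by
    funext w
    rw [liuIntegrand_eq n, ← Finset.mul_prod_erase _ _ (Finset.mem_univ (Sum.inr x₀)),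
      Function.update_self, Finset.prod_congr rfl fun j hj => by
        rw [Function.update_of_ne (Finset.ne_of_mem_erase hj)]]
    simp only [varLabel, Sum.elim_inr]
    ring
  rw [hc, e]
  set Q := ∏ x ∈ Finset.univ.erase (Sum.inr x₀), labelWeight α β (varLabel n x) (p x)
  refine wedgeIntegral_eq_zero_of_decay sin_pi_div_five_pos cos_pi_div_five_pos
    (C := ‖Q‖ * (D * (Real.sqrt (Fintype.card (VarIndex n ⊕ VarIndex n)) * S) ^
      Fintype.card (VarIndex n ⊕ VarIndex n))) (fun w hw' => ?_) fun w hw' => ?_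
  · refine ((differentiable_labelWeight _ w).mul ?_).const_mul _
    simp only [Matrix.det_apply']
    exact DifferentiableAt.fun_sum fun σ _ => (DifferentiableAt.fun_finsetProd fun x _ =>
      (hb _ _ w hw').1).const_mul _
  · have h1 := norm_det_le (linkMatrix (varLabel n) (Function.update p (Sum.inr x₀) w)) hS0
      fun x y => (hb x y w hw').2.trans (hsum x y)
    have h2 := (hw w (hpos.le.trans hw')).trans (exp_neg_two_re_le hD (hpos.le.trans hw'))
    rw [norm_mul, norm_mul]
    refine (mul_le_mul_of_nonneg_left (mul_le_mul h2 h1 (norm_nonneg _)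
      (mul_nonneg hD (Real.exp_pos _).le)) (norm_nonneg Q)).trans_eq ?_
    ring

end Vanishing


/-! ### Integrals over tori -/

section Torus

theorem norm_torusMap {n : ℕ} {r : Fin n → ℝ} (hr : ∀ k, 0 < r k) (θ : Fin n → ℝ) (k : Fin n) :
    ‖torusMap 0 r θ k‖ = r k := by
  simp [torusMap, abs_of_pos (hr k)]

theorem continuous_torusMap {n : ℕ} (r : Fin n → ℝ) : Continuous (torusMap 0 r) := by
  unfold torusMap
  fun_prop

theorem torusIntegral_congr {n : ℕ} {r : Fin n → ℝ} (hr : ∀ k, 0 < r k) {f g : (Fin n → ℂ) → ℂ}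
    (h : ∀ z, (∀ k, ‖z k‖ = r k) → f z = g z) : torusIntegral f 0 r = torusIntegral g 0 r := by
  simp only [torusIntegral, h _ (norm_torusMap hr _)]

theorem torusIntegrable_of_continuous {n : ℕ} {r : Fin n → ℝ} {f : (Fin n → ℂ) → ℂ}
    (h : Continuous fun θ => f (torusMap 0 r θ)) : TorusIntegrable f 0 r :=
  h.continuousOn.integrableOn_compact isCompact_Icc

theorem torusIntegral_tsum_mul {ι : Type} [Countable ι] {n : ℕ} {r : Fin n → ℝ}
    {a : ι → (Fin n → ℂ) → ℂ} {Q : (Fin n → ℂ) → ℂ}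
    (ha : ∀ i, Continuous fun θ => a i (torusMap 0 r θ))
    (hQ : Continuous fun θ => Q (torusMap 0 r θ)) {b : ι → ℝ} (hb : Summable b)
    (hab : ∀ i θ, ‖a i (torusMap 0 r θ)‖ ≤ b i) :
    TorusIntegrable (fun z => (∑' i, a i z) * Q z) 0 r ∧
      torusIntegral (fun z => (∑' i, a i z) * Q z) 0 r =
        ∑' i, torusIntegral (fun z => a i z * Q z) 0 r := by
  refine ⟨torusIntegrable_of_continuous ((continuous_tsum ha hb hab).mul hQ), ?_⟩
  set J : (Fin n → ℝ) → ℂ := fun θ => ∏ k, r k * Complex.exp (θ k * Complex.I) * Complex.I with hJ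
  have hJc : Continuous J := by
    simp only [hJ]
    fun_prop
  refine (hasSum_integral_of_dominated_convergence
    (fun i θ => ‖J θ * Q (torusMap 0 r θ)‖ * b i) (fun i => ?_) (fun i => ?_) ?_ ?_ ?_).tsum_eq.symm
  · exact (hJc.smul ((ha i).mul hQ)).aestronglyMeasurable
  · refine Filter.Eventually.of_forall fun θ => ?_
    rw [smul_eq_mul, mul_left_comm, norm_mul, mul_comm]
    exact mul_le_mul_of_nonneg_left (hab i θ) (norm_nonneg _)
  · exact Filter.Eventually.of_forall fun θ => hb.mul_left _
  · simp only [tsum_mul_left]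
    exact ((hJc.mul hQ).norm.mul continuous_const).continuousOn.integrableOn_compact isCompact_Icc
  · refine Filter.Eventually.of_forall fun θ => ?_
    exact ((hb.of_norm_bounded fun i => hab i θ).hasSum.mul_right _).const_smul _

/-- The Cauchy integral formula at the centre of a polydisc. -/
theorem torusIntegral_eq_center : ∀ {n : ℕ} {H : (Fin n → ℂ) → ℂ} {r : Fin n → ℝ},
    (∀ k, 0 < r k ∧ r k < 1) → DifferentiableOn ℂ H {z | ∀ k, ‖z k‖ < 1} →
    torusIntegral (fun z => H z * ∏ k, 1 / (2 * (Real.pi : ℂ) * Complex.I * z k)) 0 r = H 0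
  | 0, H, r, _, _ => by
    rw [torusIntegral_dim0]
    simp
  | n + 1, H, r, hr, hH => by
    have hpi : (2 * (Real.pi : ℂ) * Complex.I) ≠ 0 := Complex.two_pi_I_ne_zero
    have hz0 : ∀ θ k, torusMap 0 r θ k ≠ 0 := fun θ k => norm_pos_iff.mp (by
      rw [norm_torusMap fun k => (hr k).1]
      exact (hr k).1)
    rw [torusIntegral_succ (torusIntegrable_of_continuous ?_)]
    · have h1 : ∀ x ∈ Metric.sphere (0 : ℂ) (r 0),
          torusIntegral (fun y : Fin n → ℂ => H (Fin.cons x y) * ∏ k : Fin (n + 1),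
            1 / (2 * (Real.pi : ℂ) * Complex.I * (Fin.cons x y : Fin (n + 1) → ℂ) k)) 0
            (r ∘ Fin.succ) = (2 * (Real.pi : ℂ) * Complex.I)⁻¹ • ((x - 0)⁻¹ • H (Fin.cons x 0)) := by
        intro x hx
        have hx1 : ‖x‖ < 1 := by
          rw [mem_sphere_zero_iff_norm.mp hx]
          exact (hr 0).2
        have hd : DifferentiableOn ℂ (fun y : Fin n → ℂ => (2 * (Real.pi : ℂ) * Complex.I)⁻¹ •
            ((x - 0)⁻¹ • H (Fin.cons x y))) {z | ∀ k, ‖z k‖ < 1} := by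
          have hc : DifferentiableOn ℂ (fun y : Fin n → ℂ => H (Fin.cons x y))
              {z | ∀ k, ‖z k‖ < 1} := by
            refine hH.comp (fun y _ => DifferentiableAt.differentiableWithinAt ?_) fun y hy => ?_
            · refine differentiableAt_pi.mpr fun k => ?_
              induction k using Fin.cases with
              | zero => exact differentiableAt_const x
              | succ k => exact differentiableAt_apply k y
            · intro k
              induction k using Fin.cases with
              | zero => exact hx1
              | succ k => exact hy k
          have := (hc.const_smul (x - 0)⁻¹).const_smul (2 * (Real.pi : ℂ) * Complex.I)⁻¹
          exact this
        refine Eq.trans ?_ (torusIntegral_eq_center (fun k => hr k.succ) hd)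
        refine congrArg (fun g => torusIntegral g 0 (r ∘ Fin.succ)) (funext fun y => ?_)
        rw [Fin.prod_univ_succ]
        simp only [Fin.cons_zero, Fin.cons_succ, smul_eq_mul, sub_zero]
        rw [one_div (2 * (Real.pi : ℂ) * Complex.I * x), mul_inv]
        ring
      rw [show (0 : Fin (n + 1) → ℂ) 0 = 0 from rfl,
        show (0 : Fin (n + 1) → ℂ) ∘ Fin.succ = 0 from rfl,
        circleIntegral.integral_congr (hr 0).1.le h1, circleIntegral.integral_smul]
      have hd : DifferentiableOn ℂ (fun x : ℂ => H (Fin.cons x 0)) (Metric.ball 0 1) := by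
        refine hH.comp (fun x _ => DifferentiableAt.differentiableWithinAt ?_) fun x hx => ?_
        · refine differentiableAt_pi.mpr fun k => ?_
          induction k using Fin.cases with
          | zero => exact differentiableAt_id
          | succ k => exact differentiableAt_const _
        · intro k
          induction k using Fin.cases with
          | zero => simpa using hx
          | succ k => simp
      have hcl : DiffContOnCl ℂ (fun x : ℂ => H (Fin.cons x 0)) (Metric.ball 0 (r 0)) :=
        DifferentiableOn.diffContOnCl_ball (U := Metric.ball 0 1) hd
          (Metric.closedBall_subset_ball (hr 0).2)
      rw [hcl.two_pi_i_inv_smul_circleIntegral_sub_inv_smul (Metric.mem_ball_self (hr 0).1)]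
      congr 1
      funext k
      induction k using Fin.cases with
      | zero => rfl
      | succ k => rfl
    · refine Continuous.mul (hH.continuousOn.comp_continuous (continuous_torusMap r) fun θ k => ?_)
        (continuous_finsetProd _ fun k _ => ?_)
      · rw [norm_torusMap fun k => (hr k).1]
        exact (hr k).2
      · exact continuous_const.div (continuous_const.mul
          ((continuous_apply k).comp (continuous_torusMap r))) fun θ => mul_ne_zero hpi (hz0 θ k)

end Torus

/-! ### The equal-time formula -/

section EqualTime

variable {M : ℕ} {α β : Fin (M + 1) → ℝ} (Γ : ContourSystem M)

/-- The choice of sides of the variables `v` that gives a nonzero integral. -/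
def outSides (n : Fin (M + 1) → ℕ) (x : VarIndex n) : Bool := decide (x.1 = 0)

variable (α β) in
/-- `D_n(z)` without the vanishing integrals, and with the powers of `z` cancelled. -/
noncomputable def liuReduced (n : Fin (M + 1) → ℕ) (z : Fin M → ℂ) : ℂ :=
  (∏ k : Fin M, (1 - z k) ^ n k.castSucc) *
  ∑ s : VarIndex n → Bool, (∏ x, sideWeight z x.1 (s x)) *
    contourIntegral (liuContours Γ n s (outSides n))
      (fun w => liuIntegrand α β n (fun x => w (Sum.inl x)) (fun x => w (Sum.inr x)))

theorem prod_sideWeight_outSides (n : Fin (M + 1) → ℕ) (z : Fin M → ℂ) :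
    ∏ x, sideWeight z x.1 (outSides n x) = ∏ k : Fin M, (-(z k / (1 - z k))) ^ n k.succ := by
  rw [Fintype.prod_sigma, Fin.prod_univ_succ, Finset.prod_eq_one fun l _ => by
    simp [sideWeight, outSides], one_mul]
  refine Finset.prod_congr rfl fun k _ => ?_
  simp [sideWeight, outSides, Fin.succ_ne_zero]

theorem liuTerm_eq (hα : StrictMono α) (n : Fin (M + 1) → ℕ) {z : Fin M → ℂ}
    (hz : ∀ k, z k ≠ 0 ∧ z k ≠ 1) : liuTerm α β Γ n z = liuReduced α β Γ n z := by
  have h1 : ∀ s s' : VarIndex n → Bool, s' ≠ outSides n →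
      (∏ x, sideWeight z x.1 (s x)) * (∏ x, sideWeight z x.1 (s' x)) *
        contourIntegral (liuContours Γ n s s')
          (fun w => liuIntegrand α β n (fun x => w (Sum.inl x)) (fun x => w (Sum.inr x))) = 0 := by
    intro s s' hs
    obtain ⟨x, hx⟩ := Function.ne_iff.mp hs
    by_cases h0 : x.1 = 0
    · have hf : s' x = false := by simpa [outSides, h0] using hx
      have hw : sideWeight z x.1 (s' x) = 0 := by
        rw [h0, hf]
        simp [sideWeight]
      rw [Finset.prod_eq_zero (f := fun x => sideWeight z x.1 (s' x)) (Finset.mem_univ x) hw,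
        mul_zero, zero_mul]
    · have ht : s' x = true := by simpa [outSides, h0] using hx
      rw [contourIntegral_liu_eq_zero Γ hα n s s' h0 ht, mul_zero]
  rw [liuTerm, liuReduced, Finset.prod_mul_distrib, mul_assoc]
  congr 1
  rw [Finset.mul_sum]
  refine Finset.sum_congr rfl fun s _ => ?_
  rw [Finset.sum_eq_single (outSides n) (fun s' _ hs => h1 s s' hs)
    fun h => absurd (Finset.mem_univ _) h, prod_sideWeight_outSides]
  have h2 : (∏ k : Fin M, (1 - (z k)⁻¹) ^ n k.succ) *
      ∏ k : Fin M, (-(z k / (1 - z k))) ^ n k.succ = 1 := by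
    rw [← Finset.prod_mul_distrib]
    refine Finset.prod_eq_one fun k _ => ?_
    obtain ⟨h0, h1⟩ := hz k
    have h1' : 1 - z k ≠ 0 := sub_ne_zero.mpr h1.symm
    rw [← mul_pow, show (1 - (z k)⁻¹) * -(z k / (1 - z k)) = 1 by field_simp; ring, one_pow]
  linear_combination (exp := 1) (∏ x, sideWeight z x.1 (s x)) *
    contourIntegral (liuContours Γ n s (outSides n)) (fun w => liuIntegrand α β n
      (fun x => w (Sum.inl x)) (fun x => w (Sum.inr x))) * h2

/-- At `z = 0` only the `in` contours have a nonzero coefficient. -/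
theorem liuReduced_zero (n : Fin (M + 1) → ℕ) : liuReduced α β Γ n 0 = linkTerm α β Γ n := by
  rw [liuReduced, Finset.prod_eq_one fun k _ => by simp, one_mul,
    Finset.sum_eq_single (fun _ => true) (fun s _ hs => ?_) fun h => absurd (Finset.mem_univ _) h,
    Finset.prod_eq_one fun x _ => ?_, one_mul, linkTerm, liuContours_eq]
  · congr 1
    funext x
    rcases x with x | x
    · rfl
    · by_cases h : x.1 = 0
      · simp [labelWedge, varLabel, outSides, h, sideWedge, sideVertex, Γ.rightOut_zero]
      · simp [labelWedge, varLabel, outSides, h]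
  · obtain ⟨i, l⟩ := x
    induction i using Fin.cases <;> simp [sideWeight]
  · obtain ⟨⟨i, l⟩, hx⟩ := Function.ne_iff.mp hs
    have hw : sideWeight (0 : Fin M → ℂ) i (s ⟨i, l⟩) = 0 := by
      rw [Bool.eq_false_of_not_eq_true hx]
      induction i using Fin.cases <;> simp [sideWeight]
    rw [Finset.prod_eq_zero (f := fun x => sideWeight (0 : Fin M → ℂ) x.1 (s x))
      (Finset.mem_univ ⟨i, l⟩) hw, zero_mul]

theorem one_sub_ne_zero_of_norm_lt {w : ℂ} (h : ‖w‖ < 1) : 1 - w ≠ 0 := by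
  refine sub_ne_zero.mpr fun h1 => ?_
  rw [← h1, norm_one] at h
  exact lt_irrefl _ h

theorem differentiableAt_sideWeight {z : Fin M → ℂ} (hz : ∀ k, ‖z k‖ < 1) (i : Fin (M + 1))
    (s : Bool) : DifferentiableAt ℂ (fun z => sideWeight z i s) z := by
  induction i using Fin.cases with
  | zero => exact differentiableAt_const _
  | succ k =>
    have h := one_sub_ne_zero_of_norm_lt (hz k)
    cases s <;> simp only [sideWeight, Fin.cases_succ, if_true, Bool.false_eq_true, if_false] <;>
      fun_prop (disch := exact h)

theorem differentiableAt_liuReduced (n : Fin (M + 1) → ℕ) {z : Fin M → ℂ} (hz : ∀ k, ‖z k‖ < 1) :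
    DifferentiableAt ℂ (liuReduced α β Γ n) z := by
  unfold liuReduced
  have := fun (x : VarIndex n) s => differentiableAt_sideWeight hz x.1 s
  fun_prop

theorem norm_sideWeight_le {r : Fin M → ℝ} (hr : ∀ k, 0 < r k ∧ r k < 1) {z : Fin M → ℂ}
    (hz : ∀ k, ‖z k‖ = r k) (i : Fin (M + 1)) (s : Bool) :
    ‖sideWeight z i s‖ ≤ 1 + ∑ k, 1 / (1 - r k) := by
  have h0 : ∀ k, 0 ≤ 1 / (1 - r k) := fun k => (one_div_pos.mpr (sub_pos.mpr (hr k).2)).le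
  have hsum : 0 ≤ ∑ k, 1 / (1 - r k) := Finset.sum_nonneg fun k _ => h0 k
  induction i using Fin.cases with
  | zero => cases s <;> simp only [sideWeight, Fin.cases_zero, if_true, Bool.false_eq_true,
      if_false, norm_zero, norm_one] <;> linarith
  | succ k =>
    have h1 : ‖1 / (1 - z k)‖ ≤ 1 / (1 - r k) := by
      rw [norm_div, norm_one]
      refine one_div_le_one_div_of_le (sub_pos.mpr (hr k).2) ?_
      have := norm_sub_norm_le 1 (z k)
      rwa [norm_one, hz] at this
    have h2 := Finset.single_le_sum (fun k _ => h0 k) (Finset.mem_univ k)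
    have h3 : ‖z k / (1 - z k)‖ ≤ 1 / (1 - r k) := by
      rw [div_eq_mul_one_div, norm_mul, hz]
      exact (mul_le_of_le_one_left (norm_nonneg _) (hr k).2.le).trans h1
    cases s <;> simp only [sideWeight, Fin.cases_succ, if_true, Bool.false_eq_true, if_false,
      norm_neg] <;> linarith

theorem exists_liuReduced_le (hα : StrictMono α) {r : Fin M → ℝ} (hr : ∀ k, 0 < r k ∧ r k < 1) :
    ∃ C : ℝ, 0 ≤ C ∧ ∀ (n : Fin (M + 1) → ℕ) (z : Fin M → ℂ), (∀ k, ‖z k‖ = r k) →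
      ‖liuReduced α β Γ n z‖ ≤ (Real.sqrt (2 * ∑ i, n i : ℕ) * C) ^ (2 * ∑ i, n i) := by
  obtain ⟨C, hC, hb⟩ := exists_contourIntegral_liu_le α β Γ hα
  set B := 1 + ∑ k, 1 / (1 - r k) with hB
  have hB1 : 1 ≤ B := le_add_of_nonneg_right (Finset.sum_nonneg fun k _ =>
    (one_div_pos.mpr (sub_pos.mpr (hr k).2)).le)
  -- `2 ^ N` choices of sides, `2 ^ N` for the powers of `1 - z`, and `B ^ N` for the coefficients
  refine ⟨4 * B * C, by positivity, fun n z hz => ?_⟩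
  set N := ∑ i, n i with hN
  have hcard : Fintype.card (VarIndex n) = N := by simp [hN]
  have h1 : ‖∏ k : Fin M, (1 - z k) ^ n k.castSucc‖ ≤ 2 ^ N := by
    rw [norm_prod]
    calc _ ≤ ∏ k : Fin M, (2 : ℝ) ^ n k.castSucc := by
          refine Finset.prod_le_prod (fun _ _ => norm_nonneg _) fun k _ => ?_
          rw [norm_pow]
          have := norm_sub_le 1 (z k)
          rw [norm_one, hz] at this
          exact pow_le_pow_left₀ (norm_nonneg _) (by linarith [(hr k).2]) _
      _ = 2 ^ ∑ k : Fin M, n k.castSucc := Finset.prod_pow_eq_pow_sum _ _ _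
      _ ≤ 2 ^ N := pow_le_pow_right₀ one_le_two (by
          rw [hN, Fin.sum_univ_castSucc]
          exact Nat.le_add_right _ _)
  have h2 : ∀ s : VarIndex n → Bool, ‖(∏ x, sideWeight z x.1 (s x)) *
      contourIntegral (liuContours Γ n s (outSides n)) (fun w => liuIntegrand α β n
        (fun x => w (Sum.inl x)) (fun x => w (Sum.inr x)))‖ ≤
      B ^ N * (Real.sqrt (2 * N : ℕ) * C) ^ (2 * N) := by
    intro s
    rw [norm_mul, norm_prod]
    refine mul_le_mul ?_ (hb n s _) (norm_nonneg _) (by positivity)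
    rw [← hcard, ← Finset.card_univ, ← Finset.prod_const]
    exact Finset.prod_le_prod (fun _ _ => norm_nonneg _) fun x _ => norm_sideWeight_le hr hz _ _
  have h3 := (norm_sum_le _ _).trans (Finset.sum_le_sum fun s (_ : s ∈ Finset.univ) => h2 s)
  rw [Finset.sum_const, Finset.card_univ, Fintype.card_fun, Fintype.card_bool, hcard,
    nsmul_eq_mul] at h3
  rw [liuReduced, norm_mul]
  refine (mul_le_mul h1 h3 (norm_nonneg _) (by positivity)).trans ?_
  have h4 : (4 * B) ^ N ≤ (4 * B) ^ (2 * N) :=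
    pow_le_pow_right₀ (by linarith) (by lia)
  calc _ = (4 * B) ^ N * (Real.sqrt (2 * N : ℕ) * C) ^ (2 * N) := by
        push_cast
        rw [mul_pow 4 B, show (4 : ℝ) = 2 * 2 by norm_num, mul_pow 2 2]
        ring
    _ ≤ (4 * B) ^ (2 * N) * (Real.sqrt (2 * N : ℕ) * C) ^ (2 * N) := by gcongr
    _ = _ := by
        rw [← mul_pow]
        ring_nf

/-- The majorant is a Fredholm-type series, sorted by multiplicities. -/
theorem summable_majorant {C : ℝ} (hC : 0 ≤ C) : Summable fun n : Fin (M + 1) → ℕ =>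
    1 / (∏ i, ((n i).factorial : ℝ)) ^ 2 * (Real.sqrt (2 * ∑ i, n i : ℕ) * C) ^ (2 * ∑ i, n i) := by
  have h := (summable_counts (Y := Label M)
    (Ψ := fun c => (((Real.sqrt (∑ y, c y : ℕ) * C) ^ (∑ y, c y) : ℝ) : ℂ))
    (g := fun k => (Real.sqrt k * C) ^ k) (fun k => by positivity)
    (fun c => by rw [Complex.norm_real, Real.norm_of_nonneg (by positivity)])
    (summable_card_hadamard hC _)).norm.comp_injective labelCounts_injective
  refine h.congr fun n => ?_
  simp only [Function.comp_apply]
  rw [sum_labelCounts, prod_factorial_labelCounts, norm_mul, norm_div, norm_one, norm_pow, norm_prod,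
    Complex.norm_real, Real.norm_of_nonneg (by positivity)]
  simp only [Complex.norm_natCast]

variable {r : Fin M → ℝ}

theorem ne_zero_one_of_norm_eq (hr : ∀ k, 0 < r k ∧ r k < 1) {z : Fin M → ℂ}
    (hz : ∀ k, ‖z k‖ = r k) (k : Fin M) : z k ≠ 0 ∧ z k ≠ 1 := by
  refine ⟨norm_pos_iff.mp ((hr k).1.trans_eq (hz k).symm), fun h => ?_⟩
  have := (hr k).2
  rw [← hz, h, norm_one] at this
  exact lt_irrefl _ this

theorem exists_liuSummand_le (hα : StrictMono α) (hr : ∀ k, 0 < r k ∧ r k < 1) :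
    ∃ b : (Fin (M + 1) → ℕ) → ℝ, Summable b ∧ ∀ n z, (∀ k, ‖z k‖ = r k) →
      ‖liuSummand α β Γ z n‖ ≤ b n := by
  obtain ⟨C, hC, h⟩ := exists_liuReduced_le (β := β) Γ hα hr
  refine ⟨_, summable_majorant hC, fun n z hz => ?_⟩
  rw [liuSummand, liuTerm_eq Γ hα n (ne_zero_one_of_norm_eq hr hz), norm_mul, norm_div, norm_one,
    norm_pow, norm_prod]
  simp only [Complex.norm_natCast]
  exact mul_le_mul_of_nonneg_left (h n z hz) (by positivity)

/-- Only the value at `z = 0` of each term contributes to the integral over the circles. -/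
theorem liuOuter_integral (hα : StrictMono α) (hr : ∀ k, 0 < r k ∧ r k < 1) :
    TorusIntegrable (liuOuter α β Γ) 0 r ∧
      liuFormula α β Γ r = fredholm (labelMeasure M) (linkKernel α β Γ) := by
  have hr0 : ∀ k, 0 < r k := fun k => (hr k).1
  have hlt : ∀ θ k, ‖torusMap 0 r θ k‖ < 1 := fun θ k => by
    rw [norm_torusMap hr0]
    exact (hr k).2
  have hne := fun θ => ne_zero_one_of_norm_eq hr (norm_torusMap hr0 θ)
  obtain ⟨b, hb, hbound⟩ := exists_liuSummand_le (β := β) Γ hα hr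
  have hpi : (2 * (Real.pi : ℂ) * Complex.I) ≠ 0 := Complex.two_pi_I_ne_zero
  have hz := fun k : Fin M => (continuous_apply k).comp (continuous_torusMap r)
  have hcont : ∀ n, Continuous fun θ => liuSummand α β Γ (torusMap 0 r θ) n := by
    intro n
    simp only [liuSummand, liuTerm_eq Γ hα n (hne _)]
    exact continuous_const.mul (continuous_iff_continuousAt.mpr fun θ =>
      (differentiableAt_liuReduced Γ n (hlt θ)).continuousAt.comp (continuous_torusMap r).continuousAt)
  obtain ⟨h1, h2⟩ := torusIntegral_tsum_mul (a := fun n z => liuSummand α β Γ z n)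
    (Q := fun z => ∏ k : Fin M, 1 / (2 * (Real.pi : ℂ) * Complex.I * z k * (1 - z k))) hcont
    (continuous_finsetProd _ fun k _ => continuous_const.div ((continuous_const.mul (hz k)).mul
      (continuous_const.sub (hz k))) fun θ => mul_ne_zero (mul_ne_zero hpi (hne θ k).1)
        (sub_ne_zero.mpr (hne θ k).2.symm)) hb fun n θ => hbound n _ (norm_torusMap hr0 θ)
  refine ⟨h1, h2.trans ?_⟩
  rw [fredholm_linkKernel_eq_tsum Γ hα]
  refine tsum_congr fun n => ?_
  -- the remaining integrand is holomorphic in the unit polydisc up to the factors `1 / z_k`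
  set H : (Fin M → ℂ) → ℂ := fun z =>
    1 / (∏ i, ((n i).factorial : ℂ)) ^ 2 * liuReduced α β Γ n z * ∏ k, 1 / (1 - z k) with hH
  have hd : DifferentiableOn ℂ H {z | ∀ k, ‖z k‖ < 1} := fun z hz =>
    (DifferentiableAt.fun_mul ((differentiableAt_liuReduced Γ n hz).const_mul _)
      (by fun_prop (disch := exact one_sub_ne_zero_of_norm_lt (hz _)))).differentiableWithinAt
  have h3 := torusIntegral_eq_center hr hd
  have h4 : H 0 = 1 / (∏ i, ((n i).factorial : ℂ)) ^ 2 * linkTerm α β Γ n := by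
    simp [hH, liuReduced_zero]
  rw [← h4, ← h3]
  refine torusIntegral_congr hr0 fun z hz => ?_
  simp only [hH]
  rw [liuSummand, liuTerm_eq Γ hα n (ne_zero_one_of_norm_eq hr hz), mul_assoc _ (∏ k, 1 / (1 - z k)),
    ← Finset.prod_mul_distrib]
  congr 1
  exact Finset.prod_congr rfl fun k _ => by
    rw [one_div_mul_one_div, mul_comm (1 - z k)]

theorem liuConverges (hα : StrictMono α) (hr : ∀ k, 0 < r k ∧ r k < 1) :
    LiuConverges α β Γ r := by
  obtain ⟨b, hb, hbound⟩ := exists_liuSummand_le (β := β) Γ hα hr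
  exact ⟨fun n s s' => contourIntegrable_liu Γ hα n s s',
    fun z hz => hb.of_norm_bounded fun n => hbound n z hz, (liuOuter_integral Γ hα hr).1⟩

theorem liuFormula_eq_fredholmDet (hα : StrictMono α) (hr : ∀ k, 0 < r k ∧ r k < 1) :
    liuFormula α β Γ r = fredholmDet volume Γ.gammaL.density (kernelKParam α β Γ) := by
  rw [(liuOuter_integral Γ hα hr).2, fredholm_linkKernel Γ hα, fredholmDet_kernelK Γ hα]

end EqualTime

end ParabolicAiry

theorem mainTheorem1 (M : ℕ) (α β : Fin (M + 1) → ℝ) (hα : StrictMono α)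
    (Γ : ContourSystem M) (r : Fin M → ℝ) (hr : ∀ k, 0 < r k ∧ r k < 1) :
    -- all integrals and series converge absolutely
    LiuConverges α β Γ r ∧
    (∀ (i : Fin (M + 1)) (s t : ℝ),
      ContourIntegrable (kernelContours Γ i)
        (kernelIntegrand α β i (Γ.gammaL.point s) (Γ.gammaL.point t))) ∧
    FredholmConverges volume Γ.gammaL.density (kernelKParam α β Γ) ∧
    FredholmConverges halfLine (fun _ => 1)
      (fun (_ : Unit) lam (_ : Unit) θ => kernelL α β Γ lam θ) ∧
    FredholmConverges halfLine (fun _ => 1)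
      (fun i lam j θ => kernelB α β i lam j θ - kernelA α β Γ i lam j θ) ∧
    FredholmConverges volume (fun _ => 1) (fun i x j y => -cutAiry α β i x j y) ∧
    -- the equal-time formula equals `det (I + K)`
    liuFormula α β Γ r =
      fredholmDet volume Γ.gammaL.density (kernelKParam α β Γ) ∧
    -- `det (I + K) = det (I + L)`
    fredholmDet volume Γ.gammaL.density (kernelKParam α β Γ) =
      fredholmDet halfLine (fun _ => 1)
        (fun (_ : Unit) lam (_ : Unit) θ => kernelL α β Γ lam θ) ∧
    -- `det (I + L) = det (I + B - A)`
    fredholmDet halfLine (fun _ => 1)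
        (fun (_ : Unit) lam (_ : Unit) θ => kernelL α β Γ lam θ) =
      fredholmDet halfLine (fun _ => 1)
        (fun i lam j θ => kernelB α β i lam j θ - kernelA α β Γ i lam j θ) ∧
    -- `A` and `B` in terms of the extended Airy kernel
    (∀ (i j : Fin (M + 1)) (lam θ : ℝ), 0 < lam → 0 < θ →
      IntegrableOn (conjAiryProduct α β i lam j θ) (Ioi 0) ∧
      kernelA α β Γ i lam j θ = ∫ γ in Ioi (0 : ℝ), conjAiryProduct α β i lam j θ γ) ∧
    (∀ (i j : Fin (M + 1)) (lam θ : ℝ), i < j → 0 < lam → 0 < θ →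
      Integrable (conjAiryProduct α β i lam j θ) ∧
      kernelB α β i lam j θ = ∫ γ : ℝ, conjAiryProduct α β i lam j θ γ) ∧
    (∀ (i j : Fin (M + 1)) (lam θ : ℝ), 0 < lam → 0 < θ →
      kernelB α β i lam j θ - kernelA α β Γ i lam j θ =
        -(((Real.exp (-conjExponent α β i lam + conjExponent α β j θ) : ℝ) : ℂ) *
          extAiry (α i) (lam + β i + α i ^ 2) (α j) (θ + β j + α j ^ 2))) ∧
    -- `det (I + B - A) = det (I - χ^{1/2} K_Ai^ext χ^{1/2})`
    fredholmDet halfLine (fun _ => 1)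
        (fun i lam j θ => kernelB α β i lam j θ - kernelA α β Γ i lam j θ) =
      fredholmDet volume (fun _ => 1) (fun i x j y => -cutAiry α β i x j y) ∧
    -- the equal-time formula equals the extended-Airy-kernel determinant
    liuFormula α β Γ r =
      fredholmDet volume (fun _ => 1) (fun i x j y => -cutAiry α β i x j y) := by
  refine ⟨liuConverges Γ hα hr, contourIntegrable_kernelK Γ hα, fredholmConverges_kernelK Γ hα,
    fredholmConverges_kernelL Γ hα, fredholmConverges_kernelBA Γ hα,
    fredholmConverges_cutAiry hα Γ, liuFormula_eq_fredholmDet Γ hα hr, ?_,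
    fredholmDet_kernelL_eq_kernelBA Γ hα,
    fun i j x y hx hy => ⟨integrableOn_conjAiryProduct hα Γ i j hx hy, kernelA_eq Γ i j hx hy⟩,
    fun i j x y hij hx hy => ⟨integrable_conjAiryProduct hα hij x y, kernelB_eq hα hij hx hy⟩,
    fun i j x y hx hy => kernelB_sub_kernelA hα Γ i j hx hy, fredholmDet_cutAiry hα Γ, ?_⟩
  · rw [fredholmDet_kernelK Γ hα, fredholmDet_kernelL_eq Γ hα]
  · rw [liuFormula_eq_fredholmDet Γ hα hr, fredholmDet_kernelK Γ hα,
      ← fredholmDet_kernelL_eq Γ hα, fredholmDet_kernelL_eq_kernelBA Γ hα,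
      fredholmDet_cutAiry hα Γ]
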